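/- **Setting.** $\lambda$ is the security parameter. PPT means strict probabilistic polynomial time. Adversaries (distinguishers) are non-uniform PPT, i.e. PPT with an advice of polynomial length depending on $\lambda$ only; $\overset{c}{\approx}$ and $\overset{s}{\approx}$ denote computational and statistical indistinguishability. **Scheme.** An MKR-PKE scheme consists of PPT algorithms $(\mathsf{Gen},\mathsf{Enc},\mathsf{ParDec},\mathsf{Dec},\mathsf{ReRand})$. Secret keys form a finite abelian group $(\mathcal{SK},+)$, public keys an abelian group $(\mathcal{PK},\cdot)$ with efficient operations. Plaintexts are the elements of a set $\mathcal M\subseteq\{0,1\}^{l}$ and a dummy message $\perp\notin\mathcal M$, and ciphertexts are bit strings of one fixed length, for each $\lambda$. It is required that: (i) $\mathsf{Dec}(sk,\mathsf{Enc}(pk,x))=x$ for all $(pk,sk)$ output by $\mathsf{Gen}(1^\lambda)$ and $x\in\mathcal M\cup\{\perp\}$; (ii) $pk$ is the image of $sk$ under a group homomorphism $\mathcal{SK}\to\mathcal{PK}$, and the $sk$ output by $\mathsf{Gen}(1^\lambda)$ is statistically close to uniform in $\mathcal{SK}$; (iii) (partially decryptable) $\mathsf{ParDec}(sk_1,\mathsf{Enc}(pk_1\cdot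 pk_2,x))$ and $\mathsf{Enc}(pk_2,x)$ have the same distribution, for all key pairs $(pk_1,sk_1),(pk_2,sk_2)$ output by $\mathsf{Gen}(1^\lambda)$ and all $x\in\mathcal M\cup\{\perp\}$. The scheme is *rerandomizable* if $\mathsf{ReRand}(pk,ct)\overset{s}{\approx}\mathsf{Enc}(pk,x)$ for every $pk\in\mathcal{PK}$, every $x\in\mathcal M\cup\{\perp\}$ and every given ciphertext $ct$ that $\mathsf{Enc}(pk,x)$ can output, with a negligible bound uniform in $pk,x,ct$. It has *indistinguishable multiple encryptions* if $(pk,\mathsf{Enc}(pk,m_1),\dots,\mathsf{Enc}(pk,m_q))\overset{c}{\approx}(pk,\mathsf{Enc}(pk,m_1'),\dots,\mathsf{Enc}(pk,m_q'))$, where $(pk,sk)\gets\mathsf{Gen}(1^\lambda)$, for all polynomial $q$ and all message tuples $(m_i),(m_i')$ (depending on $\lambda$). **Functionalities.** $\mathcal F_{\mathsf{MPSU}}$: on input sets $X_1,\dots,X_m\subseteq\mathcal M$ of size $n$ of parties $P_1,\dots,P_m$, it outputs $\bigcup_i X_i$ to $P_1$ and nothing to the others. $\mathcal F_{\mathsf{bssPMT}}$: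 on sets $T^1,\dots,T^B$ of a sender and queries $q^1,\dots,q^B$ of a receiver, it gives them uniformly random bits $e_S^b$ and $e_R^b$ with $e_S^b\oplus e_R^b=1$ iff $q^b\in T^b$. $\mathcal F_{\mathsf{ROT}}$: on a bit $\beta$ of the receiver, it gives uniform strings $(r_0,r_1)$ of the ciphertext length to the sender and $r_\beta$ to the receiver. **Protocol PK-MPSU.** Public: polynomial-time hash functions $h_1,h_2,h_3:\mathcal M\to[B]$ (possibly depending on a public seed) and a polynomial-time Cuckoo hashing procedure. Each $P_i$ runs $(pk_i,sk_i)\gets\mathsf{Gen}(1^\lambda)$ and publishes $pk_i$; $pk=\prod_i pk_i$. 1. Each $P_i$ computes the simple hash table $\mathcal T_i^b=\{x\Vert a: x\in X_i,\ h_a(x)=b\}$, $b\in[B]$, and each $P_j$, $j\ge2$, a Cuckoo table $\mathcal C_j^1,\dots,\mathcal C_j^B$ in which each $x\in X_j$ is placed in exactly one bin, as $x\Vert a$ in bin $h_a(x)$, and the other bins are empty. 2. For $1\le i<j\le m$, $P_i$ (sender, sets $\mathcal T_i^b$) and $P_j$ (receiver, queries $\mathcal C_j^b$, a dummy query for an empty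 bin) invoke $\mathcal F_{\mathsf{bssPMT}}$ and get bits $e_{i,j}^b$ and $e_{j,i}^b$. 3. For $2\le j\le m$, $b\in[B]$: $P_j$ sets $c_j^b=\mathsf{Enc}(pk,x)$ for the element $x$ in $\mathcal C_j^b$, or $\mathsf{Enc}(pk,\perp)$ for an empty bin. Then, for $i=2,\dots,j-1$ and at last for $i=1$: $P_j$ (sender) and $P_i$ (receiver, input $e_{i,j}^b$) invoke $\mathcal F_{\mathsf{ROT}}$; with its strings $r_0,r_1$, $P_j$ sends $u_{e_{j,i}^b}=r_{e_{j,i}^b}\oplus c_j^b$ and $u_{e_{j,i}^b\oplus1}=r_{e_{j,i}^b\oplus 1}\oplus\mathsf{Enc}(pk,\perp)$; $P_i$ computes $v'=\mathsf{ReRand}(pk,u_{e_{i,j}^b}\oplus r_{e_{i,j}^b})$. If $i\ge2$, $P_i$ returns $v'$ and $P_j$ sets $c_j^b=\mathsf{ReRand}(pk,v')$; if $i=1$, $P_1$ keeps $v'$ as the entry $(j,b)$ of a vector of length $(m-1)B$. 4. $P_1$ permutes this vector by a uniformly random permutation and sends it to $P_2$. For $j=2,\dots,m$, $P_j$ replaces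 each entry $ct$ of the vector received by $\mathsf{ReRand}(pk_1\prod_{d>j}pk_d,\mathsf{ParDec}(sk_j,ct))$, permutes the result by a uniformly random permutation, and sends it to $P_{j+1}$ ($P_m$ sends it to $P_1$). 5. $P_1$ decrypts all entries with $sk_1$ and outputs $X_1\cup Y$, where $Y$ is the set of the plaintexts other than $\perp$. **Theorem.** Let the number $m$ of parties be fixed, and let $n$, $B$, $l$ be (efficiently computable) polynomially bounded functions of $\lambda$. If the MKR-PKE scheme is rerandomizable and has indistinguishable multiple encryptions, then PK-MPSU securely realizes $\mathcal F_{\mathsf{MPSU}}$ in the $(\mathcal F_{\mathsf{bssPMT}},\mathcal F_{\mathsf{ROT}})$-hybrid model against any semi-honest adversary that corrupts $t<m$ parties. That is, for every set $C$ of parties other than the set of all parties there is a PPT simulator (without advice) that, from $1^\lambda$, the public seed, the inputs $X_i$ of the $P_i\in C$ and, if $P_1\in C$, the union $\bigcup_iX_i$, produces views such that, for every non-uniform PPT distinguisher, the joint distribution of these views and of the output of the functionality to the honest parties cannot be distinguished, with more than a negligible advantage, from the joint distribution of the views of the parties in $C$ (inputs, random tapes, outputs received from the hybrid functionalities, and all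 messages received) and of the honest parties' output in the protocol. The bound is uniform over all public seeds and all input sets of size $n$ for which the Cuckoo hashing of $X_2,\dots,X_m$ succeeds. -/

import Mathlib

namespace PKMPSU

/-! ## A probabilistic programming language with a step count

Programs act on booleans, pairs and lists.  A run costs the total size of all values that it
produces, so a program whose cost is polynomially bounded is exactly a probabilistic polynomial
time algorithm (`fold` gives bounded loops, nested loops give a clock of any polynomial length). -/

/-- Data types of the language. -/
inductive Ty : Type
  | unit : Ty
  | bool : Ty
  | prod : Ty → Ty → Ty
  | list : Ty → Ty

/-- The values of a data type. -/
@[reducible] def Ty.den : Ty → Type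
  | .unit => Unit
  | .bool => Bool
  | .prod a b => a.den × b.den
  | .list a => List a.den

/-- The size of a value. -/
def Ty.size : (a : Ty) → a.den → ℕ
  | .unit, _ => 1
  | .bool, _ => 1
  | .prod a b, x => 1 + a.size x.1 + b.size x.2
  | .list a, x => 1 + (x.map fun y => 1 + a.size y).sum

/-- Programs with an input of one type and an output of another. -/
inductive Tm : Ty → Ty → Type
  | id {a : Ty} : Tm a a
  | comp {a b c : Ty} : Tm b c → Tm a b → Tm a c
  | star {a : Ty} : Tm a .unit
  | pair {a b c : Ty} : Tm a b → Tm a c → Tm a (.prod b c)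
  | fst {a b : Ty} : Tm (.prod a b) a
  | snd {a b : Ty} : Tm (.prod a b) b
  | lit {a : Ty} : Bool → Tm a .bool
  | ite {a b : Ty} : Tm a .bool → Tm a b → Tm a b → Tm a b
  | nil {a b : Ty} : Tm a (.list b)
  | cons {a : Ty} : Tm (.prod a (.list a)) (.list a)
  /-- case distinction on a list: empty, or head and tail -/
  | caseList {e a c : Ty} : Tm e c → Tm (.prod e (.prod a (.list a))) c → Tm (.prod e (.list a)) c
  /-- left fold over a list, in an environment and from a start value -/
  | fold {e a c : Ty} : Tm (.prod e (.prod c a)) c → Tm (.prod e (.prod c (.list a))) c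
  /-- a uniformly random entry of a list, as a one-element list (empty for the empty list) -/
  | pick {a : Ty} : Tm (.list a) (.list a)

/-- A value together with the cost of producing it by one elementary step. -/
def costed (a : Ty) (x : a.den) : a.den × ℕ := (x, a.size x)

/-- Semantics: the joint distribution of the output and of the number of steps. -/
noncomputable def Tm.eval : {a b : Ty} → Tm a b → a.den → PMF (b.den × ℕ)
  | a, _, .id, x => PMF.pure (costed a x)
  | _, _, .comp g f, x =>
      (f.eval x).bind fun y => (g.eval y.1).map fun z => (z.1, y.2 + z.2 + 1)
  | _, _, .star, _ => PMF.pure (costed .unit ())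
  | _, _, .pair f g, x =>
      (f.eval x).bind fun y => (g.eval x).map fun z => ((y.1, z.1), y.2 + z.2 + 1)
  | _, b, .fst, x => PMF.pure (costed b x.1)
  | _, b, .snd, x => PMF.pure (costed b x.2)
  | _, _, .lit v, _ => PMF.pure (costed .bool v)
  | _, _, .ite t f g, x =>
      (t.eval x).bind fun y =>
        (if y.1 then f.eval x else g.eval x).map fun z => (z.1, y.2 + z.2 + 1)
  | _, .list b, .nil, _ => PMF.pure (costed (.list b) [])
  | _, .list b, .cons, x => PMF.pure (costed (.list b) (x.1 :: x.2))
  | _, _, .caseList f g, x =>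
      match x with
      | (e, []) => (f.eval e).map fun z => (z.1, z.2 + 1)
      | (e, y :: l) => (g.eval (e, (y, l))).map fun z => (z.1, z.2 + 1)
  | _, b, .fold s, x =>
      x.2.2.foldl
        (fun q y => q.bind fun acc => (s.eval (x.1, (acc.1, y))).map fun z => (z.1, acc.2 + z.2 + 1))
        (PMF.pure (costed b x.2.1))
  | _, .list b, .pick, x =>
      match x with
      | [] => PMF.pure (costed (.list b) [])
      | y :: l => (PMF.uniformOfFintype (Fin (l.length + 1))).map fun i =>
          costed (.list b) [(y :: l).get i]

/-- The output distribution of a program. -/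
noncomputable def Tm.run {a b : Ty} (t : Tm a b) (x : a.den) : PMF b.den :=
  (t.eval x).map Prod.fst

/-- `t` runs in (strict) polynomial time: on every input and for all random choices, the number
of steps is at most a fixed polynomial in the size of the input. -/
def Tm.PolyTime {a b : Ty} (t : Tm a b) : Prop :=
  ∃ p : Polynomial ℕ, ∀ x : a.den, ∀ o ∈ (t.eval x).support, o.2 ≤ p.eval (a.size x)

/-! ## Encodings -/

/-- Bit strings of length `k`. -/
abbrev BV (k : ℕ) : Type := Fin k → Bool

/-- Bitwise exclusive or. -/
def BV.xor {k : ℕ} (u v : BV k) : BV k := fun i => Bool.xor (u i) (v i)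

abbrev unaryT : Ty := .list .unit
abbrev bitsT : Ty := .list .bool

/-- The number `i` in unary; as a security parameter, the string `1^i`. -/
def unary (i : ℕ) : unaryT.den := List.replicate i ()

def codeBV {k : ℕ} (v : BV k) : bitsT.den := List.ofFn v

def codeFin {k : ℕ} (i : Fin k) : unaryT.den := unary i

def codeOpt {α β : Type} (c : α → β) (o : Option α) : List β := (o.map c).toList

def codeVec {α β : Type} {k : ℕ} (c : α → β) (v : Fin k → α) : List β :=
  List.ofFn fun i => c (v i)

/-- The code of a finite set is the sorted list of the codes of its elements; so it carries
nothing but the set. -/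
def codeSet {α : Type} {k : ℕ} (r : α → BV k) (X : Finset α) : (Ty.list bitsT).den :=
  (X.image fun x => codeBV (r x)).sort (· ≤ ·)

/-- The deterministic functions `f n` (`n` the security parameter) are computed, on codes, by one
polynomial-time program that also receives `1^n`. -/
def PolyTimeFun {α β : ℕ → Type} {a b : Ty} (cα : ∀ n, α n → a.den) (cβ : ∀ n, β n → b.den)
    (f : ∀ n, α n → β n) : Prop :=
  ∃ t : Tm (.prod unaryT a) b, t.PolyTime ∧
    ∀ n x, t.run (unary n, cα n x) = PMF.pure (cβ n (f n x))

/-- A length (or size) parameter: `1^n ↦ 1^(f n)` is computable in polynomial time. In particular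
`f` is polynomially bounded. -/
def PolyLength (f : ℕ → ℕ) : Prop :=
  ∃ t : Tm unaryT unaryT, t.PolyTime ∧ ∀ n, t.run (unary n) = PMF.pure (unary (f n))

def PolyBounded (f : ℕ → ℕ) : Prop := ∃ p : Polynomial ℕ, ∀ n, f n ≤ p.eval n

/-! ## Indistinguishability -/

def Negligible (μ : ℕ → ℝ) : Prop :=
  Asymptotics.SuperpolynomialDecay Filter.atTop (fun n : ℕ => (n : ℝ)) μ

/-- Statistical distance of two distributions on a finite set. -/
noncomputable def statDist {α : Type} [Fintype α] (p q : PMF α) : ℝ :=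
  (1 / 2) * ∑ x, |(p x).toReal - (q x).toReal|

/-- The probability that `D` outputs `true` on `1^n`, the advice `z` and a sample of `p`. -/
noncomputable def acceptProb {a c : Ty} (D : Tm (.prod unaryT (.prod c a)) .bool) (n : ℕ)
    (z : c.den) (p : PMF a.den) : ℝ :=
  ((p.bind fun x => D.run (unary n, (z, x))) true).toReal

/-- Computational indistinguishability of two ensembles indexed by the security parameter `n` and a
further index in `ι n` (the inputs), against all non-uniform PPT distinguishers: PPT
algorithms that receive an advice of polynomial size depending on `n` only. The bound is uniform
in the further index. -/
def CompIndist {ι : ℕ → Type} {a : Ty} (p q : ∀ n, ι n → PMF a.den) : Prop :=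
  ∀ (c : Ty) (advice : ℕ → c.den) (D : Tm (.prod unaryT (.prod c a)) .bool),
    D.PolyTime → PolyBounded (fun n => c.size (advice n)) →
    ∃ μ : ℕ → ℝ, Negligible μ ∧
      ∀ n i, |acceptProb D n (advice n) (p n i) - acceptProb D n (advice n) (q n i)| ≤ μ n

/-! ## Multi-key rerandomizable public-key encryption -/

/-- The data of an MKR-PKE scheme. Keys, plaintexts and ciphertexts are bit strings of lengths that
depend on the security parameter; the plaintext space `M n` is extended by the dummy message `⊥`
(`none`). The probabilistic algorithms take their random coins as a last argument. -/
structure MKRScheme where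
  SK : ℕ → Type
  PK : ℕ → Type
  M : ℕ → Type
  [grpSK : ∀ n, AddCommGroup (SK n)]
  [grpPK : ∀ n, CommGroup (PK n)]
  [finSK : ∀ n, Fintype (SK n)]
  [decM : ∀ n, DecidableEq (M n)]
  skLen : ℕ → ℕ
  pkLen : ℕ → ℕ
  /-- bit length of the plaintexts, that is of the set elements -/
  msgLen : ℕ → ℕ
  ctLen : ℕ → ℕ
  repSK : ∀ n, SK n ↪ BV (skLen n)
  repPK : ∀ n, PK n ↪ BV (pkLen n)
  repM : ∀ n, M n ↪ BV (msgLen n)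
  genCoins : ℕ → ℕ
  encCoins : ℕ → ℕ
  parCoins : ℕ → ℕ
  reCoins : ℕ → ℕ
  gen : ∀ n, BV (genCoins n) → PK n × SK n
  enc : ∀ n, PK n → Option (M n) → BV (encCoins n) → BV (ctLen n)
  parDec : ∀ n, SK n → BV (ctLen n) → BV (parCoins n) → BV (ctLen n)
  dec : ∀ n, SK n → BV (ctLen n) → Option (M n)
  reRand : ∀ n, PK n → BV (ctLen n) → BV (reCoins n) → BV (ctLen n)

attribute [instance] MKRScheme.grpSK MKRScheme.grpPK MKRScheme.finSK MKRScheme.decM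

namespace MKRScheme

variable (S : MKRScheme)

def codePK (n : ℕ) (pk : S.PK n) : bitsT.den := codeBV (S.repPK n pk)
def codeSK (n : ℕ) (sk : S.SK n) : bitsT.den := codeBV (S.repSK n sk)
def codeM (n : ℕ) (x : S.M n) : bitsT.den := codeBV (S.repM n x)
def codeMsg (n : ℕ) (x : Option (S.M n)) : (Ty.list bitsT).den := codeOpt (S.codeM n) x

/-- The algorithms of the scheme, and the group operations on public keys, run in polynomial
time. -/
structure Efficient : Prop where
  skLen : PolyLength S.skLen
  pkLen : PolyLength S.pkLen
  msgLen : PolyLength S.msgLen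
  ctLen : PolyLength S.ctLen
  genCoins : PolyLength S.genCoins
  encCoins : PolyLength S.encCoins
  parCoins : PolyLength S.parCoins
  reCoins : PolyLength S.reCoins
  gen : PolyTimeFun (a := bitsT) (b := .prod bitsT bitsT)
    (fun _ r => codeBV r) (fun n k => (S.codePK n k.1, S.codeSK n k.2)) S.gen
  enc : PolyTimeFun (α := fun n => S.PK n × Option (S.M n) × BV (S.encCoins n))
    (a := .prod bitsT (.prod (.list bitsT) bitsT)) (b := bitsT)
    (fun n x => (S.codePK n x.1, (S.codeMsg n x.2.1, codeBV x.2.2))) (fun _ c => codeBV c)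
    (fun n x => S.enc n x.1 x.2.1 x.2.2)
  parDec : PolyTimeFun (α := fun n => S.SK n × BV (S.ctLen n) × BV (S.parCoins n))
    (a := .prod bitsT (.prod bitsT bitsT)) (b := bitsT)
    (fun n x => (S.codeSK n x.1, (codeBV x.2.1, codeBV x.2.2))) (fun _ c => codeBV c)
    (fun n x => S.parDec n x.1 x.2.1 x.2.2)
  dec : PolyTimeFun (α := fun n => S.SK n × BV (S.ctLen n))
    (a := .prod bitsT bitsT) (b := .list bitsT)
    (fun n x => (S.codeSK n x.1, codeBV x.2)) S.codeMsg
    (fun n x => S.dec n x.1 x.2)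
  reRand : PolyTimeFun (α := fun n => S.PK n × BV (S.ctLen n) × BV (S.reCoins n))
    (a := .prod bitsT (.prod bitsT bitsT)) (b := bitsT)
    (fun n x => (S.codePK n x.1, (codeBV x.2.1, codeBV x.2.2))) (fun _ c => codeBV c)
    (fun n x => S.reRand n x.1 x.2.1 x.2.2)
  mulPK : PolyTimeFun (α := fun n => S.PK n × S.PK n)
    (a := .prod bitsT bitsT) (b := bitsT)
    (fun n x => (S.codePK n x.1, S.codePK n x.2)) S.codePK (fun _ x => x.1 * x.2)
  invPK : PolyTimeFun (a := bitsT) (b := bitsT) S.codePK S.codePK (fun _ x => x⁻¹)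

/-- Distribution of `Enc(pk, x)`. -/
noncomputable def encDist (n : ℕ) (pk : S.PK n) (x : Option (S.M n)) : PMF (BV (S.ctLen n)) :=
  (PMF.uniformOfFintype (BV (S.encCoins n))).map (S.enc n pk x)

/-- Distribution of `ReRand(pk, ct)` for a given ciphertext. -/
noncomputable def reRandDist (n : ℕ) (pk : S.PK n) (ct : BV (S.ctLen n)) : PMF (BV (S.ctLen n)) :=
  (PMF.uniformOfFintype (BV (S.reCoins n))).map (S.reRand n pk ct)

/-- Distribution of `ParDec(sk, ct)` for a given ciphertext. -/
noncomputable def parDecDist (n : ℕ) (sk : S.SK n) (ct : BV (S.ctLen n)) : PMF (BV (S.ctLen n)) :=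
  (PMF.uniformOfFintype (BV (S.parCoins n))).map (S.parDec n sk ct)

/-- Distribution of the secret keys that `Gen` outputs. -/
noncomputable def genSKDist (n : ℕ) : PMF (S.SK n) :=
  (PMF.uniformOfFintype (BV (S.genCoins n))).map fun r => (S.gen n r).2

/-- Decryption inverts encryption, for plaintexts and for `⊥`. -/
def Correct : Prop :=
  ∀ n (r : BV (S.genCoins n)) (x : Option (S.M n)) (r' : BV (S.encCoins n)),
    S.dec n (S.gen n r).2 (S.enc n (S.gen n r).1 x r') = x

/-- Keys form groups: the public key is the image of the secret key under a homomorphism (so that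
products of public keys belong to sums of secret keys), and the secret key is uniform in the group
of secret keys, up to a negligible statistical distance. -/
def KeyHomomorphic : Prop :=
  (∃ toPub : ∀ n, S.SK n → S.PK n,
    (∀ n s s', toPub n (s + s') = toPub n s * toPub n s') ∧
    ∀ n r, (S.gen n r).1 = toPub n (S.gen n r).2) ∧
  Negligible fun n => statDist (S.genSKDist n) (PMF.uniformOfFintype (S.SK n))

/-- `ParDec(sk₁, Enc(pk₁ · pk₂, x)) = Enc(pk₂, x)`, as distributions. -/
def PartiallyDecryptable : Prop :=
  ∀ n (r₁ r₂ : BV (S.genCoins n)) (x : Option (S.M n)),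
    ((S.encDist n ((S.gen n r₁).1 * (S.gen n r₂).1) x).bind fun ct =>
      S.parDecDist n (S.gen n r₁).2 ct) = S.encDist n (S.gen n r₂).1 x

/-- Rerandomizing any given encryption of `x` under `pk` yields a distribution statistically close
to that of a fresh encryption of `x` under `pk`. -/
def Rerandomizable : Prop :=
  ∃ ε : ℕ → ℝ, Negligible ε ∧
    ∀ n (pk : S.PK n) (x : Option (S.M n)) (r : BV (S.encCoins n)),
      statDist (S.reRandDist n pk (S.enc n pk x r)) (S.encDist n pk x) ≤ ε n

/-- A public key and independent encryptions under it of the messages in a given list. -/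
noncomputable def multiEncDist (n : ℕ) {q : ℕ} (msgs : Fin q → Option (S.M n)) :
    PMF (Ty.prod bitsT (.list bitsT)).den :=
  (PMF.uniformOfFintype (BV (S.genCoins n) × (Fin q → BV (S.encCoins n)))).map fun ω =>
    (S.codePK n (S.gen n ω.1).1,
      List.ofFn fun i => codeBV (S.enc n (S.gen n ω.1).1 (msgs i) (ω.2 i)))

/-- Indistinguishable multiple encryptions. -/
def IndMultEnc : Prop :=
  ∀ q : ℕ → ℕ, PolyBounded q → ∀ msgs msgs' : ∀ n, Fin (q n) → Option (S.M n),
    CompIndist (ι := fun _ => Unit) (a := .prod bitsT (.list bitsT))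
      (fun n _ => S.multiEncDist n (msgs n)) (fun n _ => S.multiEncDist n (msgs' n))

end MKRScheme

/-! ## Hashing to bins -/

/-- Public parameters of the protocol: the size of the input sets, the number of bins, the three
hash functions (which may depend on a public seed), and the procedure that computes
the Cuckoo hash table of a set. An entry `x ‖ i` is the pair `(x, i)`. -/
structure HashParams (S : MKRScheme) where
  setSize : ℕ → ℕ
  bins : ℕ → ℕ
  seedLen : ℕ → ℕ
  hash : ∀ n, BV (seedLen n) → Fin 3 → S.M n → Fin (bins n)
  cuckoo : ∀ n, BV (seedLen n) → Finset (S.M n) → Fin (bins n) → Option (S.M n × Fin 3)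

/-- `C` is a Cuckoo hash table of `X`: every `x ∈ X` lies in exactly one bin, that bin is `h i x`
and holds `x ‖ i` for some `i`, and the bins hold nothing else. -/
def IsCuckooTable {M : Type} {B : ℕ} (h : Fin 3 → M → Fin B) (X : Finset M)
    (C : Fin B → Option (M × Fin 3)) : Prop :=
  (∀ b x i, C b = some (x, i) → x ∈ X ∧ h i x = b) ∧
  ∀ x ∈ X, ∃! b, ∃ i, C b = some (x, i)

/-- The bin `b` of the simple hash table of `X`: all `x ‖ i` with `x ∈ X` and `h i x = b`. -/
def simpleTable {M : Type} [DecidableEq M] {B : ℕ} (h : Fin 3 → M → Fin B) (X : Finset M)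
    (b : Fin B) : Finset (M × Fin 3) :=
  (X ×ˢ Finset.univ).filter fun y => h y.2 y.1 = b

structure HashParams.Efficient {S : MKRScheme} (P : HashParams S) : Prop where
  setSize : PolyLength P.setSize
  bins : PolyLength P.bins
  seedLen : PolyLength P.seedLen
  hash : PolyTimeFun (α := fun n => BV (P.seedLen n) × Fin 3 × S.M n)
    (a := .prod bitsT (.prod unaryT bitsT)) (b := unaryT)
    (fun n x => (codeBV x.1, (codeFin x.2.1, S.codeM n x.2.2))) (fun _ => codeFin)
    (fun n x => P.hash n x.1 x.2.1 x.2.2)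
  cuckoo : PolyTimeFun (α := fun n => BV (P.seedLen n) × Finset (S.M n))
    (a := .prod bitsT (.list bitsT)) (b := .list (.list (.prod bitsT unaryT)))
    (fun n x => (codeBV x.1, codeSet (S.repM n) x.2))
    (fun n => codeVec (codeOpt fun y => (S.codeM n y.1, codeFin y.2)))
    (fun n x => P.cuckoo n x.1 x.2)

/-! ## Ideal functionalities -/

/-- Batch secret-shared private membership test. The sender inputs sets, the receiver inputs
one query for each set; they get uniform shares (sender's first) of the membership bits.
`a` is the randomness of the functionality. -/
def funcBssPMT {I : Type} [DecidableEq I] {B : ℕ} (T : Fin B → Finset I) (x : Fin B → I)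
    (a : Fin B → Bool) : (Fin B → Bool) × (Fin B → Bool) :=
  (a, fun b => Bool.xor (a b) (decide (x b ∈ T b)))

/-- Random oblivious transfer: the sender gets the two random strings `r false`, `r true`
and the receiver gets the one that its input bit selects. `r` is the randomness of the
functionality. -/
def funcROT {k : ℕ} (bit : Bool) (r : Bool → BV k) : (Bool → BV k) × BV k := (r, r bit)

/-- Multi-party private set union: the output of the leader. -/
def funcMPSU {M : Type} [DecidableEq M] {m : ℕ} (X : Fin m → Finset M) : Finset M :=
  Finset.univ.biUnion X

/-! ## The protocol

There are `k + 1` parties `0, …, k`; party `0` is the leader. The positions of the ciphertext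
vectors are the pairs `(j, b)` of a non-leader `j.succ` and a bin `b`. -/

section Protocol

abbrev Slot {S : MKRScheme} (P : HashParams S) (k n : ℕ) : Type := Fin k × Fin (P.bins n)

/-- The random tape of one party: coins for key generation; for encrypting its elements; for
the encryptions of `⊥` that it prepares for each other party; for rerandomizing as receiver of the
oblivious transfer with a given party; the same as sender; the shuffle permutation; coins
for partial decryption; and for the rerandomization before the shuffle. -/
abbrev Tape {S : MKRScheme} (P : HashParams S) (k n : ℕ) : Type :=
  BV (S.genCoins n) ×
  (Fin (P.bins n) → BV (S.encCoins n)) ×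
  (Fin (k + 1) → Fin (P.bins n) → BV (S.encCoins n)) ×
  (Fin (k + 1) → Fin (P.bins n) → BV (S.reCoins n)) ×
  (Fin (k + 1) → Fin (P.bins n) → BV (S.reCoins n)) ×
  Equiv.Perm (Slot P k n) ×
  (Slot P k n → BV (S.parCoins n)) ×
  (Slot P k n → BV (S.reCoins n))

namespace Tape

variable {S : MKRScheme} {P : HashParams S} {k n : ℕ} (t : Tape P k n)

def gen : BV (S.genCoins n) := t.1
def encElem : Fin (P.bins n) → BV (S.encCoins n) := t.2.1
def encDummy : Fin (k + 1) → Fin (P.bins n) → BV (S.encCoins n) := t.2.2.1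
def reReceiver : Fin (k + 1) → Fin (P.bins n) → BV (S.reCoins n) := t.2.2.2.1
def reSender : Fin (k + 1) → Fin (P.bins n) → BV (S.reCoins n) := t.2.2.2.2.1
def perm : Equiv.Perm (Slot P k n) := t.2.2.2.2.2.1
def parDec : Slot P k n → BV (S.parCoins n) := t.2.2.2.2.2.2.1
def reShuffle : Slot P k n → BV (S.reCoins n) := t.2.2.2.2.2.2.2

end Tape

/-- The randomness of the functionalities: for sender `i` and receiver `j` of the batch membership
test, and for sender `j` and receiver `i` of the oblivious transfers. -/
abbrev FuncCoins {S : MKRScheme} (P : HashParams S) (k n : ℕ) : Type :=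
  (Fin (k + 1) → Fin (k + 1) → Fin (P.bins n) → Bool) ×
  (Fin (k + 1) → Fin (k + 1) → Fin (P.bins n) → Bool → BV (S.ctLen n))

set_option synthInstance.maxSize 10000 in
instance {S : MKRScheme} (P : HashParams S) (k n : ℕ) : Fintype (Tape P k n) := inferInstance

set_option synthInstance.maxSize 10000 in
instance {S : MKRScheme} (P : HashParams S) (k n : ℕ) : Fintype (FuncCoins P k n) := inferInstance

instance {S : MKRScheme} (P : HashParams S) (k n : ℕ) : Nonempty (Tape P k n) :=
  ⟨(fun _ => false, fun _ _ => false, fun _ _ _ => false, fun _ _ _ => false, fun _ _ _ => false,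
    1, fun _ _ => false, fun _ _ => false)⟩

instance {S : MKRScheme} (P : HashParams S) (k n : ℕ) : Nonempty (FuncCoins P k n) :=
  ⟨(fun _ _ _ => false, fun _ _ _ _ _ => false)⟩

/-- An execution: public seed, inputs, random tapes, and randomness of the functionalities. -/
structure Exec {S : MKRScheme} (P : HashParams S) (k n : ℕ) where
  seed : BV (P.seedLen n)
  X : Fin (k + 1) → Finset (S.M n)
  tape : Fin (k + 1) → Tape P k n
  func : FuncCoins P k n

namespace Exec

variable {S : MKRScheme} {P : HashParams S} {k n : ℕ} (E : Exec P k n)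

/-- Key generation. -/
def pk (i : Fin (k + 1)) : S.PK n := (S.gen n (E.tape i).gen).1
def sk (i : Fin (k + 1)) : S.SK n := (S.gen n (E.tape i).gen).2

/-- The joint public key. -/
def pkAll : S.PK n := ∏ i, E.pk i

/-- The public key that remains after the partial decryption by party `j ≠ 0`: the product of the
keys of the leader and of the parties after `j`. -/
def pkRest (j : Fin (k + 1)) : S.PK n :=
  E.pk 0 * ∏ d ∈ Finset.univ.filter (fun d => j < d), E.pk d

/-- The Cuckoo hash table of party `j`. -/
def cuckooTable (j : Fin (k + 1)) : Fin (P.bins n) → Option (S.M n × Fin 3) :=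
  P.cuckoo n E.seed (E.X j)

/-- The simple hash table of party `i`, as a table of sets of queries. (For an empty bin of a
Cuckoo table the query is `none`, which is in no such set.) -/
def queryTable (i : Fin (k + 1)) (b : Fin (P.bins n)) : Finset (Option (S.M n × Fin 3)) :=
  (simpleTable (P.hash n E.seed) (E.X i) b).image some

/-- The outputs of the membership test with sender `i` and receiver `j`. -/
def pmt (i j : Fin (k + 1)) : (Fin (P.bins n) → Bool) × (Fin (P.bins n) → Bool) :=
  funcBssPMT (E.queryTable i) (E.cuckooTable j) (E.func.1 i j)

/-- The share `e_{i,j}^b` that party `i` gets from the membership test with party `j`. The party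
with the smaller index is the sender. -/
def share (i j : Fin (k + 1)) (b : Fin (P.bins n)) : Bool :=
  if i < j then (E.pmt i j).1 b else (E.pmt j i).2 b

/-- The outputs of the oblivious transfer with sender `j` and receiver `i`, whose input is
`e_{i,j}^b`. -/
def rot (j i : Fin (k + 1)) (b : Fin (P.bins n)) : (Bool → BV (S.ctLen n)) × BV (S.ctLen n) :=
  funcROT (E.share i j b) (E.func.2 j i b)

/-- The plaintext in bin `b` of party `j`: its element, or `⊥` for an empty bin. -/
def elem (j : Fin (k + 1)) (b : Fin (P.bins n)) : Option (S.M n) :=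
  (E.cuckooTable j b).map Prod.fst

/-- The masked messages `u_{j,i,0}^b`, `u_{j,i,1}^b` from `j` to `i`, if party `j` holds `c`. -/
def maskPair (j i : Fin (k + 1)) (b : Fin (P.bins n)) (c : BV (S.ctLen n)) :
    Bool → BV (S.ctLen n) := fun β =>
  BV.xor ((E.rot j i b).1 β)
    (if β = E.share j i b then c else S.enc n E.pkAll none ((E.tape j).encDummy i b))

/-- The ciphertext that the receiver `i` rerandomizes, from the masked messages `u`. -/
def unmask (j i : Fin (k + 1)) (b : Fin (P.bins n)) (u : Bool → BV (S.ctLen n)) :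
    BV (S.ctLen n) :=
  BV.xor (u (E.share i j b)) (E.rot j i b).2

/-- The receiver's rerandomization. -/
def reply (j i : Fin (k + 1)) (b : Fin (P.bins n)) (u : Bool → BV (S.ctLen n)) :
    BV (S.ctLen n) :=
  S.reRand n E.pkAll (E.unmask j i b u) ((E.tape i).reReceiver j b)

/-- The ciphertext `c_j^b` of party `j` after its exchanges with the parties `1, …, t`. -/
def held (j : Fin (k + 1)) (b : Fin (P.bins n)) : ℕ → BV (S.ctLen n)
  | 0 => S.enc n E.pkAll (E.elem j b) ((E.tape j).encElem b)
  | t + 1 =>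
      let i : Fin (k + 1) := Fin.ofNat (k + 1) (t + 1)
      S.reRand n E.pkAll (E.reply j i b (E.maskPair j i b (held j b t))) ((E.tape j).reSender i b)

/-- The messages `u_{j,i,·}^b` for `i < j`. The exchanges of `j` are in the order
`1, …, j - 1, 0`. -/
def msgU (j i : Fin (k + 1)) (b : Fin (P.bins n)) : Bool → BV (S.ctLen n) :=
  E.maskPair j i b (E.held j b (if i = 0 then (j : ℕ) - 1 else (i : ℕ) - 1))

/-- The message `v'_{j,i}^b` from `i` to `j`, for `0 < i < j`. -/
def msgV (j i : Fin (k + 1)) (b : Fin (P.bins n)) : BV (S.ctLen n) :=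
  E.reply j i b (E.msgU j i b)

/-- The leader's vector before its shuffle. -/
def leaderVec (s : Slot P k n) : BV (S.ctLen n) := E.reply s.1.succ 0 s.2 (E.msgU s.1.succ 0 s.2)

/-- The vector that party `t` sends in the decryption and shuffle phase. -/
def chain : ℕ → Slot P k n → BV (S.ctLen n)
  | 0 => fun s => E.leaderVec ((E.tape 0).perm s)
  | t + 1 =>
      let j : Fin (k + 1) := Fin.ofNat (k + 1) (t + 1)
      let vec : Slot P k n → BV (S.ctLen n) := fun s =>
        S.reRand n (E.pkRest j) (S.parDec n (E.sk j) (chain t s) ((E.tape j).parDec s))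
          ((E.tape j).reShuffle s)
      fun s => vec ((E.tape j).perm s)

/-- The leader's output: its own set and all plaintexts other than `⊥`. -/
def output : Finset (S.M n) :=
  E.X 0 ∪ Finset.univ.biUnion fun s => (S.dec n (E.sk 0) (E.chain k s)).toFinset

end Exec

/-- The view of a party: its input and random tape, all public keys, its outputs from the
functionalities and all messages that it receives. -/
structure View {S : MKRScheme} (P : HashParams S) (k n : ℕ) where
  input : Finset (S.M n)
  tape : Tape P k n
  pks : Fin (k + 1) → S.PK n
  shares : Fin (k + 1) → Option (Fin (P.bins n) → Bool)
  rotSender : Fin (k + 1) → Option (Fin (P.bins n) → Bool → BV (S.ctLen n))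
  rotReceiver : Fin (k + 1) → Option (Fin (P.bins n) → BV (S.ctLen n))
  msgsU : Fin (k + 1) → Option (Fin (P.bins n) → Bool → BV (S.ctLen n))
  msgsV : Fin (k + 1) → Option (Fin (P.bins n) → BV (S.ctLen n))
  vec : Slot P k n → BV (S.ctLen n)

/-- The view of party `i`. -/
def Exec.view {S : MKRScheme} {P : HashParams S} {k n : ℕ} (E : Exec P k n) (i : Fin (k + 1)) :
    View P k n where
  input := E.X i
  tape := E.tape i
  pks := E.pk
  shares := fun j => if j = i then none else some (E.share i j)
  rotSender := fun j => if j < i then some fun b => (E.rot i j b).1 else none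
  rotReceiver := fun j => if i < j then some fun b => (E.rot j i b).2 else none
  msgsU := fun j => if i < j then some (E.msgU j i) else none
  msgsV := fun j => if 0 < j ∧ j < i then some (E.msgV i j) else none
  vec := if i = 0 then E.chain k else E.chain ((i : ℕ) - 1)

/-! Codes of views, for the distinguisher and the simulator. -/

abbrev slotsT : Ty := .list (.list bitsT)

def codeSlots {S : MKRScheme} {P : HashParams S} {k n : ℕ} {q : ℕ} (v : Slot P k n → BV q) :
    slotsT.den :=
  codeVec (codeVec codeBV) fun j b => v (j, b)

def codePair {q : ℕ} (u : Bool → BV q) : (Ty.prod bitsT bitsT).den :=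
  (codeBV (u false), codeBV (u true))

abbrev tapeT : Ty :=
  .prod bitsT (.prod (.list bitsT) (.prod slotsT (.prod slotsT (.prod slotsT
    (.prod (.list (.list (.prod unaryT unaryT))) (.prod slotsT slotsT))))))

def codeTape {S : MKRScheme} {P : HashParams S} {k n : ℕ} (t : Tape P k n) : tapeT.den :=
  (codeBV t.gen, codeVec codeBV t.encElem, codeVec (codeVec codeBV) t.encDummy,
    codeVec (codeVec codeBV) t.reReceiver, codeVec (codeVec codeBV) t.reSender,
    codeVec (codeVec fun s : Slot P k n => (codeFin s.1, codeFin s.2)) fun j b => t.perm (j, b),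
    codeSlots t.parDec, codeSlots t.reShuffle)

abbrev viewT : Ty :=
  .prod (.list bitsT) (.prod tapeT (.prod (.list bitsT)
    (.prod (.list (.list bitsT))
    (.prod (.list (.list (.list (.prod bitsT bitsT))))
    (.prod (.list (.list (.list bitsT)))
    (.prod (.list (.list (.list (.prod bitsT bitsT))))
    (.prod (.list (.list (.list bitsT))) slotsT)))))))

def codeView {S : MKRScheme} {P : HashParams S} {k n : ℕ} (V : View P k n) : viewT.den :=
  (codeSet (S.repM n) V.input, codeTape V.tape, codeVec (S.codePK n) V.pks,
    codeVec (codeOpt codeBV) V.shares,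
    codeVec (codeOpt (codeVec codePair)) V.rotSender,
    codeVec (codeOpt (codeVec codeBV)) V.rotReceiver,
    codeVec (codeOpt (codeVec codePair)) V.msgsU,
    codeVec (codeOpt (codeVec codeBV)) V.msgsV,
    codeSlots V.vec)

/-! ## Security -/

/-- Views of the corrupted parties: one (optional) entry for each party. -/
abbrev viewsT : Ty := .list (.list viewT)

/-- Views of the corrupted parties and output of the leader, if it is honest. -/
abbrev jointT : Ty := .prod viewsT (.list (.list bitsT))

/-- What the simulator receives: `1^n`, the public seed, the inputs of the corrupted parties and,
if the leader is corrupted, its output. -/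
abbrev simInT : Ty := .prod unaryT (.prod bitsT (.prod (.list (.list (.list bitsT)))
  (.list (.list bitsT))))

/-- Public seed and inputs of all parties: sets of the prescribed size for which Cuckoo hashing
succeeds. -/
structure Inputs {S : MKRScheme} (P : HashParams S) (k n : ℕ) where
  seed : BV (P.seedLen n)
  X : Fin (k + 1) → Finset (S.M n)
  card_eq : ∀ i, (X i).card = P.setSize n
  isCuckooTable : ∀ j, j ≠ 0 → IsCuckooTable (P.hash n seed) (X j) (P.cuckoo n seed (X j))

/-- Code of the output, if it belongs to a party in question. -/
def codeOutput (S : MKRScheme) (n : ℕ) (p : Prop) [Decidable p] (Y : Finset (S.M n)) :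
    (Ty.list (.list bitsT)).den :=
  if p then [codeSet (S.repM n) Y] else []

variable {S : MKRScheme} (P : HashParams S) (k : ℕ) (C : Finset (Fin (k + 1)))

/-- Real execution: joint distribution of the views of the corrupted parties and of the output of
the honest parties. -/
noncomputable def realDist (n : ℕ) (I : Inputs P k n) : PMF jointT.den :=
  (PMF.uniformOfFintype ((Fin (k + 1) → Tape P k n) × FuncCoins P k n)).map fun ω =>
    let E : Exec P k n := ⟨I.seed, I.X, ω.1, ω.2⟩
    (codeVec (codeOpt codeView) (fun i => if i ∈ C then some (E.view i) else none),
      codeOutput S n (0 ∉ C) E.output)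

/-- Ideal execution: the simulator's output and the output of the honest parties from the
functionality. -/
noncomputable def idealDist (sim : Tm simInT viewsT) (n : ℕ) (I : Inputs P k n) :
    PMF jointT.den :=
  (sim.run (unary n, (codeBV I.seed,
      (codeVec (codeOpt (codeSet (S.repM n))) (fun i => if i ∈ C then some (I.X i) else none),
        codeOutput S n (0 ∈ C) (funcMPSU I.X))))).map fun V =>
    (V, codeOutput S n (0 ∉ C) (funcMPSU I.X))

/-- The protocol securely realizes the private set union functionality against semi-honest
adversaries that corrupt the parties in `C`: some PPT simulator produces the corrupted
views from the corrupted inputs and outputs, up to computational indistinguishability jointly with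
the output of the honest parties. -/
def SecurelyRealizes : Prop :=
  ∃ sim : Tm simInT viewsT, sim.PolyTime ∧
    CompIndist (ι := fun n => Inputs P k n) (a := jointT) (realDist P k C) (idealDist P k C sim)

end Protocol

end PKMPSU

/-!
# PK-MPSU is secure against semi-honest adversaries

For fixed keys, the interaction splits into independent pieces. For each party `j` and each bin, the
ciphertext of `j` visits the parties `1, …, j - 1` and at last the leader `0`; then one vector of
ciphertexts visits all parties. Both are sequential processes (`runF`), in which a state is passed
from party to party, and closeness of two of them follows step by step (`close_proc`).

*The exchanges.* If a party of an exchange is honest, what the other one sees can be produced from a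
fresh encryption of the plaintext in question. A change of variables of the masks and shares makes
the view independent of the membership bit (`realExch_eq`), and rerandomizability turns the
ciphertext which the honest party sends into a fresh encryption. Hence the records of all exchanges
are close to a function of the corrupted parties' inputs and of fresh encryptions, under the joint
key, of tracked plaintexts (`close_records`).

*The shuffle phase.* The leader's vector of plaintexts lists each element of the union outside of
the leader's set exactly once, namely for the first party that has it (`enumerates_finalMsg`). If
the leader is corrupted, there is an honest party `h ≠ 0`. Its partial decryption and
rerandomization produce fresh encryptions under the remaining key, in uniformly random order, so
that it may start from any listing of the same set (`close_vectors`, `Enumerates.exists_perm`). Such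
a listing is computed from the union. If the leader is honest, this is not needed: its vector
consists of replies that have already been replaced, and its output is not part of the views.
Partial decryptability speaks of keys generated by `Gen` only; products of public keys are most
likely of this kind, as they are images of nearly uniform secret keys (`prob_bad_keys`).

*The keys.* By now, the secret key of the honest party `h` is not used. As its public key is nearly
the image of a uniform element under a homomorphism, the joint key may be drawn first by `Gen`, and
the public key of `h` is chosen accordingly (`close_programKeys`).

*The encryptions.* What is left is a function of the joint key and of encryptions under it, so that
the tracked plaintexts may be replaced by `⊥` (`compIndist_hybrid`). The inputs that maximize the
advantage become part of the advice of the reduction, which makes the bound uniform in the inputs.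
The result is the simulator.

The simulator and the reduction have to be programs with a polynomial step count. The predicates
`Samples` and `Computes` say that a family of distributions or values, which depend on a context, is
produced by such a program from the code of the context; their closure properties mirror the
definitions of the simulated objects.
-/

namespace PKMPSU

open PMF (uniformOfFintype)
open scoped ENNReal

/-! ### Expectations and statistical closeness -/

section Expectation

variable {α β γ : Type}

/-- The expectation of a nonnegative function under a distribution. -/
noncomputable def expect (p : PMF α) (φ : α → ℝ≥0∞) : ℝ≥0∞ := ∑' x, p x * φ x

theorem expect_pure (a : α) (φ : α → ℝ≥0∞) : expect (PMF.pure a) φ = φ a := by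
  classical
  unfold expect
  rw [tsum_eq_single a]
  · simp
  · intro b hb
    simp [PMF.pure_apply, hb]

theorem expect_bind (p : PMF α) (f : α → PMF β) (φ : β → ℝ≥0∞) :
    expect (p.bind f) φ = expect p fun a => expect (f a) φ := by
  unfold expect
  simp only [PMF.bind_apply, ← ENNReal.tsum_mul_right, ← ENNReal.tsum_mul_left]
  rw [ENNReal.tsum_comm]
  simp only [mul_assoc]

theorem expect_map (p : PMF α) (f : α → β) (φ : β → ℝ≥0∞) :
    expect (p.map f) φ = expect p fun a => φ (f a) := by
  rw [← PMF.bind_pure_comp, expect_bind]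
  simp [expect_pure]

theorem expect_mono {p : PMF α} {φ ψ : α → ℝ≥0∞} (h : ∀ x ∈ p.support, φ x ≤ ψ x) :
    expect p φ ≤ expect p ψ := by
  refine ENNReal.tsum_le_tsum fun x => ?_
  by_cases hx : p x = 0
  · simp [hx]
  · exact mul_le_mul_right (h x ((p.mem_support_iff x).2 hx)) _

theorem expect_const (p : PMF α) (c : ℝ≥0∞) : expect p (fun _ => c) = c := by
  simp [expect, ENNReal.tsum_mul_right, p.tsum_coe]

theorem expect_add (p : PMF α) (φ ψ : α → ℝ≥0∞) :
    expect p (fun x => φ x + ψ x) = expect p φ + expect p ψ := by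
  simp [expect, mul_add, ENNReal.tsum_add]

theorem expect_le_one {p : PMF α} {φ : α → ℝ≥0∞} (h : ∀ x, φ x ≤ 1) : expect p φ ≤ 1 :=
  (expect_mono fun x _ => h x).trans (expect_const p 1).le

theorem expect_le {p : PMF α} {φ : α → ℝ≥0∞} {c : ℝ≥0∞} (h : ∀ x ∈ p.support, φ x ≤ c) :
    expect p φ ≤ c :=
  (expect_mono h).trans (expect_const p c).le

theorem apply_eq_expect (p : PMF α) (a : α) [DecidableEq α] :
    p a = expect p fun x => if x = a then 1 else 0 := by
  unfold expect
  rw [tsum_eq_single a]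
  · simp
  · intro b hb
    simp [hb]

/-- The probability of an event. -/
noncomputable def prob (p : PMF α) (A : α → Prop) : ℝ≥0∞ := by
  classical exact expect p fun x => if A x then 1 else 0

theorem prob_bind (p : PMF α) (f : α → PMF β) (A : β → Prop) :
    prob (p.bind f) A = expect p fun a => prob (f a) A := expect_bind _ _ _

theorem prob_map (p : PMF α) (f : α → β) (A : β → Prop) :
    prob (p.map f) A = prob p fun a => A (f a) := expect_map _ _ _

theorem prob_le_one (p : PMF α) (A : α → Prop) : prob p A ≤ 1 := by
  classical
  exact expect_le_one fun x => by split_ifs <;> simp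

theorem prob_mono {p : PMF α} {A B : α → Prop} (h : ∀ x ∈ p.support, A x → B x) :
    prob p A ≤ prob p B := by
  classical
  refine expect_mono fun x hx => ?_
  by_cases hA : A x
  · simp [hA, h x hx hA]
  · simp [hA]

theorem prob_eq_zero {p : PMF α} {A : α → Prop} (h : ∀ x ∈ p.support, ¬ A x) : prob p A = 0 := by
  classical
  refine le_antisymm (expect_le fun x hx => ?_) bot_le
  simp [h x hx]

theorem prob_or_le (p : PMF α) (A B : α → Prop) :
    prob p (fun x => A x ∨ B x) ≤ prob p A + prob p B := by
  classical
  unfold prob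
  rw [← expect_add]
  refine expect_mono fun x _ => ?_
  by_cases hA : A x <;> by_cases hB : B x <;> simp [hA, hB]

theorem prob_exists_le {ι : Type} [Fintype ι] (p : PMF α) (A : ι → α → Prop) :
    prob p (fun x => ∃ i, A i x) ≤ ∑ i, prob p (A i) := by
  classical
  have h : ∀ s : Finset ι, prob p (fun x => ∃ i ∈ s, A i x) ≤ ∑ i ∈ s, prob p (A i) := by
    intro s
    induction s using Finset.induction_on with
    | empty => simp [prob_eq_zero]
    | insert a s ha ih =>
      rw [Finset.sum_insert ha]
      refine le_trans (prob_mono (B := fun x => A a x ∨ ∃ i ∈ s, A i x) ?_)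
        ((prob_or_le _ _ _).trans (add_le_add le_rfl ih))
      intro x _
      simp
  simpa using h Finset.univ

/-- If `f x` has the bad event with probability at most `δ` for `x` outside of an event `B`, then
the bind has it with probability at most `prob p B + δ`. -/
theorem prob_bind_le {p : PMF α} {f : α → PMF β} {A : β → Prop} (B : α → Prop) {δ ε : ℝ≥0∞}
    (hB : prob p B ≤ ε) (h : ∀ x ∈ p.support, ¬ B x → prob (f x) A ≤ δ) :
    prob (p.bind f) A ≤ ε + δ := by
  classical
  rw [prob_bind]
  refine le_trans (expect_mono (ψ := fun x => (if B x then 1 else 0) + δ) fun x hx => ?_) ?_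
  · by_cases hx' : B x
    · simpa [hx'] using (prob_le_one (f x) A).trans le_self_add
    · simpa [hx'] using h x hx hx'
  · rw [expect_add, expect_const]
    exact add_le_add hB le_rfl

/-- Two distributions are `ε`-close if no test with values in `[0, 1]` has expectations that differ
by more than `ε`. On finite types this is the statistical distance. -/
def Close (ε : ℝ≥0∞) (p q : PMF α) : Prop :=
  ∀ φ : α → ℝ≥0∞, (∀ x, φ x ≤ 1) →
    expect p φ ≤ expect q φ + ε ∧ expect q φ ≤ expect p φ + ε

namespace Close

variable {ε δ : ℝ≥0∞} {p q r : PMF α}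

theorem refl (p : PMF α) : Close 0 p p := fun _ _ => by simp

theorem symm (h : Close ε p q) : Close ε q p := fun φ hφ => (h φ hφ).symm

theorem mono (h : Close ε p q) (hle : ε ≤ δ) : Close δ p q := fun φ hφ =>
  ⟨(h φ hφ).1.trans (add_le_add le_rfl hle), (h φ hφ).2.trans (add_le_add le_rfl hle)⟩

theorem of_eq (h : p = q) : Close ε p q := h ▸ (Close.refl p).mono bot_le

theorem trans (h : Close ε p q) (h' : Close δ q r) : Close (ε + δ) p r := fun φ hφ => by
  constructor
  · calc expect p φ ≤ expect q φ + ε := (h φ hφ).1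
      _ ≤ (expect r φ + δ) + ε := add_le_add (h' φ hφ).1 le_rfl
      _ = _ := by ring
  · calc expect r φ ≤ expect q φ + δ := (h' φ hφ).2
      _ ≤ (expect p φ + ε) + δ := add_le_add (h φ hφ).2 le_rfl
      _ = _ := by ring

/-- The same distribution followed by kernels that are close off a bad event. -/
theorem bind_bad {p : PMF α} {f g : α → PMF β} (B : α → Prop) (hB : prob p B ≤ δ)
    (h : ∀ x ∈ p.support, ¬ B x → Close ε (f x) (g x)) :
    Close (δ + ε) (p.bind f) (p.bind g) := by
  classical
  have key : ∀ f g : α → PMF β, (∀ x ∈ p.support, ¬ B x → Close ε (f x) (g x)) →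
      ∀ φ : β → ℝ≥0∞, (∀ x, φ x ≤ 1) →
      expect (p.bind f) φ ≤ expect (p.bind g) φ + (δ + ε) := by
    intro f g h φ hφ
    rw [expect_bind, expect_bind]
    refine le_trans (expect_mono (ψ := fun x => expect (g x) φ + ((if B x then 1 else 0) + ε))
      fun x hx => ?_) ?_
    · by_cases hx' : B x
      · simp only [hx', if_true]
        exact (expect_le_one hφ).trans (le_add_left le_self_add)
      · simpa [hx'] using (h x hx hx' φ hφ).1
    · rw [expect_add, expect_add, expect_const]
      exact add_le_add le_rfl (add_le_add hB le_rfl)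
  exact fun φ hφ => ⟨key f g h φ hφ, key g f (fun x hx hx' => (h x hx hx').symm) φ hφ⟩

theorem bind_right {p : PMF α} {f g : α → PMF β} (h : ∀ x ∈ p.support, Close ε (f x) (g x)) :
    Close ε (p.bind f) (p.bind g) := by
  have := bind_bad (p := p) (f := f) (g := g) (fun _ => False) (δ := 0) (ε := ε)
    (prob_eq_zero (by simp)).le (fun x hx _ => h x hx)
  simpa only [zero_add] using this

theorem bind_left (h : Close ε p q) (f : α → PMF β) : Close ε (p.bind f) (q.bind f) :=
  fun φ hφ => by
    rw [expect_bind, expect_bind]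
    exact h _ fun x => expect_le_one hφ

theorem bind {f g : α → PMF β} (h : Close ε p q) (h' : ∀ x ∈ q.support, Close δ (f x) (g x)) :
    Close (ε + δ) (p.bind f) (q.bind g) :=
  (h.bind_left f).trans (bind_right h')

theorem map (h : Close ε p q) (f : α → β) : Close ε (p.map f) (q.map f) := h.bind_left _

theorem prob_le (h : Close ε p q) (A : α → Prop) : prob p A ≤ prob q A + ε := by
  classical
  exact (h _ fun x => by split_ifs <;> simp).1

end Close

/-- Kernels that agree off a bad event. -/
theorem Close.of_bad {p : PMF α} {f g : α → β} {δ : ℝ≥0∞} (B : α → Prop) (hB : prob p B ≤ δ)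
    (h : ∀ x ∈ p.support, ¬ B x → f x = g x) : Close δ (p.map f) (p.map g) := by
  have := Close.bind_bad (p := p) (f := PMF.pure ∘ f) (g := PMF.pure ∘ g) B hB (ε := 0)
    (fun x hx hx' => by
      simp only [Function.comp, h x hx hx']
      exact Close.refl _)
  simpa only [add_zero, PMF.bind_pure_comp] using this

theorem close_of_statDist [Fintype α] (p q : PMF α) :
    Close (ENNReal.ofReal (statDist p q)) p q := by
  have key : ∀ p q : PMF α, ∀ φ : α → ℝ≥0∞, (∀ x, φ x ≤ 1) →
      expect p φ ≤ expect q φ + ENNReal.ofReal (statDist p q) := by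
    intro p q φ hφ
    have hfin : ∀ p : PMF α, expect p φ ≠ ⊤ := fun p =>
      ne_top_of_le_ne_top ENNReal.one_ne_top (expect_le_one hφ)
    have hreal : ∀ p : PMF α, (expect p φ).toReal = ∑ x, (p x).toReal * (φ x).toReal := by
      intro p
      unfold expect
      rw [tsum_fintype, ENNReal.toReal_sum]
      · simp
      · intro x _
        exact ENNReal.mul_ne_top (p.apply_ne_top x)
          (ne_top_of_le_ne_top ENNReal.one_ne_top (hφ x))
    have hsum : ∀ p : PMF α, ∑ x, (p x).toReal = 1 := by
      intro p
      rw [← ENNReal.toReal_sum (fun x _ => p.apply_ne_top x),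
        ← tsum_fintype (L := .unconditional _), p.tsum_coe]
      simp
    have hnn : 0 ≤ statDist p q := by unfold statDist; positivity
    rw [← ENNReal.ofReal_toReal (hfin p), ← ENNReal.ofReal_toReal (hfin q),
      ← ENNReal.ofReal_add ENNReal.toReal_nonneg hnn]
    refine ENNReal.ofReal_le_ofReal ?_
    rw [hreal, hreal, ← sub_le_iff_le_add', ← Finset.sum_sub_distrib]
    -- subtracting `1 / 2` from the test does not change the difference of the expectations
    have hhalf : ∑ x, ((p x).toReal * (φ x).toReal - (q x).toReal * (φ x).toReal)
        = ∑ x, ((p x).toReal - (q x).toReal) * ((φ x).toReal - 1 / 2) := by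
      have : ∑ x, ((p x).toReal - (q x).toReal) * (1 / 2) = 0 := by
        rw [← Finset.sum_mul, Finset.sum_sub_distrib, hsum, hsum]; simp
      rw [← sub_zero (∑ x, ((p x).toReal * (φ x).toReal - (q x).toReal * (φ x).toReal)), ← this,
        ← Finset.sum_sub_distrib]
      exact Finset.sum_congr rfl fun x _ => by ring
    rw [hhalf, statDist, Finset.mul_sum]
    refine Finset.sum_le_sum fun x _ => ?_
    refine (le_abs_self _).trans ?_
    rw [abs_mul, mul_comm]
    refine mul_le_mul_of_nonneg_right ?_ (abs_nonneg _)
    have h1 : (φ x).toReal ≤ 1 := by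
      simpa using ENNReal.toReal_mono ENNReal.one_ne_top (hφ x)
    have h0 : 0 ≤ (φ x).toReal := ENNReal.toReal_nonneg
    rw [abs_le]
    constructor <;> linarith
  have hs : statDist p q = statDist q p := by
    unfold statDist
    simp only [abs_sub_comm]
  exact fun φ hφ => ⟨key p q φ hφ, hs ▸ key q p φ hφ⟩

end Expectation

/-! ### Uniform distributions and products of distributions -/

section Uniform

variable {α β γ : Type}

theorem uniform_map_equiv [Fintype α] [Nonempty α] [Fintype β] [Nonempty β] (e : α ≃ β) :
    (uniformOfFintype α).map e = uniformOfFintype β := by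
  classical
  ext b
  rw [PMF.map_apply, tsum_eq_single (e.symm b)]
  · simp [Fintype.card_congr e]
  · intro a ha
    have : b ≠ e a := fun h => ha (by simp [h])
    simp [this]

theorem uniform_prod [Fintype α] [Nonempty α] [Fintype β] [Nonempty β] [i : Fintype (α × β)]
    [Nonempty (α × β)] :
    uniformOfFintype (α × β) =
      (uniformOfFintype α).bind fun a => (uniformOfFintype β).map (Prod.mk a) := by
  classical
  ext ⟨a, b⟩
  rw [PMF.bind_apply, tsum_eq_single a]
  · rw [PMF.map_apply, tsum_eq_single b]
    · have : @Fintype.card (α × β) i = Fintype.card α * Fintype.card β :=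
        (@Fintype.card_congr _ _ i (instFintypeProd α β) (Equiv.refl _)).trans
          (@Fintype.card_prod α β _ _)
      simp only [PMF.uniformOfFintype_apply, if_true, this, Nat.cast_mul]
      rw [ENNReal.mul_inv] <;> simp
    · intro b' hb'
      simp [hb'.symm]
  · intro a' ha'
    rw [PMF.map_apply]
    simp [ha'.symm]

/-- The product of the distributions `p i`, sampled coordinate by coordinate. -/
noncomputable def piFin : (m : ℕ) → (Fin m → PMF α) → PMF (Fin m → α)
  | 0, _ => PMF.pure Fin.elim0
  | m + 1, p => (p 0).bind fun a => (piFin m fun i => p i.succ).map fun f => Fin.cons a f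

theorem piFin_succ (m : ℕ) (p : Fin (m + 1) → PMF α) :
    piFin (m + 1) p = (p 0).bind fun a => (piFin m fun i => p i.succ).map fun f =>
      Fin.cons a f := rfl

/-- Resampling one coordinate does not change a product distribution. -/
theorem piFin_resample {m : ℕ} (p : Fin m → PMF α) (i : Fin m) :
    piFin m p = (p i).bind fun a => (piFin m p).map fun f => Function.update f i a := by
  induction m with
  | zero => exact i.elim0
  | succ m ih =>
    refine Fin.cases ?_ (fun i => ?_) i
    · simp only [piFin_succ, PMF.map_bind, PMF.map_comp]
      have : ∀ a a' : α, ((fun f : Fin (m + 1) → α => Function.update f 0 a) ∘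
          fun f : Fin m → α => (Fin.cons a' f : Fin (m + 1) → α)) =
          fun f : Fin m → α => (Fin.cons a f : Fin (m + 1) → α) := by
        intro a a'
        funext f
        simp [Fin.update_cons_zero]
      simp only [this, PMF.bind_const]
    · simp only [piFin_succ, PMF.map_bind, PMF.map_comp]
      rw [PMF.bind_comm]
      congr 1
      funext a
      conv_lhs => rw [ih (fun i => p i.succ) i]
      rw [PMF.map_bind]
      congr 1
      funext b
      rw [PMF.map_comp]
      congr 1
      funext f
      simp [Fin.cons_update]

theorem piFin_map {m : ℕ} (p : Fin m → PMF α) (f : Fin m → α → β) :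
    piFin m (fun i => (p i).map (f i)) = (piFin m p).map fun w i => f i (w i) := by
  induction m with
  | zero =>
    simp only [piFin, PMF.pure_map]
    congr 1
    funext i
    exact i.elim0
  | succ m ih =>
    simp only [piFin_succ, PMF.map_bind, PMF.map_comp, PMF.bind_map]
    congr 1
    funext a
    simp only [Function.comp]
    rw [ih (fun i => p i.succ) (fun i => f i.succ), PMF.map_comp]
    congr 1
    funext w
    funext i
    refine Fin.cases ?_ (fun i => ?_) i <;> simp

theorem piFin_pure {m : ℕ} (v : Fin m → α) : piFin m (fun i => PMF.pure (v i)) = PMF.pure v := by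
  induction m with
  | zero =>
    simp only [piFin]
    congr 1
    funext i
    exact i.elim0
  | succ m ih =>
    rw [piFin_succ, PMF.pure_bind, ih (fun i => v i.succ), PMF.pure_map]
    congr 1
    exact Fin.cons_self_tail v

/-- A product of distributions of pairs is a pair of product distributions. -/
theorem piFin_pair {m : ℕ} (p : Fin m → PMF α) (q : Fin m → PMF β) :
    piFin m (fun i => (p i).bind fun a => (q i).map (Prod.mk a)) =
      (piFin m p).bind fun f => (piFin m q).map fun g i => (f i, g i) := by
  induction m with
  | zero =>
    simp only [piFin, PMF.pure_map, PMF.pure_bind]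
    congr 1
    funext i
    exact i.elim0
  | succ m ih =>
    simp only [piFin_succ, PMF.map_bind, PMF.map_comp, PMF.bind_map, PMF.bind_bind]
    rw [ih (fun i => p i.succ) (fun i => q i.succ)]
    congr 1
    funext a
    simp only [Function.comp_def, PMF.map_bind, PMF.map_comp]
    rw [PMF.bind_comm]
    congr 1
    funext f
    congr 1
    funext b
    congr 1
    funext g
    funext i
    refine Fin.cases ?_ (fun i => ?_) i <;> simp

theorem uniform_pi [Fintype α] [Nonempty α] {m : ℕ} [Fintype (Fin m → α)]
    [Nonempty (Fin m → α)] :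
    uniformOfFintype (Fin m → α) = piFin m fun _ => uniformOfFintype α := by
  rename_i i1 i2
  revert i1 i2
  induction m with
  | zero =>
    intro i1 i2
    rw [← uniform_map_equiv (α := Unit) (Equiv.ofUnique Unit (Fin 0 → α))]
    have : uniformOfFintype Unit = PMF.pure () := by
      ext u
      simp
    rw [this, PMF.pure_map, piFin]
    congr 1
  | succ m ih =>
    intro i1 i2
    rw [← uniform_map_equiv (Fin.consEquiv fun _ : Fin (m + 1) => α), uniform_prod, PMF.map_bind,
      piFin_succ, ih]
    congr 1
    funext a
    rw [PMF.map_comp]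
    rfl

theorem Close.piFin {m : ℕ} {p q : Fin m → PMF α} {ε : Fin m → ℝ≥0∞}
    (h : ∀ i, Close (ε i) (p i) (q i)) : Close (∑ i, ε i) (piFin m p) (piFin m q) := by
  induction m with
  | zero => exact Close.of_eq rfl
  | succ m ih =>
    rw [piFin_succ, piFin_succ, Fin.sum_univ_succ]
    exact (h 0).bind fun a _ => (ih fun i => h i.succ).map _

theorem prob_piFin_le {m : ℕ} {p : Fin m → PMF α} {A : Fin m → α → Prop} {ε : Fin m → ℝ≥0∞}
    (h : ∀ i, prob (p i) (A i) ≤ ε i) : prob (piFin m p) (fun f => ∃ i, A i (f i)) ≤ ∑ i, ε i := by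
  refine (prob_exists_le _ _).trans (Finset.sum_le_sum fun i _ => ?_)
  refine le_trans (le_of_eq ?_) (h i)
  rw [piFin_resample p i, prob_bind]
  have : ∀ a, prob ((piFin m p).map fun f => Function.update f i a) (fun f => A i (f i)) =
      prob (piFin m p) fun _ => A i a := fun a => by
    rw [prob_map]
    simp
  simp only [this]
  unfold prob
  congr 1
  funext a
  exact expect_const _ _

end Uniform

/-! ### Sequential processes -/

section Sequential

variable {m : ℕ} {σ κ τ : Type} (st : Fin m → σ → κ → τ × σ)

/-- The outputs of a sequential process: the parties in the list act one after the other, party `i`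
with coins `f i`, each seeing the state and producing an output and a new state. The outputs of the
parties that do not act are given by `g`. -/
def runF : List (Fin m) → σ → (Fin m → κ) → (Fin m → τ) → Fin m → τ
  | [], _, _, g => g
  | i :: L, c, f, g =>
      Function.update (runF L (st i c (f i)).2 f g) i (st i c (f i)).1

/-- The distribution of the outputs of a sequential process, if the coins of party `i` are
distributed according to `p i`. -/
noncomputable def proc (p : Fin m → PMF κ) : List (Fin m) → σ → (Fin m → τ) → PMF (Fin m → τ)
  | [], _, g => PMF.pure g
  | i :: L, c, g => (p i).bind fun a =>
      (proc p L (st i c a).2 g).map fun w => Function.update w i (st i c a).1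

theorem runF_update_of_notMem {i : Fin m} {L : List (Fin m)} (hi : i ∉ L) (c : σ) (f : Fin m → κ)
    (g : Fin m → τ) (a : κ) : runF st L c (Function.update f i a) g = runF st L c f g := by
  induction L generalizing c with
  | nil => rfl
  | cons j L ih =>
    simp only [List.mem_cons, not_or] at hi
    simp only [runF]
    rw [Function.update_of_ne (Ne.symm hi.1), ih hi.2]

theorem map_runF (p : Fin m → PMF κ) {L : List (Fin m)} (hL : L.Nodup) (c : σ) (g : Fin m → τ) :
    (piFin m p).map (fun f => runF st L c f g) = proc st p L c g := by
  induction L generalizing c with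
  | nil => exact PMF.map_const _ _
  | cons i L ih =>
    rw [List.nodup_cons] at hL
    rw [piFin_resample p i, PMF.map_bind, proc]
    congr 1
    funext a
    rw [← ih hL.2, PMF.map_comp, PMF.map_comp]
    congr 1
    funext f
    simp only [Function.comp, runF, Function.update_self]
    rw [runF_update_of_notMem st hL.1]

/-- `s` lists the states before the actions of the parties in `L`, starting from `c`. -/
def IsTrace (f : Fin m → κ) (s : Fin m → σ) : List (Fin m) → σ → Prop
  | [], _ => True
  | i :: L, c => s i = c ∧ IsTrace f s L (st i c (f i)).2

theorem runF_apply {f : Fin m → κ} {s : Fin m → σ} {L : List (Fin m)} {c : σ} (hL : L.Nodup)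
    (h : IsTrace st f s L c) (g : Fin m → τ) {i : Fin m} (hi : i ∈ L) :
    runF st L c f g i = (st i (s i) (f i)).1 := by
  induction L generalizing c with
  | nil => simp at hi
  | cons j L ih =>
    rw [List.nodup_cons] at hL
    obtain ⟨h1, h2⟩ := h
    simp only [runF]
    by_cases hij : i = j
    · subst hij
      simp [h1]
    · rw [Function.update_of_ne hij]
      exact ih hL.2 h2 (by simpa [hij] using hi)

end Sequential

/-! ### Semantics and running time of programs -/

theorem piFin_snoc {α : Type} (m : ℕ) (p : Fin (m + 1) → PMF α) :
    piFin (m + 1) p = (p (Fin.last m)).bind fun a =>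
      (piFin m fun i => p i.castSucc).map fun f => Fin.snoc (α := fun _ => α) f a := by
  induction m with
  | zero =>
    simp only [piFin, PMF.pure_map]
    congr 1
    funext a
    congr 1
    funext i
    obtain rfl : i = 0 := Fin.ext (by omega)
    rfl
  | succ m ih =>
    rw [piFin_succ]
    conv_lhs => enter [2, a]; rw [ih fun i => p i.succ]
    simp only [PMF.map_bind, PMF.map_comp, piFin_succ]
    rw [PMF.bind_comm]
    congr 1
    funext a
    congr 1
    funext b
    congr 1
    funext f
    simp only [Function.comp]
    rw [Fin.cons_snoc_eq_snoc_cons]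

section Run

variable {a b c e : Ty}

theorem run_id (x : a.den) : (Tm.id : Tm a a).run x = PMF.pure x := by
  simp [Tm.run, Tm.eval, PMF.pure_map, costed]

theorem run_comp (g : Tm b c) (f : Tm a b) (x : a.den) :
    (Tm.comp g f).run x = (f.run x).bind g.run := by
  simp only [Tm.run, Tm.eval, PMF.map_bind, PMF.map_comp, PMF.bind_map]
  rfl

theorem run_star (x : a.den) : (Tm.star : Tm a .unit).run x = PMF.pure () := by
  simp [Tm.run, Tm.eval, PMF.pure_map, costed]

theorem run_pair (f : Tm a b) (g : Tm a c) (x : a.den) :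
    (Tm.pair f g).run x = (f.run x).bind fun y => (g.run x).map fun z => (y, z) := by
  simp only [Tm.run, Tm.eval, PMF.map_bind, PMF.map_comp, PMF.bind_map]
  rfl

theorem run_fst (x : (Ty.prod a b).den) : (Tm.fst : Tm (.prod a b) a).run x = PMF.pure x.1 := by
  simp [Tm.run, Tm.eval, PMF.pure_map, costed]

theorem run_snd (x : (Ty.prod a b).den) : (Tm.snd : Tm (.prod a b) b).run x = PMF.pure x.2 := by
  simp [Tm.run, Tm.eval, PMF.pure_map, costed]

theorem run_lit (v : Bool) (x : a.den) : (Tm.lit v : Tm a .bool).run x = PMF.pure v := by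
  simp [Tm.run, Tm.eval, PMF.pure_map, costed]

theorem run_ite (t : Tm a .bool) (f g : Tm a b) (x : a.den) :
    (Tm.ite t f g).run x = (t.run x).bind fun v => if v then f.run x else g.run x := by
  simp only [Tm.run, Tm.eval, PMF.map_bind, PMF.map_comp, PMF.bind_map]
  congr 1
  funext y
  simp only [Function.comp_def]
  split_ifs <;> rfl

theorem run_nil (x : a.den) : (Tm.nil : Tm a (.list b)).run x = PMF.pure [] := by
  simp [Tm.run, Tm.eval, PMF.pure_map, costed]

theorem run_cons (x : (Ty.prod a (.list a)).den) :
    (Tm.cons : Tm (.prod a (.list a)) (.list a)).run x = PMF.pure (x.1 :: x.2) := by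
  simp [Tm.run, Tm.eval, PMF.pure_map, costed]

theorem run_caseList_nil (f : Tm e c) (g : Tm (.prod e (.prod a (.list a))) c) (x : e.den) :
    (Tm.caseList f g).run (x, []) = f.run x := by
  simp only [Tm.run, Tm.eval, PMF.map_comp]
  rfl

theorem run_caseList_cons (f : Tm e c) (g : Tm (.prod e (.prod a (.list a))) c) (x : e.den)
    (y : a.den) (l : List a.den) :
    (Tm.caseList f g).run (x, y :: l) = g.run (x, (y, l)) := by
  simp only [Tm.run, Tm.eval, PMF.map_comp]
  rfl

theorem run_fold (s : Tm (.prod e (.prod c a)) c) (x : e.den) (z : c.den) (l : List a.den) :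
    (Tm.fold s).run (x, (z, l)) =
      l.foldl (fun q y => q.bind fun acc => s.run (x, (acc, y))) (PMF.pure z) := by
  have h : ∀ (q : PMF (c.den × ℕ)),
      (l.foldl (fun q y => q.bind fun acc => (s.eval (x, (acc.1, y))).map
        fun z => (z.1, acc.2 + z.2 + 1)) q).map Prod.fst =
      l.foldl (fun q y => q.bind fun acc => s.run (x, (acc, y))) (q.map Prod.fst) := by
    induction l with
    | nil => intro q; rfl
    | cons y l ih =>
      intro q
      simp only [List.foldl_cons]
      rw [ih]
      congr 1
      simp only [Tm.run, PMF.map_bind, PMF.map_comp, PMF.bind_map]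
      rfl
  simp only [Tm.run, Tm.eval]
  rw [h, PMF.pure_map]
  rfl

theorem run_pick_cons (y : a.den) (l : List a.den) :
    (Tm.pick : Tm (.list a) (.list a)).run (y :: l) =
      (uniformOfFintype (Fin (l.length + 1))).map fun i => [(y :: l).get i] := by
  simp only [Tm.run, Tm.eval, PMF.map_comp]
  rfl

end Run

section Cost

variable {a b c e : Ty}

theorem size_pos : ∀ (a : Ty) (x : a.den), 1 ≤ a.size x
  | .unit, _ => le_rfl
  | .bool, _ => le_rfl
  | .prod _ _, _ => by simp only [Ty.size]; omega
  | .list _, _ => by simp only [Ty.size]; omega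

theorem size_prod (x : a.den) (y : b.den) :
    (Ty.prod a b).size (x, y) = 1 + a.size x + b.size y := rfl

theorem size_nil : (Ty.list a).size [] = 1 := rfl

theorem size_cons (y : a.den) (l : List a.den) :
    (Ty.list a).size (y :: l) = (Ty.list a).size l + (1 + a.size y) := by
  simp only [Ty.size, List.map_cons, List.sum_cons]
  omega

theorem size_le_of_mem {y : a.den} {l : List a.den} (h : y ∈ l) :
    a.size y + 1 ≤ (Ty.list a).size l := by
  induction l with
  | nil => simp at h
  | cons z l ih =>
    rw [size_cons]
    rcases List.mem_cons.1 h with rfl | h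
    · have := size_pos (.list a) l; omega
    · have := ih h; omega

theorem length_le_size (l : List a.den) : l.length + 1 ≤ (Ty.list a).size l := by
  induction l with
  | nil => simp [Ty.size]
  | cons z l ih => rw [size_cons, List.length_cons]; omega

/-- An output is no larger than the cost of producing it. -/
theorem size_le_cost (t : Tm a b) (x : a.den) (o : b.den × ℕ) (ho : o ∈ (t.eval x).support) :
    b.size o.1 ≤ o.2 := by
  induction t with
  | id | star | fst | snd | lit | nil | cons =>
    simp only [Tm.eval, PMF.mem_support_pure_iff] at ho
    subst ho
    exact le_rfl
  | comp g f ihg ihf =>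
    simp only [Tm.eval, PMF.mem_support_bind_iff, PMF.mem_support_map_iff] at ho
    obtain ⟨y, hy, z, hz, rfl⟩ := ho
    have := ihg _ _ hz
    simp only
    omega
  | pair f g ihf ihg =>
    simp only [Tm.eval, PMF.mem_support_bind_iff, PMF.mem_support_map_iff] at ho
    obtain ⟨y, hy, z, hz, rfl⟩ := ho
    have := ihg _ _ hz
    have := ihf _ _ hy
    simp only [Ty.size]
    omega
  | ite t f g iht ihf ihg =>
    simp only [Tm.eval, PMF.mem_support_bind_iff, PMF.mem_support_map_iff] at ho
    obtain ⟨y, hy, z, hz, rfl⟩ := ho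
    simp only
    split_ifs at hz
    · have := ihf _ _ hz; omega
    · have := ihg _ _ hz; omega
  | caseList f g ihf ihg =>
    rcases x with ⟨x, _ | ⟨y, l⟩⟩
    all_goals
      simp only [Tm.eval, PMF.mem_support_map_iff] at ho
      obtain ⟨z, hz, rfl⟩ := ho
      simp only
    · have := ihf _ _ hz; omega
    · have := ihg _ _ hz; omega
  | @fold e a c s ih =>
    obtain ⟨x, z, l⟩ := x
    simp only [Tm.eval] at ho
    have h : ∀ (q : PMF (c.den × ℕ)), (∀ o ∈ q.support, c.size o.1 ≤ o.2) →
        ∀ o ∈ (l.foldl (fun q y => q.bind fun acc => (s.eval (x, (acc.1, y))).map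
        fun z => (z.1, acc.2 + z.2 + 1)) q).support, c.size o.1 ≤ o.2 := by
      clear ho
      induction l with
      | nil => exact fun q h => h
      | cons y l ihl =>
        intro q hq
        refine ihl _ fun o ho => ?_
        simp only [PMF.mem_support_bind_iff, PMF.mem_support_map_iff] at ho
        obtain ⟨w, hw, z, hz, rfl⟩ := ho
        have := ih _ _ hz
        simp only
        omega
    refine h _ (fun o ho => ?_) _ ho
    rw [PMF.mem_support_pure_iff] at ho
    subst ho
    exact le_rfl
  | pick =>
    rcases x with _ | ⟨y, l⟩
    · simp only [Tm.eval, PMF.mem_support_pure_iff] at ho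
      subst ho
      exact le_rfl
    · simp only [Tm.eval, PMF.mem_support_map_iff] at ho
      obtain ⟨z, hz, rfl⟩ := ho
      exact le_rfl

theorem mem_support_run {t : Tm a b} {x : a.den} {y : b.den} :
    y ∈ (t.run x).support ↔ ∃ n, (y, n) ∈ (t.eval x).support := by
  unfold Tm.run
  rw [PMF.mem_support_map_iff]
  constructor
  · rintro ⟨⟨z, n⟩, h, rfl⟩
    exact ⟨n, h⟩
  · rintro ⟨n, h⟩
    exact ⟨_, h, rfl⟩

theorem eval_mono (p : Polynomial ℕ) {x y : ℕ} (h : x ≤ y) : p.eval x ≤ p.eval y := by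
  rw [Polynomial.eval_eq_sum, Polynomial.eval_eq_sum]
  exact Finset.sum_le_sum fun i _ => Nat.mul_le_mul_left _ (Nat.pow_le_pow_left h i)

theorem Tm.PolyTime.size_le {t : Tm a b} {p : Polynomial ℕ}
    (hp : ∀ x : a.den, ∀ o ∈ (t.eval x).support, o.2 ≤ p.eval (a.size x)) {x : a.den} {y : b.den}
    (hy : y ∈ (t.run x).support) : b.size y ≤ p.eval (a.size x) := by
  obtain ⟨n, hn⟩ := mem_support_run.1 hy
  exact (size_le_cost t x _ hn).trans (hp x _ hn)

theorem polyTime_of_pure {t : Tm a b} {f : a.den → b.den}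
    (h : ∀ x, t.eval x = PMF.pure (costed b (f x))) (hf : ∀ x, b.size (f x) ≤ a.size x + 1) :
    t.PolyTime :=
  ⟨Polynomial.X + 1, fun x o ho => by
    rw [h, PMF.mem_support_pure_iff] at ho
    subst ho
    simpa [costed] using hf x⟩

theorem polyTime_id : (Tm.id : Tm a a).PolyTime :=
  polyTime_of_pure (f := fun x => x) (fun _ => rfl) fun x => by omega

theorem polyTime_star : (Tm.star : Tm a .unit).PolyTime :=
  polyTime_of_pure (f := fun _ => ()) (fun _ => rfl) fun x => by simp [Ty.size]

theorem polyTime_fst : (Tm.fst : Tm (.prod a b) a).PolyTime :=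
  polyTime_of_pure (f := fun x => x.1) (fun _ => rfl) fun x => by simp only [Ty.size]; omega

theorem polyTime_snd : (Tm.snd : Tm (.prod a b) b).PolyTime :=
  polyTime_of_pure (f := fun x => x.2) (fun _ => rfl) fun x => by simp only [Ty.size]; omega

theorem polyTime_lit (v : Bool) : (Tm.lit v : Tm a .bool).PolyTime :=
  polyTime_of_pure (f := fun _ => v) (fun _ => rfl) fun x => by simp [Ty.size]

theorem polyTime_nil : (Tm.nil : Tm a (.list b)).PolyTime :=
  polyTime_of_pure (f := fun _ => []) (fun _ => rfl) fun x => by simp [Ty.size]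

theorem polyTime_cons : (Tm.cons : Tm (.prod a (.list a)) (.list a)).PolyTime :=
  polyTime_of_pure (f := fun x => x.1 :: x.2) (fun _ => rfl) fun x => by
    rw [size_cons]; simp only [Ty.size]; omega

theorem polyTime_comp {g : Tm b c} {f : Tm a b} (hg : g.PolyTime) (hf : f.PolyTime) :
    (Tm.comp g f).PolyTime := by
  obtain ⟨p, hp⟩ := hf
  obtain ⟨q, hq⟩ := hg
  refine ⟨p + q.comp p + 1, fun x o ho => ?_⟩
  simp only [Tm.eval, PMF.mem_support_bind_iff, PMF.mem_support_map_iff] at ho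
  obtain ⟨y, hy, z, hz, rfl⟩ := ho
  have h1 := hp _ _ hy
  have h2 := (hq _ _ hz).trans (eval_mono q ((size_le_cost f x y hy).trans h1))
  simp only [Polynomial.eval_add, Polynomial.eval_comp, Polynomial.eval_one]
  omega

theorem polyTime_pair {f : Tm a b} {g : Tm a c} (hf : f.PolyTime) (hg : g.PolyTime) :
    (Tm.pair f g).PolyTime := by
  obtain ⟨p, hp⟩ := hf
  obtain ⟨q, hq⟩ := hg
  refine ⟨p + q + 1, fun x o ho => ?_⟩
  simp only [Tm.eval, PMF.mem_support_bind_iff, PMF.mem_support_map_iff] at ho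
  obtain ⟨y, hy, z, hz, rfl⟩ := ho
  have h1 := hp _ _ hy
  have h2 := hq _ _ hz
  simp only [Polynomial.eval_add, Polynomial.eval_one]
  omega

theorem polyTime_ite {t : Tm a .bool} {f g : Tm a b} (ht : t.PolyTime) (hf : f.PolyTime)
    (hg : g.PolyTime) : (Tm.ite t f g).PolyTime := by
  obtain ⟨r, hr⟩ := ht
  obtain ⟨p, hp⟩ := hf
  obtain ⟨q, hq⟩ := hg
  refine ⟨r + p + q + 1, fun x o ho => ?_⟩
  simp only [Tm.eval, PMF.mem_support_bind_iff, PMF.mem_support_map_iff] at ho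
  obtain ⟨y, hy, z, hz, rfl⟩ := ho
  have h1 := hr _ _ hy
  simp only [Polynomial.eval_add, Polynomial.eval_one]
  split_ifs at hz
  · have := hp _ _ hz; omega
  · have := hq _ _ hz; omega

theorem polyTime_caseList {f : Tm e c} {g : Tm (.prod e (.prod a (.list a))) c} (hf : f.PolyTime)
    (hg : g.PolyTime) : (Tm.caseList f g).PolyTime := by
  obtain ⟨p, hp⟩ := hf
  obtain ⟨q, hq⟩ := hg
  refine ⟨p + q + 1, fun x o ho => ?_⟩
  simp only [Polynomial.eval_add, Polynomial.eval_one]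
  rcases x with ⟨x, _ | ⟨y, l⟩⟩
  all_goals
    simp only [Tm.eval, PMF.mem_support_map_iff] at ho
    obtain ⟨z, hz, rfl⟩ := ho
    simp only
  · have h1 := hp _ _ hz
    have h2 := eval_mono p (show e.size x ≤ (Ty.prod e (.list a)).size (x, []) by
      simp only [Ty.size]; omega)
    omega
  · have h1 := hq _ _ hz
    have h2 := eval_mono q (show (Ty.prod e (.prod a (.list a))).size (x, (y, l)) ≤
      (Ty.prod e (.list a)).size (x, y :: l) by
        rw [size_prod, size_prod, size_prod, size_cons]; omega)
    omega

theorem polyTime_pick : (Tm.pick : Tm (.list a) (.list a)).PolyTime := by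
  refine ⟨Polynomial.X + 1, fun x o ho => ?_⟩
  rcases x with _ | ⟨y, l⟩
  · simp only [Tm.eval, PMF.mem_support_pure_iff] at ho
    subst ho
    simp [costed]
  · simp only [Tm.eval, PMF.mem_support_map_iff] at ho
    obtain ⟨z, hz, rfl⟩ := ho
    have := size_le_of_mem (List.get_mem (y :: l) z)
    simp only [costed, size_cons, size_nil, Polynomial.eval_add, Polynomial.eval_X,
      Polynomial.eval_one] at *
    omega

/-- A loop runs in polynomial time if its body does and all intermediate values of the accumulator
are polynomially bounded, which an invariant has to guarantee. -/
theorem polyTime_fold {s : Tm (.prod e (.prod c a)) c} (hs : s.PolyTime) (q : Polynomial ℕ)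
    (Inv : e.den → c.den → List a.den → ℕ → c.den → Prop) (h0 : ∀ x z l, Inv x z l 0 z)
    (hstep : ∀ x z l i acc y, i < l.length → y ∈ l → Inv x z l i acc →
      ∀ w ∈ (s.run (x, (acc, y))).support, Inv x z l (i + 1) w)
    (hb : ∀ x z l i acc, i ≤ l.length → Inv x z l i acc →
      c.size acc ≤ q.eval ((Ty.prod e (.prod c (.list a))).size (x, (z, l)))) :
    (Tm.fold s).PolyTime := by
  obtain ⟨p, hp⟩ := hs
  refine ⟨Polynomial.X + Polynomial.X * (p.comp (2 + Polynomial.X + q) + 1), fun X o ho => ?_⟩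
  obtain ⟨x, z, l⟩ := X
  simp only [Tm.eval] at ho
  set N := (Ty.prod e (.prod c (.list a))).size (x, (z, l)) with hN
  set K := p.eval (2 + N + q.eval N) + 1 with hK
  have h : ∀ (l' : List a.den) (i : ℕ) (q' : PMF (c.den × ℕ)), i + l'.length = l.length →
      (∀ y ∈ l', y ∈ l) →
      (∀ o ∈ q'.support, Inv x z l i o.1 ∧ o.2 ≤ c.size z + i * K) →
      ∀ o ∈ (l'.foldl (fun q y => q.bind fun acc => (s.eval (x, (acc.1, y))).map
      fun z => (z.1, acc.2 + z.2 + 1)) q').support, o.2 ≤ c.size z + l.length * K := by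
    intro l'
    induction l' with
    | nil =>
      intro i q' hi _ hq' o ho
      have := (hq' o ho).2
      simp only [List.length_nil, add_zero] at hi
      rwa [hi] at this
    | cons y l' ih =>
      intro i q' hi hl' hq' o ho
      simp only [List.length_cons] at hi
      refine ih (i + 1) _ (by omega) (fun w hw => hl' w (List.mem_cons_of_mem _ hw)) ?_ o ho
      intro o ho
      simp only [PMF.mem_support_bind_iff, PMF.mem_support_map_iff] at ho
      obtain ⟨w, hw, v, hv, rfl⟩ := ho
      obtain ⟨hinv, hcost⟩ := hq' w hw
      have hy : y ∈ l := hl' y List.mem_cons_self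
      refine ⟨hstep x z l i w.1 y (by omega) hy hinv v.1 (mem_support_run.2 ⟨v.2, hv⟩), ?_⟩
      have h1 := hp _ _ hv
      have h2 : (Ty.prod e (.prod c a)).size (x, (w.1, y)) ≤ 2 + N + q.eval N := by
        have := hb x z l i w.1 (by omega) hinv
        rw [← hN] at this
        have h3 := size_le_of_mem hy
        have h4 : N = 1 + e.size x + (1 + c.size z + (Ty.list a).size l) := rfl
        rw [size_prod, size_prod]
        omega
      have h3 := h1.trans (eval_mono p h2)
      simp only [add_mul, one_mul]
      omega
  have h1 := h l 0 (PMF.pure (costed c z)) (by simp) (fun _ h => h) (fun o ho => by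
    rw [PMF.mem_support_pure_iff] at ho
    subst ho
    exact ⟨h0 _ _ _, by simp [costed]⟩) o ho
  have hlen : c.size z ≤ N ∧ l.length ≤ N := by
    have := length_le_size l
    rw [hN, size_prod, size_prod]
    omega
  simp only [Polynomial.eval_add, Polynomial.eval_mul, Polynomial.eval_comp, Polynomial.eval_X,
    Polynomial.eval_one, Polynomial.eval_ofNat]
  exact h1.trans (add_le_add hlen.1 (Nat.mul_le_mul_right _ hlen.2))

/-- A loop whose body increases the size of the accumulator at most by a polynomial in the sizes of
the environment and of the current entry. -/
theorem polyTime_fold_growth {s : Tm (.prod e (.prod c a)) c} (hs : s.PolyTime)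
    (r : Polynomial ℕ) (h : ∀ x acc y, ∀ w ∈ (s.run (x, (acc, y))).support,
      c.size w ≤ c.size acc + r.eval (e.size x + a.size y)) : (Tm.fold s).PolyTime := by
  refine polyTime_fold hs (Polynomial.X + Polynomial.X * r)
    (fun x z l i acc => c.size acc ≤ c.size z +
      i * r.eval ((Ty.prod e (.prod c (.list a))).size (x, (z, l)))) (by simp) ?_ ?_
  · intro x z l i acc y _ hy hinv w hw
    have h1 := h _ _ _ w hw
    have h2 := eval_mono r (show e.size x + a.size y ≤
      (Ty.prod e (.prod c (.list a))).size (x, (z, l)) by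
        have := size_le_of_mem hy
        rw [size_prod, size_prod]; omega)
    simp only [add_mul, one_mul]
    omega
  · intro x z l i acc hi hinv
    have := length_le_size l
    simp only [Polynomial.eval_add, Polynomial.eval_mul, Polynomial.eval_X]
    refine hinv.trans (add_le_add ?_ (Nat.mul_le_mul_right _ ?_)) <;>
    · rw [size_prod, size_prod]; omega

end Cost

/-! ### Distributions and functions that are computed in polynomial time -/

section Rules

variable {a b c d e : Ty} {Γ : Type} {cΓ : Γ → e.den}

/-- The distributions `p γ` are sampled, from the code of `γ`, by one polynomial-time program.
`Γ` plays the role of a context: a type of tuples of arguments, which includes the security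
parameter; the code need not determine the arguments. -/
def Samples (cΓ : Γ → e.den) (p : Γ → PMF b.den) : Prop :=
  ∃ t : Tm e b, t.PolyTime ∧ ∀ γ, t.run (cΓ γ) = p γ

/-- The values `v γ` are computed, from the code of `γ`, by one polynomial-time program. -/
def Computes (cΓ : Γ → e.den) (v : Γ → b.den) : Prop :=
  ∃ t : Tm e b, t.PolyTime ∧ ∀ γ, t.run (cΓ γ) = PMF.pure (v γ)

theorem Samples.congr {p q : Γ → PMF b.den} (h : Samples cΓ p) (hpq : ∀ γ, p γ = q γ) :
    Samples cΓ q := (funext hpq : p = q) ▸ h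

theorem Computes.congr {u v : Γ → b.den} (h : Computes cΓ u) (huv : ∀ γ, u γ = v γ) :
    Computes cΓ v := (funext huv : u = v) ▸ h

/-- Substitution: sampling in another context, whose code is computed from the given one. -/
theorem Samples.subst {Δ : Type} {cΔ : Δ → d.den} {p : Δ → PMF b.den} (hp : Samples cΔ p)
    {g : Γ → Δ} (hg : Computes cΓ fun γ => cΔ (g γ)) : Samples cΓ fun γ => p (g γ) := by
  obtain ⟨t, ht, h⟩ := hp
  obtain ⟨s, hs, h'⟩ := hg
  exact ⟨.comp t s, polyTime_comp ht hs, fun γ => by rw [run_comp, h', PMF.pure_bind, h]⟩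

theorem Computes.subst {Δ : Type} {cΔ : Δ → d.den} {v : Δ → b.den} (hp : Computes cΔ v)
    {g : Γ → Δ} (hg : Computes cΓ fun γ => cΔ (g γ)) : Computes cΓ fun γ => v (g γ) :=
  Samples.subst hp hg

/-- Application of a function on data. -/
theorem Computes.app {f : a.den → b.den} (hf : Computes (e := a) (fun x => x) f) {v : Γ → a.den}
    (hv : Computes cΓ v) : Computes cΓ fun γ => f (v γ) :=
  Samples.subst hf hv

theorem Computes.self : Computes cΓ cΓ :=
  ⟨.id, polyTime_id, fun _ => run_id _⟩

theorem Samples.bind_map {p : Γ → PMF b.den} {q : Γ → PMF c.den} (hp : Samples cΓ p)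
    (hq : Samples cΓ q) : Samples (b := .prod b c) cΓ fun γ => (p γ).bind fun y =>
      (q γ).map fun z => (y, z) := by
  obtain ⟨t, ht, h⟩ := hp
  obtain ⟨s, hs, h'⟩ := hq
  exact ⟨.pair t s, polyTime_pair ht hs, fun γ => by rw [run_pair, h, h']⟩

theorem Computes.pair {u : Γ → b.den} {v : Γ → c.den} (hu : Computes cΓ u) (hv : Computes cΓ v) :
    Computes (b := .prod b c) cΓ fun γ => (u γ, v γ) :=
  (Samples.bind_map hu hv).congr fun γ => by rw [PMF.pure_bind, PMF.pure_map]

theorem Computes.fst {v : Γ → (Ty.prod a b).den} (hv : Computes cΓ v) :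
    Computes cΓ fun γ => (v γ).1 :=
  Computes.app ⟨.fst, polyTime_fst, fun x => run_fst x⟩ hv

theorem Computes.snd {v : Γ → (Ty.prod a b).den} (hv : Computes cΓ v) :
    Computes cΓ fun γ => (v γ).2 :=
  Computes.app ⟨.snd, polyTime_snd, fun x => run_snd x⟩ hv

/-- Sampling `y` from `p γ` and continuing in the context that is extended by `y`. -/
theorem Samples.bind {β : Γ → Type} {cβ : ∀ γ, β γ → b.den} {p : ∀ γ, PMF (β γ)}
    {q : ∀ γ, β γ → PMF d.den} (hp : Samples cΓ fun γ => (p γ).map (cβ γ))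
    (hq : Samples (e := .prod e b) (fun x : Σ γ, β γ => (cΓ x.1, cβ x.1 x.2))
      fun x => q x.1 x.2) : Samples cΓ fun γ => (p γ).bind (q γ) := by
  obtain ⟨s, hs, h⟩ := hp
  obtain ⟨t, ht, h'⟩ := hq
  refine ⟨.comp t (.pair .id s), polyTime_comp ht (polyTime_pair polyTime_id hs), fun γ => ?_⟩
  rw [run_comp, run_pair, run_id, PMF.pure_bind, h, PMF.map_comp, PMF.bind_map]
  congr 1
  funext y
  exact h' ⟨γ, y⟩

/-- Deterministic postprocessing of a sample. -/
theorem Samples.map {β : Γ → Type} {cβ : ∀ γ, β γ → b.den} {p : ∀ γ, PMF (β γ)}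
    {v : ∀ γ, β γ → d.den} (hp : Samples cΓ fun γ => (p γ).map (cβ γ))
    (hv : Computes (e := .prod e b) (fun x : Σ γ, β γ => (cΓ x.1, cβ x.1 x.2))
      fun x => v x.1 x.2) : Samples cΓ fun γ => (p γ).map (v γ) :=
  Samples.bind hp hv

theorem Computes.ite {t : Γ → Bool} {u v : Γ → b.den} (ht : Computes (b := .bool) cΓ t)
    (hu : Computes cΓ u) (hv : Computes cΓ v) :
    Computes cΓ fun γ => if t γ then u γ else v γ := by
  obtain ⟨r, hr, h⟩ := ht
  obtain ⟨s, hs, h'⟩ := hu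
  obtain ⟨s', hs', h''⟩ := hv
  refine ⟨.ite r s s', polyTime_ite hr hs hs', fun γ => ?_⟩
  rw [run_ite, h, PMF.pure_bind, h', h'']
  beta_reduce
  split_ifs <;> rfl

theorem Computes.lit (v : Bool) : Computes (b := .bool) cΓ fun _ => v :=
  ⟨.lit v, polyTime_lit v, fun _ => run_lit _ _⟩

theorem Computes.nil : Computes (b := .list b) cΓ fun _ => [] :=
  ⟨.nil, polyTime_nil, fun _ => run_nil _⟩

theorem Computes.star : Computes (b := .unit) cΓ fun _ => () :=
  ⟨.star, polyTime_star, fun _ => run_star _⟩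

theorem Computes.cons {u : Γ → a.den} {v : Γ → List a.den} (hu : Computes cΓ u)
    (hv : Computes (b := .list a) cΓ v) : Computes (b := .list a) cΓ fun γ => u γ :: v γ :=
  Computes.app (f := fun x : (Ty.prod a (.list a)).den => (x.1 :: x.2 : (Ty.list a).den))
    ⟨.cons, polyTime_cons, fun x => run_cons x⟩ (hu.pair hv)

theorem Computes.const : ∀ {b : Ty} (x : b.den), Computes cΓ fun _ => x
  | .unit, _ => Computes.star
  | .bool, x => Computes.lit x
  | .prod _ _, x => (Computes.const x.1).pair (Computes.const x.2)
  | .list _, l => by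
    induction l with
    | nil => exact Computes.nil
    | cons y l ih => exact (Computes.const y).cons ih

theorem Computes.ofFn {m : ℕ} {v : Fin m → Γ → a.den} (h : ∀ i, Computes cΓ (v i)) :
    Computes (b := .list a) cΓ fun γ => List.ofFn fun i => v i γ := by
  induction m with
  | zero => exact Computes.nil.congr fun γ => by simp
  | succ m ih =>
    exact ((h 0).cons (ih fun i => h i.succ)).congr fun γ => by simp [List.ofFn_succ]

/-- Case distinction on a list. -/
theorem Computes.caseList {l : Γ → List a.den} {u : Γ → c.den} {v : Γ → a.den → List a.den → c.den}
    (hl : Computes (b := .list a) cΓ l) (hu : Computes cΓ u)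
    (hv : Computes (e := .prod e (.prod a (.list a)))
      (fun x : Γ × a.den × List a.den => (cΓ x.1, (x.2.1, x.2.2))) fun x => v x.1 x.2.1 x.2.2) :
    Computes cΓ fun γ => match l γ with
      | [] => u γ
      | y :: l' => v γ y l' := by
  obtain ⟨r, hr, h⟩ := hl
  obtain ⟨s, hs, h'⟩ := hu
  obtain ⟨t, ht, h''⟩ := hv
  refine ⟨.comp (.caseList s t) (.pair .id r),
    polyTime_comp (polyTime_caseList hs ht) (polyTime_pair polyTime_id hr), fun γ => ?_⟩
  rw [run_comp, run_pair, run_id, PMF.pure_bind, h, PMF.pure_map, PMF.pure_bind]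
  beta_reduce
  generalize l γ = l
  rcases l with _ | ⟨y, l'⟩
  · rw [run_caseList_nil, h']
  · rw [run_caseList_cons, h'' (γ, (y, l'))]

theorem Computes.elim {α : Γ → Type} {cα : ∀ γ, α γ → a.den} {o : ∀ γ, Option (α γ)}
    {u : Γ → c.den} {v : ∀ γ, α γ → c.den}
    (ho : Computes (b := .list a) cΓ fun γ => codeOpt (cα γ) (o γ)) (hu : Computes cΓ u)
    (hv : Computes (e := .prod e a) (fun x : Σ γ, α γ => (cΓ x.1, cα x.1 x.2))
      fun x => v x.1 x.2) :
    Computes cΓ fun γ => (o γ).elim (u γ) (v γ) := by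
  obtain ⟨r, hr, h⟩ := ho
  obtain ⟨s, hs, h'⟩ := hu
  obtain ⟨t, ht, h''⟩ := hv
  refine ⟨.comp (.caseList s (.comp t (.pair .fst (.comp .fst .snd)))) (.pair .id r),
    polyTime_comp (polyTime_caseList hs (polyTime_comp ht (polyTime_pair polyTime_fst
      (polyTime_comp polyTime_fst polyTime_snd)))) (polyTime_pair polyTime_id hr), fun γ => ?_⟩
  rw [run_comp, run_pair, run_id, PMF.pure_bind, h, PMF.pure_map, PMF.pure_bind]
  beta_reduce
  generalize o γ = o
  rcases o with _ | y
  · exact (run_caseList_nil _ _ _).trans (h' γ)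
  · refine (run_caseList_cons _ _ _ _ _).trans ?_
    rw [run_comp, run_pair, run_fst, run_comp, run_snd]
    simp only [PMF.pure_bind, run_fst, PMF.pure_map]
    exact h'' ⟨γ, y⟩

/-- Inside a context that is extended by a value, functions of the old context. -/
theorem Computes.weaken {β : Γ → Type} {cβ : (Σ γ, β γ) → b.den} {v : Γ → c.den}
    (h : Computes cΓ v) : Computes (e := .prod e b) (fun x : Σ γ, β γ => (cΓ x.1, cβ x))
      fun x => v x.1 :=
  Computes.subst h (g := fun x : Σ γ, β γ => x.1)
    (Computes.fst (v := fun x : Σ γ, β γ => ((cΓ x.1, cβ x) : (Ty.prod e b).den))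
      Computes.self)

theorem Samples.weaken {β : Γ → Type} {cβ : (Σ γ, β γ) → b.den} {p : Γ → PMF c.den}
    (h : Samples cΓ p) : Samples (e := .prod e b) (fun x : Σ γ, β γ => (cΓ x.1, cβ x))
      fun x => p x.1 :=
  Samples.subst h (g := fun x : Σ γ, β γ => x.1)
    (Computes.fst (v := fun x : Σ γ, β γ => ((cΓ x.1, cβ x) : (Ty.prod e b).den))
      Computes.self)

/-- The value by which a context is extended. -/
theorem Computes.var {β : Γ → Type} {cβ : (Σ γ, β γ) → b.den} :
    Computes (e := .prod e b) (fun x : Σ γ, β γ => (cΓ x.1, cβ x)) fun x => cβ x :=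
  Computes.snd (v := fun x : Σ γ, β γ => ((cΓ x.1, cβ x) : (Ty.prod e b).den))
    Computes.self

/-- Loops with a deterministic body. The body increases the size of the accumulator at most by a
polynomial in the sizes of the environment and of the current entry. -/
theorem Computes.foldl {step : d.den → c.den → a.den → c.den}
    (hs : Computes (e := .prod d (.prod c a)) (fun x => x) fun x => step x.1 x.2.1 x.2.2)
    (r : Polynomial ℕ)
    (hr : ∀ x acc y, c.size (step x acc y) ≤ c.size acc + r.eval (d.size x + a.size y))
    {x : Γ → d.den} {z : Γ → c.den} {l : Γ → List a.den} (hx : Computes cΓ x)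
    (hz : Computes cΓ z) (hl : Computes (b := .list a) cΓ l) :
    Computes cΓ fun γ => (l γ).foldl (step (x γ)) (z γ) := by
  obtain ⟨t, ht, h⟩ := hs
  refine Computes.app (f := fun x : (Ty.prod d (.prod c (.list a))).den =>
    x.2.2.foldl (step x.1) x.2.1) (v := fun γ => (x γ, (z γ, l γ))) ?_ (hx.pair (hz.pair hl))
  refine ⟨.fold t, polyTime_fold_growth ht r fun x acc y w hw => ?_, fun x => ?_⟩
  · rw [h (x, (acc, y)), PMF.mem_support_pure_iff] at hw
    subst hw
    exact hr x acc y
  · obtain ⟨x, z, l⟩ := x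
    rw [run_fold]
    induction l generalizing z with
    | nil => rfl
    | cons y l ih =>
      simp only [List.foldl_cons, PMF.pure_bind]
      rw [h (x, (z, y))]
      exact ih _

end Rules

/-! ### Lists and numbers in unary -/

section Lists

variable {a b c d e : Ty} {Γ : Type} {cΓ : Γ → e.den}

/-- A default value of each data type. -/
def Ty.dflt : (a : Ty) → a.den
  | .unit => ()
  | .bool => false
  | .prod a b => (a.dflt, b.dflt)
  | .list _ => []

theorem Computes.tail {l : Γ → List a.den} (hl : Computes (b := .list a) cΓ l) :
    Computes (b := .list a) cΓ fun γ => (l γ).tail :=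
  (Computes.caseList (v := fun _ _ l => l) hl Computes.nil (Computes.snd (Computes.snd
    (v := fun x : Γ × a.den × List a.den => ((cΓ x.1, (x.2.1, x.2.2)) :
      (Ty.prod e (.prod a (.list a))).den)) Computes.self))).congr fun γ => by
    rcases l γ with _ | ⟨y, l'⟩ <;> rfl

theorem Computes.headD {l : Γ → List a.den} (hl : Computes (b := .list a) cΓ l) :
    Computes cΓ fun γ => (l γ).headD a.dflt :=
  (Computes.caseList (v := fun _ y _ => y) hl (Computes.const a.dflt) (Computes.fst (Computes.snd
    (v := fun x : Γ × a.den × List a.den => ((cΓ x.1, (x.2.1, x.2.2)) :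
      (Ty.prod e (.prod a (.list a))).den)) Computes.self))).congr fun γ => by
    rcases l γ with _ | ⟨y, l'⟩ <;> rfl

theorem Computes.drop {i : Γ → ℕ} {l : Γ → List a.den} (hi : Computes cΓ fun γ => unary (i γ))
    (hl : Computes (b := .list a) cΓ l) : Computes (b := .list a) cΓ fun γ => (l γ).drop (i γ) := by
  refine (Computes.foldl (d := .unit) (c := .list a) (a := .unit) (step := fun _ acc _ => acc.tail)
    (Computes.tail (Computes.fst (Computes.snd Computes.self))) 0 ?_ Computes.star hl hi).congr
    fun γ => ?_
  · rintro x (_ | ⟨y, l⟩) _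
    · simp
    · simp only [List.tail_cons, size_cons]
      omega
  · generalize l γ = l
    generalize i γ = i
    simp only [unary]
    induction i generalizing l with
    | zero => simp
    | succ i ih =>
      simp only [List.replicate_succ, List.foldl_cons]
      rw [ih, List.drop_tail]

theorem Computes.nth {i : Γ → ℕ} {l : Γ → List a.den} (hi : Computes cΓ fun γ => unary (i γ))
    (hl : Computes (b := .list a) cΓ l) : Computes cΓ fun γ => (l γ).getD (i γ) a.dflt :=
  (Computes.headD (hi.drop hl)).congr fun _ => by
    rw [List.getD_eq_getElem?_getD, ← List.head?_drop, List.headD_eq_head?_getD]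

theorem getD_ofFn {α : Type} {m : ℕ} (v : Fin m → α) (i : Fin m) (z : α) :
    (List.ofFn v).getD i z = v i := by
  simp [List.getD_eq_getElem?_getD]

/-- Reading an entry of a table. -/
theorem Computes.lookup {α : Γ → Type} {cα : ∀ γ, α γ → a.den} {L : Γ → ℕ}
    {v : ∀ γ, Fin (L γ) → α γ} {i : ∀ γ, Fin (L γ)}
    (hv : Computes (b := .list a) cΓ fun γ => codeVec (cα γ) (v γ))
    (hi : Computes cΓ fun γ => codeFin (i γ)) : Computes cΓ fun γ => cα γ (v γ (i γ)) :=
  (Computes.nth (i := fun γ => (i γ : ℕ)) hi hv).congr fun _ => getD_ofFn _ _ _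

/-- Reading a fixed entry of a table. -/
theorem Computes.entry {α : Γ → Type} {cα : ∀ γ, α γ → a.den} {m : ℕ}
    {v : ∀ γ, Fin m → α γ} (hv : Computes (b := .list a) cΓ fun γ => codeVec (cα γ) (v γ))
    (i : Fin m) : Computes cΓ fun γ => cα γ (v γ i) :=
  Computes.lookup (L := fun _ => m) (i := fun _ => i) hv (Computes.const _)

theorem unary_succ (n : ℕ) : unary (n + 1) = () :: unary n := rfl

theorem Computes.uadd {i j : Γ → ℕ} (hi : Computes cΓ fun γ => unary (i γ))
    (hj : Computes cΓ fun γ => unary (j γ)) : Computes cΓ fun γ => unary (i γ + j γ) := by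
  refine (Computes.foldl (d := .unit) (c := unaryT) (a := .unit) (step := fun _ acc _ => () :: acc)
    (Computes.cons Computes.star (Computes.fst (Computes.snd Computes.self))) 2 ?_
    Computes.star hi hj).congr fun γ => ?_
  · intro _ acc _
    rw [size_cons]
    simp [Ty.size]
  · generalize i γ = i
    generalize j γ = j
    induction j generalizing i with
    | zero => rfl
    | succ j ih =>
      rw [unary_succ, List.foldl_cons, ← unary_succ, ih]
      congr 1
      omega

theorem Computes.umul (m : ℕ) {i : Γ → ℕ} (hi : Computes cΓ fun γ => unary (i γ)) :
    Computes cΓ fun γ => unary (m * i γ) := by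
  induction m with
  | zero => exact (Computes.const (unary 0)).congr fun γ => by simp
  | succ m ih => exact (ih.uadd hi).congr fun γ => by rw [Nat.succ_mul]

/-- One step of a tabulation: the number of entries that are still to be found is decreased, and
the entry with this index is put in front of the entries that are already known. -/
def tabStep (f : Tm (.prod e unaryT) a) :
    Tm (.prod e (.prod (.prod unaryT (.list a)) .unit)) (.prod unaryT (.list a)) :=
  let i : Tm (.prod e (.prod (.prod unaryT (.list a)) .unit)) unaryT :=
    .comp (.caseList .nil (.comp .snd .snd)) (.pair .star (.comp .fst (.comp .fst .snd)))
  .pair i (.comp .cons (.pair (.comp f (.pair .fst i)) (.comp .snd (.comp .fst .snd))))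

theorem run_tabStep (f : Tm (.prod e unaryT) a) (x : e.den) (r : unaryT.den) (l : List a.den) :
    (tabStep f).run (x, ((r, l), ())) =
      (f.run (x, r.tail)).map fun y => ((r.tail, y :: l) : (Ty.prod unaryT (.list a)).den) := by
  have hi : (Tm.comp (.caseList .nil (.comp .snd .snd)) (.pair .star (.comp .fst (.comp .fst .snd))) :
      Tm (.prod e (.prod (.prod unaryT (.list a)) .unit)) unaryT).run (x, ((r, l), ())) =
      PMF.pure r.tail := by
    simp only [run_comp, run_pair, run_star, run_snd, run_fst, PMF.pure_bind, PMF.pure_map]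
    rcases r with _ | ⟨_, r⟩
    · rw [run_caseList_nil, run_nil]; rfl
    · rw [run_caseList_cons, run_comp, run_snd, PMF.pure_bind, run_snd]; rfl
  unfold tabStep
  rw [run_pair, hi, PMF.pure_bind, run_comp, run_pair, run_comp, run_pair, hi]
  simp only [run_comp, run_fst, run_snd, PMF.pure_bind, PMF.pure_map, PMF.bind_bind,
    PMF.map_bind, run_cons]
  simp only [← PMF.bind_pure_comp, Function.comp_def]

theorem polyTime_tabStep {f : Tm (.prod e unaryT) a} (hf : f.PolyTime) :
    (tabStep f).PolyTime := by
  have hi : (Tm.comp (.caseList .nil (.comp .snd .snd))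
      (.pair .star (.comp .fst (.comp .fst .snd))) :
      Tm (.prod e (.prod (.prod unaryT (.list a)) .unit)) unaryT).PolyTime :=
    polyTime_comp (polyTime_caseList polyTime_nil (polyTime_comp polyTime_snd polyTime_snd))
      (polyTime_pair polyTime_star (polyTime_comp polyTime_fst
        (polyTime_comp polyTime_fst polyTime_snd)))
  exact polyTime_pair hi (polyTime_comp polyTime_cons (polyTime_pair
    (polyTime_comp hf (polyTime_pair polyTime_fst hi))
    (polyTime_comp polyTime_snd (polyTime_comp polyTime_fst polyTime_snd))))

theorem polyTime_fold_tabStep {f : Tm (.prod e unaryT) a} (hf : f.PolyTime) :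
    (Tm.fold (tabStep f)).PolyTime := by
  obtain ⟨p, hp⟩ := hf
  refine polyTime_fold (polyTime_tabStep ⟨p, hp⟩) (2 + 2 * Polynomial.X + Polynomial.X * (1 + p))
    (fun x z l i acc => unaryT.size acc.1 ≤ unaryT.size z.1 ∧ (Ty.list a).size acc.2 ≤
      (Ty.list a).size z.2 + i * (1 + p.eval ((Ty.prod e (.prod (.prod unaryT (.list a))
        (.list .unit))).size (x, (z, l))))) (by simp) ?_ ?_
  · rintro x z l i ⟨r, o⟩ ⟨⟩ _ _ ⟨h1, h2⟩ w hw
    rw [run_tabStep, PMF.mem_support_map_iff] at hw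
    obtain ⟨y, hy, rfl⟩ := hw
    have hr : unaryT.size r.tail ≤ unaryT.size r := by
      rcases r with _ | ⟨_, r⟩
      · exact le_rfl
      · rw [size_cons]; simp
    refine ⟨hr.trans h1, ?_⟩
    have h3 := (Tm.PolyTime.size_le hp hy).trans (eval_mono p (show _ ≤
      (Ty.prod e (.prod (.prod unaryT (.list a)) (.list .unit))).size (x, (z, l)) by
        have e1 : (Ty.prod e unaryT).size (x, r.tail) = 1 + e.size x + unaryT.size r.tail := rfl
        have e2 : (Ty.prod e (.prod (.prod unaryT (.list a)) (.list .unit))).size (x, (z, l)) =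
          1 + e.size x + (1 + (1 + unaryT.size z.1 + (Ty.list a).size z.2) +
            (Ty.list .unit).size l) := rfl
        simp only at h1
        omega))
    simp only [size_cons, add_mul, one_mul] at h2 ⊢
    omega
  · rintro x ⟨z1, z2⟩ l i ⟨r, o⟩ hi ⟨h1, h2⟩
    have hl := length_le_size (a := .unit) l
    set N := (Ty.prod e (.prod (.prod unaryT (.list a)) (.list .unit))).size (x, ((z1, z2), l))
      with hN
    have hN' : N = 1 + e.size x + (1 + (1 + unaryT.size z1 + (Ty.list a).size z2) +
      (Ty.list .unit).size l) := rfl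
    have h4 : i * (1 + p.eval N) ≤ N * (1 + p.eval N) := Nat.mul_le_mul_right _ (by omega)
    have h5 : (Ty.prod unaryT (.list a)).size (r, o) = 1 + unaryT.size r + (Ty.list a).size o := rfl
    simp only [Polynomial.eval_add, Polynomial.eval_mul, Polynomial.eval_X,
      Polynomial.eval_one, Polynomial.eval_ofNat] at h1 h2 ⊢
    rw [h5]
    omega

theorem foldl_bind {α β : Type} (f : α → β → PMF α) (l : List β) (q : PMF α) :
    l.foldl (fun q y => q.bind fun acc => f acc y) q =
      q.bind fun z => l.foldl (fun q y => q.bind fun acc => f acc y) (PMF.pure z) := by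
  induction l generalizing q with
  | nil => simp
  | cons y l ih =>
    simp only [List.foldl_cons, PMF.pure_bind]
    rw [ih, PMF.bind_bind]
    congr 1
    funext z
    rw [ih (f z y)]

/-- Tabulation: sampling independently an entry for each index, in front of a given list. -/
theorem Samples.tab_append {L : Γ → ℕ} {p : ∀ γ, Fin (L γ) → PMF a.den} {l : Γ → List a.den}
    (hL : Computes cΓ fun γ => unary (L γ))
    (hp : Samples (e := .prod e unaryT) (fun x : Σ γ, Fin (L γ) => (cΓ x.1, codeFin x.2))
      fun x => p x.1 x.2) (hl : Computes (b := .list a) cΓ l) :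
    Samples (b := .list a) cΓ fun γ =>
      (piFin (L γ) (p γ)).map fun w => List.ofFn w ++ l γ := by
  obtain ⟨f, hf, h⟩ := hp
  obtain ⟨t, ht, hL⟩ := hL
  obtain ⟨t', ht', hl⟩ := hl
  refine ⟨.comp .snd (.comp (.fold (tabStep f)) (.pair .id (.pair (.pair t t') t))),
    polyTime_comp polyTime_snd (polyTime_comp (polyTime_fold_tabStep hf) (polyTime_pair polyTime_id
      (polyTime_pair (polyTime_pair ht ht') ht))), fun γ => ?_⟩
  have key : ∀ (m : ℕ) (hm : m ≤ L γ) (l : List a.den),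
      ((unary m).foldl (fun q y => q.bind fun acc => (tabStep f).run (cΓ γ, (acc, y)))
        (PMF.pure (unary m, l))).map Prod.snd =
      (piFin m fun i => p γ (i.castLE hm)).map fun w => List.ofFn w ++ l := by
    intro m
    induction m with
    | zero =>
      intro _ l
      simp [unary, piFin, PMF.pure_map]
    | succ m ih =>
      intro hm l
      have hlast := h ⟨γ, ⟨m, hm⟩⟩
      simp only [codeFin] at hlast
      rw [unary_succ, List.foldl_cons, PMF.pure_bind, run_tabStep]
      simp only [List.tail_cons]
      rw [foldl_bind, hlast, PMF.map_bind, PMF.bind_map, piFin_snoc, PMF.map_bind]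
      congr 1
      funext y
      simp only [Function.comp]
      rw [ih (by omega) (y :: l), PMF.map_comp]
      congr 1
      funext w
      simp only [Function.comp, List.ofFn_succ_last]
      simp
  simp only [run_comp, run_pair, run_id, PMF.pure_bind, hL, hl, PMF.pure_map]
  refine Eq.trans ?_ (key (L γ) le_rfl (l γ))
  rw [← PMF.bind_pure_comp, run_fold]
  congr 1
  funext z
  exact run_snd z

theorem Samples.tab {β : Γ → Type} {cβ : ∀ γ, β γ → b.den} {L : Γ → ℕ}
    {p : ∀ γ, Fin (L γ) → PMF (β γ)} (hL : Computes cΓ fun γ => unary (L γ))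
    (hp : Samples (e := .prod e unaryT) (fun x : Σ γ, Fin (L γ) => (cΓ x.1, codeFin x.2))
      fun x => (p x.1 x.2).map (cβ x.1)) :
    Samples (b := .list b) cΓ fun γ => (piFin (L γ) (p γ)).map (codeVec (cβ γ)) :=
  (Samples.tab_append (p := fun γ i => (p γ i).map (cβ γ)) hL hp Computes.nil).congr fun γ => by
    rw [piFin_map (p γ) fun _ => cβ γ, PMF.map_comp]
    congr 1
    funext w
    exact List.append_nil _

theorem Computes.tab_append {L : Γ → ℕ} {v : ∀ γ, Fin (L γ) → a.den} {l : Γ → List a.den}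
    (hL : Computes cΓ fun γ => unary (L γ))
    (hv : Computes (e := .prod e unaryT) (fun x : Σ γ, Fin (L γ) => (cΓ x.1, codeFin x.2))
      fun x => v x.1 x.2) (hl : Computes (b := .list a) cΓ l) :
    Computes (b := .list a) cΓ fun γ => List.ofFn (v γ) ++ l γ :=
  Samples.congr (Samples.tab_append (p := fun γ i => PMF.pure (v γ i)) hL hv hl) fun γ => by
    rw [piFin_pure, PMF.pure_map]

theorem Computes.tab {L : Γ → ℕ} {v : ∀ γ, Fin (L γ) → a.den}
    (hL : Computes cΓ fun γ => unary (L γ))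
    (hv : Computes (e := .prod e unaryT) (fun x : Σ γ, Fin (L γ) => (cΓ x.1, codeFin x.2))
      fun x => v x.1 x.2) : Computes (b := .list a) cΓ fun γ => List.ofFn (v γ) :=
  (Computes.tab_append hL hv Computes.nil).congr fun γ => by simp

end Lists

/-! ### Equality tests and finite sets of strings -/

section Equality

variable {a b c d e : Ty} {Γ : Type} {cΓ : Γ → e.den}

theorem Computes.and {u v : Γ → Bool} (hu : Computes (b := .bool) cΓ u)
    (hv : Computes (b := .bool) cΓ v) : Computes (b := .bool) cΓ fun γ => u γ && v γ :=
  (Computes.ite hu hv (Computes.lit false)).congr fun γ => by cases u γ <;> simp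

theorem Computes.bne {u v : Γ → Bool} (hu : Computes (b := .bool) cΓ u)
    (hv : Computes (b := .bool) cΓ v) : Computes (b := .bool) cΓ fun γ => Bool.xor (u γ) (v γ) :=
  (Computes.ite hu (Computes.ite hv (Computes.lit false) (Computes.lit true)) hv).congr
    fun γ => by cases u γ <;> cases v γ <;> simp

theorem Computes.beq_bool {u v : Γ → Bool} (hu : Computes (b := .bool) cΓ u)
    (hv : Computes (b := .bool) cΓ v) : Computes (b := .bool) cΓ fun γ => decide (u γ = v γ) :=
  (Computes.ite hu hv (Computes.ite hv (Computes.lit false) (Computes.lit true))).congr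
    fun γ => by cases u γ <;> cases v γ <;> simp

/-- One step of the comparison of two lists; the accumulator holds the part of the second list that
has not been compared yet, and the result so far. -/
def cmpStep (f : a.den → a.den → Bool) (acc : List a.den × Bool) (y : a.den) :
    List a.den × Bool :=
  match acc.1 with
  | [] => ([], false)
  | z :: r => (r, acc.2 && f y z)

theorem foldl_cmpStep {f : a.den → a.den → Bool} (hf : ∀ y z, f y z = true ↔ y = z)
    [DecidableEq a.den] (u v : List a.den) (t : Bool) :
    ((u.foldl (cmpStep f) (v, t)).2 && (u.foldl (cmpStep f) (v, t)).1.isEmpty) =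
      (t && decide (u = v)) := by
  induction u generalizing v t with
  | nil => cases v <;> simp
  | cons y u ih =>
    rcases v with _ | ⟨z, v⟩
    · simp [cmpStep, ih]
    · simp only [List.foldl_cons, cmpStep, ih]
      have : f y z = decide (y = z) := by
        rw [Bool.eq_iff_iff]; simp [hf]
      simp [this, Bool.and_assoc]

/-- Lists are compared in polynomial time if their entries are. -/
theorem Computes.beq_list [DecidableEq a.den] {f : a.den → a.den → Bool}
    (hf : ∀ y z, f y z = true ↔ y = z)
    (hc : Computes (e := .prod a a) (b := .bool) (fun x => x) fun x => f x.1 x.2)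
    {u v : Γ → List a.den} (hu : Computes (b := .list a) cΓ u)
    (hv : Computes (b := .list a) cΓ v) :
    Computes (b := .bool) cΓ fun γ => decide (u γ = v γ) := by
  have hstep : Computes (e := .prod .unit (.prod (.prod (.list a) .bool) a))
      (b := .prod (.list a) .bool) (fun x => x) fun x => cmpStep f x.2.1 x.2.2 := by
    have h := Computes.caseList (e := .prod .unit (.prod (.prod (.list a) .bool) a))
      (cΓ := fun x => x) (c := .prod (.list a) .bool)
      (l := fun x => x.2.1.1) (u := fun _ => ([], false))
      (v := fun x z r => (r, x.2.1.2 && f x.2.2 z))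
      (Computes.fst (Computes.fst (Computes.snd Computes.self)))
      (Computes.const (b := .prod (.list a) .bool) ([], false)) ?_
    · refine h.congr fun x => ?_
      rcases hx : x.2.1.1 with _ | ⟨z, r⟩ <;> simp [cmpStep, hx]
    · have hs := Computes.self (e := .prod (.prod .unit (.prod (.prod (.list a) .bool) a))
        (.prod a (.list a))) (cΓ := fun x :
        (Ty.prod .unit (.prod (.prod (.list a) .bool) a)).den × a.den × List a.den =>
        (x.1, (x.2.1, x.2.2)))
      have hy := Computes.app hc
        ((Computes.snd (Computes.snd (Computes.fst hs))).pair (Computes.fst (Computes.snd hs)))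
      exact (Computes.snd (Computes.snd hs)).pair (Computes.and
        (Computes.snd (Computes.fst (Computes.snd (Computes.fst hs)))) hy)
  have hfold := Computes.foldl (a := a) (d := .unit) (c := .prod (.list a) .bool)
    (step := fun _ acc y => cmpStep f acc y) hstep 0 (by
      rintro _ ⟨l, t⟩ y
      rcases l with _ | ⟨z, r⟩
      · simp [cmpStep, Ty.size]
      · have h1 : (Ty.prod (.list a) .bool).size (r, t && f y z) =
          1 + (Ty.list a).size r + 1 := rfl
        have h2 : (Ty.prod (.list a) .bool).size (z :: r, t) =
          1 + (Ty.list a).size (z :: r) + 1 := rfl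
        simp only [cmpStep, h1, h2, size_cons]
        omega) (cΓ := cΓ) (x := fun _ => ()) (z := fun γ => (v γ, true)) (l := u)
      Computes.star (hv.pair (Computes.lit true)) hu
  refine (Computes.and (Computes.snd hfold) (Computes.caseList (v := fun _ _ _ => false)
    (Computes.fst hfold) (Computes.lit true) (Computes.lit false))).congr fun γ => ?_
  have := foldl_cmpStep hf (u γ) (v γ) true
  rw [Bool.true_and] at this
  rw [← this]
  congr 1
  generalize (List.foldl (cmpStep f) (v γ, true) (u γ)).1 = l
  cases l <;> rfl

theorem Computes.beq_bits {u v : Γ → bitsT.den} (hu : Computes (b := bitsT) cΓ u)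
    (hv : Computes (b := bitsT) cΓ v) : Computes (b := .bool) cΓ fun γ => decide (u γ = v γ) :=
  Computes.beq_list (a := .bool) (f := fun y z => decide (y = z)) (by simp)
    (Computes.beq_bool (Computes.fst Computes.self) (Computes.snd Computes.self)) hu hv

theorem Computes.beq_unary {i j : Γ → ℕ} (hi : Computes cΓ fun γ => unary (i γ))
    (hj : Computes cΓ fun γ => unary (j γ)) :
    Computes (b := .bool) cΓ fun γ => decide (i γ = j γ) :=
  (Computes.beq_list (a := .unit) (f := fun _ _ => true) (by simp) (Computes.lit true)
    hi hj).congr fun γ => by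
      have : unary (i γ) = unary (j γ) ↔ i γ = j γ :=
        ⟨fun h => by simpa [unary] using congrArg List.length h, fun h => by rw [h]⟩
      simp [this]

theorem Computes.mem {u : Γ → bitsT.den} {l : Γ → List bitsT.den} (hu : Computes (b := bitsT) cΓ u)
    (hl : Computes (b := .list bitsT) cΓ l) :
    Computes (b := .bool) cΓ fun γ => decide (u γ ∈ l γ) := by
  refine (Computes.foldl (d := bitsT) (c := .bool) (a := bitsT)
    (step := fun x acc y => if decide (x = y) then true else acc)
    (Computes.ite (Computes.beq_bits (Computes.fst Computes.self)
      (Computes.snd (Computes.snd Computes.self))) (Computes.lit true)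
      (Computes.fst (Computes.snd Computes.self))) 0 (by simp [Ty.size]) hu
      (Computes.lit false) hl).congr fun γ => ?_
  have : ∀ (l : List bitsT.den) (t : Bool),
      l.foldl (fun acc y => if decide (u γ = y) then true else acc) t =
        (t || decide (u γ ∈ l)) := by
    intro l
    induction l with
    | nil => simp
    | cons y l ih =>
      intro t
      rw [List.foldl_cons, ih]
      by_cases h : u γ = y <;> simp [h]
  exact (this (l γ) false).trans (Bool.false_or _)

/-- The entries of one list that do not occur in another one (in some order). -/
theorem Computes.sdiff {l l' : Γ → List bitsT.den} (hl : Computes (b := .list bitsT) cΓ l)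
    (hl' : Computes (b := .list bitsT) cΓ l') :
    Computes (b := .list bitsT) cΓ fun γ => ((l γ).filter (· ∉ l' γ)).reverse := by
  refine (Computes.foldl (d := .list bitsT) (c := .list bitsT) (a := bitsT)
    (step := fun x acc y => if decide (y ∈ x) then acc else y :: acc)
    (Computes.ite (Computes.mem (Computes.snd (Computes.snd Computes.self))
      (Computes.fst Computes.self)) (Computes.fst (Computes.snd Computes.self))
      (Computes.cons (Computes.snd (Computes.snd Computes.self))
        (Computes.fst (Computes.snd Computes.self)))) (1 + Polynomial.X) ?_ hl'
      Computes.nil hl).congr fun γ => ?_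
  · intro x acc y
    simp only [Polynomial.eval_add, Polynomial.eval_one, Polynomial.eval_X]
    split_ifs
    · omega
    · rw [size_cons]; omega
  · have : ∀ (l : List bitsT.den) (t : List bitsT.den),
        l.foldl (fun acc y => if decide (y ∈ l' γ) then acc else y :: acc) t =
          (l.filter (· ∉ l' γ)).reverse ++ t := by
      intro l
      induction l with
      | nil => simp
      | cons y l ih =>
        intro t
        rw [List.foldl_cons, ih]
        by_cases h : y ∈ l' γ <;> simp [h]
    exact (this (l γ) []).trans (List.append_nil _)

theorem Computes.length {l : Γ → List a.den} (hl : Computes (b := .list a) cΓ l) :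
    Computes cΓ fun γ => unary (l γ).length := by
  refine (Computes.foldl (d := .unit) (c := unaryT) (a := a) (step := fun _ acc _ => () :: acc)
    (Computes.cons Computes.star (Computes.fst (Computes.snd Computes.self))) 2 ?_
    Computes.star (Computes.const (unary 0)) hl).congr fun γ => ?_
  · intro _ acc _
    rw [size_cons]
    simp [Ty.size]
  · have : ∀ (l : List a.den) (i : ℕ),
        l.foldl (fun (acc : unaryT.den) _ => () :: acc) (unary i) = unary (i + l.length) := by
      intro l
      induction l with
      | nil => simp
      | cons y l ih =>
        intro i
        rw [List.foldl_cons, ← unary_succ, ih, List.length_cons]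
        congr 1
        omega
    simp [this (l γ) 0]

end Equality

/-! ### Sampling -/

section Sampling

variable {a b c d e : Ty} {Γ : Type} {cΓ : Γ → e.den}

theorem run_pick {m : ℕ} (l : List a.den) (hl : l.length = m + 1) :
    (Tm.pick : Tm (.list a) (.list a)).run l =
      (uniformOfFintype (Fin (m + 1))).map fun i => [l.get (i.cast hl.symm)] := by
  rcases l with _ | ⟨y, l⟩
  · simp at hl
  · obtain rfl : l.length = m := by simpa using hl
    exact run_pick_cons y l

/-- A uniformly random entry of a nonempty table. -/
theorem Samples.pick {L : Γ → ℕ} {v : ∀ γ, Fin (L γ + 1) → a.den}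
    (hv : Computes (b := .list a) cΓ fun γ => List.ofFn (v γ)) :
    Samples cΓ fun γ => (uniformOfFintype (Fin (L γ + 1))).map (v γ) := by
  have h1 : Samples (b := .list a) cΓ fun γ =>
      (uniformOfFintype (Fin (L γ + 1))).map fun i => [v γ i] := by
    obtain ⟨t, ht, h⟩ := hv
    refine ⟨.comp .pick t, polyTime_comp polyTime_pick ht, fun γ => ?_⟩
    rw [run_comp, h, PMF.pure_bind, run_pick _ (List.length_ofFn)]
    congr 1
    funext i
    rw [List.get_ofFn]
    rfl
  refine (Samples.map (β := fun _ => List a.den) (b := .list a) (cβ := fun _ l => l)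
    (p := fun γ => (uniformOfFintype (Fin (L γ + 1))).map fun i => [v γ i])
    (v := fun _ l => l.headD a.dflt) (h1.congr fun γ => by rw [PMF.map_comp]; rfl)
    (Computes.headD Computes.var)).congr fun γ => ?_
  rw [PMF.map_comp]
  rfl

theorem Samples.bool : Samples (b := .bool) cΓ fun _ => uniformOfFintype Bool := by
  refine (Samples.pick (a := .bool) (L := fun _ => 1) (v := fun _ i => decide (i = 0))
    (Computes.const (b := .list .bool) _)).congr fun γ => ?_
  exact uniform_map_equiv (finTwoEquiv.trans Equiv.boolNot) |>.symm ▸ by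
    congr 1
    funext i
    fin_cases i <;> rfl

/-- Uniform tables. -/
theorem Samples.unif_table {α : Γ → Type} [∀ γ, Fintype (α γ)] [∀ γ, Nonempty (α γ)]
    {cα : ∀ γ, α γ → a.den} {L : Γ → ℕ} (hL : Computes cΓ fun γ => unary (L γ))
    (hα : Samples cΓ fun γ => (uniformOfFintype (α γ)).map (cα γ)) :
    Samples (b := .list a) cΓ fun γ =>
      (uniformOfFintype (Fin (L γ) → α γ)).map (codeVec (cα γ)) :=
  (Samples.tab (p := fun γ _ => uniformOfFintype (α γ)) hL hα.weaken).congr fun γ => by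
    rw [uniform_pi]

theorem Samples.unif_BV {L : Γ → ℕ} (hL : Computes cΓ fun γ => unary (L γ)) :
    Samples (b := bitsT) cΓ fun γ => (uniformOfFintype (BV (L γ))).map codeBV :=
  Samples.unif_table (a := .bool) (α := fun _ => Bool) (cα := fun _ x => x) hL
    (Samples.bool.congr fun _ => (PMF.map_id _).symm)

/-- Uniform pairs. -/
theorem Samples.unif_prod {α β : Γ → Type} [∀ γ, Fintype (α γ)] [∀ γ, Nonempty (α γ)]
    [∀ γ, Fintype (β γ)] [∀ γ, Nonempty (β γ)]
    {cα : ∀ γ, α γ → a.den} {cβ : ∀ γ, β γ → b.den}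
    (hα : Samples cΓ fun γ => (uniformOfFintype (α γ)).map (cα γ))
    (hβ : Samples cΓ fun γ => (uniformOfFintype (β γ)).map (cβ γ)) :
    Samples (b := .prod a b) cΓ fun γ =>
      (uniformOfFintype (α γ × β γ)).map fun x => (cα γ x.1, cβ γ x.2) :=
  (Samples.bind_map hα hβ).congr fun γ => by
    rw [uniform_prod, PMF.map_bind, PMF.bind_map]
    simp only [Function.comp_def, PMF.map_comp]

/-- A uniform choice of a position `p` and the exchange of the first entry, which is `t`, with the
one at `p`. -/
theorem Samples.swap_head :
    Samples (e := .prod a (.list a)) (b := .list a) (fun x => x)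
      fun x => (uniformOfFintype (Fin (x.2.length + 1))).map fun p =>
        List.ofFn fun q : Fin (x.2.length + 1) => (x.1 :: x.2).get (Equiv.swap 0 p q) := by
  have hlen : Computes (e := .prod a (.list a)) (fun x => x) fun x => unary (x.2.length + 1) :=
    (Computes.length (a := a) (Computes.snd Computes.self)).uadd (Computes.const (unary 1))
  refine Samples.pick (a := .list a) (Computes.tab hlen (Computes.tab hlen.weaken ?_))
  have hq := Computes.snd (Computes.self (e := .prod (.prod (.prod a (.list a)) unaryT) unaryT)
    (cΓ := fun x : Σ y : Σ x : (Ty.prod a (.list a)).den, Fin (x.2.length + 1),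
      Fin (y.1.2.length + 1) => ((x.1.1, codeFin x.1.2), codeFin x.2)))
  have hp := Computes.snd (Computes.fst (Computes.self
    (e := .prod (.prod (.prod a (.list a)) unaryT) unaryT)
    (cΓ := fun x : Σ y : Σ x : (Ty.prod a (.list a)).den, Fin (x.2.length + 1),
      Fin (y.1.2.length + 1) => ((x.1.1, codeFin x.1.2), codeFin x.2))))
  have hx := Computes.fst (Computes.fst (Computes.self
    (e := .prod (.prod (.prod a (.list a)) unaryT) unaryT)
    (cΓ := fun x : Σ y : Σ x : (Ty.prod a (.list a)).den, Fin (x.2.length + 1),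
      Fin (y.1.2.length + 1) => ((x.1.1, codeFin x.1.2), codeFin x.2))))
  have hz : Computes (e := .prod (.prod (.prod a (.list a)) unaryT) unaryT)
    (fun x : Σ y : Σ x : (Ty.prod a (.list a)).den, Fin (x.2.length + 1),
      Fin (y.1.2.length + 1) => ((x.1.1, codeFin x.1.2), codeFin x.2)) fun _ => unary 0 :=
    Computes.const _
  have hi := Computes.ite (Computes.beq_unary hq hz) hp (Computes.ite (Computes.beq_unary hq hp)
    hz hq)
  refine (Computes.nth (i := fun x => ((Equiv.swap 0 x.1.2 x.2 : Fin _) : ℕ)) (hi.congr ?_)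
    (Computes.cons (Computes.fst hx) (Computes.snd hx))).congr ?_
  · rintro ⟨⟨x, p⟩, q⟩
    simp only [Equiv.swap_apply_def, decide_eq_true_eq, codeFin, Fin.ext_iff, Fin.val_zero]
    split_ifs <;> rfl
  · rintro ⟨⟨x, p⟩, q⟩
    exact List.getD_eq_getElem _ _ (by
      rw [List.length_cons]
      exact (Equiv.swap 0 p q).isLt)

/-- The exchange of the first two positions of the decomposition of permutations of `m + 1`
objects. -/
theorem comp_decompose {α : Type} {m : ℕ} (x : Fin (m + 1) → α) (p : Fin (m + 1))
    (s : Equiv.Perm (Fin m)) (q : Fin (m + 1)) :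
    (x 0 :: List.ofFn fun i => x (s i).succ).get
        ((Equiv.swap 0 p q).cast (by simp)) =
      x ((Equiv.Perm.decomposeFin.symm (p, s⁻¹))⁻¹ q) := by
  have h : (Equiv.Perm.decomposeFin.symm (p, s⁻¹))⁻¹ q =
      Fin.cases 0 (fun i => (s i).succ) (Equiv.swap 0 p q) := by
    rw [Equiv.Perm.inv_eq_iff_eq]
    have hq : q = Equiv.swap 0 p (Equiv.swap 0 p q) := by simp
    generalize Equiv.swap 0 p q = r at hq
    refine hq.trans ?_
    refine Fin.cases ?_ (fun i => ?_) r
    · simp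
    · simp
  rw [h]
  generalize Equiv.swap 0 p q = r
  refine Fin.cases ?_ (fun i => ?_) r
  · simp
  · simp

/-- A uniformly random rearrangement of a list. -/
theorem Samples.shuffle {N : Γ → ℕ} {x : ∀ γ, Fin (N γ) → a.den}
    (hx : Computes (b := .list a) cΓ fun γ => List.ofFn (x γ)) :
    Samples (b := .list a) cΓ fun γ =>
      (uniformOfFintype (Equiv.Perm (Fin (N γ)))).map fun s => List.ofFn fun i => x γ (s i) := by
  obtain ⟨t, ht, h⟩ := Samples.swap_head (a := a)
  obtain ⟨t', ht', h'⟩ := hx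
  have hsz : ∀ l l' : List a.den, l.Perm l' → (Ty.list a).size l = (Ty.list a).size l' := by
    intro l l' hl
    simp only [Ty.size]
    rw [(hl.map _).sum_eq]
  let s : Tm (.prod .unit (.prod (.list a) a)) (.list a) :=
    .comp t (.pair (.comp .snd .snd) (.comp .fst .snd))
  have hs : ∀ acc y, s.run ((), (acc, y)) = t.run (y, acc) := fun acc y => by
    simp only [s, run_comp, run_pair, run_snd, run_fst, PMF.pure_bind, PMF.pure_map]
  refine ⟨.comp (.fold s) (.pair .star (.pair .nil t')), polyTime_comp
    (polyTime_fold_growth (polyTime_comp ht (polyTime_pair (polyTime_comp polyTime_snd polyTime_snd)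
      (polyTime_comp polyTime_fst polyTime_snd))) (1 + Polynomial.X) ?_)
    (polyTime_pair polyTime_star (polyTime_pair polyTime_nil ht')), fun γ => ?_⟩
  · rintro ⟨⟩ acc y w hw
    rw [hs, h, PMF.mem_support_map_iff] at hw
    obtain ⟨p, _, rfl⟩ := hw
    have h1 := Equiv.Perm.ofFn_comp_perm (Equiv.swap 0 p) fun q => (y :: acc).get q
    rw [List.ofFn_get] at h1
    have h2 := hsz _ _ h1
    simp only [Function.comp_def] at h2
    simp only [Polynomial.eval_add, Polynomial.eval_one, Polynomial.eval_X]
    rw [size_cons] at h2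
    exact h2.trans_le (by omega)
  · have key : ∀ (N : ℕ) (x : Fin N → a.den),
        (Tm.fold s).run ((), ([], (List.ofFn x).reverse)) =
          (uniformOfFintype (Equiv.Perm (Fin N))).map fun s => List.ofFn fun i => x (s i) := by
      intro N
      induction N with
      | zero =>
        intro x
        rw [run_fold]
        simp only [List.ofFn_zero, List.reverse_nil, List.foldl_nil]
        exact (PMF.map_const _ _).symm
      | succ N ih =>
        intro x
        have ih' := ih fun i => x i.succ
        rw [run_fold] at ih' ⊢
        rw [List.ofFn_succ, List.reverse_cons, List.foldl_append, ih', List.foldl_cons,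
          List.foldl_nil, PMF.bind_map]
        rw [← uniform_map_equiv (((Equiv.inv (Equiv.Perm (Fin N))).prodCongr
          (Equiv.refl (Fin (N + 1)))).trans ((Equiv.prodComm _ _).trans
          (Equiv.Perm.decomposeFin.symm.trans (Equiv.inv _)))), uniform_prod, PMF.map_bind,
          PMF.map_bind]
        congr 1
        funext σ
        simp only [Function.comp, PMF.map_comp]
        rw [hs, h]
        have hcast : ∀ (M : ℕ) (hM : M = N) (l : List a.den) (hl : l.length = M + 1),
            ((uniformOfFintype (Fin (M + 1))).map fun p => List.ofFn fun q : Fin (M + 1) =>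
              l.get ((Equiv.swap 0 p q).cast hl.symm)) =
            (uniformOfFintype (Fin (N + 1))).map fun p => List.ofFn fun q : Fin (N + 1) =>
              l.get ((Equiv.swap 0 p q).cast (by omega)) := by
          rintro M rfl l hl
          rfl
        refine (hcast _ List.length_ofFn _ (by simp)).trans ?_
        congr 1
        funext p
        congr 1
        funext q
        rw [comp_decompose]
        rfl
    rw [run_comp, run_pair, run_star, PMF.pure_bind, run_pair, run_nil, PMF.pure_bind, h',
      PMF.pure_map, PMF.pure_map, PMF.pure_bind]
    have hrev : List.ofFn (x γ) = (List.ofFn fun i => x γ i.rev).reverse := by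
      refine List.ext_getElem (by simp) fun i h1 h2 => ?_
      simp only [List.getElem_ofFn, List.getElem_reverse, List.length_ofFn]
      congr 1
      ext
      simp only [Fin.val_rev, List.length_ofFn] at h1 ⊢
      omega
    beta_reduce
    rw [hrev, key]
    conv_rhs =>
      rw [← uniform_map_equiv (Equiv.mulLeft (Fin.revPerm (n := N γ))), PMF.map_comp]
    rfl

end Sampling

/-! ### The protocol as a sequential process -/

section Game

variable {S : MKRScheme} {n : ℕ}

/-- The coins of the exchange of a party `j` with a party `i` about one bin: for the dummy
encryption by `j`, the rerandomizations by `i` and by `j`, the membership test and the oblivious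
transfer. -/
abbrev PairCoins (S : MKRScheme) (n : ℕ) : Type :=
  BV (S.encCoins n) × BV (S.reCoins n) × BV (S.reCoins n) × Bool × (Bool → BV (S.ctLen n))

/-- The record of the exchange of a party `j` with a party `i` about one bin: the coins of `j` for
the dummy encryption, of `i` and of `j` for rerandomizing, the shares of `i` and of `j`, the outputs
of the oblivious transfer for `j` and for `i`, the masked messages and the reply. -/
@[ext] structure Exch (S : MKRScheme) (n : ℕ) where
  dummy : BV (S.encCoins n)
  recv : BV (S.reCoins n)
  send : BV (S.reCoins n)
  shareI : Bool
  shareJ : Bool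
  rotS : Bool → BV (S.ctLen n)
  rotR : BV (S.ctLen n)
  msgU : Bool → BV (S.ctLen n)
  msgV : BV (S.ctLen n)

/-- The zero string, which stands for data that is not shown. -/
def zeroBV {q : ℕ} : BV q := fun _ => false

/-- The value if the condition holds, and a fixed value otherwise: this hides what the corrupted
parties do not see. -/
def visible {α : Type} (p : Prop) [Decidable p] (dflt x : α) : α := if p then x else dflt

/-- The exchange as the protocol prescribes it, if `j` holds the ciphertext `c`, and `d` tells
whether the query of `j` belongs to the set of `i`; the result is restricted to what the corrupted
parties see. The reply to the leader `i = 0` counts as visible, as it enters the shuffle phase. -/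
def realExch {m : ℕ} (C : Finset (Fin (m + 1))) (pk : S.PK n) (j i : Fin (m + 1)) (d : Bool)
    (c : BV (S.ctLen n)) (κ : PairCoins S n) : Exch S n × BV (S.ctLen n) :=
  let e := κ.2.2.2.1
  let e' := Bool.xor e d
  let u : Bool → BV (S.ctLen n) := fun β =>
    BV.xor (κ.2.2.2.2 β) (if β = e' then c else S.enc n pk none κ.1)
  let v := S.reRand n pk (BV.xor (u e) (κ.2.2.2.2 e)) κ.2.1
  ({ dummy := visible (j ∈ C) zeroBV κ.1
     recv := visible (i ∈ C) zeroBV κ.2.1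
     send := visible (j ∈ C) zeroBV κ.2.2.1
     shareI := visible (i ∈ C) false e
     shareJ := visible (j ∈ C) false e'
     rotS := visible (j ∈ C) (fun _ => zeroBV) κ.2.2.2.2
     rotR := visible (i ∈ C) zeroBV (κ.2.2.2.2 e)
     msgU := visible (i ∈ C) (fun _ => zeroBV) u
     msgV := visible (j ∈ C ∨ i = 0) zeroBV v },
   S.reRand n pk v κ.2.2.1)

/-- The visible coins of a pair of parties that have no exchange. -/
def noExch {m : ℕ} (C : Finset (Fin (m + 1))) (j i : Fin (m + 1)) (κ : PairCoins S n) :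
    Exch S n where
  dummy := visible (j ∈ C) zeroBV κ.1
  recv := visible (i ∈ C) zeroBV κ.2.1
  send := visible (j ∈ C) zeroBV κ.2.2.1
  shareI := false
  shareJ := false
  rotS := fun _ => zeroBV
  rotR := zeroBV
  msgU := fun _ => zeroBV
  msgV := zeroBV

/-- The action of party `i` in the process of the exchanges of party `j` about a bin. -/
def realStep {m : ℕ} (C : Finset (Fin (m + 1))) (pk : S.PK n) (j : Fin (m + 1))
    (d : Fin (m + 1) → Bool) (i : Fin (m + 1)) (c : BV (S.ctLen n)) (κ : PairCoins S n) :
    Exch S n × BV (S.ctLen n) :=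
  if i < j then realExch C pk j i (d i) c κ else (noExch C j i κ, c)

/-- The simulated exchange. If one of the parties is honest, a given ciphertext `F` replaces the one
that the honest party produces: the reply if `i` is honest, the one that `i` can open if `j`
is. -/
def simExch {m : ℕ} (C : Finset (Fin (m + 1))) (pk : S.PK n) (j i : Fin (m + 1)) (d : Bool)
    (c : BV (S.ctLen n)) (κ : PairCoins S n) (F : BV (S.ctLen n)) : Exch S n × BV (S.ctLen n) :=
  if i ∈ C ∧ j ∈ C then realExch C pk j i d c κ else
  let e := κ.2.2.2.1
  let v := if i ∈ C then S.reRand n pk F κ.2.1 else F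
  ({ dummy := visible (j ∈ C) zeroBV κ.1
     recv := visible (i ∈ C) zeroBV κ.2.1
     send := visible (j ∈ C) zeroBV κ.2.2.1
     shareI := visible (i ∈ C) false e
     shareJ := visible (j ∈ C) false e
     rotS := visible (j ∈ C) (fun _ => zeroBV) κ.2.2.2.2
     rotR := visible (i ∈ C) zeroBV (κ.2.2.2.2 e)
     msgU := visible (i ∈ C) (fun _ => zeroBV) fun β =>
       if β = e then BV.xor (κ.2.2.2.2 β) F else κ.2.2.2.2 β
     msgV := visible (j ∈ C ∨ i = 0) zeroBV v },
   if j ∈ C then S.reRand n pk F κ.2.2.1 else c)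

/-- The action of party `i` in the simulated process; its coins include the ciphertext that replaces
the one of an honest party. -/
def simStep {m : ℕ} (C : Finset (Fin (m + 1))) (pk : S.PK n) (j : Fin (m + 1))
    (d : Fin (m + 1) → Bool) (i : Fin (m + 1)) (c : BV (S.ctLen n))
    (κ : PairCoins S n × BV (S.ctLen n)) : Exch S n × BV (S.ctLen n) :=
  if i < j then simExch C pk j i (d i) c κ.1 κ.2 else (noExch C j i κ.1, c)

/-- The order in which the parties take part in the exchanges of party `j`: the parties
`1, …, j - 1`, then the leader; the others follow without an exchange. -/
def exchOrder {m : ℕ} (j : Fin (m + 1)) : List (Fin (m + 1)) :=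
  ((List.finRange m).map Fin.succ).filter (· < j) ++
    0 :: ((List.finRange m).map Fin.succ).filter (¬ · < j)

variable {P : HashParams S} {k : ℕ}

/-- The coins of a party in the shuffle phase. -/
abbrev ChainCoins (P : HashParams S) (k n : ℕ) : Type :=
  Equiv.Perm (Slot P k n) × (Slot P k n → BV (S.parCoins n)) × (Slot P k n → BV (S.reCoins n))

/-- The product of the public keys of the leader and of the parties after `j`. -/
def restKey (pk : Fin (k + 1) → S.PK n) (j : Fin (k + 1)) : S.PK n :=
  pk 0 * ∏ d ∈ Finset.univ.filter (fun d => j < d), pk d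

/-- The action of party `t` in the shuffle phase: the output consists of its coins, if it is
corrupted, and of the vector that it sends. -/
def chainStep (C : Finset (Fin (k + 1))) (pk : Fin (k + 1) → S.PK n) (sk : Fin (k + 1) → S.SK n)
    (t : Fin (k + 1)) (c : Slot P k n → BV (S.ctLen n)) (κ : ChainCoins P k n) :
    (ChainCoins P k n × (Slot P k n → BV (S.ctLen n))) × (Slot P k n → BV (S.ctLen n)) :=
  let v : Slot P k n → BV (S.ctLen n) := if t = 0 then fun s => c (κ.1 s) else fun s =>
    S.reRand n (restKey pk t) (S.parDec n (sk t) (c (κ.1 s)) (κ.2.1 (κ.1 s))) (κ.2.2 (κ.1 s))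
  ((visible (t ∈ C) (1, fun _ => zeroBV, fun _ => zeroBV) κ, v), v)

/-- The simulated action: party `h`, unless it is the leader, sends fresh encryptions of the
plaintexts `y` in random order. -/
def simChainStep (C : Finset (Fin (k + 1))) (pk : Fin (k + 1) → S.PK n)
    (sk : Fin (k + 1) → S.SK n) (h : Fin (k + 1)) (y : Slot P k n → Option (S.M n))
    (t : Fin (k + 1)) (c : Slot P k n → BV (S.ctLen n))
    (κ : ChainCoins P k n × (Slot P k n → BV (S.encCoins n))) :
    (ChainCoins P k n × (Slot P k n → BV (S.ctLen n))) × (Slot P k n → BV (S.ctLen n)) :=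
  if t = h ∧ h ≠ 0 then
    let v : Slot P k n → BV (S.ctLen n) := fun s => S.enc n (restKey pk h) (y (κ.1.1 s)) (κ.2 s)
    ((visible (t ∈ C) (1, fun _ => zeroBV, fun _ => zeroBV) κ.1, v), v)
  else chainStep C pk sk t c κ.1

/-- The records of all exchanges, with the visible coins for the first encryptions: an entry for
each party and bin. -/
abbrev Records (P : HashParams S) (k n : ℕ) : Type :=
  Fin (k + 1) → Fin (P.bins n) → BV (S.encCoins n) × (Fin (k + 1) → Exch S n)

/-- The outputs of the shuffle phase. -/
abbrev Vectors (P : HashParams S) (k n : ℕ) : Type :=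
  Fin (k + 1) → ChainCoins P k n × (Slot P k n → BV (S.ctLen n))

/-- The vector of the leader before its shuffle. -/
def leaderOf (TR : Records P k n) (s : Slot P k n) : BV (S.ctLen n) :=
  ((TR s.1.succ s.2).2 0).msgV

/-- The view of party `i`, put together from its set, its coins for key generation, the public keys,
and the outputs of the two phases. -/
def mkView (X : Finset (S.M n)) (g : BV (S.genCoins n)) (pk : Fin (k + 1) → S.PK n)
    (TR : Records P k n) (CH : Vectors P k n) (i : Fin (k + 1)) : View P k n where
  input := X
  tape := (g, fun b => (TR i b).1, fun i' b => ((TR i b).2 i').dummy,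
    fun j b => ((TR j b).2 i).recv, fun i' b => ((TR i b).2 i').send, (CH i).1.1, (CH i).1.2.1,
    (CH i).1.2.2)
  pks := pk
  shares := fun j => if j = i then none else
    some fun b => if i < j then ((TR j b).2 i).shareI else ((TR i b).2 j).shareJ
  rotSender := fun j => if j < i then some fun b => ((TR i b).2 j).rotS else none
  rotReceiver := fun j => if i < j then some fun b => ((TR j b).2 i).rotR else none
  msgsU := fun j => if i < j then some fun b => ((TR j b).2 i).msgU else none
  msgsV := fun j => if 0 < j ∧ j < i then some fun b => ((TR i b).2 j).msgV else none
  vec := if i = 0 then (CH (Fin.last k)).2 else (CH (Fin.ofNat (k + 1) ((i : ℕ) - 1))).2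

/-- The coins of party `j` for the exchanges about one bin. -/
abbrev BinCoins (S : MKRScheme) (k n : ℕ) : Type :=
  BV (S.encCoins n) × (Fin (k + 1) → PairCoins S n)

set_option synthInstance.maxSize 10000 in
instance : Fintype (BinCoins S k n) := inferInstance

set_option synthInstance.maxSize 10000 in
instance : Fintype (ChainCoins P k n) := inferInstance

instance : Nonempty (BinCoins S k n) :=
  ⟨(fun _ => false, fun _ => (fun _ => false, fun _ => false, fun _ => false, false,
    fun _ _ => false))⟩

instance : Nonempty (ChainCoins P k n) := ⟨(1, fun _ _ => false, fun _ _ => false)⟩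

/-- The randomness of an execution, arranged by the phases of the protocol. -/
abbrev Coins (P : HashParams S) (k n : ℕ) : Type :=
  (Fin (k + 1) → BV (S.genCoins n)) × (Fin (k + 1) → Fin (P.bins n) → BinCoins S k n) ×
    (Fin (k + 1) → ChainCoins P k n)

/-- The rearrangement of the random tapes and the randomness of the functionalities. -/
def coinsEquiv : ((Fin (k + 1) → Tape P k n) × FuncCoins P k n) ≃ Coins P k n where
  toFun ω := (fun i => (ω.1 i).gen,
    fun j b => ((ω.1 j).encElem b, fun i => ((ω.1 j).encDummy i b, (ω.1 i).reReceiver j b,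
      (ω.1 j).reSender i b, ω.2.1 i j b, ω.2.2 j i b)),
    fun t => ((ω.1 t).perm, (ω.1 t).parDec, (ω.1 t).reShuffle))
  invFun r := (fun i => (r.1 i, fun b => (r.2.1 i b).1, fun i' b => ((r.2.1 i b).2 i').1,
      fun j b => ((r.2.1 j b).2 i).2.1, fun i' b => ((r.2.1 i b).2 i').2.2.1,
      (r.2.2 i).1, (r.2.2 i).2.1, (r.2.2 i).2.2),
    (fun i j b => ((r.2.1 j b).2 i).2.2.2.1, fun j i b => ((r.2.1 j b).2 i).2.2.2.2))
  left_inv _ := rfl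
  right_inv _ := rfl

instance : Inhabited (Exch S n) :=
  ⟨⟨zeroBV, zeroBV, zeroBV, false, false, fun _ => zeroBV, zeroBV, fun _ => zeroBV, zeroBV⟩⟩

theorem BV.xor_xor {q : ℕ} (u v : BV q) : BV.xor (BV.xor u v) u = v := by
  funext i
  simp only [BV.xor]
  cases u i <;> cases v i <;> rfl

theorem mem_exchOrder {m : ℕ} (j i : Fin (m + 1)) : i ∈ exchOrder j := by
  unfold exchOrder
  refine Fin.cases ?_ (fun i => ?_) i
  · simp
  · by_cases h : i.succ < j
    · simp [h]
    · simp [not_lt.1 h]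

theorem nodup_exchOrder {m : ℕ} (j : Fin (m + 1)) : (exchOrder j).Nodup := by
  unfold exchOrder
  have h := (List.nodup_finRange m).map (Fin.succ_injective m)
  rw [List.nodup_append]
  refine ⟨h.filter _, ?_, ?_⟩
  · rw [List.nodup_cons]
    exact ⟨by simp [Fin.succ_ne_zero], h.filter _⟩
  · intro a ha b hb
    simp only [List.mem_filter, List.mem_map, List.mem_cons] at ha hb
    rintro rfl
    rcases hb with rfl | hb
    · obtain ⟨⟨i, _, hi⟩, _⟩ := ha
      exact Fin.succ_ne_zero _ hi
    · simp_all

end Game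

/-! ### Executions in terms of the sequential processes -/

section Bridge

variable {S : MKRScheme} {n k : ℕ} {P : HashParams S}

theorem isTrace_of_forall {m : ℕ} {σ κ τ : Type} {st : Fin m → σ → κ → τ × σ} {f : Fin m → κ}
    {s : Fin m → σ} {c : σ} {L : List (Fin m)}
    (h : ∀ i ∈ L, s i = c ∧ (st i c (f i)).2 = c) : IsTrace st f s L c := by
  induction L with
  | nil => trivial
  | cons i L ih =>
    have hi := h i List.mem_cons_self
    exact ⟨hi.1, hi.2.symm ▸ ih fun i' hi' => h i' (List.mem_cons_of_mem _ hi')⟩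

/-- The state along the order of exchanges, if `u t` is the state after `t` exchanges. -/
theorem isTrace_exchOrder {m : ℕ} {σ κ τ : Type} {st : Fin (m + 1) → σ → κ → τ × σ}
    {f : Fin (m + 1) → κ} {j : Fin (m + 1)} (u : ℕ → σ)
    (hu : ∀ i : Fin m, i.succ < j → (st i.succ (u i) (f i.succ)).2 = u (i + 1))
    (hst : ∀ i, ¬ i < j → ∀ c, (st i c (f i)).2 = c) :
    IsTrace st f (fun i => if i = 0 then u (j - 1) else if i < j then u (i - 1) else
      (st 0 (u (j - 1)) (f 0)).2) (exchOrder j) (u 0) := by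
  set s : Fin (m + 1) → σ := fun i => if i = 0 then u (j - 1) else if i < j then u (i - 1) else
      (st 0 (u (j - 1)) (f 0)).2 with hs
  have htail : IsTrace st f s (0 :: ((List.finRange m).map Fin.succ).filter (¬ · < j))
      (u (j - 1)) := by
    refine ⟨by simp [hs], isTrace_of_forall fun i hi => ?_⟩
    simp only [List.mem_filter, List.mem_map, decide_eq_true_eq] at hi
    obtain ⟨⟨i, _, rfl⟩, hi⟩ := hi
    exact ⟨by simp [hs, Fin.succ_ne_zero, hi], hst _ hi _⟩
  have key : ∀ q t, t + q = m → t ≤ (j : ℕ) - 1 → IsTrace st f s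
      ((((List.finRange m).drop t).map Fin.succ).filter (· < j) ++
        0 :: ((List.finRange m).map Fin.succ).filter (¬ · < j)) (u t) := by
    intro q
    induction q with
    | zero =>
      intro t ht htj
      have hj := j.isLt
      have : t = (j : ℕ) - 1 := by omega
      rw [List.drop_eq_nil_of_le (by simp; omega)]
      rw [this]
      exact htail
    | succ q ih =>
      intro t ht htj
      have hd : (List.finRange m).drop t = ⟨t, by omega⟩ :: (List.finRange m).drop (t + 1) := by
        rw [List.drop_eq_getElem_cons (by simp; omega)]
        simp
      by_cases htj' : t + 1 < j
      · have hlt : (⟨t, by omega⟩ : Fin m).succ < j := by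
          rw [Fin.lt_def]; simpa using htj'
        rw [hd, List.map_cons, List.filter_cons_of_pos (by simpa using hlt), List.cons_append]
        refine ⟨?_, ?_⟩
        · simp only [hs]
          rw [if_neg (Fin.succ_ne_zero _), if_pos hlt]
          rfl
        rw [hu _ hlt]
        exact ih (t + 1) (by omega) (by omega)
      · have : t = (j : ℕ) - 1 := by omega
        have hnil : (((List.finRange m).drop t).map Fin.succ).filter (· < j) = [] := by
          rw [List.filter_eq_nil_iff]
          intro i hi
          simp only [List.mem_map, List.mem_drop_iff_getElem] at hi
          obtain ⟨i', ⟨a, ha, rfl⟩, rfl⟩ := hi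
          simp only [Fin.lt_def, List.getElem_finRange, Fin.val_succ, Fin.val_cast,
            decide_eq_true_eq]
          omega
        rw [hnil, this]
        exact htail
  have := key m 0 (by omega) (by omega)
  rwa [List.drop_zero] at this

/-- The state along all parties in their order. -/
theorem isTrace_finRange {m : ℕ} {σ κ τ : Type} {st : Fin m → σ → κ → τ × σ}
    {f : Fin m → κ} (u : ℕ → σ) (hu : ∀ i : Fin m, (st i (u i) (f i)).2 = u (i + 1)) :
    IsTrace st f (fun i => u i) (List.finRange m) (u 0) := by
  have key : ∀ q t, t + q = m →
      IsTrace st f (fun i => u i) ((List.finRange m).drop t) (u t) := by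
    intro q
    induction q with
    | zero =>
      intro t ht
      rw [List.drop_eq_nil_of_le (by simp; omega)]
      trivial
    | succ q ih =>
      intro t ht
      rw [List.drop_eq_getElem_cons (by simp; omega)]
      refine ⟨by simp, ?_⟩
      have := hu ⟨t, by omega⟩
      simp only [List.getElem_finRange, Fin.cast_mk]
      rw [this]
      exact ih (t + 1) (by omega)
  simpa using key m 0 (by omega)

variable (C : Finset (Fin (k + 1)))

/-- Whether the query of party `j` in bin `b` belongs to the set of party `i`. -/
def member (P : HashParams S) (seed : BV (P.seedLen n)) (X : Fin (k + 1) → Finset (S.M n))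
    (j : Fin (k + 1)) (b : Fin (P.bins n)) (i : Fin (k + 1)) : Bool :=
  decide (P.cuckoo n seed (X j) b ∈ (simpleTable (P.hash n seed) (X i) b).image some)

/-- The plaintext of party `j` in bin `b`. -/
def plainElem (P : HashParams S) (seed : BV (P.seedLen n)) (X : Fin (k + 1) → Finset (S.M n))
    (j : Fin (k + 1)) (b : Fin (P.bins n)) : Option (S.M n) :=
  (P.cuckoo n seed (X j) b).map Prod.fst

/-- The records of the exchanges in the protocol. -/
def realRecords (pk : S.PK n) (seed : BV (P.seedLen n)) (X : Fin (k + 1) → Finset (S.M n))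
    (r : Fin (k + 1) → Fin (P.bins n) → BinCoins S k n) : Records P k n := fun j b =>
  (visible (j ∈ C) zeroBV (r j b).1,
    runF (realStep C pk j (member P seed X j b)) (exchOrder j)
      (S.enc n pk (plainElem P seed X j b) (r j b).1) (r j b).2 default)

/-- The outputs of the shuffle phase in the protocol. -/
def realVectors (pk : Fin (k + 1) → S.PK n) (sk : Fin (k + 1) → S.SK n)
    (c : Slot P k n → BV (S.ctLen n)) (r : Fin (k + 1) → ChainCoins P k n) : Vectors P k n :=
  runF (chainStep C pk sk) (List.finRange (k + 1)) c r
    fun _ => ((1, fun _ => zeroBV, fun _ => zeroBV), fun _ => zeroBV)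

variable {C}
variable (E : Exec P k n)

/-- An exchange of the process is the exchange of the execution, for any ciphertext that `j` holds.
-/
theorem exec_step {j i : Fin (k + 1)} (hij : i < j) (b : Fin (P.bins n)) (c : BV (S.ctLen n)) :
    realStep C E.pkAll j (member P E.seed E.X j b) i c
      ((coinsEquiv (E.tape, E.func)).2.1 j b |>.2 i) =
    ({ dummy := visible (j ∈ C) zeroBV ((E.tape j).encDummy i b)
       recv := visible (i ∈ C) zeroBV ((E.tape i).reReceiver j b)
       send := visible (j ∈ C) zeroBV ((E.tape j).reSender i b)
       shareI := visible (i ∈ C) false (E.share i j b)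
       shareJ := visible (j ∈ C) false (E.share j i b)
       rotS := visible (j ∈ C) (fun _ => zeroBV) (E.rot j i b).1
       rotR := visible (i ∈ C) zeroBV (E.rot j i b).2
       msgU := visible (i ∈ C) (fun _ => zeroBV) (E.maskPair j i b c)
       msgV := visible (j ∈ C ∨ i = 0) zeroBV (E.reply j i b (E.maskPair j i b c)) },
     S.reRand n E.pkAll (E.reply j i b (E.maskPair j i b c)) ((E.tape j).reSender i b)) := by
  have h1 : E.share i j b = E.func.1 i j b := by simp [Exec.share, hij, Exec.pmt, funcBssPMT]
  have h2 : E.share j i b = Bool.xor (E.func.1 i j b) (member P E.seed E.X j b i) := by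
    rw [Exec.share, if_neg hij.not_gt]
    rfl
  have h3 : (E.rot j i b).1 = E.func.2 j i b := rfl
  have h4 : (E.rot j i b).2 = E.func.2 j i b (E.func.1 i j b) := by
    simp [Exec.rot, funcROT, h1]
  have h5 : ∀ β, E.maskPair j i b c β = BV.xor (E.func.2 j i b β)
      (if β = Bool.xor (E.func.1 i j b) (member P E.seed E.X j b i) then c
        else S.enc n E.pkAll none ((E.tape j).encDummy i b)) := by
    intro β
    simp only [Exec.maskPair, h2, h3]
  have h5' : E.maskPair j i b c = fun β => BV.xor (E.func.2 j i b β)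
      (if β = Bool.xor (E.func.1 i j b) (member P E.seed E.X j b i) then c
        else S.enc n E.pkAll none ((E.tape j).encDummy i b)) := funext h5
  rw [realStep, if_pos hij, Exec.reply, Exec.unmask, h1, h2, h3, h4, h5']
  rfl

/-- The states of the process are the ciphertexts that party `j` holds in the execution. -/
theorem exec_trace (j : Fin (k + 1)) (b : Fin (P.bins n)) :
    IsTrace (realStep C E.pkAll j (member P E.seed E.X j b))
      ((coinsEquiv (E.tape, E.func)).2.1 j b).2
      (fun i => if i = 0 then E.held j b (j - 1) else if i < j then E.held j b (i - 1) else
        (realStep C E.pkAll j (member P E.seed E.X j b) 0 (E.held j b (j - 1))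
          (((coinsEquiv (E.tape, E.func)).2.1 j b).2 0)).2)
      (exchOrder j) (E.held j b 0) := by
  refine isTrace_exchOrder (E.held j b) (fun i hi => ?_) (fun i hi c => ?_)
  · rw [exec_step E hi]
    have : i.succ = Fin.ofNat (k + 1) ((i : ℕ) + 1) := by
      ext
      simp [Nat.mod_eq_of_lt (show (i : ℕ) + 1 < k + 1 by omega)]
    rw [this]
    rfl
  · simp [realStep, hi]

/-- The records of the process are what the corrupted parties see of the exchanges. -/
theorem exec_record {j i : Fin (k + 1)} (hij : i < j) (b : Fin (P.bins n)) :
    (realRecords C E.pkAll E.seed E.X (coinsEquiv (E.tape, E.func)).2.1 j b).2 i =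
    { dummy := visible (j ∈ C) zeroBV ((E.tape j).encDummy i b)
      recv := visible (i ∈ C) zeroBV ((E.tape i).reReceiver j b)
      send := visible (j ∈ C) zeroBV ((E.tape j).reSender i b)
      shareI := visible (i ∈ C) false (E.share i j b)
      shareJ := visible (j ∈ C) false (E.share j i b)
      rotS := visible (j ∈ C) (fun _ => zeroBV) (E.rot j i b).1
      rotR := visible (i ∈ C) zeroBV (E.rot j i b).2
      msgU := visible (i ∈ C) (fun _ => zeroBV) (E.msgU j i b)
      msgV := visible (j ∈ C ∨ i = 0) zeroBV (E.reply j i b (E.msgU j i b)) } := by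
  refine (runF_apply _ (nodup_exchOrder j) (exec_trace E j b) _ (mem_exchOrder j i)).trans ?_
  rw [exec_step E hij]
  by_cases hi : i = 0
  · simp [hi, Exec.msgU]
  · simp [hi, hij, Exec.msgU]

/-- The records contain the visible coins of all pairs of parties, also of those without an
exchange. -/
theorem exec_record_coins (j i : Fin (k + 1)) (b : Fin (P.bins n)) :
    let T := (realRecords C E.pkAll E.seed E.X (coinsEquiv (E.tape, E.func)).2.1 j b).2 i
    T.dummy = visible (j ∈ C) zeroBV ((E.tape j).encDummy i b) ∧
    T.recv = visible (i ∈ C) zeroBV ((E.tape i).reReceiver j b) ∧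
    T.send = visible (j ∈ C) zeroBV ((E.tape j).reSender i b) := by
  by_cases hij : i < j
  · rw [exec_record E hij]
    exact ⟨rfl, rfl, rfl⟩
  · have := runF_apply _ (nodup_exchOrder j) (exec_trace (C := C) E j b) default (mem_exchOrder j i)
    simp only [realStep, hij, if_false] at this
    intro T
    have hT : T = noExch C j i ((coinsEquiv (E.tape, E.func)).2.1 j b |>.2 i) := this
    rw [hT]
    exact ⟨rfl, rfl, rfl⟩

theorem exec_leader :
    leaderOf (realRecords C E.pkAll E.seed E.X (coinsEquiv (E.tape, E.func)).2.1) =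
      E.leaderVec := by
  funext s
  unfold leaderOf
  rw [exec_record E (Fin.succ_pos _)]
  simp [visible, Exec.leaderVec]

/-- The outputs of the process in the shuffle phase are what the corrupted parties see of this
phase. -/
theorem exec_chain (t : Fin (k + 1)) :
    realVectors C E.pk E.sk E.leaderVec (coinsEquiv (E.tape, E.func)).2.2 t =
      (visible (t ∈ C) (1, fun _ => zeroBV, fun _ => zeroBV)
        ((E.tape t).perm, (E.tape t).parDec, (E.tape t).reShuffle), E.chain t) := by
  have hstep : ∀ i : Fin (k + 1), chainStep C E.pk E.sk i
      (if (i : ℕ) = 0 then E.leaderVec else E.chain (i - 1))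
      ((coinsEquiv (E.tape, E.func)).2.2 i) =
      ((visible (i ∈ C) (1, fun _ => zeroBV, fun _ => zeroBV)
        ((E.tape i).perm, (E.tape i).parDec, (E.tape i).reShuffle), E.chain i), E.chain i) := by
    intro i
    refine Fin.cases ?_ (fun i => ?_) i
    · rfl
    · have hi : i.succ = Fin.ofNat (k + 1) ((i : ℕ) + 1) := by
        ext
        simp [Nat.mod_eq_of_lt (show (i : ℕ) + 1 < k + 1 by omega)]
      have hv : E.chain (i.succ : ℕ) = fun s => S.reRand n (restKey E.pk i.succ)
          (S.parDec n (E.sk i.succ) (E.chain i ((E.tape i.succ).perm s))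
            ((E.tape i.succ).parDec ((E.tape i.succ).perm s)))
          ((E.tape i.succ).reShuffle ((E.tape i.succ).perm s)) := by
        rw [Fin.val_succ, Exec.chain, ← hi]
        rfl
      rw [hv]
      simp only [chainStep, Fin.succ_ne_zero, if_false, Fin.val_succ, Nat.add_eq_zero_iff,
        one_ne_zero, and_false, Nat.add_sub_cancel]
      rfl
  have htr : IsTrace (chainStep C E.pk E.sk) (coinsEquiv (E.tape, E.func)).2.2
      (fun i => if (i : ℕ) = 0 then E.leaderVec else E.chain (i - 1)) (List.finRange (k + 1))
      E.leaderVec := by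
    have := isTrace_finRange (st := chainStep C E.pk E.sk)
      (f := (coinsEquiv (E.tape, E.func)).2.2)
      (fun i => if i = 0 then E.leaderVec else E.chain (i - 1)) (fun i => by
        rw [hstep]
        simp)
    simpa using this
  refine (runF_apply _ (List.nodup_finRange _) htr _ (List.mem_finRange t)).trans ?_
  rw [hstep]

/-- The view of a corrupted party, in terms of the phases of the protocol. -/
theorem exec_view {i : Fin (k + 1)} (hi : i ∈ C) :
    E.view i = mkView (E.X i) ((coinsEquiv (E.tape, E.func)).1 i) E.pk
      (realRecords C E.pkAll E.seed E.X (coinsEquiv (E.tape, E.func)).2.1)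
      (realVectors C E.pk E.sk E.leaderVec (coinsEquiv (E.tape, E.func)).2.2) i := by
  have hr := fun j b => exec_record_coins (C := C) E i j b
  have hr' := fun j b => exec_record_coins (C := C) E j i b
  unfold mkView Exec.view
  congr 1
  · simp only [hr, hr', exec_chain]
    simp only [visible, hi, if_true]
    simp only [realRecords, visible, hi, if_true]
    rfl
  · funext j
    by_cases hij : j = i
    · simp [hij]
    · simp only [hij, if_false]
      congr 1
      funext b
      by_cases hlt : i < j
      · simp [hlt, exec_record E hlt, visible, hi]
      · have hlt' : j < i := lt_of_le_of_ne (not_lt.1 hlt) hij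
        simp [hlt, exec_record E hlt', visible, hi]
  · funext j
    by_cases hlt : j < i
    · simp [hlt, exec_record E hlt, visible, hi]
    · simp [hlt]
  · funext j
    by_cases hlt : i < j
    · simp [hlt, exec_record E hlt, visible, hi]
    · simp [hlt]
  · funext j
    by_cases hlt : i < j
    · simp only [hlt, exec_record E hlt, visible, hi, if_true]
    · simp [hlt]
  · funext j
    by_cases hlt : 0 < j ∧ j < i
    · simp only [hlt, exec_record E hlt.2, visible, hi, if_true, true_or, and_self]
      rfl
    · simp [hlt]
  · have : ((Fin.ofNat (k + 1) ((i : ℕ) - 1) : Fin (k + 1)) : ℕ) = (i : ℕ) - 1 := by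
      simp [Nat.mod_eq_of_lt (show (i : ℕ) - 1 < k + 1 by omega)]
    simp only [exec_chain, this, Fin.val_last]

/-- The leader's output depends on the last vector of the shuffle phase. -/
theorem exec_output : E.output = E.X 0 ∪ Finset.univ.biUnion fun s =>
    (S.dec n (E.sk 0) ((realVectors C E.pk E.sk E.leaderVec
      (coinsEquiv (E.tape, E.func)).2.2 (Fin.last k)).2 s)).toFinset := by
  rw [exec_chain]
  rfl

end Bridge

/-! ### One bin: the exchanges can be simulated -/

section Slot

variable {S : MKRScheme} {n m : ℕ} (C : Finset (Fin (m + 1))) (pk : S.PK n)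
  (j : Fin (m + 1)) (d : Fin (m + 1) → Bool)

/-- The coins of an exchange other than the first three components. -/
abbrev MaskCoins (S : MKRScheme) (n : ℕ) : Type := Bool × (Bool → BV (S.ctLen n))

/-- The plaintext that party `j` holds after its exchange with party `i`. -/
def nextMsg (i : Fin (m + 1)) (a : Option (S.M n)) : Option (S.M n) :=
  if i < j ∧ d i then none else a

/-- Simulated coins of an exchange: the coins of the protocol and an encryption of `a`. -/
noncomputable def simCoins (a : Option (S.M n)) : PMF (PairCoins S n × BV (S.ctLen n)) :=
  (uniformOfFintype (PairCoins S n)).bind fun κ => (S.encDist n pk a).map (Prod.mk κ)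

theorem uniform_pairCoins : uniformOfFintype (PairCoins S n) =
    (uniformOfFintype (BV (S.encCoins n))).bind fun x =>
    (uniformOfFintype (BV (S.reCoins n))).bind fun y =>
    (uniformOfFintype (BV (S.reCoins n))).bind fun z =>
    (uniformOfFintype (MaskCoins S n)).map fun q => (x, y, z, q) := by
  rw [uniform_prod]
  congr 1
  funext x
  rw [uniform_prod, PMF.map_bind]
  congr 1
  funext y
  rw [uniform_prod, PMF.map_comp, PMF.map_bind]
  congr 1
  funext z
  rw [PMF.map_comp]
  rfl

theorem map_bind_comm {α β γ : Type} (p : PMF α) (q : PMF β) (f : α → β → γ) :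
    (p.bind fun a => q.map (f a)) = q.bind fun b => p.map fun a => f a b := by
  simp only [PMF.map, PMF.bind_comm p, Function.comp_def]

/-- The coins for the receiver's rerandomization may be drawn last. -/
theorem uniform_pairCoins_recv : uniformOfFintype (PairCoins S n) =
    (uniformOfFintype (BV (S.encCoins n))).bind fun x =>
    (uniformOfFintype (BV (S.reCoins n))).bind fun z =>
    (uniformOfFintype (MaskCoins S n)).bind fun q =>
    (uniformOfFintype (BV (S.reCoins n))).map fun y => (x, y, z, q) := by
  rw [uniform_pairCoins]
  congr 1
  funext x
  rw [PMF.bind_comm]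
  congr 1
  funext z
  rw [map_bind_comm]

/-- The visible part of an exchange with an honest party, if the receiver opens `w` and replies
with `v`. -/
def exchRecord (i : Fin (m + 1)) (w v : BV (S.ctLen n)) (κ : PairCoins S n) : Exch S n where
  dummy := visible (j ∈ C) zeroBV κ.1
  recv := visible (i ∈ C) zeroBV κ.2.1
  send := visible (j ∈ C) zeroBV κ.2.2.1
  shareI := visible (i ∈ C) false κ.2.2.2.1
  shareJ := visible (j ∈ C) false κ.2.2.2.1
  rotS := visible (j ∈ C) (fun _ => zeroBV) κ.2.2.2.2
  rotR := visible (i ∈ C) zeroBV (κ.2.2.2.2 κ.2.2.2.1)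
  msgU := visible (i ∈ C) (fun _ => zeroBV) fun β =>
    if β = κ.2.2.2.1 then BV.xor (κ.2.2.2.2 β) w else κ.2.2.2.2 β
  msgV := visible (j ∈ C ∨ i = 0) zeroBV v

variable {C}

theorem simExch_eq {i : Fin (m + 1)} (h : ¬ (i ∈ C ∧ j ∈ C)) (b : Bool) (c : BV (S.ctLen n))
    (κ : PairCoins S n) (F : BV (S.ctLen n)) : simExch C pk j i b c κ F =
      (exchRecord C j i F (if i ∈ C then S.reRand n pk F κ.2.1 else F) κ,
        if j ∈ C then S.reRand n pk F κ.2.2.1 else c) := by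
  rw [simExch, if_neg h]
  rfl

theorem BV.xor_xor_left {q : ℕ} (u v : BV q) : BV.xor (BV.xor u v) v = u := by
  funext i
  simp [BV.xor]

/-- The ciphertext that the receiver opens in an exchange of the protocol. -/
def opened (b : Bool) (c : BV (S.ctLen n)) (x : BV (S.encCoins n)) : BV (S.ctLen n) :=
  if b then S.enc n pk none x else c

/-- A change of variables of the masks: if the receiver is honest, the share of the sender hides the
membership bit; if the receiver is corrupted, the unselected mask hides the ciphertext that it
does not open. -/
theorem realExch_eq {i : Fin (m + 1)} (h : ¬ (i ∈ C ∧ j ∈ C)) (b : Bool) (c : BV (S.ctLen n))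
    (x : BV (S.encCoins n)) : ∃ σ : Equiv.Perm (MaskCoins S n), ∀ y z q,
      realExch C pk j i b c (x, y, z, q) =
        (exchRecord C j i (opened pk b c x) (S.reRand n pk (opened pk b c x) y) (x, y, z, σ q),
          S.reRand n pk (S.reRand n pk (opened pk b c x) y) z) := by
  have hopen : ∀ q : MaskCoins S n,
      (if q.1 = Bool.xor q.1 b then c else S.enc n pk none x) = opened pk b c x := by
    rintro ⟨e, ρ⟩
    cases b <;> cases e <;> rfl
  have hunmask : ∀ q : MaskCoins S n, BV.xor (BV.xor (q.2 q.1)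
      (if q.1 = Bool.xor q.1 b then c else S.enc n pk none x)) (q.2 q.1) = opened pk b c x := by
    intro q
    rw [BV.xor_xor, hopen]
  by_cases hi : i ∈ C
  · have hj : j ∉ C := fun hj => h ⟨hi, hj⟩
    set o : BV (S.ctLen n) := if b then c else S.enc n pk none x with ho
    have hinv : Function.Involutive fun q : MaskCoins S n =>
        ((q.1, fun β => if β = q.1 then q.2 β else BV.xor (q.2 β) o) : MaskCoins S n) := by
      rintro ⟨e, ρ⟩
      ext1
      · rfl
      · funext β
        by_cases hβ : β = e <;> simp [hβ, BV.xor_xor_left]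
    refine ⟨hinv.toPerm, fun y z q => ?_⟩
    simp only [realExch, hunmask]
    refine Prod.ext (Exch.ext ?_ ?_ ?_ ?_ ?_ ?_ ?_ ?_ ?_) rfl <;>
      simp only [exchRecord, visible, hi, hj, if_true, if_false, Function.Involutive.coe_toPerm]
    funext β
    obtain ⟨e, ρ⟩ := q
    by_cases hβ : β = e
    · subst hβ
      simp only [if_true]
      rw [hopen (β, ρ)]
    · simp only [hβ, if_false]
      have hsel : (if β = Bool.xor e b then c else S.enc n pk none x) = o := by
        cases b <;> cases e <;> cases β <;> first | exact absurd rfl hβ | rfl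
      rw [hsel]
  · have hinv : Function.Involutive fun q : MaskCoins S n =>
        ((Bool.xor q.1 b, q.2) : MaskCoins S n) := by
      rintro ⟨e, ρ⟩
      simp
    refine ⟨hinv.toPerm, fun y z q => ?_⟩
    simp only [realExch, hunmask]
    refine Prod.ext (Exch.ext ?_ ?_ ?_ ?_ ?_ ?_ ?_ ?_ ?_) rfl <;>
      simp only [exchRecord, visible, hi, if_false, Function.Involutive.coe_toPerm]

variable {ε : ℝ≥0∞} {pk}

theorem prob_encDist_range (a : Option (S.M n)) :
    prob (S.encDist n pk a) (fun c => c ∉ Set.range (S.enc n pk a)) = 0 := by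
  rw [MKRScheme.encDist, prob_map]
  exact prob_eq_zero fun r _ h => h ⟨r, rfl⟩

theorem prob_reRandDist_range
    (hrr : ∀ a r, Close ε (S.reRandDist n pk (S.enc n pk a r)) (S.encDist n pk a))
    {a : Option (S.M n)} {c : BV (S.ctLen n)}
    (hc : c ∈ Set.range (S.enc n pk a)) :
    prob (S.reRandDist n pk c) (fun c => c ∉ Set.range (S.enc n pk a)) ≤ ε := by
  obtain ⟨r, rfl⟩ := hc
  refine ((hrr a r).prob_le _).trans ?_
  rw [prob_encDist_range, zero_add]

/-- The receiver opens an encryption of `⊥` if the query belongs to its set, and otherwise the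
ciphertext of party `j`. -/
theorem opened_mem {i : Fin (m + 1)} (hij : i < j) {a : Option (S.M n)} {c : BV (S.ctLen n)}
    (hc : c ∈ Set.range (S.enc n pk a)) (x : BV (S.encCoins n)) :
    opened pk (d i) c x ∈ Set.range (S.enc n pk (nextMsg j d i a)) := by
  unfold opened nextMsg
  cases h : d i
  · simpa using hc
  · simp [hij]

/-- If party `j` holds a fresh encryption, then the receiver opens a fresh encryption. -/
theorem encDist_opened {i : Fin (m + 1)} (hij : i < j) (a : Option (S.M n)) :
    ((S.encDist n pk a).bind fun c => (uniformOfFintype (BV (S.encCoins n))).map fun x =>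
      opened pk (d i) c x) = S.encDist n pk (nextMsg j d i a) := by
  unfold opened nextMsg
  cases h : d i
  · have hconst : ∀ c : BV (S.ctLen n), (uniformOfFintype (BV (S.encCoins n))).map (fun _ => c) =
        PMF.pure c := fun c => PMF.map_const _ _
    simp only [Bool.false_eq_true, if_false, and_false, hconst, PMF.bind_pure]
  · simp only [hij, if_true, and_self, PMF.bind_const]
    rfl

theorem mem_support_encDist {a : Option (S.M n)} {c : BV (S.ctLen n)}
    (hc : c ∈ (S.encDist n pk a).support) : c ∈ Set.range (S.enc n pk a) := by
  rw [MKRScheme.encDist, PMF.support_map] at hc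
  obtain ⟨r, _, rfl⟩ := hc
  exact ⟨r, rfl⟩

/-- The exchange in the protocol, with the coins of the receiver's rerandomization drawn last. -/
theorem map_realExch {i : Fin (m + 1)} (h : ¬ (i ∈ C ∧ j ∈ C)) (b : Bool) (c : BV (S.ctLen n)) :
    (uniformOfFintype (PairCoins S n)).map (realExch C pk j i b c) =
      (uniformOfFintype (BV (S.encCoins n))).bind fun x =>
      (uniformOfFintype (BV (S.reCoins n))).bind fun z =>
      (uniformOfFintype (MaskCoins S n)).bind fun q =>
      (uniformOfFintype (BV (S.reCoins n))).map fun y =>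
        (exchRecord C j i (opened pk b c x) (S.reRand n pk (opened pk b c x) y) (x, y, z, q),
          S.reRand n pk (S.reRand n pk (opened pk b c x) y) z) := by
  rw [uniform_pairCoins_recv, PMF.map_bind]
  congr 1
  funext x
  rw [PMF.map_bind]
  congr 1
  funext z
  rw [map_bind_comm, PMF.map_bind]
  simp only [PMF.map_comp]
  conv_rhs => rw [map_bind_comm]
  congr 1
  funext y
  obtain ⟨σ, hσ⟩ := realExch_eq (pk := pk) j h b c x
  conv_rhs => rw [← uniform_map_equiv σ, PMF.map_comp]
  congr 1
  funext q
  exact hσ y z q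

/-- An exchange of a corrupted party that holds an encryption of `a`. -/
theorem close_step_corrupt
    (hrr : ∀ a r, Close ε (S.reRandDist n pk (S.enc n pk a r)) (S.encDist n pk a))
    (hj : j ∈ C) (i : Fin (m + 1)) {a : Option (S.M n)} {c : BV (S.ctLen n)}
    (hc : c ∈ Set.range (S.enc n pk a)) :
    Close ε ((uniformOfFintype (PairCoins S n)).map (realStep C pk j d i c))
      ((simCoins pk (nextMsg j d i a)).map (simStep C pk j d i c)) := by
  have hconst : ∀ κ : PairCoins S n, ∀ f : PairCoins S n → Exch S n × BV (S.ctLen n),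
      ((S.encDist n pk (nextMsg j d i a)).map (Prod.mk κ)).map (fun o => f o.1) =
        PMF.pure (f κ) := fun κ f => by
    rw [PMF.map_comp]
    exact PMF.map_const _ (f κ)
  by_cases hij : i < j
  · by_cases hi : i ∈ C
    · refine Close.of_eq ?_
      have : simStep C pk j d i c = fun o => realExch C pk j i (d i) c o.1 := by
        funext o
        rw [simStep, if_pos hij, simExch, if_pos ⟨hi, hj⟩]
      have h2 : realStep C pk j d i c = realExch C pk j i (d i) c := by
        funext o
        rw [realStep, if_pos hij]
      rw [this, h2, simCoins, PMF.map_bind]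
      simp only [hconst]
      exact (PMF.bind_pure_comp _ _).symm
    · have hh : ¬ (i ∈ C ∧ j ∈ C) := fun h => hi h.1
      have h2 : realStep C pk j d i c = realExch C pk j i (d i) c := by
        funext o
        rw [realStep, if_pos hij]
      have h3 : simStep C pk j d i c = fun o => (exchRecord C j i o.2 o.2 o.1,
          S.reRand n pk o.2 o.1.2.2.1) := by
        funext o
        rw [simStep, if_pos hij, simExch_eq pk j hh, if_neg hi, if_pos hj]
      rw [h2, map_realExch j hh, h3, simCoins, uniform_pairCoins_recv]
      simp only [PMF.map_bind, PMF.bind_bind, PMF.bind_map, Function.comp_def, PMF.map_comp]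
      refine Close.bind_right fun x _ => Close.bind_right fun z _ => Close.bind_right fun q _ => ?_
      -- for fixed other coins, both sides are images of the receiver's reply under one function
      let G : BV (S.ctLen n) → Exch S n × BV (S.ctLen n) := fun v =>
        (exchRecord C j i v v (x, zeroBV, z, q), S.reRand n pk v z)
      have hG : ∀ w v y, exchRecord C j i w v (x, y, z, q) =
          exchRecord C j i v v (x, zeroBV, z, q) := by
        intro w v y
        simp [exchRecord, visible, hi]
      have hw := opened_mem j d hij hc x
      obtain ⟨r, hr⟩ := hw
      have := (hrr (nextMsg j d i a) r).map G
      rw [hr, MKRScheme.reRandDist, PMF.map_comp] at this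
      simp only [hG]
      refine (Close.of_eq (ε := 0) ?_).trans (this.trans (Close.of_eq (ε := 0) ?_)) |>.mono
        (by simp)
      · rfl
      · rw [PMF.bind_const]
  · refine Close.of_eq ?_
    have h1 : simStep C pk j d i c = fun o => (noExch C j i o.1, c) := by
      funext o
      rw [simStep, if_neg hij]
    have h2 : realStep C pk j d i c = fun κ => (noExch C j i κ, c) := by
      funext o
      rw [realStep, if_neg hij]
    rw [h1, h2, simCoins, PMF.map_bind]
    simp only [hconst _ fun κ => (noExch C j i κ, c)]
    exact (PMF.bind_pure_comp _ _).symm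

/-- After a simulated exchange, a corrupted party most likely holds an encryption of the
plaintext in question. -/
theorem prob_step_corrupt
    (hrr : ∀ a r, Close ε (S.reRandDist n pk (S.enc n pk a r)) (S.encDist n pk a))
    (hj : j ∈ C) (i : Fin (m + 1)) {a : Option (S.M n)} {c : BV (S.ctLen n)}
    (hc : c ∈ Set.range (S.enc n pk a)) :
    prob ((simCoins pk (nextMsg j d i a)).map (simStep C pk j d i c))
      (fun o => o.2 ∉ Set.range (S.enc n pk (nextMsg j d i a))) ≤ ε + ε := by
  have hre : ∀ c ∈ Set.range (S.enc n pk (nextMsg j d i a)),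
      prob (uniformOfFintype (BV (S.reCoins n)))
        (fun z => S.reRand n pk c z ∉ Set.range (S.enc n pk (nextMsg j d i a))) ≤ ε := by
    intro c hc
    have := prob_reRandDist_range hrr hc
    rwa [MKRScheme.reRandDist, prob_map] at this
  by_cases hij : i < j
  · by_cases hi : i ∈ C
    · rw [simCoins, uniform_pairCoins]
      simp only [PMF.bind_bind, PMF.bind_map, Function.comp_def, PMF.map_bind, PMF.map_comp]
      rw [prob_bind]
      refine expect_le fun x _ => ?_
      have hw := opened_mem j d hij hc x
      refine prob_bind_le (fun y => S.reRand n pk (opened pk (d i) c x) y ∉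
        Set.range (S.enc n pk (nextMsg j d i a))) (hre _ hw) fun y _ hy => ?_
      refine (prob_bind_le (δ := 0) (fun z => S.reRand n pk (S.reRand n pk (opened pk (d i) c x) y) z
        ∉ Set.range (S.enc n pk (nextMsg j d i a))) (hre _ (not_not.1 hy)) fun z _ hz => ?_).trans
        (by simp)
      rw [prob_bind]
      refine expect_le fun q _ => ?_
      rw [prob_map, nonpos_iff_eq_zero]
      refine prob_eq_zero fun F _ => ?_
      have : (simStep C pk j d i c ((x, y, z, q), F)).2 =
          S.reRand n pk (S.reRand n pk (opened pk (d i) c x) y) z := by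
        rw [simStep, if_pos hij, simExch, if_pos ⟨hi, hj⟩, realExch]
        obtain ⟨e, ρ⟩ := q
        simp only [BV.xor_xor, opened]
        cases d i <;> cases e <;> rfl
      rw [this]
      exact hz
    · have hh : ¬ (i ∈ C ∧ j ∈ C) := fun h => hi h.1
      have h3 : simStep C pk j d i c = fun o => (exchRecord C j i o.2 o.2 o.1,
          S.reRand n pk o.2 o.1.2.2.1) := by
        funext o
        rw [simStep, if_pos hij, simExch_eq pk j hh, if_neg hi, if_pos hj]
      rw [simCoins, uniform_pairCoins, h3]
      simp only [PMF.bind_bind, PMF.bind_map, Function.comp_def, PMF.map_bind, PMF.map_comp]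
      rw [prob_bind]
      refine expect_le fun x _ => ?_
      rw [prob_bind]
      refine expect_le fun y _ => ?_
      rw [PMF.bind_comm, prob_bind]
      refine expect_le fun q _ => ?_
      rw [map_bind_comm, prob_bind]
      refine expect_le fun F hF => ?_
      rw [prob_map]
      exact (hre F (mem_support_encDist hF)).trans le_self_add
  · rw [prob_map, prob_eq_zero fun o _ => ?_]
    · exact bot_le
    · simpa [simStep, hij, nextMsg] using hc

/-- An exchange of an honest party that holds a fresh encryption of `a`: afterwards, it holds a
fresh encryption again. -/
theorem close_step_honest
    (hrr : ∀ a r, Close ε (S.reRandDist n pk (S.enc n pk a r)) (S.encDist n pk a))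
    (hj : j ∉ C) (i : Fin (m + 1)) (a : Option (S.M n)) (c₀ : BV (S.ctLen n)) :
    Close (ε + ε)
      ((S.encDist n pk a).bind fun c =>
        (uniformOfFintype (PairCoins S n)).map (realStep C pk j d i c))
      ((simCoins pk (nextMsg j d i a)).bind fun o =>
        (S.encDist n pk (nextMsg j d i a)).map fun c => ((simStep C pk j d i c₀ o).1, c)) := by
  by_cases hij : i < j
  · have hh : ¬ (i ∈ C ∧ j ∈ C) := fun h => hj h.2
    have h2 : ∀ c, realStep C pk j d i c = realExch C pk j i (d i) c := by
      intro c
      funext o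
      rw [realStep, if_pos hij]
    have h3 : ∀ o, (simStep C pk j d i c₀ o).1 = exchRecord C j i o.2
        (if i ∈ C then S.reRand n pk o.2 o.1.2.1 else o.2) o.1 := by
      intro o
      rw [simStep, if_pos hij, simExch_eq pk j hh]
    simp only [h2, h3, map_realExch j hh]
    -- the record does not depend on the coins that only the honest party `j` sees
    have hG : ∀ (w v : BV (S.ctLen n)) x y z q, exchRecord C j i w v (x, y, z, q) =
        exchRecord C j i w v (zeroBV, y, zeroBV, q) := by
      intro w v x y z q
      simp [exchRecord, visible, hj]
    set a' := nextMsg j d i a with ha'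
    let R : BV (S.ctLen n) → MaskCoins S n → BV (S.reCoins n) → BV (S.ctLen n) → Exch S n :=
      fun w q y v => exchRecord C j i w v (zeroBV, y, zeroBV, q)
    have hreal : ((S.encDist n pk a).bind fun c =>
        (uniformOfFintype (BV (S.encCoins n))).bind fun x =>
        (uniformOfFintype (BV (S.reCoins n))).bind fun z =>
        (uniformOfFintype (MaskCoins S n)).bind fun q =>
        (uniformOfFintype (BV (S.reCoins n))).map fun y =>
          (exchRecord C j i (opened pk (d i) c x) (S.reRand n pk (opened pk (d i) c x) y)
            (x, y, z, q), S.reRand n pk (S.reRand n pk (opened pk (d i) c x) y) z)) =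
        (S.encDist n pk a').bind fun w => (uniformOfFintype (MaskCoins S n)).bind fun q =>
        (uniformOfFintype (BV (S.reCoins n))).bind fun y =>
        (S.reRandDist n pk (S.reRand n pk w y)).map fun c => (R w q y (S.reRand n pk w y), c) := by
      rw [ha', ← encDist_opened j d hij]
      simp only [PMF.bind_bind, PMF.bind_map, Function.comp_def, hG, R, MKRScheme.reRandDist,
        PMF.map_comp]
      refine congrArg _ (funext fun c => congrArg _ (funext fun x => ?_))
      rw [PMF.bind_comm]
      refine congrArg _ (funext fun q => ?_)
      rw [map_bind_comm]
    have hsim : ((simCoins pk a').bind fun o => (S.encDist n pk a').map fun c =>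
          (exchRecord C j i o.2 (if i ∈ C then S.reRand n pk o.2 o.1.2.1 else o.2) o.1, c)) =
        (S.encDist n pk a').bind fun w => (uniformOfFintype (MaskCoins S n)).bind fun q =>
        (uniformOfFintype (BV (S.reCoins n))).bind fun y =>
        (S.encDist n pk a').map fun c =>
          (R w q y (if i ∈ C then S.reRand n pk w y else w), c) := by
      rw [simCoins, uniform_pairCoins_recv]
      simp only [PMF.bind_bind, PMF.bind_map, Function.comp_def, hG, R]
      rw [PMF.bind_const, PMF.bind_const, PMF.bind_comm]
      conv_rhs => rw [PMF.bind_comm]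
      conv_lhs => rw [PMF.bind_comm]
      refine congrArg _ (funext fun q => ?_)
      rw [PMF.bind_comm]
    rw [hreal, hsim]
    by_cases hi : i ∈ C
    · simp only [hi, if_true]
      refine Close.bind_right fun w hw => Close.bind_right fun q _ => ?_
      obtain ⟨r, rfl⟩ := mem_support_encDist hw
      have hB := prob_reRandDist_range hrr (a := a') ⟨r, rfl⟩
      rw [MKRScheme.reRandDist, prob_map] at hB
      refine Close.bind_bad _ hB fun y _ hy => Close.map ?_ _
      obtain ⟨r', hr'⟩ := not_not.1 hy
      rw [← hr']
      exact hrr _ _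
    · simp only [hi, if_false]
      -- the record depends on the reply only, which is an almost fresh encryption
      have hR : ∀ w q y v, R w q y v = R zeroBV q zeroBV v := by
        intro w q y v
        simp [R, exchRecord, visible, hi]
      let T : PMF (Exch S n × BV (S.ctLen n)) := (uniformOfFintype (MaskCoins S n)).bind fun q =>
        (S.encDist n pk a').bind fun v => (S.encDist n pk a').map fun c => (R zeroBV q zeroBV v, c)
      have hT : ((S.encDist n pk a').bind fun w => (uniformOfFintype (MaskCoins S n)).bind fun q =>
          (uniformOfFintype (BV (S.reCoins n))).bind fun y =>
          (S.encDist n pk a').map fun c => (R w q y w, c)) =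
            (S.encDist n pk a').bind fun _ => T := by
        simp only [hR, PMF.bind_const, T]
        rw [PMF.bind_comm]
      rw [hT]
      refine Close.bind_right fun w hw => Close.bind_right fun q _ => ?_
      obtain ⟨r, rfl⟩ := mem_support_encDist hw
      have h1 : ((uniformOfFintype (BV (S.reCoins n))).bind fun y =>
          (S.reRandDist n pk (S.reRand n pk (S.enc n pk a' r) y)).map fun c =>
            (R (S.enc n pk a' r) q y (S.reRand n pk (S.enc n pk a' r) y), c)) =
          (S.reRandDist n pk (S.enc n pk a' r)).bind fun v =>
            (S.reRandDist n pk v).map fun c => (R zeroBV q zeroBV v, c) := by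
        simp only [hR (S.enc n pk a' r)]
        conv_rhs => rw [MKRScheme.reRandDist, PMF.bind_map]
        rfl
      rw [h1]
      refine Close.bind (hrr _ _) fun v hv => Close.map ?_ _
      obtain ⟨r', rfl⟩ := mem_support_encDist hv
      exact hrr _ _
  · have h1 : ∀ o, (simStep C pk j d i c₀ o).1 = noExch C j i o.1 := by
      intro o
      rw [simStep, if_neg hij]
    have h2 : ∀ c, realStep C pk j d i c = fun κ => (noExch C j i κ, c) := by
      intro c
      funext o
      rw [realStep, if_neg hij]
    have h3 : nextMsg j d i a = a := by simp [nextMsg, hij]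
    simp only [h1, h2, h3, simCoins, PMF.bind_bind, PMF.bind_map, Function.comp_def, PMF.bind_const]
    refine (Close.of_eq (ε := 0) ?_).mono bot_le
    rw [map_bind_comm]

/-- The plaintexts that party `j` holds after its exchanges with the parties in `L`. -/
def heldMsg (L : List (Fin (m + 1))) (a : Option (S.M n)) : Fin (m + 1) → Option (S.M n) :=
  runF (fun i a (_ : Unit) => (nextMsg j d i a, nextMsg j d i a)) L a (fun _ => ()) fun _ => none

theorem proc_cons {m : ℕ} {σ κ τ : Type} (st : Fin m → σ → κ → τ × σ) (p : Fin m → PMF κ)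
    (i : Fin m) (L : List (Fin m)) (c : σ) (g : Fin m → τ) :
    proc st p (i :: L) c g = ((p i).map (st i c)).bind fun o =>
      (proc st p L o.2 g).map fun w => Function.update w i o.1 := by
  rw [PMF.bind_map]
  rfl

theorem proc_congr {m : ℕ} {σ κ τ : Type} (st : Fin m → σ → κ → τ × σ) {p q : Fin m → PMF κ}
    {L : List (Fin m)} (h : ∀ i ∈ L, p i = q i) (c : σ) (g : Fin m → τ) :
    proc st p L c g = proc st q L c g := by
  induction L generalizing c with
  | nil => rfl
  | cons i L ih =>
    rw [proc_cons, proc_cons, h i List.mem_cons_self]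
    simp only [ih fun i hi => h i (List.mem_cons_of_mem _ hi)]

theorem heldMsg_cons {i : Fin (m + 1)} (L : List (Fin (m + 1))) (a : Option (S.M n)) :
    heldMsg j d (i :: L) a = Function.update (heldMsg j d L (nextMsg j d i a)) i
      (nextMsg j d i a) := rfl

/-- The exchanges of a corrupted party that holds an encryption of `a`. -/
theorem close_proc_corrupt
    (hrr : ∀ a r, Close ε (S.reRandDist n pk (S.enc n pk a r)) (S.encDist n pk a))
    (hj : j ∈ C) {L : List (Fin (m + 1))} (hL : L.Nodup) {a : Option (S.M n)}
    {c : BV (S.ctLen n)} (hc : c ∈ Set.range (S.enc n pk a)) (g : Fin (m + 1) → Exch S n) :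
    Close (L.length * (3 * ε))
      (proc (realStep C pk j d) (fun _ => uniformOfFintype (PairCoins S n)) L c g)
      (proc (simStep C pk j d) (fun i => simCoins pk (heldMsg j d L a i)) L c g) := by
  induction L generalizing a c with
  | nil => exact (Close.refl _).mono bot_le
  | cons i L ih =>
    have hi := (List.nodup_cons.1 hL).1
    rw [proc_cons, proc_cons, heldMsg_cons, Function.update_self]
    have hp : ∀ c, proc (simStep C pk j d) (fun i' => simCoins pk
          (Function.update (heldMsg j d L (nextMsg j d i a)) i (nextMsg j d i a) i')) L c g =
        proc (simStep C pk j d)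
          (fun i' => simCoins pk (heldMsg j d L (nextMsg j d i a) i')) L c g :=
      fun c => proc_congr _ (fun i' hi' => by
        rw [Function.update_of_ne (show i' ≠ i from fun h => hi (h ▸ hi'))]) c g
    simp only [hp]
    refine (((close_step_corrupt j d hrr hj i hc).bind_left _).trans
      (Close.bind_bad _ (prob_step_corrupt j d hrr hj i hc) fun o _ ho =>
        (ih (List.nodup_cons.1 hL).2 (not_not.1 ho)).map _)).mono (le_of_eq ?_)
    push_cast [List.length_cons]
    ring

/-- The exchanges of an honest party, which starts with a fresh encryption of `a`. -/
theorem close_proc_honest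
    (hrr : ∀ a r, Close ε (S.reRandDist n pk (S.enc n pk a r)) (S.encDist n pk a))
    (hj : j ∉ C) {L : List (Fin (m + 1))} (hL : L.Nodup) (a : Option (S.M n))
    (c₀ : BV (S.ctLen n)) (g : Fin (m + 1) → Exch S n) :
    Close (L.length * (3 * ε))
      ((S.encDist n pk a).bind fun c =>
        proc (realStep C pk j d) (fun _ => uniformOfFintype (PairCoins S n)) L c g)
      (proc (simStep C pk j d) (fun i => simCoins pk (heldMsg j d L a i)) L c₀ g) := by
  induction L generalizing a c₀ with
  | nil => exact (Close.of_eq (ε := 0) (PMF.bind_const _ _)).mono bot_le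
  | cons i L ih =>
    have hi := (List.nodup_cons.1 hL).1
    simp only [proc_cons]
    rw [heldMsg_cons, Function.update_self]
    have hp : ∀ c, proc (simStep C pk j d) (fun i' => simCoins pk
          (Function.update (heldMsg j d L (nextMsg j d i a)) i (nextMsg j d i a) i')) L c g =
        proc (simStep C pk j d)
          (fun i' => simCoins pk (heldMsg j d L (nextMsg j d i a) i')) L c g :=
      fun c => proc_congr _ (fun i' hi' => by
        rw [Function.update_of_ne (show i' ≠ i from fun h => hi (h ▸ hi'))]) c g
    simp only [hp]
    rw [← PMF.bind_bind]
    refine Close.mono (((close_step_honest j d hrr hj i a c₀).bind_left _).trans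
      (δ := L.length * (3 * ε)) ?_) ?_
    · rw [PMF.bind_bind, PMF.bind_map]
      refine Close.bind_right fun o _ => ?_
      have := (ih (List.nodup_cons.1 hL).2 (nextMsg j d i a) (simStep C pk j d i c₀ o).2).map
        fun w => Function.update w i (simStep C pk j d i c₀ o).1
      rw [PMF.map_bind] at this
      rw [PMF.bind_map]
      exact this
    · push_cast [List.length_cons]
      calc ε + ε + L.length * (3 * ε) ≤ 3 * ε + L.length * (3 * ε) := by
            gcongr
            calc ε + ε = 2 * ε := (two_mul ε).symm
              _ ≤ 3 * ε := by gcongr; norm_num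
        _ = _ := by ring

/-- In the protocol, the ciphertexts most likely remain encryptions of the plaintexts in question,
along the exchange with party `i`. -/
theorem prob_realStep
    (hrr : ∀ a r, Close ε (S.reRandDist n pk (S.enc n pk a r)) (S.encDist n pk a))
    (hj : 0 < j) (i : Fin (m + 1)) {a : Option (S.M n)} {c : BV (S.ctLen n)}
    (hc : c ∈ Set.range (S.enc n pk a)) :
    prob ((uniformOfFintype (PairCoins S n)).map (realStep C pk j d i c))
      (fun o => o.2 ∉ Set.range (S.enc n pk (nextMsg j d i a)) ∨
        (i = 0 ∧ o.1.msgV ∉ Set.range (S.enc n pk (nextMsg j d i a)))) ≤ ε + ε := by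
  have hre : ∀ c ∈ Set.range (S.enc n pk (nextMsg j d i a)),
      prob (uniformOfFintype (BV (S.reCoins n)))
        (fun z => S.reRand n pk c z ∉ Set.range (S.enc n pk (nextMsg j d i a))) ≤ ε := by
    intro c hc
    have := prob_reRandDist_range hrr hc
    rwa [MKRScheme.reRandDist, prob_map] at this
  by_cases hij : i < j
  · rw [uniform_pairCoins]
    simp only [PMF.map_bind, PMF.map_comp]
    rw [prob_bind]
    refine expect_le fun x _ => ?_
    have hw := opened_mem j d hij hc x
    refine prob_bind_le _ (hre _ hw) fun y _ hy => ?_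
    refine (prob_bind_le (δ := 0) _ (hre _ (not_not.1 hy)) fun z _ hz => ?_).trans (by simp)
    rw [prob_map, nonpos_iff_eq_zero]
    refine prob_eq_zero fun q _ => ?_
    have h1 : ∀ q : MaskCoins S n, BV.xor (BV.xor (q.2 q.1)
        (if q.1 = Bool.xor q.1 (d i) then c else S.enc n pk none x)) (q.2 q.1) =
        opened pk (d i) c x := by
      rintro ⟨e, ρ⟩
      simp only [BV.xor_xor, opened]
      cases d i <;> cases e <;> rfl
    simp only [Function.comp, realStep, if_pos hij, realExch, h1]
    rintro (h | ⟨h0, h⟩)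
    · exact hz h
    · refine h ?_
      simpa [visible, h0] using hy
  · rw [prob_map, prob_eq_zero fun o _ => ?_]
    · exact bot_le
    · have h0 : i ≠ 0 := fun h => hij (h ▸ hj)
      simpa [realStep, hij, nextMsg, h0] using hc

/-- In the protocol, the entry for the leader is most likely an encryption of the plaintext in
question. -/
theorem prob_leader
    (hrr : ∀ a r, Close ε (S.reRandDist n pk (S.enc n pk a r)) (S.encDist n pk a))
    (hj : 0 < j) {L : List (Fin (m + 1))} (hL : L.Nodup) (h0 : 0 ∈ L) {a : Option (S.M n)}
    {c : BV (S.ctLen n)} (hc : c ∈ Set.range (S.enc n pk a)) (g : Fin (m + 1) → Exch S n) :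
    prob (proc (realStep C pk j d) (fun _ => uniformOfFintype (PairCoins S n)) L c g)
      (fun T => (T 0).msgV ∉ Set.range (S.enc n pk (heldMsg j d L a 0))) ≤
      L.length * (3 * ε) := by
  induction L generalizing a c with
  | nil => simp at h0
  | cons i L ih =>
    have hi := (List.nodup_cons.1 hL).1
    rw [proc_cons, heldMsg_cons]
    have hle : ε + ε ≤ 3 * ε := by
      calc ε + ε = 2 * ε := (two_mul ε).symm
        _ ≤ 3 * ε := by gcongr; norm_num
    refine (prob_bind_le (δ := L.length * (3 * ε)) _ (prob_realStep (C := C) j d hrr hj i hc)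
      fun o _ ho => ?_).trans ?_
    · rw [not_or, not_not, not_and, not_not] at ho
      rw [prob_map]
      by_cases h : i = 0
      · subst h
        simp only [Function.update_self]
        rw [prob_eq_zero fun o _ => not_not.2 (ho.2 rfl)]
        exact bot_le
      · simp only [Function.update_of_ne (Ne.symm h)]
        exact ih (List.nodup_cons.1 hL).2 ((List.mem_cons.1 h0).resolve_left (Ne.symm h)) ho.1
    · push_cast [List.length_cons]
      calc ε + ε + L.length * (3 * ε) ≤ 3 * ε + L.length * (3 * ε) := by gcongr
        _ = _ := by ring

theorem length_exchOrder : (exchOrder j).length = m + 1 := by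
  have h1 := (nodup_exchOrder j).length_le_card
  have h2 : (Finset.univ : Finset (Fin (m + 1))).card ≤ (exchOrder j).toFinset.card :=
    Finset.card_le_card fun i _ => List.mem_toFinset.2 (mem_exchOrder j i)
  have h3 := (exchOrder j).toFinset_card_le
  simp only [Finset.card_univ, Fintype.card_fin] at h1 h2
  omega

theorem heldMsg_append (L L' : List (Fin (m + 1))) (a : Option (S.M n)) {i : Fin (m + 1)}
    (hi : i ∉ L) :
    heldMsg j d (L ++ L') a i =
      heldMsg j d L' (if ∃ i ∈ L, i < j ∧ d i = true then none else a) i := by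
  induction L generalizing a with
  | nil => simp
  | cons i' L ih =>
    rw [List.cons_append, heldMsg_cons, Function.update_of_ne
      (show i ≠ i' from fun h => hi (h ▸ List.mem_cons_self)),
      ih _ fun h => hi (List.mem_cons_of_mem _ h)]
    congr 1
    simp only [List.mem_cons, nextMsg, exists_eq_or_imp]
    by_cases h1 : ∃ i ∈ L, i < j ∧ d i = true <;> by_cases h2 : i' < j ∧ d i' = true <;>
      simp [h1, h2]

/-- The plaintext that enters the shuffle phase: the element, unless it belongs to the set of an
earlier party. -/
theorem heldMsg_zero (hj : 0 < j) (a : Option (S.M n)) :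
    heldMsg j d (exchOrder j) a 0 = if ∃ i, i < j ∧ d i = true then none else a := by
  unfold exchOrder
  rw [heldMsg_append, heldMsg_cons, Function.update_self]
  · unfold nextMsg
    have : (∃ i, i < j ∧ d i = true) ↔
        (∃ i ∈ ((List.finRange m).map Fin.succ).filter (· < j), i < j ∧ d i = true) ∨
          d 0 = true := by
      constructor
      · rintro ⟨i, hi, hd⟩
        revert hi hd
        refine Fin.cases (fun _ h => Or.inr h) (fun i hi hd => Or.inl ⟨i.succ, ?_, hi, hd⟩) i
        simpa using hi
      · rintro (⟨i, _, hi⟩ | h)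
        · exact ⟨i, hi⟩
        · exact ⟨0, hj, h⟩
    simp only [this]
    by_cases h1 : ∃ i ∈ ((List.finRange m).map Fin.succ).filter (· < j), i < j ∧ d i = true <;>
      by_cases h2 : d 0 = true <;> simp [h2, hj]
  · simp [Fin.succ_ne_zero]

end Slot

/-! ### All bins -/

section Phase

variable {S : MKRScheme} {n m : ℕ} (C : Finset (Fin (m + 1))) (pk : S.PK n)
  (j : Fin (m + 1)) (d : Fin (m + 1) → Bool) (x : Option (S.M n))

/-- The coins of a bin in the simulation: those of the protocol, and those of the encryptions which
replace the ciphertexts of the honest parties. -/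
abbrev SimBinCoins (S : MKRScheme) (m n : ℕ) : Type :=
  BinCoins S m n × (Fin (m + 1) → BV (S.encCoins n))

set_option synthInstance.maxSize 10000 in
instance : Fintype (SimBinCoins S m n) := inferInstance

/-- The record of party `j` about a bin. -/
def realBin (r : BinCoins S m n) : BV (S.encCoins n) × (Fin (m + 1) → Exch S n) :=
  (visible (j ∈ C) zeroBV r.1,
    runF (realStep C pk j d) (exchOrder j) (S.enc n pk x r.1) r.2 default)

/-- The simulated record of party `j` about a bin, from given ciphertexts `F`. -/
def simBin (F : Fin (m + 1) → BV (S.ctLen n)) (r : BinCoins S m n) :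
    BV (S.encCoins n) × (Fin (m + 1) → Exch S n) :=
  (visible (j ∈ C) zeroBV r.1,
    runF (simStep C pk j d) (exchOrder j) (if j ∈ C then S.enc n pk x r.1 else zeroBV)
      (fun i => (r.2 i, F i)) default)

theorem map_realBin : (uniformOfFintype (BinCoins S m n)).map (realBin C pk j d x) =
    (uniformOfFintype (BV (S.encCoins n))).bind fun r =>
      (proc (realStep C pk j d) (fun _ => uniformOfFintype (PairCoins S n)) (exchOrder j)
        (S.enc n pk x r) default).map (Prod.mk (visible (j ∈ C) zeroBV r)) := by
  rw [uniform_prod, PMF.map_bind]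
  simp only [PMF.map_comp]
  congr 1
  funext r
  rw [← map_runF _ _ (nodup_exchOrder j), PMF.map_comp, ← uniform_pi]
  rfl

theorem map_simBin (μ : Fin (m + 1) → Option (S.M n)) :
    (uniformOfFintype (SimBinCoins S m n)).map
        (fun r => simBin C pk j d x (fun i => S.enc n pk (μ i) (r.2 i)) r.1) =
    (uniformOfFintype (BV (S.encCoins n))).bind fun r =>
      (proc (simStep C pk j d) (fun i => simCoins pk (μ i)) (exchOrder j)
        (if j ∈ C then S.enc n pk x r else zeroBV) default).map
          (Prod.mk (visible (j ∈ C) zeroBV r)) := by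
  rw [uniform_prod, uniform_prod, PMF.map_bind, PMF.bind_bind]
  simp only [PMF.map_comp, PMF.bind_map]
  congr 1
  funext r
  rw [← map_runF _ _ (nodup_exchOrder j), PMF.map_comp]
  have h : (piFin (m + 1) fun i => simCoins pk (μ i)) =
      (uniformOfFintype (Fin (m + 1) → PairCoins S n)).bind fun κ =>
        (uniformOfFintype (Fin (m + 1) → BV (S.encCoins n))).map fun ω i =>
          (κ i, S.enc n pk (μ i) (ω i)) := by
    simp only [simCoins]
    rw [piFin_pair, uniform_pi]
    congr 1
    funext κ
    simp only [MKRScheme.encDist]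
    rw [piFin_map, PMF.map_comp, uniform_pi (α := BV (S.encCoins n))]
    rfl
  rw [h, PMF.map_bind]
  congr 1
  funext κ
  rw [PMF.map_comp]
  rfl

variable {pk} {ε : ℝ≥0∞}

/-- All exchanges of party `j` about one bin can be simulated from fresh encryptions of the tracked
plaintexts. -/
theorem close_bin
    (hrr : ∀ a r, Close ε (S.reRandDist n pk (S.enc n pk a r)) (S.encDist n pk a)) :
    Close ((m + 1 : ℕ) * (3 * ε)) ((uniformOfFintype (BinCoins S m n)).map (realBin C pk j d x))
      ((uniformOfFintype (SimBinCoins S m n)).map fun r => simBin C pk j d x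
        (fun i => S.enc n pk (heldMsg j d (exchOrder j) x i) (r.2 i)) r.1) := by
  rw [map_realBin, map_simBin]
  have hl := length_exchOrder j
  by_cases hj : j ∈ C
  · simp only [hj, if_true]
    exact Close.bind_right fun r _ =>
      (hl ▸ close_proc_corrupt j d hrr hj (nodup_exchOrder j) ⟨r, rfl⟩ default).map _
  · simp only [hj, if_false, visible, PMF.bind_const]
    have := (close_proc_honest j d hrr hj (nodup_exchOrder j) x zeroBV default).map
      (Prod.mk (zeroBV : BV (S.encCoins n)))
    rwa [MKRScheme.encDist, PMF.bind_map, PMF.map_bind, hl] at this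

/-- The leader most likely receives an encryption of the element `x` of the bin if no party before
`j` has it, and of `⊥` otherwise. -/
theorem prob_bin (hj : 0 < j)
    (hrr : ∀ a r, Close ε (S.reRandDist n pk (S.enc n pk a r)) (S.encDist n pk a)) :
    prob ((uniformOfFintype (BinCoins S m n)).map (realBin C pk j d x))
      (fun T => (T.2 0).msgV ∉
        Set.range (S.enc n pk (if ∃ i, i < j ∧ d i = true then none else x))) ≤
      (m + 1 : ℕ) * (3 * ε) := by
  rw [map_realBin, prob_bind, ← heldMsg_zero j d hj]
  have hl := length_exchOrder j
  refine expect_le fun r _ => ?_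
  rw [prob_map]
  have h := prob_leader (C := C) j d hrr hj (nodup_exchOrder j) (mem_exchOrder j 0) (a := x)
    ⟨r, rfl⟩ default
  rwa [hl] at h

end Phase

section Records

variable {S : MKRScheme} {n k : ℕ} {P : HashParams S} (C : Finset (Fin (k + 1))) (pk : S.PK n)
  (seed : BV (P.seedLen n)) (X : Fin (k + 1) → Finset (S.M n))

/-- The simulated records, from given ciphertexts `F` for each party `j`, bin, and party `i`. -/
def simRecords (F : Fin (k + 1) → Fin (P.bins n) → Fin (k + 1) → BV (S.ctLen n))
    (r : Fin (k + 1) → Fin (P.bins n) → BinCoins S k n) : Records P k n := fun j b =>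
  simBin C pk j (member P seed X j b) (plainElem P seed X j b) (F j b) (r j b)

/-- The plaintexts of the ciphertexts that the simulation replaces. -/
def trackedMsg (j : Fin (k + 1)) (b : Fin (P.bins n)) (i : Fin (k + 1)) : Option (S.M n) :=
  heldMsg j (member P seed X j b) (exchOrder j) (plainElem P seed X j b) i

/-- The plaintexts in the vector of the leader. -/
def finalMsg (s : Slot P k n) : Option (S.M n) :=
  if ∃ i, i < s.1.succ ∧ member P seed X s.1.succ s.2 i = true then none
  else plainElem P seed X s.1.succ s.2

variable {pk} {ε : ℝ≥0∞}

/-- All exchanges can be simulated from fresh encryptions of the tracked plaintexts. -/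
theorem close_records
    (hrr : ∀ a r, Close ε (S.reRandDist n pk (S.enc n pk a r)) (S.encDist n pk a)) :
    Close ((k + 1 : ℕ) * (P.bins n * ((k + 1 : ℕ) * (3 * ε))))
      ((uniformOfFintype (Fin (k + 1) → Fin (P.bins n) → BinCoins S k n)).map
        (realRecords C pk seed X))
      ((uniformOfFintype (Fin (k + 1) → Fin (P.bins n) → SimBinCoins S k n)).map fun r =>
        simRecords C pk seed X (fun j b i => S.enc n pk (trackedMsg seed X j b i) ((r j b).2 i))
          fun j b => (r j b).1) := by
  have h1 : (uniformOfFintype (Fin (k + 1) → Fin (P.bins n) → BinCoins S k n)).map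
      (realRecords C pk seed X) = piFin (k + 1) fun j => piFin (P.bins n) fun b =>
        (uniformOfFintype (BinCoins S k n)).map
          (realBin C pk j (member P seed X j b) (plainElem P seed X j b)) := by
    simp only [piFin_map]
    rw [uniform_pi, uniform_pi]
    rfl
  have h2 : ((uniformOfFintype (Fin (k + 1) → Fin (P.bins n) → SimBinCoins S k n)).map fun r =>
        simRecords C pk seed X (fun j b i => S.enc n pk (trackedMsg seed X j b i) ((r j b).2 i))
          fun j b => (r j b).1) = piFin (k + 1) fun j => piFin (P.bins n) fun b =>
        (uniformOfFintype (SimBinCoins S k n)).map fun r => simBin C pk j (member P seed X j b)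
          (plainElem P seed X j b) (fun i => S.enc n pk (trackedMsg seed X j b i) (r.2 i)) r.1 := by
    simp only [piFin_map]
    rw [uniform_pi, uniform_pi]
    rfl
  rw [h1, h2]
  refine (Close.piFin fun j => Close.piFin fun b => close_bin C j _ _ hrr).mono (le_of_eq ?_)
  simp [nsmul_eq_mul]

/-- In the protocol, the leader's vector most likely consists of encryptions of `finalMsg`. -/
theorem prob_records
    (hrr : ∀ a r, Close ε (S.reRandDist n pk (S.enc n pk a r)) (S.encDist n pk a)) :
    prob ((uniformOfFintype (Fin (k + 1) → Fin (P.bins n) → BinCoins S k n)).map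
        (realRecords C pk seed X))
      (fun TR => ∃ s, leaderOf TR s ∉ Set.range (S.enc n pk (finalMsg seed X s))) ≤
      (k + 1 : ℕ) * (P.bins n * ((k + 1 : ℕ) * (3 * ε))) := by
  have h1 : (uniformOfFintype (Fin (k + 1) → Fin (P.bins n) → BinCoins S k n)).map
      (realRecords C pk seed X) = piFin (k + 1) fun j => piFin (P.bins n) fun b =>
        (uniformOfFintype (BinCoins S k n)).map
          (realBin C pk j (member P seed X j b) (plainElem P seed X j b)) := by
    simp only [piFin_map]
    rw [uniform_pi, uniform_pi]
    rfl
  rw [h1]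
  refine (prob_mono (B := fun TR => ∃ j, ∃ b, 0 < j ∧ (((TR j b).2 0).msgV ∉ Set.range (S.enc n pk
    (if ∃ i, i < j ∧ member P seed X j b i = true then none else plainElem P seed X j b))))
    fun TR _ ⟨s, hs⟩ => ⟨s.1.succ, s.2, Fin.succ_pos _, hs⟩).trans ?_
  refine (prob_piFin_le (ε := fun _ => ∑ b : Fin (P.bins n), ((k + 1 : ℕ) * (3 * ε)))
    fun j => prob_piFin_le
      (A := fun b (T : BV (S.encCoins n) × (Fin (k + 1) → Exch S n)) =>
        0 < j ∧ ((T.2 0).msgV ∉ Set.range (S.enc n pk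
          (if ∃ i, i < j ∧ member P seed X j b i = true then none else plainElem P seed X j b))))
    fun b => ?_).trans (le_of_eq ?_)
  · by_cases hj : 0 < j
    · simp only [hj, true_and]
      exact prob_bin C j _ _ hj hrr
    · rw [prob_eq_zero fun _ _ h => hj h.1]
      exact bot_le
  · simp [nsmul_eq_mul]

end Records

/-! ### The shuffle phase -/

section Tables

variable {α β ι : Type} [Fintype ι] [DecidableEq ι]

/-- Closeness entry by entry, for functions of tables of independent coins. -/
theorem close_table [Fintype α] [Nonempty α] [Fintype β] [Nonempty β] {γ : Type} {ε : ℝ≥0∞}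
    {f : ι → α → γ} {f' : ι → β → γ}
    (h : ∀ s, Close ε ((uniformOfFintype α).map (f s)) ((uniformOfFintype β).map (f' s))) :
    Close (Fintype.card ι * ε) ((uniformOfFintype (ι → α)).map fun r s => f s (r s))
      ((uniformOfFintype (ι → β)).map fun r s => f' s (r s)) := by
  let e := Fintype.equivFin ι
  have key : ∀ (δ : Type) [Fintype δ] [Nonempty δ] (g : ι → δ → γ),
      ((uniformOfFintype (ι → δ)).map fun r s => g s (r s)) =
        (piFin (Fintype.card ι) fun i => (uniformOfFintype δ).map (g (e.symm i))).map
          fun w s => w (e s) := by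
    intro δ _ _ g
    rw [piFin_map, ← uniform_pi, ← uniform_map_equiv (Equiv.arrowCongr e.symm (Equiv.refl δ)),
      PMF.map_comp, PMF.map_comp]
    congr 1
    funext r s
    simp [Equiv.arrowCongr]
  rw [key, key]
  refine (((Close.piFin fun i => h (e.symm i)).map _)).mono (le_of_eq ?_)
  simp [nsmul_eq_mul]

end Tables

section SequentialClose

variable {m : ℕ} {σ κ κ' τ : Type} {st : Fin m → σ → κ → τ × σ} {st' : Fin m → σ → κ' → τ × σ}
  {p : Fin m → PMF κ} {p' : Fin m → PMF κ'} {η : ℝ≥0∞}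

/-- Two sequential processes are close if their steps are, as long as an invariant `Inv L c` of the
remaining parties `L` and the state `c` holds, which a step of the second one most likely
preserves. -/
theorem close_proc (Inv : List (Fin m) → σ → Prop)
    (hst : ∀ i L c, Inv (i :: L) c → Close η ((p i).map (st i c)) ((p' i).map (st' i c)))
    (hInv : ∀ i L c, Inv (i :: L) c → prob ((p' i).map (st' i c)) (fun o => ¬ Inv L o.2) ≤ η)
    (L : List (Fin m)) (c : σ) (hc : Inv L c) (g : Fin m → τ) :
    Close (L.length * (η + η)) (proc st p L c g) (proc st' p' L c g) := by
  induction L generalizing c with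
  | nil => exact (Close.refl _).mono bot_le
  | cons i L ih =>
    rw [proc_cons, proc_cons]
    refine (((hst i L c hc).bind_left _).trans (Close.bind_bad _ (hInv i L c hc) fun o _ ho =>
      (ih o.2 (not_not.1 ho)).map _)).mono (le_of_eq ?_)
    push_cast [List.length_cons]
    ring

/-- An invariant of the states of a process whose outputs show the states. -/
theorem prob_proc (Inv : List (Fin m) → σ → Prop) (φ : τ → σ)
    (hφ : ∀ i c κ, φ (st i c κ).1 = (st i c κ).2)
    (hInv : ∀ i L c, Inv (i :: L) c → prob ((p i).map (st i c)) (fun o => ¬ Inv L o.2) ≤ η)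
    (L : List (Fin m)) (i : Fin m) (hL : (L ++ [i]).Nodup) (c : σ) (hc : Inv (L ++ [i]) c)
    (g : Fin m → τ) :
    prob (proc st p (L ++ [i]) c g) (fun w => ¬ Inv [] (φ (w i))) ≤ (L ++ [i]).length * η := by
  induction L generalizing c with
  | nil =>
    rw [List.nil_append, proc_cons]
    refine (prob_bind_le _ (hInv i [] c hc) (δ := 0) fun o ho hgood => ?_).trans (by simp)
    rw [PMF.support_map] at ho
    obtain ⟨κ, _, rfl⟩ := ho
    rw [prob_map, nonpos_iff_eq_zero]
    refine prob_eq_zero fun w _ => ?_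
    rwa [Function.update_self, hφ]
  | cons i' L ih =>
    rw [List.cons_append, proc_cons]
    have hi : i ≠ i' := by
      rintro rfl
      simp at hL
    refine (prob_bind_le _ (hInv i' _ c hc) (δ := (L ++ [i]).length * η) fun o _ ho => ?_).trans
      (le_of_eq ?_)
    · rw [prob_map]
      simp only [Function.update_of_ne hi]
      exact ih (List.nodup_cons.1 hL).2 _ (not_not.1 ho)
    · push_cast [List.length_cons]
      ring

/-- The number of a party, in terms of the number of the parties that act later. -/
theorem val_of_suffix {i : Fin m} {L : List (Fin m)} (h : (i :: L) <:+ List.finRange m) :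
    (i : ℕ) + L.length + 1 = m := by
  obtain ⟨L', h⟩ := h
  have h1 := congrArg List.length h
  have h2 : (L' ++ i :: L)[L'.length]? = some i := by simp
  rw [h, List.getElem?_eq_some_iff] at h2
  obtain ⟨h3, h4⟩ := h2
  simp only [List.length_append, List.length_cons, List.length_finRange] at h1
  rw [← h4]
  simp
  omega

end SequentialClose

section Chain

variable {S : MKRScheme} {n k : ℕ} {P : HashParams S}

/-- The product of the keys of the leader and of the parties from `t` on: the key of the
ciphertexts that party `t` receives in the shuffle phase. -/
def keyFrom (pk : Fin (k + 1) → S.PK n) (t : ℕ) : S.PK n :=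
  pk 0 * ∏ d ∈ Finset.univ.filter (fun d : Fin (k + 1) => 0 < d ∧ t ≤ d), pk d

theorem keyFrom_succ (pk : Fin (k + 1) → S.PK n) (t : Fin (k + 1)) :
    keyFrom pk (t + 1) = restKey pk t := by
  unfold keyFrom restKey
  congr 2
  ext d
  simp only [Finset.mem_filter, Finset.mem_univ, true_and, Fin.lt_def, Fin.val_zero]
  omega

theorem keyFrom_zero (pk : Fin (k + 1) → S.PK n) : keyFrom pk 0 = ∏ i, pk i := by
  rw [Fin.prod_univ_succ]
  unfold keyFrom
  congr 1
  simp [Finset.prod_filter, Fin.prod_univ_succ]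

theorem keyFrom_eq_mul (pk : Fin (k + 1) → S.PK n) {t : Fin (k + 1)} (ht : t ≠ 0) :
    keyFrom pk t = pk t * keyFrom pk (t + 1) := by
  have h : (Finset.univ.filter fun d : Fin (k + 1) => 0 < d ∧ (t : ℕ) ≤ d) =
      insert t (Finset.univ.filter fun d : Fin (k + 1) => 0 < d ∧ (t : ℕ) + 1 ≤ d) := by
    ext d
    have := Fin.pos_iff_ne_zero.2 ht
    simp only [Finset.mem_filter, Finset.mem_univ, true_and, Finset.mem_insert, Fin.lt_def,
      Fin.ext_iff, Fin.val_zero] at this ⊢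
    omega
  unfold keyFrom
  rw [h, Finset.prod_insert (by simp), mul_left_comm]

theorem keyFrom_last (pk : Fin (k + 1) → S.PK n) : keyFrom pk (k + 1) = pk 0 := by
  unfold keyFrom
  rw [Finset.filter_false_of_mem, Finset.prod_empty, mul_one]
  intro d _
  omega

/-- The vector consists of encryptions of a permutation of `x`. -/
def EncryptsPerm (K : S.PK n) (x : Slot P k n → Option (S.M n))
    (c : Slot P k n → BV (S.ctLen n)) : Prop :=
  ∃ σ : Equiv.Perm (Slot P k n), ∀ s, c s ∈ Set.range (S.enc n K (x (σ s)))

/-- Partial decryption and rerandomization of all entries of a vector. -/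
def decryptVec (K : S.PK n) (sk : S.SK n) (c : Slot P k n → BV (S.ctLen n))
    (r : Slot P k n → BV (S.parCoins n) × BV (S.reCoins n)) : Slot P k n → BV (S.ctLen n) :=
  fun s => S.reRand n K (S.parDec n sk (c s) (r s).1) (r s).2

variable {ε : ℝ≥0∞}

/-- Partial decryption followed by rerandomization yields fresh encryptions under the remaining key.
This key has to be a possible output of `Gen`, as partial decryptability speaks of such keys only.
-/
theorem close_decryptVec (hpar : S.PartiallyDecryptable)
    (hrr : ∀ K a r, Close ε (S.reRandDist n K (S.enc n K a r)) (S.encDist n K a))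
    (r₁ r₂ : BV (S.genCoins n)) {z : Slot P k n → Option (S.M n)}
    {c : Slot P k n → BV (S.ctLen n)}
    (hc : ∀ s, c s ∈ Set.range (S.enc n ((S.gen n r₁).1 * (S.gen n r₂).1) (z s))) :
    Close ((k * P.bins n : ℕ) * ε)
      ((uniformOfFintype (Slot P k n → BV (S.parCoins n) × BV (S.reCoins n))).map
        (decryptVec (S.gen n r₂).1 (S.gen n r₁).2 c))
      ((uniformOfFintype (Slot P k n → BV (S.encCoins n))).map fun r s =>
        S.enc n (S.gen n r₂).1 (z s) (r s)) := by
  have hcard : Fintype.card (Slot P k n) = k * P.bins n := by simp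
  rw [← hcard]
  refine close_table (f := fun s (r : BV (S.parCoins n) × BV (S.reCoins n)) =>
    S.reRand n (S.gen n r₂).1 (S.parDec n (S.gen n r₁).2 (c s) r.1) r.2) fun s => ?_
  obtain ⟨r, hr⟩ := hc s
  have h1 : ((uniformOfFintype (BV (S.parCoins n) × BV (S.reCoins n))).map fun r =>
      S.reRand n (S.gen n r₂).1 (S.parDec n (S.gen n r₁).2 (c s) r.1) r.2) =
      (S.parDecDist n (S.gen n r₁).2 (c s)).bind fun c' => S.reRandDist n (S.gen n r₂).1 c' := by
    rw [uniform_prod, PMF.map_bind, MKRScheme.parDecDist, PMF.bind_map]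
    simp only [PMF.map_comp]
    rfl
  rw [h1]
  have h2 : Close ε ((S.parDecDist n (S.gen n r₁).2 (c s)).bind fun c' =>
      S.reRandDist n (S.gen n r₂).1 c') ((S.parDecDist n (S.gen n r₁).2 (c s)).bind fun _ =>
        S.encDist n (S.gen n r₂).1 (z s)) := by
    refine Close.bind_right fun c' hc' => ?_
    have : c' ∈ (S.encDist n (S.gen n r₂).1 (z s)).support := by
      rw [← hpar n r₁ r₂ (z s), PMF.mem_support_bind_iff]
      refine ⟨c s, ?_, hc'⟩
      rw [MKRScheme.encDist, PMF.support_map]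
      exact ⟨r, by simp, hr⟩
    obtain ⟨r', rfl⟩ := mem_support_encDist this
    exact hrr _ _ _
  rwa [PMF.bind_const] at h2

variable (C : Finset (Fin (k + 1))) {g : Fin (k + 1) → BV (S.genCoins n)}

theorem uniform_chainCoins : uniformOfFintype (ChainCoins P k n) =
    (uniformOfFintype (Equiv.Perm (Slot P k n))).bind fun τ =>
      (uniformOfFintype (Slot P k n → BV (S.parCoins n) × BV (S.reCoins n))).map fun r =>
        (τ, fun s => (r s).1, fun s => (r s).2) := by
  rw [uniform_prod]
  congr 1
  funext τ
  rw [← uniform_map_equiv (Equiv.arrowProdEquivProdArrow (Slot P k n) (fun _ => BV (S.parCoins n))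
    fun _ => BV (S.reCoins n)), PMF.map_comp]
  rfl

/-- The states of the shuffle phase before the parties in a final segment of the list act. -/
def ChainInv (pk : Fin (k + 1) → S.PK n) (x : Slot P k n → Option (S.M n))
    (L : List (Fin (k + 1))) (c : Slot P k n → BV (S.ctLen n)) : Prop :=
  L <:+ List.finRange (k + 1) ∧ EncryptsPerm (keyFrom pk (k + 1 - L.length)) x c

theorem chainInv_cons {pk : Fin (k + 1) → S.PK n} {x : Slot P k n → Option (S.M n)}
    {t : Fin (k + 1)} {L : List (Fin (k + 1))} {c : Slot P k n → BV (S.ctLen n)} :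
    ChainInv pk x (t :: L) c ↔
      (t :: L) <:+ List.finRange (k + 1) ∧ EncryptsPerm (keyFrom pk t) x c := by
  refine and_congr_right fun h => ?_
  have h1 := val_of_suffix h
  have h2 : k + 1 - (t :: L).length = t := by
    rw [List.length_cons]
    omega
  rw [h2]

theorem chainInv_tail {pk : Fin (k + 1) → S.PK n} {x : Slot P k n → Option (S.M n)}
    {t : Fin (k + 1)} {L : List (Fin (k + 1))} (h : (t :: L) <:+ List.finRange (k + 1))
    {c : Slot P k n → BV (S.ctLen n)} :
    ChainInv pk x L c ↔ EncryptsPerm (restKey pk t) x c := by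
  have h1 := val_of_suffix h
  have h2 : k + 1 - L.length = t + 1 := by omega
  rw [ChainInv, h2, keyFrom_succ]
  exact and_iff_right ((List.suffix_cons t L).trans h)

theorem encryptsPerm_comp {K : S.PK n} {x : Slot P k n → Option (S.M n)}
    {c : Slot P k n → BV (S.ctLen n)} (h : EncryptsPerm K x c) (τ : Equiv.Perm (Slot P k n)) :
    EncryptsPerm K x fun s => c (τ s) := by
  obtain ⟨σ, hσ⟩ := h
  exact ⟨τ.trans σ, fun s => hσ (τ s)⟩

/-- A step of the shuffle phase preserves the invariant. -/
theorem prob_chainStep (hpar : S.PartiallyDecryptable)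
    (hrr : ∀ K a r, Close ε (S.reRandDist n K (S.enc n K a r)) (S.encDist n K a))
    (hgood : ∀ t, ∃ u, (S.gen n u).1 = restKey (fun i => (S.gen n (g i)).1) t)
    (x : Slot P k n → Option (S.M n)) (t : Fin (k + 1)) (L : List (Fin (k + 1)))
    (c : Slot P k n → BV (S.ctLen n)) (hc : ChainInv (fun i => (S.gen n (g i)).1) x (t :: L) c) :
    prob ((uniformOfFintype (ChainCoins P k n)).map
      (chainStep C (fun i => (S.gen n (g i)).1) (fun i => (S.gen n (g i)).2) t c))
      (fun o => ¬ ChainInv (fun i => (S.gen n (g i)).1) x L o.2) ≤ (k * P.bins n : ℕ) * ε := by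
  obtain ⟨hL, hc⟩ := chainInv_cons.1 hc
  simp only [chainInv_tail hL]
  by_cases ht : t = 0
  · rw [prob_map, prob_eq_zero]
    · exact bot_le
    · intro κ _
      subst ht
      rw [not_not, ← keyFrom_succ]
      simp only [chainStep, if_true]
      have : keyFrom (fun i => (S.gen n (g i)).1) ((0 : Fin (k + 1)) + 1 : ℕ) =
          keyFrom (fun i => (S.gen n (g i)).1) ((0 : Fin (k + 1)) : ℕ) := by
        unfold keyFrom
        congr 2
        ext d
        simp only [Finset.mem_filter, Finset.mem_univ, true_and, Fin.lt_def, Fin.val_zero]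
        omega
      rw [this]
      exact encryptsPerm_comp hc κ.1
  · obtain ⟨u, hu⟩ := hgood t
    rw [keyFrom_eq_mul _ ht, keyFrom_succ, ← hu] at hc
    obtain ⟨σ, hσ⟩ := hc
    rw [uniform_chainCoins, PMF.map_bind, prob_bind]
    refine expect_le fun τ _ => ?_
    rw [PMF.map_comp, prob_map]
    refine (prob_mono (B := fun r => ¬ ∀ s, decryptVec (S.gen n u).1 (S.gen n (g t)).2 c r s ∈
      Set.range (S.enc n (S.gen n u).1 (x (σ s)))) fun r _ h hall => h ?_).trans ?_
    · have := (close_decryptVec hpar hrr (g t) u hσ).prob_le fun v => ¬ ∀ s, v s ∈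
        Set.range (S.enc n (S.gen n u).1 (x (σ s)))
      rw [prob_map, prob_map] at this
      refine this.trans ?_
      rw [prob_eq_zero fun r _ h => h fun s => ⟨r s, rfl⟩, zero_add]
    · simp only [Function.comp, chainStep, if_neg ht]
      rw [← hu]
      exact encryptsPerm_comp (c := decryptVec (S.gen n u).1 (S.gen n (g t)).2 c r) ⟨σ, hall⟩ τ

/-- The action of an honest party `h ≠ 0` in the shuffle phase can be simulated. -/
theorem close_chainStep (hpar : S.PartiallyDecryptable)
    (hrr : ∀ K a r, Close ε (S.reRandDist n K (S.enc n K a r)) (S.encDist n K a))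
    (hgood : ∀ t, ∃ u, (S.gen n u).1 = restKey (fun i => (S.gen n (g i)).1) t)
    (x : Slot P k n → Option (S.M n)) {h : Fin (k + 1)} (hh : h ∉ C) (π : Equiv.Perm (Slot P k n))
    (t : Fin (k + 1)) (L : List (Fin (k + 1)))
    (c : Slot P k n → BV (S.ctLen n)) (hc : ChainInv (fun i => (S.gen n (g i)).1) x (t :: L) c) :
    Close ((k * P.bins n : ℕ) * ε)
      ((uniformOfFintype (ChainCoins P k n × (Slot P k n → BV (S.encCoins n)))).map
        (simChainStep C (fun i => (S.gen n (g i)).1) (fun i => (S.gen n (g i)).2) h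
          (fun s => x (π s)) t c))
      ((uniformOfFintype (ChainCoins P k n)).map
        (chainStep C (fun i => (S.gen n (g i)).1) (fun i => (S.gen n (g i)).2) t c)) := by
  obtain ⟨hL, hc⟩ := chainInv_cons.1 hc
  by_cases ht : t = h ∧ h ≠ 0
  · obtain ⟨rfl, ht⟩ := ht
    obtain ⟨u, hu⟩ := hgood t
    rw [keyFrom_eq_mul _ ht, keyFrom_succ, ← hu] at hc
    obtain ⟨σ, hσ⟩ := hc
    let G : (Slot P k n → BV (S.ctLen n)) →
        (ChainCoins P k n × (Slot P k n → BV (S.ctLen n))) × (Slot P k n → BV (S.ctLen n)) :=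
      fun v => (((1, fun _ => zeroBV, fun _ => zeroBV), v), v)
    -- both sides are images of a vector of encryptions in uniformly random order
    have h1 : (uniformOfFintype (ChainCoins P k n × (Slot P k n → BV (S.encCoins n)))).map
        (simChainStep C (fun i => (S.gen n (g i)).1) (fun i => (S.gen n (g i)).2) t
          (fun s => x (π s)) t c) =
        (uniformOfFintype (Equiv.Perm (Slot P k n))).bind fun τ =>
          ((uniformOfFintype (Slot P k n → BV (S.encCoins n))).map fun r s =>
            S.enc n (S.gen n u).1 (x (τ s)) (r s)).map G := by
      rw [uniform_prod, uniform_chainCoins]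
      simp only [PMF.map_bind, PMF.bind_bind, PMF.bind_map, PMF.map_comp]
      conv_rhs => rw [← uniform_map_equiv (Equiv.mulLeft π), PMF.bind_map]
      congr 1
      funext τ
      have : ∀ ρ r, simChainStep C (fun i => (S.gen n (g i)).1) (fun i => (S.gen n (g i)).2) t
          (fun s => x (π s)) t c ((τ, ρ), r) =
          G fun s => S.enc n (S.gen n u).1 (x (π (τ s))) (r s) := by
        intro ρ r
        simp only [simChainStep, ht, ne_eq, not_false_eq_true, and_self, if_true, visible, hh,
          if_false, ← hu, G]
      simp only [Function.comp_def, PMF.map_comp, this, PMF.bind_const]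
      rfl
    have h2 : (uniformOfFintype (ChainCoins P k n)).map
        (chainStep C (fun i => (S.gen n (g i)).1) (fun i => (S.gen n (g i)).2) t c) =
        (uniformOfFintype (Equiv.Perm (Slot P k n))).bind fun τ =>
          ((uniformOfFintype (Slot P k n → BV (S.parCoins n) × BV (S.reCoins n))).map
            (decryptVec (S.gen n u).1 (S.gen n (g t)).2 c)).map fun v => G fun s => v (τ s) := by
      rw [uniform_chainCoins, PMF.map_bind]
      simp only [PMF.map_comp]
      congr 1
      funext τ
      congr 1
      funext r
      simp only [Function.comp, chainStep, if_neg ht, visible, hh, if_false, ← hu]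
      rfl
    have h3 : ((uniformOfFintype (Equiv.Perm (Slot P k n))).bind fun τ =>
          ((uniformOfFintype (Slot P k n → BV (S.encCoins n))).map fun r s =>
            S.enc n (S.gen n u).1 (x (τ s)) (r s)).map G) =
        (uniformOfFintype (Equiv.Perm (Slot P k n))).bind fun τ =>
          ((uniformOfFintype (Slot P k n → BV (S.encCoins n))).map fun r s =>
            S.enc n (S.gen n u).1 (x (σ s)) (r s)).map fun v => G fun s => v (τ s) := by
      conv_lhs => rw [← uniform_map_equiv (Equiv.mulLeft σ), PMF.bind_map]
      congr 1
      funext τ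
      simp only [Function.comp, PMF.map_comp]
      conv_lhs => rw [← uniform_map_equiv (Equiv.arrowCongr τ.symm (Equiv.refl (BV (S.encCoins n)))),
        PMF.map_comp]
      rfl
    rw [h1, h2, h3]
    exact Close.bind_right fun τ _ => ((close_decryptVec hpar hrr (g t) u hσ).map _).symm
  · refine Close.of_eq ?_
    have : simChainStep C (fun i => (S.gen n (g i)).1) (fun i => (S.gen n (g i)).2) h
        (fun s => x (π s)) t c = fun κ =>
        chainStep C (fun i => (S.gen n (g i)).1) (fun i => (S.gen n (g i)).2) t c κ.1 := by
      funext κ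
      rw [simChainStep, if_neg ht]
    rw [this, uniform_prod, PMF.map_bind]
    simp only [PMF.map_comp]
    rw [← PMF.bind_pure_comp]
    congr 1
    funext κ
    exact PMF.map_const _
      (chainStep C (fun i => (S.gen n (g i)).1) (fun i => (S.gen n (g i)).2) t c κ)

/-- The simulated outputs of the shuffle phase. -/
def simVectors (pk : Fin (k + 1) → S.PK n) (sk : Fin (k + 1) → S.SK n) (h : Fin (k + 1))
    (y : Slot P k n → Option (S.M n)) (c : Slot P k n → BV (S.ctLen n))
    (r : Fin (k + 1) → ChainCoins P k n × (Slot P k n → BV (S.encCoins n))) : Vectors P k n :=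
  runF (simChainStep C pk sk h y) (List.finRange (k + 1)) c r
    fun _ => ((1, fun _ => zeroBV, fun _ => zeroBV), fun _ => zeroBV)

/-- The shuffle phase can be simulated: the honest party `h` rerandomizes and permutes, hence its
vector hides the order of the plaintexts, and `x` may be permuted by any fixed `π`. -/
theorem close_vectors (hpar : S.PartiallyDecryptable)
    (hrr : ∀ K a r, Close ε (S.reRandDist n K (S.enc n K a r)) (S.encDist n K a))
    (hgood : ∀ t, ∃ u, (S.gen n u).1 = restKey (fun i => (S.gen n (g i)).1) t)
    {x : Slot P k n → Option (S.M n)} {h : Fin (k + 1)} (hh : h ∉ C)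
    (π : Equiv.Perm (Slot P k n)) {c : Slot P k n → BV (S.ctLen n)}
    (hc : EncryptsPerm (∏ i, (S.gen n (g i)).1) x c) :
    Close ((k + 1 : ℕ) * ((k * P.bins n : ℕ) * ε + (k * P.bins n : ℕ) * ε))
      ((uniformOfFintype (Fin (k + 1) → ChainCoins P k n)).map
        (realVectors C (fun i => (S.gen n (g i)).1) (fun i => (S.gen n (g i)).2) c))
      ((uniformOfFintype
        (Fin (k + 1) → ChainCoins P k n × (Slot P k n → BV (S.encCoins n)))).map
        (simVectors C (fun i => (S.gen n (g i)).1) (fun i => (S.gen n (g i)).2) h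
          (fun s => x (π s)) c)) := by
  have hc' : ChainInv (fun i => (S.gen n (g i)).1) x (List.finRange (k + 1)) c := by
    refine ⟨List.suffix_refl _, ?_⟩
    rwa [List.length_finRange, Nat.sub_self, keyFrom_zero]
  have := close_proc (ChainInv (fun i => (S.gen n (g i)).1) x)
    (close_chainStep C hpar hrr hgood x hh π) (prob_chainStep C hpar hrr hgood x)
    (List.finRange (k + 1)) c hc' fun _ => ((1, fun _ => zeroBV, fun _ => zeroBV), fun _ => zeroBV)
  rw [List.length_finRange, ← map_runF _ _ (List.nodup_finRange _),
    ← map_runF _ _ (List.nodup_finRange _), ← uniform_pi, ← uniform_pi] at this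
  exact this.symm

/-- At the end of the shuffle phase, the leader most likely receives encryptions of the plaintexts
under its own key. -/
theorem prob_vectors (hpar : S.PartiallyDecryptable)
    (hrr : ∀ K a r, Close ε (S.reRandDist n K (S.enc n K a r)) (S.encDist n K a))
    (hgood : ∀ t, ∃ u, (S.gen n u).1 = restKey (fun i => (S.gen n (g i)).1) t)
    {x : Slot P k n → Option (S.M n)} {c : Slot P k n → BV (S.ctLen n)}
    (hc : EncryptsPerm (∏ i, (S.gen n (g i)).1) x c) :
    prob ((uniformOfFintype (Fin (k + 1) → ChainCoins P k n)).map
        (realVectors C (fun i => (S.gen n (g i)).1) (fun i => (S.gen n (g i)).2) c))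
      (fun CH => ¬ EncryptsPerm (S.gen n (g 0)).1 x (CH (Fin.last k)).2) ≤
      (k + 1 : ℕ) * ((k * P.bins n : ℕ) * ε) := by
  have hc' : ChainInv (fun i => (S.gen n (g i)).1) x (List.finRange (k + 1)) c := by
    refine ⟨List.suffix_refl _, ?_⟩
    rwa [List.length_finRange, Nat.sub_self, keyFrom_zero]
  have hlast := List.finRange_succ_last (n := k)
  have := prob_proc (st := chainStep C (fun i => (S.gen n (g i)).1) (fun i => (S.gen n (g i)).2))
    (ChainInv (fun i => (S.gen n (g i)).1) x) Prod.snd (fun _ _ _ => rfl)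
    (prob_chainStep C hpar hrr hgood x) ((List.finRange k).map Fin.castSucc) (Fin.last k)
    (hlast ▸ List.nodup_finRange _) c (hlast ▸ hc')
    fun _ => ((1, fun _ => zeroBV, fun _ => zeroBV), fun _ => zeroBV)
  rw [← hlast, List.length_finRange, ← map_runF _ _ (List.nodup_finRange _), ← uniform_pi] at this
  refine (prob_mono (B := fun CH : Vectors P k n =>
    ¬ ChainInv (fun i => (S.gen n (g i)).1) x [] (CH (Fin.last k)).2)
    fun CH _ h h' => h ?_).trans this
  have h2 := h'.2
  rwa [List.length_nil, Nat.sub_zero, keyFrom_last] at h2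

end Chain

/-! ### The plaintexts of the shuffle phase -/

section Listing

/-- The map `y` hits each element of `D` exactly once, and otherwise takes the value `none`. -/
def Enumerates {ι M : Type} (y : ι → Option M) (D : Finset M) : Prop :=
  (∀ s a, y s = some a → a ∈ D) ∧ ∀ a ∈ D, ∃! s, y s = some a

/-- Two listings of a set differ by a permutation. Hence the leader's vector of plaintexts is
determined by the union, up to the order, which the shuffle of an honest party hides. -/
theorem Enumerates.exists_perm {ι M : Type} [Fintype ι] [DecidableEq ι] {x y : ι → Option M}
    {D : Finset M} (hx : Enumerates x D) (hy : Enumerates y D) :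
    ∃ π : Equiv.Perm ι, ∀ s, y s = x (π s) := by
  have key : ∀ {z : ι → Option M}, Enumerates z D →
      ∃ e : {s // (z s).isSome} ≃ D, ∀ s, z s.1 = some (e s).1 := by
    intro z hz
    let f : {s // (z s).isSome} → D := fun s => ⟨(z s.1).get s.2, hz.1 s.1 _ (by simp)⟩
    have hf : ∀ s, z s.1 = some (f s).1 := fun s => by simp [f]
    have hbij : Function.Bijective f := by
      constructor
      · intro s t hst
        obtain ⟨_, _, huniq⟩ := hz.2 (f s).1 (f s).2
        exact Subtype.ext ((huniq s.1 (hf s)).trans (huniq t.1 (hst ▸ hf t)).symm)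
      · intro a
        obtain ⟨s, hs, _⟩ := hz.2 a.1 a.2
        refine ⟨⟨s, by simp [hs]⟩, Subtype.ext (Option.some_injective _ ?_)⟩
        rw [← hf, hs]
    exact ⟨Equiv.ofBijective f hbij, hf⟩
  obtain ⟨e, he⟩ := key hx
  obtain ⟨e', he'⟩ := key hy
  refine ⟨(e'.trans e.symm).extendSubtype, fun s => ?_⟩
  by_cases hs : (y s).isSome
  · have := Equiv.extendSubtype_apply_of_mem (p := fun s => (y s).isSome = true) (e'.trans e.symm)
      s hs
    rw [this, he' ⟨s, hs⟩, he]
    simp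
  · have := Equiv.extendSubtype_not_mem (e'.trans e.symm) s hs
    rw [Option.not_isSome_iff_eq_none] at hs this
    rw [hs, this]

end Listing

section Plaintexts

variable {S : MKRScheme} {n k : ℕ} {P : HashParams S} (I : Inputs P k n)

/-- The query in a bin belongs to the set of party `i` if the element does. -/
theorem member_iff {j : Fin (k + 1)} (hj : j ≠ 0) (b : Fin (P.bins n)) (i : Fin (k + 1)) :
    member P I.seed I.X j b i = true ↔ ∃ a ∈ I.X i, plainElem P I.seed I.X j b = some a := by
  unfold member plainElem simpleTable
  simp only [decide_eq_true_eq, Finset.mem_image, Finset.mem_filter, Finset.mem_product,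
    Finset.mem_univ, and_true, Option.map_eq_some_iff]
  constructor
  · rintro ⟨⟨a, q⟩, ⟨ha, _⟩, h⟩
    exact ⟨a, ha, (a, q), h.symm, rfl⟩
  · rintro ⟨a, ha, ⟨a', q⟩, h, rfl⟩
    exact ⟨(a', q), ⟨ha, ((I.isCuckooTable j hj).1 b a' q h).2⟩, h.symm⟩

theorem plainElem_mem {j : Fin (k + 1)} (hj : j ≠ 0) {b : Fin (P.bins n)} {a : S.M n}
    (h : plainElem P I.seed I.X j b = some a) : a ∈ I.X j := by
  obtain ⟨⟨a', q⟩, h', rfl⟩ := Option.map_eq_some_iff.1 h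
  exact ((I.isCuckooTable j hj).1 b a' q h').1

theorem finalMsg_eq_some {s : Slot P k n} {a : S.M n} : finalMsg I.seed I.X s = some a ↔
    plainElem P I.seed I.X s.1.succ s.2 = some a ∧ ∀ i < s.1.succ, a ∉ I.X i := by
  unfold finalMsg
  simp only [member_iff I (Fin.succ_ne_zero s.1)]
  split_ifs with h
  · obtain ⟨i, hi, a', ha', hp⟩ := h
    simp only [hp, Option.some.injEq, false_iff, not_and]
    rintro rfl h
    exact h i hi ha'
  · push Not at h
    exact ⟨fun hp => ⟨hp, fun i hi ha => h i hi a ha hp⟩, fun hp => hp.1⟩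

/-- The plaintexts in the leader's vector are the elements of the union outside of the leader's
set, each of them once. -/
theorem enumerates_finalMsg :
    Enumerates (finalMsg I.seed I.X) (funcMPSU I.X \ I.X 0) := by
  constructor
  · intro s a h
    obtain ⟨h1, h2⟩ := (finalMsg_eq_some I).1 h
    rw [Finset.mem_sdiff, funcMPSU, Finset.mem_biUnion]
    exact ⟨⟨s.1.succ, Finset.mem_univ _, plainElem_mem I (Fin.succ_ne_zero _) h1⟩,
      h2 0 (Fin.succ_pos _)⟩
  · intro a ha
    rw [Finset.mem_sdiff, funcMPSU, Finset.mem_biUnion] at ha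
    obtain ⟨⟨i₀, _, hi₀⟩, h0⟩ := ha
    -- the first party whose set contains the element
    have hex : ∃ i, a ∈ I.X i := ⟨i₀, hi₀⟩
    obtain ⟨i, hi, hmin⟩ : ∃ i, a ∈ I.X i ∧ ∀ i' < i, a ∉ I.X i' := by
      let A := Finset.univ.filter fun i => a ∈ I.X i
      have hA : A.Nonempty := ⟨i₀, by simp [A, hi₀]⟩
      refine ⟨A.min' hA, (Finset.mem_filter.1 (A.min'_mem hA)).2, fun i' hi' h => ?_⟩
      exact not_le.2 hi' (A.min'_le i' (by simp [A, h]))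
    obtain ⟨j, rfl⟩ := Fin.exists_succ_eq.2 (show i ≠ 0 from fun h => h0 (h ▸ hi))
    obtain ⟨b, ⟨q, hb⟩, huniq⟩ := (I.isCuckooTable j.succ (Fin.succ_ne_zero j)).2 a hi
    refine ⟨(j, b), (finalMsg_eq_some I).2 ⟨by simp [plainElem, hb], hmin⟩, ?_⟩
    rintro ⟨j', b'⟩ h
    obtain ⟨h1, h2⟩ := (finalMsg_eq_some I).1 h
    have hj : j' = j := by
      have h3 := plainElem_mem I (Fin.succ_ne_zero _) h1
      rcases lt_trichotomy j'.succ j.succ with hlt | heq | hlt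
      · exact absurd h3 (hmin _ hlt)
      · exact Fin.succ_injective _ heq
      · exact absurd hi (h2 _ hlt)
    subst hj
    obtain ⟨⟨a', q'⟩, h4, rfl⟩ := Option.map_eq_some_iff.1 h1
    rw [huniq b' ⟨q', h4⟩]

/-- The leader's output, if it decrypts the vector of plaintexts in some order. -/
theorem output_eq {v : Slot P k n → Option (S.M n)} (σ : Equiv.Perm (Slot P k n))
    (hv : ∀ s, v s = finalMsg I.seed I.X (σ s)) :
    I.X 0 ∪ Finset.univ.biUnion (fun s => (v s).toFinset) = funcMPSU I.X := by
  ext a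
  obtain ⟨h1, h2⟩ := enumerates_finalMsg I
  simp only [Finset.mem_union, Finset.mem_biUnion, Finset.mem_univ, true_and, Option.mem_toFinset,
    Option.mem_def, hv]
  constructor
  · rintro (h | ⟨s, h⟩)
    · exact Finset.mem_biUnion.2 ⟨0, Finset.mem_univ _, h⟩
    · exact (Finset.mem_sdiff.1 (h1 _ a h)).1
  · intro h
    by_cases h0 : a ∈ I.X 0
    · exact Or.inl h0
    · obtain ⟨s, hs, _⟩ := h2 a (Finset.mem_sdiff.2 ⟨h, h0⟩)
      exact Or.inr ⟨σ.symm s, by simpa using hs⟩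

end Plaintexts

/-! ### From the protocol to the simulation, for fixed keys -/

section Games

variable {S : MKRScheme} {n k : ℕ} {P : HashParams S} (C : Finset (Fin (k + 1)))

/-- The code of the views of the corrupted parties. -/
def viewsOut (X : Fin (k + 1) → Finset (S.M n)) (g : Fin (k + 1) → BV (S.genCoins n))
    (pk : Fin (k + 1) → S.PK n) (TR : Records P k n) (CH : Vectors P k n) : viewsT.den :=
  codeVec (codeOpt codeView) fun i =>
    if i ∈ C then some (mkView (X i) (g i) pk TR CH i) else none

/-- The coins of the simulation for its records and vectors. -/
abbrev SimCoins (P : HashParams S) (k n : ℕ) : Type :=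
  (Fin (k + 1) → Fin (P.bins n) → BinCoins S k n) ×
    (Fin (k + 1) → ChainCoins P k n × (Slot P k n → BV (S.encCoins n)))

set_option synthInstance.maxSize 10000 in
instance : Fintype (SimCoins P k n) := inferInstance

/-- The simulated views, if `h` is an honest party, from given keys, and from given ciphertexts `F`
in place of those of the honest parties. -/
def simViews (seed : BV (P.seedLen n)) (X : Fin (k + 1) → Finset (S.M n)) (h : Fin (k + 1))
    (y : Slot P k n → Option (S.M n)) (g : Fin (k + 1) → BV (S.genCoins n))
    (pk : Fin (k + 1) → S.PK n)
    (F : Fin (k + 1) → Fin (P.bins n) → Fin (k + 1) → BV (S.ctLen n)) (r : SimCoins P k n) :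
    viewsT.den :=
  let TR := simRecords C (∏ i, pk i) seed X F r.1
  viewsOut C X g pk TR (simVectors C pk (fun i => (S.gen n (g i)).2) h y (leaderOf TR) r.2)

/-- The coins of the encryptions that replace the ciphertexts of the honest parties. -/
abbrev EncTable (P : HashParams S) (k n : ℕ) : Type :=
  Fin (k + 1) → Fin (P.bins n) → Fin (k + 1) → BV (S.encCoins n)

/-- The real execution with given coins for the keys. -/
noncomputable def realGiven (I : Inputs P k n) (g : Fin (k + 1) → BV (S.genCoins n)) :
    PMF jointT.den :=
  let pk := fun i => (S.gen n (g i)).1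
  ((uniformOfFintype (Fin (k + 1) → Fin (P.bins n) → BinCoins S k n)).map
    (realRecords C (∏ i, pk i) I.seed I.X)).bind fun TR =>
  ((uniformOfFintype (Fin (k + 1) → ChainCoins P k n)).map
    (realVectors C pk (fun i => (S.gen n (g i)).2) (leaderOf TR))).map fun CH =>
  (viewsOut C I.X g pk TR CH, codeOutput S n (0 ∉ C) (I.X 0 ∪ Finset.univ.biUnion fun s =>
    (S.dec n (S.gen n (g 0)).2 ((CH (Fin.last k)).2 s)).toFinset))

/-- The real experiment draws the coins for the keys first. -/
theorem realDist_eq (I : Inputs P k n) : realDist P k C n I =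
    (uniformOfFintype (Fin (k + 1) → BV (S.genCoins n))).bind (realGiven C I) := by
  have h : realDist P k C n I = (uniformOfFintype (Coins P k n)).map fun r =>
      let pk := fun i => (S.gen n (r.1 i)).1
      let TR := realRecords C (∏ i, pk i) I.seed I.X r.2.1
      let CH := realVectors C pk (fun i => (S.gen n (r.1 i)).2) (leaderOf TR) r.2.2
      (viewsOut C I.X r.1 pk TR CH, codeOutput S n (0 ∉ C) (I.X 0 ∪ Finset.univ.biUnion fun s =>
        (S.dec n (S.gen n (r.1 0)).2 ((CH (Fin.last k)).2 s)).toFinset)) := by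
    rw [← uniform_map_equiv (coinsEquiv (P := P) (k := k) (n := n)), PMF.map_comp]
    unfold realDist
    congr 1
    funext ω
    let E : Exec P k n := ⟨I.seed, I.X, ω.1, ω.2⟩
    have h1 := exec_leader (C := C) E
    have h2 := fun i (hi : i ∈ C) => exec_view E hi
    have h3 := exec_output (C := C) E
    have hout : E.output = _ := h3
    rw [← h1] at h3
    simp only [← h1] at h2
    refine Prod.ext ?_ ?_
    · show codeVec (codeOpt codeView) _ = codeVec (codeOpt codeView) _
      congr 1
      funext i
      by_cases hi : i ∈ C
      · rw [if_pos hi, if_pos hi]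
        exact congrArg some (h2 i hi)
      · rw [if_neg hi, if_neg hi]
    · exact congrArg (codeOutput S n (0 ∉ C)) h3
  rw [h, uniform_prod, PMF.map_bind]
  congr 1
  funext g
  rw [PMF.map_comp, uniform_prod, PMF.map_bind, realGiven, PMF.bind_map]
  congr 1
  funext r
  simp only [Function.comp, PMF.map_comp]
  rfl

/-- The simulation with given coins for the keys, where the ciphertexts of the honest parties are
replaced by encryptions of the same plaintexts; together with the output of the functionality. -/
noncomputable def simGiven (I : Inputs P k n) (h : Fin (k + 1)) (y : Slot P k n → Option (S.M n))
    (g : Fin (k + 1) → BV (S.genCoins n)) : PMF jointT.den :=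
  let pk := fun i => (S.gen n (g i)).1
  (uniformOfFintype (SimCoins P k n × EncTable P k n)).map fun r =>
    (simViews C I.seed I.X h y g pk (fun j b i => S.enc n (∏ i, pk i)
      (trackedMsg I.seed I.X j b i) (r.2 j b i)) r.1, codeOutput S n (0 ∉ C) (funcMPSU I.X))

variable {C} {ε : ℝ≥0∞}

/-- If the last vector consists of encryptions under the leader's key, its output is the union. -/
theorem decrypt_output (hcorrect : S.Correct) (I : Inputs P k n) {r : BV (S.genCoins n)}
    {c : Slot P k n → BV (S.ctLen n)}
    (hc : EncryptsPerm (S.gen n r).1 (finalMsg I.seed I.X) c) :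
    (I.X 0 ∪ Finset.univ.biUnion fun s => (S.dec n (S.gen n r).2 (c s)).toFinset) =
      funcMPSU I.X := by
  obtain ⟨σ, hσ⟩ := hc
  refine output_eq I σ fun s => ?_
  obtain ⟨r', hr'⟩ := hσ s
  rw [← hr', hcorrect]

/-- The execution and the simulation are close if the products of public keys that occur in the
shuffle phase are possible public keys. The honest party `h` sends encryptions of a listing `y` of
the plaintexts, unless it is the leader. -/
theorem close_given (hcorrect : S.Correct) (hpar : S.PartiallyDecryptable)
    (hrr : ∀ K a r, Close ε (S.reRandDist n K (S.enc n K a r)) (S.encDist n K a))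
    (I : Inputs P k n) {h : Fin (k + 1)} (hh : h ∉ C) {y : Slot P k n → Option (S.M n)}
    (hy : h ≠ 0 → Enumerates y (funcMPSU I.X \ I.X 0)) {g : Fin (k + 1) → BV (S.genCoins n)}
    (hgood : ∀ t, ∃ u, (S.gen n u).1 = restKey (fun i => (S.gen n (g i)).1) t) :
    Close ((k + 1 : ℕ) * (P.bins n * ((k + 1 : ℕ) * (3 * ε))) +
        ((k + 1 : ℕ) * ((k * P.bins n : ℕ) * ε) +
          (k + 1 : ℕ) * ((k * P.bins n : ℕ) * ε + (k * P.bins n : ℕ) * ε)) +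
        (k + 1 : ℕ) * (P.bins n * ((k + 1 : ℕ) * (3 * ε))))
      (realGiven C I g) (simGiven C I h y g) := by
  set pk := fun i => (S.gen n (g i)).1 with hpk
  -- the vector `y` may be replaced by a permutation of the plaintexts
  obtain ⟨π, hπ⟩ : ∃ π : Equiv.Perm (Slot P k n), ∀ pk sk c r,
      simVectors C pk sk h y c r =
        simVectors C pk sk h (fun s => finalMsg I.seed I.X (π s)) c r := by
    by_cases h0 : h = 0
    · refine ⟨1, fun pk sk c r => ?_⟩
      have : ∀ y : Slot P k n → Option (S.M n), simChainStep C pk sk h y =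
          fun t c κ => chainStep C pk sk t c κ.1 := by
        intro y
        funext t c κ
        simp [simChainStep, h0]
      unfold simVectors
      rw [this, this]
    · obtain ⟨π, hπ⟩ := (enumerates_finalMsg I).exists_perm (hy h0)
      exact ⟨π, fun pk sk c r => by rw [funext hπ]⟩
  have hsim : simGiven C I h y g =
      ((uniformOfFintype (Fin (k + 1) → Fin (P.bins n) → SimBinCoins S k n)).map fun r =>
        simRecords C (∏ i, pk i) I.seed I.X
          (fun j b i => S.enc n (∏ i, pk i) (trackedMsg I.seed I.X j b i) ((r j b).2 i))
          fun j b => (r j b).1).bind fun TR =>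
      ((uniformOfFintype
        (Fin (k + 1) → ChainCoins P k n × (Slot P k n → BV (S.encCoins n)))).map
        (simVectors C pk (fun i => (S.gen n (g i)).2) h
          (fun s => finalMsg I.seed I.X (π s)) (leaderOf TR))).map fun CH =>
      (viewsOut C I.X g pk TR CH, codeOutput S n (0 ∉ C) (funcMPSU I.X)) := by
    let e : SimCoins P k n × EncTable P k n ≃
        (Fin (k + 1) → Fin (P.bins n) → SimBinCoins S k n) ×
          (Fin (k + 1) → ChainCoins P k n × (Slot P k n → BV (S.encCoins n))) :=
      { toFun := fun r => (fun j b => (r.1.1 j b, r.2 j b), r.1.2)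
        invFun := fun r => ((fun j b => (r.1 j b).1, r.2), fun j b => (r.1 j b).2)
        left_inv := fun _ => rfl
        right_inv := fun _ => rfl }
    have h2 := congrArg (PMF.map fun r => (let TR := (simRecords C (∏ i, pk i) I.seed I.X
          (fun j b i => S.enc n (∏ i, pk i) (trackedMsg I.seed I.X j b i) ((r.1 j b).2 i))
          (fun j b => (r.1 j b).1))
        (viewsOut C I.X g pk TR (simVectors C pk (fun i => (S.gen n (g i)).2) h
          (fun s => finalMsg I.seed I.X (π s)) (leaderOf TR) r.2),
          codeOutput S n (0 ∉ C) (funcMPSU I.X)))) (uniform_map_equiv e)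
    rw [PMF.map_comp] at h2
    refine Eq.trans ?_ (h2.trans ?_)
    · refine congrArg (fun f => PMF.map f _) (funext fun r => ?_)
      simp only [simViews, hπ]
      rfl
    · rw [uniform_prod, PMF.map_bind, PMF.bind_map]
      simp only [PMF.map_comp]
      rfl
  rw [hsim, realGiven]
  refine Close.trans ?_ ((close_records C I.seed I.X (hrr _)).bind_left _)
  refine Close.bind_bad _ (prob_records C I.seed I.X (hrr _)) fun TR _ hTR => ?_
  have hTR' : EncryptsPerm (∏ i, pk i) (finalMsg I.seed I.X) (leaderOf TR) :=
    ⟨1, fun s => not_not.1 fun h => hTR ⟨s, h⟩⟩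
  refine Close.trans (Close.of_bad _ (prob_vectors C hpar hrr hgood hTR') fun CH _ hCH => ?_)
    ((close_vectors C hpar hrr hgood hh π hTR').map _)
  rw [decrypt_output hcorrect I (not_not.1 hCH)]

end Games

/-! ### The keys -/

section Keys

variable {S : MKRScheme} {n k : ℕ} {P : HashParams S} (C : Finset (Fin (k + 1)))

/-- The distribution of a public key. -/
noncomputable def genPKDist (S : MKRScheme) (n : ℕ) : PMF (S.PK n) :=
  (uniformOfFintype (BV (S.genCoins n))).map fun u => (S.gen n u).1

/-- The homomorphism that maps secret keys to public keys, with the group of secret keys written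
multiplicatively. -/
theorem exists_monoidHom (hkeys : S.KeyHomomorphic) (n : ℕ) :
    ∃ f : Multiplicative (S.SK n) →* S.PK n,
      ∀ r, (S.gen n r).1 = f (Multiplicative.ofAdd (S.gen n r).2) := by
  obtain ⟨⟨f, hf, hg⟩, _⟩ := hkeys
  exact ⟨MonoidHom.mk' (fun s => f n s.toAdd) fun s s' => hf n _ _, fun r => hg n r⟩

variable {ε : ℝ≥0∞}

/-- Shifting a public key by a public key with a known secret key hardly changes its
distribution. -/
theorem close_genPK_mul {f : Multiplicative (S.SK n) →* S.PK n}
    (hf : ∀ r, (S.gen n r).1 = f (Multiplicative.ofAdd (S.gen n r).2))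
    (hsk : Close ε (S.genSKDist n) (uniformOfFintype (S.SK n))) (s : Multiplicative (S.SK n)) :
    Close (ε + ε) (genPKDist S n) ((genPKDist S n).map fun K => K * f s) := by
  have h1 : genPKDist S n = (S.genSKDist n).map fun t => f (Multiplicative.ofAdd t) := by
    rw [MKRScheme.genSKDist, PMF.map_comp]
    unfold genPKDist
    congr 1
    funext r
    exact hf r
  have h2 : (genPKDist S n).map (fun K => K * f s) =
      ((S.genSKDist n).map fun t => t + s.toAdd).map fun t => f (Multiplicative.ofAdd t) := by
    rw [h1, PMF.map_comp, PMF.map_comp]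
    congr 1
    funext t
    simp only [Function.comp]
    rw [← map_mul]
    rfl
  rw [h2, h1]
  refine Close.map (hsk.trans ?_) _
  have h3 := (hsk.map fun t => t + s.toAdd).symm
  have h4 := uniform_map_equiv (Equiv.addRight s.toAdd)
  rwa [show (fun t => t + s.toAdd) = ⇑(Equiv.addRight s.toAdd) from rfl, h4] at h3

/-- Most likely, the products of public keys that occur in the shuffle phase are themselves possible
public keys. -/
theorem prob_bad_keys (hkeys : S.KeyHomomorphic)
    (hsk : Close ε (S.genSKDist n) (uniformOfFintype (S.SK n))) :
    prob (uniformOfFintype (Fin (k + 1) → BV (S.genCoins n)))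
      (fun g => ¬ ∀ t, ∃ u, (S.gen n u).1 = restKey (fun i => (S.gen n (g i)).1) t) ≤
      (k + 1 : ℕ) * (ε + ε) := by
  obtain ⟨f, hf⟩ := exists_monoidHom hkeys n
  simp only [not_forall]
  refine (prob_exists_le _ _).trans ?_
  have h : ∀ t : Fin (k + 1), prob (uniformOfFintype (Fin (k + 1) → BV (S.genCoins n)))
      (fun g => ¬ ∃ u, (S.gen n u).1 = restKey (fun i => (S.gen n (g i)).1) t) ≤ ε + ε := by
    intro t
    rw [uniform_pi, piFin_resample _ 0, map_bind_comm, prob_bind]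
    refine expect_le fun g _ => ?_
    let s : Multiplicative (S.SK n) := ∏ d ∈ Finset.univ.filter (fun d => t < d),
      Multiplicative.ofAdd (S.gen n (g d)).2
    have h1 : ∀ a, restKey (fun i => (S.gen n (Function.update g 0 a i)).1) t =
        (S.gen n a).1 * f s := by
      intro a
      simp only [restKey, s, map_prod, ← hf, Function.update_self]
      congr 1
      refine Finset.prod_congr rfl fun d hd => ?_
      have hd' : d ≠ 0 := by
        rintro rfl
        simp at hd
      rw [Function.update_of_ne hd']
    rw [prob_map]
    simp only [h1]
    have h2 := (close_genPK_mul hf hsk s).symm.prob_le fun K => ¬ ∃ u, (S.gen n u).1 = K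
    rw [genPKDist, prob_map, prob_map, prob_map] at h2
    refine h2.trans ?_
    rw [prob_eq_zero fun u _ h => h ⟨u, rfl⟩, zero_add]
  refine (Finset.sum_le_sum fun t _ => h t).trans (le_of_eq ?_)
  simp only [Finset.sum_const, Finset.card_univ, Fintype.card_fin, nsmul_eq_mul]

variable {C}

/-- The simulated views do not depend on the secret key of the honest party. -/
theorem simViews_congr {h : Fin (k + 1)} (hh : h ∉ C) {g g' : Fin (k + 1) → BV (S.genCoins n)}
    (hg : ∀ i ≠ h, g i = g' i) (seed : BV (P.seedLen n)) (X : Fin (k + 1) → Finset (S.M n))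
    (y : Slot P k n → Option (S.M n)) (pk : Fin (k + 1) → S.PK n)
    (F : Fin (k + 1) → Fin (P.bins n) → Fin (k + 1) → BV (S.ctLen n)) (r : SimCoins P k n) :
    simViews C seed X h y g pk F r = simViews C seed X h y g' pk F r := by
  have h1 : simChainStep (P := P) C pk (fun i => (S.gen n (g i)).2) h y =
      simChainStep C pk (fun i => (S.gen n (g' i)).2) h y := by
    funext t c κ
    unfold simChainStep chainStep
    by_cases ht : t = h
    · by_cases h0 : h = 0 <;> simp [ht, h0]
    · simp [ht, hg t ht]
  unfold simViews simVectors viewsOut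
  rw [h1]
  refine congrArg (codeVec (codeOpt codeView)) (funext fun i => ?_)
  by_cases hi : i ∈ C
  · rw [if_pos hi, if_pos hi, hg i fun h' => hh (h' ▸ hi)]
  · rw [if_neg hi, if_neg hi]

/-- The public keys, if the key of party `h` is chosen such that the joint key is `K`. -/
def programKeys (g : Fin (k + 1) → BV (S.genCoins n)) (h : Fin (k + 1)) (K : S.PK n) :
    Fin (k + 1) → S.PK n :=
  Function.update (fun i => (S.gen n (g i)).1) h
    (K * ∏ i ∈ Finset.univ.erase h, ((S.gen n (g i)).1)⁻¹)

theorem prod_update_eq (pk : Fin (k + 1) → S.PK n) (h : Fin (k + 1)) (K : S.PK n) :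
    ∏ i, Function.update pk h K i = K * ∏ i ∈ Finset.univ.erase h, pk i := by
  rw [← Finset.mul_prod_erase _ _ (Finset.mem_univ h), Function.update_self]
  congr 1
  exact Finset.prod_congr rfl fun i hi => by
    rw [Function.update_of_ne (Finset.ne_of_mem_erase hi)]

theorem prod_programKeys (g : Fin (k + 1) → BV (S.genCoins n)) (h : Fin (k + 1)) (K : S.PK n) :
    ∏ i, programKeys g h K i = K := by
  unfold programKeys
  rw [prod_update_eq, mul_assoc, ← Finset.prod_mul_distrib]
  simp

/-- The simulation from a joint key and encryptions under it. -/
noncomputable def simFrom (C : Finset (Fin (k + 1))) (I : Inputs P k n) (h : Fin (k + 1))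
    (y : Slot P k n → Option (S.M n)) (K : S.PK n)
    (F : Fin (k + 1) → Fin (P.bins n) → Fin (k + 1) → BV (S.ctLen n)) : PMF viewsT.den :=
  (uniformOfFintype ((Fin (k + 1) → BV (S.genCoins n)) × SimCoins P k n)).map fun r =>
    simViews C I.seed I.X h y r.1 (programKeys r.1 h K) F r.2

/-- In the simulation, the joint key may be drawn before the keys of the parties. -/
theorem close_programKeys (hkeys : S.KeyHomomorphic)
    (hsk : Close ε (S.genSKDist n) (uniformOfFintype (S.SK n)))
    (I : Inputs P k n) {h : Fin (k + 1)} (hh : h ∉ C) (y : Slot P k n → Option (S.M n)) :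
    Close (ε + ε) ((uniformOfFintype (Fin (k + 1) → BV (S.genCoins n))).bind (simGiven C I h y))
      ((uniformOfFintype (BV (S.genCoins n) × EncTable P k n)).bind fun r =>
        (simFrom C I h y (S.gen n r.1).1 fun j b i =>
          S.enc n (S.gen n r.1).1 (trackedMsg I.seed I.X j b i) (r.2 j b i)).map fun V =>
        (V, codeOutput S n (0 ∉ C) (funcMPSU I.X))) := by
  obtain ⟨f, hf⟩ := exists_monoidHom hkeys n
  -- the simulation from all coins for the keys and all public keys
  let Ψ : (Fin (k + 1) → BV (S.genCoins n)) → (Fin (k + 1) → S.PK n) → PMF jointT.den :=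
    fun g pk => (uniformOfFintype (SimCoins P k n × EncTable P k n)).map fun r =>
      (simViews C I.seed I.X h y g pk (fun j b i => S.enc n (∏ i, pk i)
        (trackedMsg I.seed I.X j b i) (r.2 j b i)) r.1, codeOutput S n (0 ∉ C) (funcMPSU I.X))
  have hreal : (uniformOfFintype (Fin (k + 1) → BV (S.genCoins n))).bind (simGiven C I h y) =
      (uniformOfFintype (Fin (k + 1) → BV (S.genCoins n))).bind fun g =>
        (genPKDist S n).bind fun K => Ψ g (Function.update (fun i => (S.gen n (g i)).1) h K) := by
    conv_lhs => rw [uniform_pi, piFin_resample _ h, map_bind_comm, ← uniform_pi, PMF.bind_bind]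
    congr 1
    funext g
    rw [PMF.bind_map, genPKDist, PMF.bind_map]
    congr 1
    funext a
    have h1 : (fun i => (S.gen n (Function.update g h a i)).1) =
        Function.update (fun i => (S.gen n (g i)).1) h (S.gen n a).1 := by
      funext i
      by_cases hi : i = h
      · subst hi
        simp
      · simp [hi]
    simp only [Function.comp, simGiven, Ψ, h1]
    congr 1
    funext r
    rw [simViews_congr hh fun i hi => Function.update_of_ne hi a g]
  have hsim : ((uniformOfFintype (BV (S.genCoins n) × EncTable P k n)).bind fun r =>
        (simFrom C I h y (S.gen n r.1).1 fun j b i =>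
          S.enc n (S.gen n r.1).1 (trackedMsg I.seed I.X j b i) (r.2 j b i)).map fun V =>
        (V, codeOutput S n (0 ∉ C) (funcMPSU I.X))) =
      (uniformOfFintype (Fin (k + 1) → BV (S.genCoins n))).bind fun g =>
        (genPKDist S n).bind fun K => Ψ g (programKeys g h K) := by
    have hp1 : uniformOfFintype (BV (S.genCoins n) × EncTable P k n) = _ := uniform_prod
    have hp2 : uniformOfFintype ((Fin (k + 1) → BV (S.genCoins n)) × SimCoins P k n) = _ :=
      uniform_prod
    have hp3 : uniformOfFintype (SimCoins P k n × EncTable P k n) = _ := uniform_prod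
    simp only [hp1, hp2, hp3, simFrom, Ψ, genPKDist, PMF.bind_bind, PMF.bind_map, PMF.map_bind,
      PMF.map_comp, Function.comp_def, prod_programKeys]
    conv_rhs => rw [PMF.bind_comm]
    refine congrArg _ (funext fun u => ?_)
    rw [PMF.bind_comm]
    refine congrArg _ (funext fun g => ?_)
    rw [map_bind_comm]
  rw [hreal, hsim]
  refine Close.bind_right fun g _ => ?_
  have h1 := close_genPK_mul hf hsk (∏ i ∈ Finset.univ.erase h,
    (Multiplicative.ofAdd (S.gen n (g i)).2)⁻¹)
  have h2 := h1.bind_left fun K => Ψ g (Function.update (fun i => (S.gen n (g i)).1) h K)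
  rw [PMF.bind_map] at h2
  simpa only [map_prod, map_inv, ← hf, programKeys, Function.comp_def] using h2

end Keys

/-! ### The simulator: algorithms of the scheme and single exchanges -/

section SchemeRules

variable {e : Ty} {Γ : Type} {cΓ : Γ → e.den} {N : Γ → ℕ}

/-- An algorithm of the scheme, applied to computed arguments. -/
theorem PolyTimeFun.computes {α β : ℕ → Type} {a b : Ty} {cα : ∀ n, α n → a.den}
    {cβ : ∀ n, β n → b.den} {f : ∀ n, α n → β n} (h : PolyTimeFun cα cβ f)
    (hN : Computes cΓ fun γ => unary (N γ)) {x : ∀ γ, α (N γ)}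
    (hx : Computes cΓ fun γ => cα (N γ) (x γ)) :
    Computes cΓ fun γ => cβ (N γ) (f (N γ) (x γ)) := by
  obtain ⟨t, ht, hrun⟩ := h
  have h1 : Computes (e := .prod unaryT a) (fun y : Σ n, α n => (unary y.1, cα y.1 y.2))
      fun y => cβ y.1 (f y.1 y.2) := ⟨t, ht, fun y => hrun y.1 y.2⟩
  exact h1.subst (g := fun γ => ⟨N γ, x γ⟩) (hN.pair hx)

theorem PolyLength.computes {f : ℕ → ℕ} (h : PolyLength f)
    (hN : Computes cΓ fun γ => unary (N γ)) : Computes cΓ fun γ => unary (f (N γ)) := by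
  obtain ⟨t, ht, hrun⟩ := h
  have h1 : Computes (e := unaryT) unary fun n => unary (f n) := ⟨t, ht, hrun⟩
  exact h1.subst hN

theorem Computes.zeroBV {L : Γ → ℕ} (hL : Computes cΓ fun γ => unary (L γ)) :
    Computes cΓ fun γ => codeBV (PKMPSU.zeroBV : BV (L γ)) :=
  Computes.tab (a := .bool) (v := fun γ (_ : Fin (L γ)) => false) hL (Computes.lit false)

theorem Computes.xor {L : Γ → ℕ} (hL : Computes cΓ fun γ => unary (L γ)) {u v : ∀ γ, BV (L γ)}
    (hu : Computes cΓ fun γ => codeBV (u γ)) (hv : Computes cΓ fun γ => codeBV (v γ)) :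
    Computes cΓ fun γ => codeBV (BV.xor (u γ) (v γ)) := by
  refine Computes.tab (a := .bool) (v := fun γ => BV.xor (u γ) (v γ)) hL ?_
  have h1 : Computes (e := .prod e unaryT) (b := .bool)
      (fun x : Σ γ, Fin (L γ) => (cΓ x.1, codeFin x.2)) fun x => u x.1 x.2 :=
    Computes.lookup (Γ := Σ γ, Fin (L γ)) (a := .bool) (α := fun _ => Bool) (cα := fun _ y => y)
      (L := fun x => L x.1) (v := fun x => u x.1) (i := fun x => x.2) hu.weaken Computes.var
  have h2 : Computes (e := .prod e unaryT) (b := .bool)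
      (fun x : Σ γ, Fin (L γ) => (cΓ x.1, codeFin x.2)) fun x => v x.1 x.2 :=
    Computes.lookup (Γ := Σ γ, Fin (L γ)) (a := .bool) (α := fun _ => Bool) (cα := fun _ y => y)
      (L := fun x => L x.1) (v := fun x => v x.1) (i := fun x => x.2) hv.weaken Computes.var
  exact h1.bne h2

theorem Computes.select {L : Γ → ℕ} {u : ∀ γ, Bool → BV (L γ)}
    (hu : Computes cΓ fun γ => codePair (u γ)) {t : Γ → Bool} (ht : Computes (b := .bool) cΓ t) :
    Computes cΓ fun γ => codeBV (u γ (t γ)) :=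
  (ht.ite hu.snd hu.fst).congr fun γ => by cases h : t γ <;> rfl

theorem Computes.visible {α : Γ → Type} {a : Ty} {cα : ∀ γ, α γ → a.den} (p : Prop) [Decidable p]
    {u v : ∀ γ, α γ} (hu : Computes cΓ fun γ => cα γ (u γ))
    (hv : Computes cΓ fun γ => cα γ (v γ)) :
    Computes cΓ fun γ => cα γ (PKMPSU.visible p (u γ) (v γ)) := by
  by_cases hp : p
  · simpa only [PKMPSU.visible, hp, if_true] using hv
  · simpa only [PKMPSU.visible, hp, if_false] using hu

theorem Computes.iteBV {L : Γ → ℕ} {t : Γ → Bool} (ht : Computes (b := .bool) cΓ t)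
    {u v : ∀ γ, BV (L γ)} (hu : Computes cΓ fun γ => codeBV (u γ))
    (hv : Computes cΓ fun γ => codeBV (v γ)) :
    Computes cΓ fun γ => codeBV (if t γ then u γ else v γ) :=
  (ht.ite hu hv).congr fun γ => by cases h : t γ <;> rfl

variable {S : MKRScheme}

theorem Computes.enc (hS : S.Efficient) (hN : Computes cΓ fun γ => unary (N γ))
    {pk : ∀ γ, S.PK (N γ)} {x : ∀ γ, Option (S.M (N γ))} {r : ∀ γ, BV (S.encCoins (N γ))}
    (hpk : Computes cΓ fun γ => S.codePK (N γ) (pk γ))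
    (hx : Computes cΓ fun γ => S.codeMsg (N γ) (x γ)) (hr : Computes cΓ fun γ => codeBV (r γ)) :
    Computes cΓ fun γ => codeBV (S.enc (N γ) (pk γ) (x γ) (r γ)) :=
  hS.enc.computes hN (x := fun γ => (pk γ, x γ, r γ)) (hpk.pair (hx.pair hr))

theorem Computes.reRand (hS : S.Efficient) (hN : Computes cΓ fun γ => unary (N γ))
    {pk : ∀ γ, S.PK (N γ)} {c : ∀ γ, BV (S.ctLen (N γ))} {r : ∀ γ, BV (S.reCoins (N γ))}
    (hpk : Computes cΓ fun γ => S.codePK (N γ) (pk γ))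
    (hc : Computes cΓ fun γ => codeBV (c γ)) (hr : Computes cΓ fun γ => codeBV (r γ)) :
    Computes cΓ fun γ => codeBV (S.reRand (N γ) (pk γ) (c γ) (r γ)) :=
  hS.reRand.computes hN (x := fun γ => (pk γ, c γ, r γ)) (hpk.pair (hc.pair hr))

theorem Computes.parDec (hS : S.Efficient) (hN : Computes cΓ fun γ => unary (N γ))
    {sk : ∀ γ, S.SK (N γ)} {c : ∀ γ, BV (S.ctLen (N γ))} {r : ∀ γ, BV (S.parCoins (N γ))}
    (hsk : Computes cΓ fun γ => S.codeSK (N γ) (sk γ))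
    (hc : Computes cΓ fun γ => codeBV (c γ)) (hr : Computes cΓ fun γ => codeBV (r γ)) :
    Computes cΓ fun γ => codeBV (S.parDec (N γ) (sk γ) (c γ) (r γ)) :=
  hS.parDec.computes hN (x := fun γ => (sk γ, c γ, r γ)) (hsk.pair (hc.pair hr))

theorem Computes.gen (hS : S.Efficient) (hN : Computes cΓ fun γ => unary (N γ))
    {r : ∀ γ, BV (S.genCoins (N γ))} (hr : Computes cΓ fun γ => codeBV (r γ)) :
    Computes (b := .prod bitsT bitsT) cΓ fun γ =>
      (S.codePK (N γ) (S.gen (N γ) (r γ)).1, S.codeSK (N γ) (S.gen (N γ) (r γ)).2) :=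
  hS.gen.computes hN hr

theorem Computes.mulPK (hS : S.Efficient) (hN : Computes cΓ fun γ => unary (N γ))
    {x y : ∀ γ, S.PK (N γ)} (hx : Computes cΓ fun γ => S.codePK (N γ) (x γ))
    (hy : Computes cΓ fun γ => S.codePK (N γ) (y γ)) :
    Computes cΓ fun γ => S.codePK (N γ) (x γ * y γ) :=
  hS.mulPK.computes hN (x := fun γ => (x γ, y γ)) (hx.pair hy)

/-- Products of public keys. The factor `x` avoids the unit of the group, for which no program is
given. -/
theorem Computes.mul_prodPK {ι : Type} [DecidableEq ι] (hS : S.Efficient)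
    (hN : Computes cΓ fun γ => unary (N γ)) {x : ∀ γ, S.PK (N γ)} {y : ∀ γ, ι → S.PK (N γ)}
    (hx : Computes cΓ fun γ => S.codePK (N γ) (x γ)) (s : Finset ι)
    (hy : ∀ i ∈ s, Computes cΓ fun γ => S.codePK (N γ) (y γ i)) :
    Computes cΓ fun γ => S.codePK (N γ) (x γ * ∏ i ∈ s, y γ i) := by
  induction s using Finset.induction_on with
  | empty => simpa using hx
  | insert i s hi ih =>
    refine (Computes.mulPK hS hN (ih fun i' hi' => hy i' (Finset.mem_insert_of_mem hi'))
      (hy i (Finset.mem_insert_self i s))).congr fun γ => ?_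
    rw [Finset.prod_insert hi, mul_assoc, mul_comm (y γ i)]

end SchemeRules

section ExchRules

variable {e : Ty} {Γ : Type} {cΓ : Γ → e.den} {N : Γ → ℕ} {S : MKRScheme}

/-- The data type of the coins of an exchange. -/
abbrev pairCoinsT : Ty := .prod bitsT (.prod bitsT (.prod bitsT (.prod .bool (.prod bitsT bitsT))))

/-- The code of the coins of an exchange. -/
def codePairCoins {n : ℕ} (κ : PairCoins S n) : pairCoinsT.den :=
  (codeBV κ.1, codeBV κ.2.1, codeBV κ.2.2.1, κ.2.2.2.1, codePair κ.2.2.2.2)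

/-- The data type of the record of an exchange. -/
abbrev exchT : Ty := .prod bitsT (.prod bitsT (.prod bitsT (.prod .bool (.prod .bool
  (.prod (.prod bitsT bitsT) (.prod bitsT (.prod (.prod bitsT bitsT) bitsT)))))))

/-- The code of the record of an exchange. -/
def codeExch {n : ℕ} (T : Exch S n) : exchT.den :=
  (codeBV T.dummy, codeBV T.recv, codeBV T.send, T.shareI, T.shareJ, codePair T.rotS,
    codeBV T.rotR, codePair T.msgU, codeBV T.msgV)

theorem Computes.exch {T : ∀ γ, Exch S (N γ)} (h1 : Computes cΓ fun γ => codeBV (T γ).dummy)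
    (h2 : Computes cΓ fun γ => codeBV (T γ).recv) (h3 : Computes cΓ fun γ => codeBV (T γ).send)
    (h4 : Computes (b := .bool) cΓ fun γ => (T γ).shareI)
    (h5 : Computes (b := .bool) cΓ fun γ => (T γ).shareJ)
    (h6 : Computes cΓ fun γ => codePair (T γ).rotS) (h7 : Computes cΓ fun γ => codeBV (T γ).rotR)
    (h8 : Computes cΓ fun γ => codePair (T γ).msgU) (h9 : Computes cΓ fun γ => codeBV (T γ).msgV) :
    Computes cΓ fun γ => codeExch (T γ) :=
  h1.pair (h2.pair (h3.pair (h4.pair (h5.pair (h6.pair (h7.pair (h8.pair h9)))))))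

variable {m : ℕ} (C : Finset (Fin (m + 1))) {pk : ∀ γ, S.PK (N γ)} (j i : Fin (m + 1))

theorem Computes.zeroPair {L : Γ → ℕ} (hL : Computes cΓ fun γ => unary (L γ)) :
    Computes cΓ fun γ => codePair fun _ => (PKMPSU.zeroBV : BV (L γ)) :=
  hL.zeroBV.pair hL.zeroBV

theorem Computes.noExch (hS : S.Efficient) (hN : Computes cΓ fun γ => unary (N γ))
    {κ : ∀ γ, PairCoins S (N γ)} (hκ : Computes cΓ fun γ => codePairCoins (κ γ)) :
    Computes cΓ fun γ => codeExch (noExch C j i (κ γ)) :=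
  Computes.exch
    (Computes.visible (cα := fun _ => codeBV) _ (hS.encCoins.computes hN).zeroBV hκ.fst)
    (Computes.visible (cα := fun _ => codeBV) _ (hS.reCoins.computes hN).zeroBV hκ.snd.fst)
    (Computes.visible (cα := fun _ => codeBV) _ (hS.reCoins.computes hN).zeroBV hκ.snd.snd.fst)
    (Computes.lit false) (Computes.lit false) (hS.ctLen.computes hN).zeroPair
    (hS.ctLen.computes hN).zeroBV (hS.ctLen.computes hN).zeroPair (hS.ctLen.computes hN).zeroBV

theorem Computes.defaultExch (hS : S.Efficient) (hN : Computes cΓ fun γ => unary (N γ)) :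
    Computes cΓ fun γ => codeExch (default : Exch S (N γ)) :=
  Computes.exch (hS.encCoins.computes hN).zeroBV (hS.reCoins.computes hN).zeroBV
    (hS.reCoins.computes hN).zeroBV
    (Computes.lit false) (Computes.lit false) (hS.ctLen.computes hN).zeroPair
    (hS.ctLen.computes hN).zeroBV (hS.ctLen.computes hN).zeroPair (hS.ctLen.computes hN).zeroBV

theorem Computes.realExch (hS : S.Efficient) (hN : Computes cΓ fun γ => unary (N γ))
    (hpk : Computes cΓ fun γ => S.codePK (N γ) (pk γ)) {d : Γ → Bool}
    (hd : Computes (b := .bool) cΓ d) {c : ∀ γ, BV (S.ctLen (N γ))}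
    (hc : Computes cΓ fun γ => codeBV (c γ)) {κ : ∀ γ, PairCoins S (N γ)}
    (hκ : Computes cΓ fun γ => codePairCoins (κ γ)) :
    Computes (b := .prod exchT bitsT) cΓ fun γ =>
      (codeExch (realExch C (pk γ) j i (d γ) (c γ) (κ γ)).1,
        codeBV (realExch C (pk γ) j i (d γ) (c γ) (κ γ)).2) := by
  have hct := hS.ctLen.computes hN
  have he : Computes (b := .bool) cΓ fun γ => (κ γ).2.2.2.1 := hκ.snd.snd.snd.fst
  have he' : Computes (b := .bool) cΓ fun γ => Bool.xor (κ γ).2.2.2.1 (d γ) := he.bne hd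
  have hρ : Computes cΓ fun γ => codePair (κ γ).2.2.2.2 := hκ.snd.snd.snd.snd
  have hnone : Computes cΓ fun γ => codeBV (S.enc (N γ) (pk γ) none (κ γ).1) :=
    Computes.enc hS hN hpk (x := fun _ => none) Computes.nil hκ.fst
  have hu1 : ∀ β : Bool, Computes cΓ fun γ => codeBV (BV.xor ((κ γ).2.2.2.2 β)
      (if β = Bool.xor (κ γ).2.2.2.1 (d γ) then c γ else S.enc (N γ) (pk γ) none (κ γ).1)) := by
    intro β
    refine Computes.xor hct (hρ.select (Computes.lit β)) ?_
    exact (((Computes.lit β).beq_bool he').iteBV hc hnone).congr fun γ => by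
      simp only [decide_eq_true_eq]
  have hu : Computes cΓ fun γ => codePair fun β => BV.xor ((κ γ).2.2.2.2 β)
      (if β = Bool.xor (κ γ).2.2.2.1 (d γ) then c γ else S.enc (N γ) (pk γ) none (κ γ).1) :=
    (hu1 false).pair (hu1 true)
  have hv := Computes.reRand hS hN hpk (Computes.xor hct (hu.select he) (hρ.select he)) hκ.snd.fst
  refine Computes.pair (Computes.exch
    (Computes.visible (cα := fun _ => codeBV) _ (hS.encCoins.computes hN).zeroBV hκ.fst)
    (Computes.visible (cα := fun _ => codeBV) _ (hS.reCoins.computes hN).zeroBV hκ.snd.fst)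
    (Computes.visible (cα := fun _ => codeBV) _ (hS.reCoins.computes hN).zeroBV hκ.snd.snd.fst)
    (Computes.visible (a := .bool) (cα := fun _ => _root_.id) _ (Computes.lit false) he)
    (Computes.visible (a := .bool) (cα := fun _ => _root_.id) _ (Computes.lit false) he')
    (Computes.visible (cα := fun _ => codePair) _ hct.zeroPair hρ)
    (Computes.visible (cα := fun _ => codeBV) _ hct.zeroBV (hρ.select he))
    (Computes.visible (cα := fun _ => codePair) _ hct.zeroPair hu)
    (Computes.visible (cα := fun _ => codeBV) _ hct.zeroBV hv)) ?_
  exact Computes.reRand hS hN hpk hv hκ.snd.snd.fst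

/-- The simulated exchange uses the membership bit only if both parties are corrupted. -/
theorem Computes.simStep (hS : S.Efficient) (hN : Computes cΓ fun γ => unary (N γ))
    (hpk : Computes cΓ fun γ => S.codePK (N γ) (pk γ)) {d : Γ → Fin (m + 1) → Bool}
    (hd : i < j → i ∈ C → j ∈ C → Computes (b := .bool) cΓ fun γ => d γ i)
    {c : ∀ γ, BV (S.ctLen (N γ))}
    (hc : Computes cΓ fun γ => codeBV (c γ)) {κ : ∀ γ, PairCoins S (N γ) × BV (S.ctLen (N γ))}
    (hκ : Computes cΓ fun γ => codePairCoins (κ γ).1) (hF : Computes cΓ fun γ => codeBV (κ γ).2) :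
    Computes (b := .prod exchT bitsT) cΓ fun γ =>
      (codeExch (simStep C (pk γ) j (d γ) i (c γ) (κ γ)).1,
        codeBV (simStep C (pk γ) j (d γ) i (c γ) (κ γ)).2) := by
  have hct := hS.ctLen.computes hN
  by_cases hij : i < j
  · simp only [PKMPSU.simStep, if_pos hij]
    by_cases hboth : i ∈ C ∧ j ∈ C
    · simp only [simExch, if_pos hboth]
      exact Computes.realExch C j i hS hN hpk (hd hij hboth.1 hboth.2) hc hκ
    · simp only [simExch_eq _ j hboth]
      have he : Computes (b := .bool) cΓ fun γ => (κ γ).1.2.2.2.1 := hκ.snd.snd.snd.fst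
      have hρ : Computes cΓ fun γ => codePair (κ γ).1.2.2.2.2 := hκ.snd.snd.snd.snd
      have hu1 : ∀ β : Bool, Computes cΓ fun γ => codeBV (if β = (κ γ).1.2.2.2.1 then
          BV.xor ((κ γ).1.2.2.2.2 β) (κ γ).2 else (κ γ).1.2.2.2.2 β) := by
        intro β
        have hρβ := hρ.select (Computes.lit β)
        exact (((Computes.lit β).beq_bool he).iteBV (Computes.xor hct hρβ hF) hρβ).congr
          fun γ => by simp only [decide_eq_true_eq]
      have hv : Computes cΓ fun γ =>
          codeBV (if i ∈ C then S.reRand (N γ) (pk γ) (κ γ).2 (κ γ).1.2.1 else (κ γ).2) := by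
        by_cases hi : i ∈ C
        · simp only [hi, if_true]
          exact Computes.reRand hS hN hpk hF hκ.snd.fst
        · simpa only [hi, if_false] using hF
      refine Computes.pair (Computes.exch
        (Computes.visible (cα := fun _ => codeBV) _ (hS.encCoins.computes hN).zeroBV hκ.fst)
        (Computes.visible (cα := fun _ => codeBV) _ (hS.reCoins.computes hN).zeroBV hκ.snd.fst)
        (Computes.visible (cα := fun _ => codeBV) _ (hS.reCoins.computes hN).zeroBV hκ.snd.snd.fst)
        (Computes.visible (a := .bool) (cα := fun _ => _root_.id) _ (Computes.lit false) he)
        (Computes.visible (a := .bool) (cα := fun _ => _root_.id) _ (Computes.lit false) he)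
        (Computes.visible (cα := fun _ => codePair) _ hct.zeroPair hρ)
        (Computes.visible (cα := fun _ => codeBV) _ hct.zeroBV (hρ.select he))
        (Computes.visible (cα := fun _ => codePair) _ hct.zeroPair ((hu1 false).pair (hu1 true)))
        (Computes.visible (cα := fun _ => codeBV) _ hct.zeroBV hv)) ?_
      by_cases hj : j ∈ C
      · simp only [hj, if_true]
        exact Computes.reRand hS hN hpk hF hκ.snd.snd.fst
      · simpa only [hj, if_false] using hc
  · simp only [PKMPSU.simStep, if_neg hij]
    exact (Computes.noExch C j i hS hN hκ).pair hc

/-- A process along a fixed list of parties is computed step by step. -/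
theorem Computes.runF {m : ℕ} {σ κ τ : Γ → Type} {a b : Ty} {cσ : ∀ γ, σ γ → a.den}
    {cτ : ∀ γ, τ γ → b.den} {st : ∀ γ, Fin m → σ γ → κ γ → τ γ × σ γ} {f : ∀ γ, Fin m → κ γ}
    (hst : ∀ i (s : ∀ γ, σ γ), Computes cΓ (fun γ => cσ γ (s γ)) →
      Computes (b := .prod b a) cΓ fun γ =>
        (cτ γ (st γ i (s γ) (f γ i)).1, cσ γ (st γ i (s γ) (f γ i)).2))
    {g : ∀ γ, Fin m → τ γ} (hg : ∀ i, Computes cΓ fun γ => cτ γ (g γ i)) (L : List (Fin m))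
    {s : ∀ γ, σ γ} (hs : Computes cΓ fun γ => cσ γ (s γ)) (i : Fin m) :
    Computes cΓ fun γ => cτ γ (PKMPSU.runF (st γ) L (s γ) (f γ) (g γ) i) := by
  induction L generalizing s with
  | nil => exact hg i
  | cons i' L ih =>
    simp only [PKMPSU.runF]
    by_cases hi : i = i'
    · subst hi
      simp only [Function.update_self]
      exact (hst i s hs).fst
    · simp only [Function.update_of_ne hi]
      exact ih (hst i' s hs).snd

end ExchRules

/-! ### The simulator: records -/

section TableRules

variable {e a b : Ty} {Γ : Type} {cΓ : Γ → e.den} {N : Γ → ℕ} {α β : Γ → Type}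
  {cα : ∀ γ, α γ → a.den} {cβ : ∀ γ, β γ → b.den}

theorem Computes.tabVec {L : Γ → ℕ} {v : ∀ γ, Fin (L γ) → α γ}
    (hL : Computes cΓ fun γ => unary (L γ))
    (hv : Computes (e := .prod e unaryT) (fun x : Σ γ, Fin (L γ) => (cΓ x.1, codeFin x.2))
      fun x => cα x.1 (v x.1 x.2)) :
    Computes (b := .list a) cΓ fun γ => codeVec (cα γ) (v γ) :=
  Computes.tab (v := fun γ i => cα γ (v γ i)) hL hv

theorem Computes.ofVec {m : ℕ} {v : ∀ γ, Fin m → α γ}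
    (hv : ∀ i, Computes cΓ fun γ => cα γ (v γ i)) :
    Computes (b := .list a) cΓ fun γ => codeVec (cα γ) (v γ) :=
  Computes.ofFn hv

/-- Reading the entry of a table with the index by which the context is extended. -/
theorem Computes.lookupVar {L : Γ → ℕ} {v : ∀ γ, Fin (L γ) → α γ}
    (hv : Computes (b := .list a) cΓ fun γ => codeVec (cα γ) (v γ)) :
    Computes (e := .prod e unaryT) (fun x : Σ γ, Fin (L γ) => (cΓ x.1, codeFin x.2))
      fun x => cα x.1 (v x.1 x.2) :=
  Computes.lookup (Γ := Σ γ, Fin (L γ)) (α := fun x => α x.1) (cα := fun x => cα x.1)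
    (L := fun x => L x.1) (v := fun x => v x.1) (i := fun x => x.2) hv.weaken Computes.var

theorem Computes.optMap {o : ∀ γ, Option (α γ)} {f : ∀ γ, α γ → β γ}
    (ho : Computes (b := .list a) cΓ fun γ => codeOpt (cα γ) (o γ))
    (hf : Computes (e := .prod e a) (fun x : Σ γ, α γ => (cΓ x.1, cα x.1 x.2))
      fun x => cβ x.1 (f x.1 x.2)) :
    Computes (b := .list b) cΓ fun γ => codeOpt (cβ γ) ((o γ).map (f γ)) :=
  (Computes.elim (c := .list b) (v := fun γ y => [cβ γ (f γ y)]) ho Computes.nil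
    (hf.cons Computes.nil)).congr fun γ => by cases h : o γ <;> rfl

end TableRules

section RecordRules

variable {e : Ty} {Γ : Type} {cΓ : Γ → e.den} {N : Γ → ℕ} {S : MKRScheme} {P : HashParams S}

/-- The data type of the coins for the exchanges about one bin. -/
abbrev binCoinsT : Ty := .prod bitsT (.list pairCoinsT)

/-- The code of the coins for the exchanges about one bin. -/
def codeBinCoins {m n : ℕ} (r : BinCoins S m n) : binCoinsT.den :=
  (codeBV r.1, codeVec codePairCoins r.2)

/-- The data type of the records of the exchanges about one bin. -/
abbrev recordT : Ty := .prod bitsT (.list exchT)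

/-- The code of the records of the exchanges about one bin. -/
def codeRecord {m n : ℕ} (T : BV (S.encCoins n) × (Fin (m + 1) → Exch S n)) : recordT.den :=
  (codeBV T.1, codeVec codeExch T.2)

theorem Computes.simBin {m : ℕ} {C : Finset (Fin (m + 1))} {j : Fin (m + 1)} (hS : S.Efficient)
    (hN : Computes cΓ fun γ => unary (N γ)) {pk : ∀ γ, S.PK (N γ)}
    (hpk : Computes cΓ fun γ => S.codePK (N γ) (pk γ)) {d : Γ → Fin (m + 1) → Bool}
    (hd : ∀ i, i < j → i ∈ C → j ∈ C → Computes (b := .bool) cΓ fun γ => d γ i)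
    {x : ∀ γ, Option (S.M (N γ))} (hx : j ∈ C → Computes cΓ fun γ => S.codeMsg (N γ) (x γ))
    {F : ∀ γ, Fin (m + 1) → BV (S.ctLen (N γ))} (hF : ∀ i, Computes cΓ fun γ => codeBV (F γ i))
    {r : ∀ γ, BinCoins S m (N γ)} (hr : Computes cΓ fun γ => codeBinCoins (r γ)) :
    Computes cΓ fun γ => codeRecord (simBin C (pk γ) j (d γ) (x γ) (F γ) (r γ)) := by
  have hr2 : ∀ i, Computes cΓ fun γ => codePairCoins ((r γ).2 i) := fun i =>
    Computes.entry (α := fun γ => PairCoins S (N γ)) (cα := fun _ => codePairCoins) hr.snd i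
  refine Computes.pair (Computes.visible (cα := fun _ => codeBV) _
    (hS.encCoins.computes hN).zeroBV hr.fst) (Computes.ofVec (α := fun γ => Exch S (N γ))
      (cα := fun _ => codeExch) fun i => ?_)
  refine Computes.runF (σ := fun γ => BV (S.ctLen (N γ))) (cσ := fun _ => codeBV)
    (cτ := fun _ => codeExch) (st := fun γ => PKMPSU.simStep C (pk γ) j (d γ))
    (f := fun γ i => ((r γ).2 i, F γ i)) (g := fun _ => default)
    (fun i s hs => Computes.simStep C j i hS hN hpk (hd i) hs (hr2 i) (hF i))
    (fun i => Computes.defaultExch hS hN) (exchOrder j) ?_ i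
  by_cases hj : j ∈ C
  · simp only [hj, if_true]
    exact Computes.enc hS hN hpk (hx hj) hr.fst
  · simp only [hj, if_false]
    exact (hS.ctLen.computes hN).zeroBV

variable {k : ℕ} {I : ∀ γ, Inputs P k (N γ)}

theorem Computes.plainElem (hP : P.Efficient) (hN : Computes cΓ fun γ => unary (N γ))
    (hseed : Computes cΓ fun γ => codeBV (I γ).seed) {j : Fin (k + 1)}
    (hX : Computes cΓ fun γ => codeSet (S.repM (N γ)) ((I γ).X j)) :
    Computes (e := .prod e unaryT)
      (fun x : Σ γ, Fin (P.bins (N γ)) => (cΓ x.1, codeFin x.2))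
      fun x => S.codeMsg (N x.1) (plainElem P (I x.1).seed (I x.1).X j x.2) := by
  have h := hP.cuckoo.computes hN (x := fun γ => ((I γ).seed, (I γ).X j)) (hseed.pair hX)
  have hy : Computes (e := .prod (.prod e unaryT) (.prod bitsT unaryT)) (b := .prod bitsT unaryT)
      (fun x : Σ y : (Σ γ, Fin (P.bins (N γ))), S.M (N y.1) × Fin 3 => ((cΓ x.1.1, codeFin x.1.2),
        (S.codeM (N x.1.1) x.2.1, codeFin x.2.2)))
      fun x => (S.codeM (N x.1.1) x.2.1, codeFin x.2.2) :=
    Computes.var (e := .prod e unaryT) (Γ := Σ γ, Fin (P.bins (N γ)))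
      (cΓ := fun x => (cΓ x.1, codeFin x.2))
  exact Computes.optMap (a := .prod bitsT unaryT) (b := bitsT)
    (Γ := Σ γ, Fin (P.bins (N γ))) (α := fun x => S.M (N x.1) × Fin 3)
    (cα := fun x y => (S.codeM (N x.1) y.1, codeFin y.2)) (β := fun x => S.M (N x.1))
    (cβ := fun x => S.codeM (N x.1)) (f := fun _ => Prod.fst)
    (Computes.lookupVar (a := .list (.prod bitsT unaryT)) (α := fun γ => Option (S.M (N γ) × Fin 3))
      (cα := fun γ => codeOpt fun y => (S.codeM (N γ) y.1, codeFin y.2)) h)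
    hy.fst

theorem mem_codeSet {n : ℕ} {X : Finset (S.M n)} {a : S.M n} :
    S.codeM n a ∈ codeSet (S.repM n) X ↔ a ∈ X := by
  unfold codeSet MKRScheme.codeM
  rw [Finset.mem_sort, Finset.mem_image]
  constructor
  · rintro ⟨a', ha', h⟩
    rwa [← (S.repM n).injective (List.ofFn_injective h)]
  · exact fun h => ⟨a, h, rfl⟩

theorem Computes.member (hP : P.Efficient) (hN : Computes cΓ fun γ => unary (N γ))
    (hseed : Computes cΓ fun γ => codeBV (I γ).seed) {j i : Fin (k + 1)} (hj : j ≠ 0)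
    (hXj : Computes cΓ fun γ => codeSet (S.repM (N γ)) ((I γ).X j))
    (hXi : Computes cΓ fun γ => codeSet (S.repM (N γ)) ((I γ).X i)) :
    Computes (e := .prod e unaryT) (b := .bool)
      (fun x : Σ γ, Fin (P.bins (N γ)) => (cΓ x.1, codeFin x.2))
      fun x => member P (I x.1).seed (I x.1).X j x.2 i := by
  have hXi' : Computes (e := .prod e unaryT) (b := .list bitsT)
      (fun x : Σ γ, Fin (P.bins (N γ)) => (cΓ x.1, codeFin x.2))
      fun x => codeSet (S.repM (N x.1)) ((I x.1).X i) := hXi.weaken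
  refine (Computes.elim (c := .bool) (a := bitsT) (α := fun x => S.M (N x.1))
    (cα := fun x => S.codeM (N x.1)) (u := fun _ => false)
    (v := fun x a => decide (S.codeM (N x.1) a ∈ codeSet (S.repM (N x.1)) ((I x.1).X i)))
    (Computes.plainElem hP hN hseed hXj) (Computes.lit false)
    (Computes.mem (Computes.var (e := .prod e unaryT) (Γ := Σ γ, Fin (P.bins (N γ)))
      (cΓ := fun x => (cΓ x.1, codeFin x.2))) hXi'.weaken)).congr fun x => ?_
  rw [Bool.eq_iff_iff, member_iff (I x.1) hj]
  cases h : PKMPSU.plainElem P (I x.1).seed (I x.1).X j x.2 with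
  | none => simp
  | some a => simpa using mem_codeSet

theorem Computes.simRecords {C : Finset (Fin (k + 1))} (hS : S.Efficient) (hP : P.Efficient)
    (hN : Computes cΓ fun γ => unary (N γ))
    {pk : ∀ γ, S.PK (N γ)} (hpk : Computes cΓ fun γ => S.codePK (N γ) (pk γ))
    (hseed : Computes cΓ fun γ => codeBV (I γ).seed)
    (hX : ∀ i ∈ C, Computes cΓ fun γ => codeSet (S.repM (N γ)) ((I γ).X i))
    {F : ∀ γ, Fin (k + 1) → Fin (P.bins (N γ)) → Fin (k + 1) → BV (S.ctLen (N γ))}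
    (hF : Computes (b := .list (.list (.list bitsT))) cΓ fun γ =>
      codeVec (codeVec (codeVec codeBV)) (F γ))
    {r : ∀ γ, Fin (k + 1) → Fin (P.bins (N γ)) → BinCoins S k (N γ)}
    (hr : Computes (b := .list (.list binCoinsT)) cΓ fun γ =>
      codeVec (codeVec codeBinCoins) (r γ)) :
    Computes (b := .list (.list recordT)) cΓ fun γ => codeVec (codeVec codeRecord)
      (simRecords C (pk γ) (I γ).seed (I γ).X (F γ) (r γ)) := by
  refine Computes.ofVec (a := .list recordT)
    (α := fun γ => Fin (P.bins (N γ)) → BV (S.encCoins (N γ)) × (Fin (k + 1) → Exch S (N γ)))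
    (cα := fun _ => codeVec codeRecord) fun j => ?_
  refine Computes.tabVec (a := recordT)
    (α := fun γ => BV (S.encCoins (N γ)) × (Fin (k + 1) → Exch S (N γ)))
    (cα := fun _ => codeRecord) (hP.bins.computes hN) ?_
  have hFj := Computes.lookupVar (a := .list bitsT) (α := fun γ => Fin (k + 1) → BV (S.ctLen (N γ)))
    (cα := fun _ => codeVec codeBV) (Computes.entry (a := .list (.list bitsT))
      (α := fun γ => Fin (P.bins (N γ)) → Fin (k + 1) → BV (S.ctLen (N γ)))
      (cα := fun _ => codeVec (codeVec codeBV)) hF j)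
  exact Computes.simBin hS hN.weaken hpk.weaken
    (fun i hij hi hj => Computes.member hP hN hseed
      (fun h => absurd (h ▸ hij) (Fin.not_lt_zero i)) (hX j hj) (hX i hi))
    (fun hj => Computes.plainElem hP hN hseed (hX j hj))
    (fun i => Computes.entry (a := bitsT) (Γ := Σ γ, Fin (P.bins (N γ)))
      (α := fun x => BV (S.ctLen (N x.1))) (cα := fun _ => codeBV) hFj i)
    (Computes.lookupVar (a := binCoinsT) (α := fun γ => BinCoins S k (N γ))
      (cα := fun _ => codeBinCoins) (Computes.entry (a := .list binCoinsT)
      (α := fun γ => Fin (P.bins (N γ)) → BinCoins S k (N γ))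
      (cα := fun _ => codeVec codeBinCoins) hr j))

end RecordRules

/-! ### The simulator: the shuffle phase -/

section SlotRules

variable {e a : Ty} {Γ : Type} {cΓ : Γ → e.den} {N : Γ → ℕ} {S : MKRScheme} {P : HashParams S}
  {k : ℕ} {α : Γ → Type} {cα : ∀ γ, α γ → a.den}

/-- The code of a position in the leader's vector. -/
def codeSlot {n : ℕ} (s : Slot P k n) : (Ty.prod unaryT unaryT).den := (codeFin s.1, codeFin s.2)

theorem Computes.slotTab {v : ∀ γ, Slot P k (N γ) → α γ}
    (hB : Computes cΓ fun γ => unary (P.bins (N γ)))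
    (hv : Computes (e := .prod e (.prod unaryT unaryT))
      (fun x : Σ γ, Slot P k (N γ) => (cΓ x.1, codeSlot x.2)) fun x => cα x.1 (v x.1 x.2)) :
    Computes (b := .list (.list a)) cΓ fun γ => codeVec (codeVec (cα γ)) fun j b => v γ (j, b) := by
  refine Computes.tabVec (a := .list a) (L := fun _ => k)
    (α := fun γ => Fin (P.bins (N γ)) → α γ)
    (cα := fun γ => codeVec (cα γ)) (v := fun γ j b => v γ (j, b)) (Computes.const _) ?_
  have hB' : Computes (e := .prod e unaryT) (fun x : Σ _ : Γ, Fin k => (cΓ x.1, codeFin x.2))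
    fun x => unary (P.bins (N x.1)) := hB.weaken
  refine Computes.tabVec (Γ := Σ _ : Γ, Fin k) (L := fun x => P.bins (N x.1))
    (α := fun x => α x.1) (cα := fun x => cα x.1) (v := fun x b => v x.1 (x.2, b)) hB' ?_
  have hx : Computes (e := .prod (.prod e unaryT) unaryT) (b := .prod (.prod e unaryT) unaryT)
    (fun x : Σ y : (Σ _ : Γ, Fin k), Fin (P.bins (N y.1)) =>
      ((cΓ x.1.1, codeFin x.1.2), codeFin x.2))
    fun x => ((cΓ x.1.1, codeFin x.1.2), codeFin x.2) := Computes.self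
  exact Computes.subst hv (g := fun x : Σ y : (Σ _ : Γ, Fin k), Fin (P.bins (N y.1)) =>
    ⟨x.1.1, (x.1.2, x.2)⟩) (hx.fst.fst.pair (hx.fst.snd.pair hx.snd))

theorem Computes.slotEntry {v : ∀ γ, Slot P k (N γ) → α γ}
    (hv : Computes (b := .list (.list a)) cΓ fun γ =>
      codeVec (codeVec (cα γ)) fun j b => v γ (j, b)) {s : ∀ γ, Slot P k (N γ)}
    (hs : Computes cΓ fun γ => codeSlot (s γ)) : Computes cΓ fun γ => cα γ (v γ (s γ)) :=
  Computes.lookup (a := a) (α := α) (cα := cα) (L := fun γ => P.bins (N γ))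
    (v := fun γ b => v γ ((s γ).1, b)) (i := fun γ => (s γ).2)
    (Computes.lookup (a := .list a) (α := fun γ => Fin (P.bins (N γ)) → α γ)
      (cα := fun γ => codeVec (cα γ)) (L := fun _ => k) (v := fun γ j b => v γ (j, b))
      (i := fun γ => (s γ).1) hv hs.fst) hs.snd

theorem Computes.slotVar : Computes (e := .prod e (.prod unaryT unaryT))
    (fun x : Σ γ, Slot P k (N γ) => (cΓ x.1, codeSlot x.2)) fun x => codeSlot x.2 :=
  Computes.var

/-- Reading the entry of a table at a position that depends on the one by which the context is
extended. -/
theorem Computes.slotAt {v : ∀ γ, Slot P k (N γ) → α γ}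
    (hv : Computes (b := .list (.list a)) cΓ fun γ =>
      codeVec (codeVec (cα γ)) fun j b => v γ (j, b)) {s : ∀ γ, Slot P k (N γ) → Slot P k (N γ)}
    (hs : Computes (e := .prod e (.prod unaryT unaryT))
      (fun x : Σ γ, Slot P k (N γ) => (cΓ x.1, codeSlot x.2)) fun x => codeSlot (s x.1 x.2)) :
    Computes (e := .prod e (.prod unaryT unaryT))
      (fun x : Σ γ, Slot P k (N γ) => (cΓ x.1, codeSlot x.2)) fun x => cα x.1 (v x.1 (s x.1 x.2)) :=
  Computes.slotEntry (Γ := Σ γ, Slot P k (N γ)) (N := fun x => N x.1) (α := fun x => α x.1)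
    (cα := fun x => cα x.1) (v := fun x => v x.1) (s := fun x => s x.1 x.2) hv.weaken hs

end SlotRules

section VectorRules

variable {e : Ty} {Γ : Type} {cΓ : Γ → e.den} {N : Γ → ℕ} {S : MKRScheme} {P : HashParams S}
  {k : ℕ} {C : Finset (Fin (k + 1))}

/-- The data type of the coins in the shuffle phase; a permutation is given by the table of its
values. -/
abbrev chainCoinsT : Ty := .prod (.list (.list (.prod unaryT unaryT))) (.prod slotsT slotsT)

/-- The code of the coins of a party in the shuffle phase. -/
def codeChainCoins {n : ℕ} (κ : ChainCoins P k n) : chainCoinsT.den :=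
  (codeVec (codeVec codeSlot) fun j b => κ.1 (j, b), codeSlots κ.2.1, codeSlots κ.2.2)

/-- The data type of the output of a party in the shuffle phase. -/
abbrev vectorT : Ty := .prod chainCoinsT slotsT

/-- The code of the output of a party in the shuffle phase. -/
def codeVector {n : ℕ} (V : ChainCoins P k n × (Slot P k n → BV (S.ctLen n))) : vectorT.den :=
  (codeChainCoins V.1, codeSlots V.2)

theorem Computes.zeroSlots {L : Γ → ℕ} (hB : Computes cΓ fun γ => unary (P.bins (N γ)))
    (hL : Computes cΓ fun γ => unary (L γ)) :
    Computes cΓ fun γ => codeSlots fun _ : Slot P k (N γ) => (PKMPSU.zeroBV : BV (L γ)) :=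
  Computes.slotTab (a := bitsT) (α := fun γ => BV (L γ)) (cα := fun _ => codeBV)
    (v := fun _ _ => PKMPSU.zeroBV) hB hL.zeroBV.weaken

theorem Computes.dfltChainCoins (hS : S.Efficient) (hP : P.Efficient)
    (hN : Computes cΓ fun γ => unary (N γ)) :
    Computes cΓ fun γ => codeChainCoins (S := S) (P := P) (k := k) (n := N γ)
      (1, fun _ => PKMPSU.zeroBV, fun _ => PKMPSU.zeroBV) := by
  have hB := hP.bins.computes hN
  exact Computes.pair (Computes.slotTab (a := .prod unaryT unaryT) (α := fun γ => Slot P k (N γ))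
    (cα := fun _ => codeSlot) (v := fun _ s => s) hB Computes.slotVar)
    ((Computes.zeroSlots hB (hS.parCoins.computes hN)).pair
      (Computes.zeroSlots hB (hS.reCoins.computes hN)))

theorem Computes.restKey (hS : S.Efficient) (hN : Computes cΓ fun γ => unary (N γ))
    {pk : ∀ γ, Fin (k + 1) → S.PK (N γ)}
    (hpk : ∀ i, Computes cΓ fun γ => S.codePK (N γ) (pk γ i)) (t : Fin (k + 1)) :
    Computes cΓ fun γ => S.codePK (N γ) (restKey (pk γ) t) :=
  Computes.mul_prodPK hS hN (hpk 0) _ fun i _ => hpk i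

theorem Computes.slotSelf {e : Ty} {Γ : Type} {cΓ : Γ → e.den} {N : Γ → ℕ} {L : Γ → ℕ}
    {v : ∀ γ, Slot P k (N γ) → BV (L γ)} (hB : Computes cΓ fun γ => unary (P.bins (N γ)))
    (hv : Computes (e := .prod e (.prod unaryT unaryT))
      (fun x : Σ γ, Slot P k (N γ) => (cΓ x.1, codeSlot x.2)) fun x => codeBV (v x.1 x.2)) :
    Computes cΓ fun γ => codeSlots (v γ) :=
  Computes.slotTab (a := bitsT) (α := fun γ => BV (L γ)) (cα := fun _ => codeBV) hB hv

theorem Computes.simChainStep (hS : S.Efficient) (hP : P.Efficient)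
    (hN : Computes cΓ fun γ => unary (N γ)) {pk : ∀ γ, Fin (k + 1) → S.PK (N γ)}
    (hpk : ∀ i, Computes cΓ fun γ => S.codePK (N γ) (pk γ i))
    {sk : ∀ γ, Fin (k + 1) → S.SK (N γ)}
    (hsk : ∀ i, Computes cΓ fun γ => S.codeSK (N γ) (sk γ i)) (h : Fin (k + 1))
    {y : ∀ γ, Slot P k (N γ) → Option (S.M (N γ))}
    (hy : Computes (b := .list (.list (.list bitsT))) cΓ fun γ =>
      codeVec (codeVec (S.codeMsg (N γ))) fun j b => y γ (j, b)) (t : Fin (k + 1))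
    {c : ∀ γ, Slot P k (N γ) → BV (S.ctLen (N γ))} (hc : Computes cΓ fun γ => codeSlots (c γ))
    {κ : ∀ γ, ChainCoins P k (N γ) × (Slot P k (N γ) → BV (S.encCoins (N γ)))}
    (hκ : Computes cΓ fun γ => codeChainCoins (κ γ).1)
    (hκ' : Computes cΓ fun γ => codeSlots (κ γ).2) :
    Computes (b := .prod vectorT slotsT) cΓ fun γ =>
      (codeVector (simChainStep C (pk γ) (sk γ) h (y γ) t (c γ) (κ γ)).1,
        codeSlots (simChainStep C (pk γ) (sk γ) h (y γ) t (c γ) (κ γ)).2) := by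
  have hB := hP.bins.computes hN
  have hπ : Computes (e := .prod e (.prod unaryT unaryT))
      (fun x : Σ γ, Slot P k (N γ) => (cΓ x.1, codeSlot x.2))
      fun x => codeSlot ((κ x.1).1.1 x.2) :=
    Computes.slotAt (a := .prod unaryT unaryT) (α := fun γ => Slot P k (N γ))
      (cα := fun _ => codeSlot) (v := fun γ s => (κ γ).1.1 s) (s := fun _ s => s)
      hκ.fst Computes.slotVar
  have hat : ∀ {L : Γ → ℕ} {v : ∀ γ, Slot P k (N γ) → BV (L γ)},
      Computes cΓ (fun γ => codeSlots (v γ)) → Computes (e := .prod e (.prod unaryT unaryT))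
      (fun x : Σ γ, Slot P k (N γ) => (cΓ x.1, codeSlot x.2))
      fun x => codeBV (v x.1 ((κ x.1).1.1 x.2)) := fun {L v} hv =>
    Computes.slotAt (a := bitsT) (α := fun γ => BV (L γ)) (cα := fun _ => codeBV)
      (v := v) (s := fun γ s => (κ γ).1.1 s) hv hπ
  have hvis : Computes cΓ fun γ => codeChainCoins
      (PKMPSU.visible (t ∈ C) (1, fun _ => PKMPSU.zeroBV, fun _ => PKMPSU.zeroBV) (κ γ).1) :=
    Computes.visible (α := fun γ => ChainCoins P k (N γ)) (cα := fun _ => codeChainCoins) _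
      (Computes.dfltChainCoins hS hP hN) hκ
  have hN' : Computes (e := .prod e (.prod unaryT unaryT))
      (fun x : Σ γ, Slot P k (N γ) => (cΓ x.1, codeSlot x.2)) fun x => unary (N x.1) := hN.weaken
  by_cases hth : t = h ∧ h ≠ 0
  · simp only [PKMPSU.simChainStep, if_pos hth]
    have hv : Computes cΓ fun γ => codeSlots fun s =>
        S.enc (N γ) (PKMPSU.restKey (pk γ) h) (y γ ((κ γ).1.1 s)) ((κ γ).2 s) := by
      refine Computes.slotSelf (L := fun γ => S.ctLen (N γ)) hB (Computes.enc hS hN'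
        (Computes.restKey hS hN hpk h).weaken ?_ ?_)
      · exact Computes.slotAt (a := .list bitsT) (α := fun γ => Option (S.M (N γ)))
          (cα := fun γ => S.codeMsg (N γ)) (v := y) (s := fun γ s => (κ γ).1.1 s) hy hπ
      · exact Computes.slotAt (a := bitsT) (α := fun γ => BV (S.encCoins (N γ)))
          (cα := fun _ => codeBV) (v := fun γ => (κ γ).2) (s := fun _ s => s) hκ' Computes.slotVar
    exact (hvis.pair hv).pair hv
  · simp only [PKMPSU.simChainStep, if_neg hth, chainStep]
    by_cases ht : t = 0
    · simp only [if_pos ht]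
      have hv : Computes cΓ fun γ => codeSlots fun s => c γ ((κ γ).1.1 s) :=
        Computes.slotSelf (L := fun γ => S.ctLen (N γ)) hB (hat hc)
      exact (hvis.pair hv).pair hv
    · simp only [if_neg ht]
      have hv : Computes cΓ fun γ => codeSlots fun s =>
          S.reRand (N γ) (PKMPSU.restKey (pk γ) t) (S.parDec (N γ) (sk γ t)
            (c γ ((κ γ).1.1 s)) ((κ γ).1.2.1 ((κ γ).1.1 s))) ((κ γ).1.2.2 ((κ γ).1.1 s)) :=
        Computes.slotSelf (L := fun γ => S.ctLen (N γ)) hB (Computes.reRand hS hN'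
          (Computes.restKey hS hN hpk t).weaken
          (Computes.parDec hS hN' (hsk t).weaken (hat hc)
            (hat (L := fun γ => S.parCoins (N γ)) (v := fun γ => (κ γ).1.2.1) hκ.snd.fst))
          (hat (L := fun γ => S.reCoins (N γ)) (v := fun γ => (κ γ).1.2.2) hκ.snd.snd))
      exact (hvis.pair hv).pair hv

theorem Computes.simVectors (hS : S.Efficient) (hP : P.Efficient)
    (hN : Computes cΓ fun γ => unary (N γ)) {pk : ∀ γ, Fin (k + 1) → S.PK (N γ)}
    (hpk : ∀ i, Computes cΓ fun γ => S.codePK (N γ) (pk γ i))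
    {sk : ∀ γ, Fin (k + 1) → S.SK (N γ)}
    (hsk : ∀ i, Computes cΓ fun γ => S.codeSK (N γ) (sk γ i)) (h : Fin (k + 1))
    {y : ∀ γ, Slot P k (N γ) → Option (S.M (N γ))}
    (hy : Computes (b := .list (.list (.list bitsT))) cΓ fun γ =>
      codeVec (codeVec (S.codeMsg (N γ))) fun j b => y γ (j, b))
    {c : ∀ γ, Slot P k (N γ) → BV (S.ctLen (N γ))} (hc : Computes cΓ fun γ => codeSlots (c γ))
    {r : ∀ γ, Fin (k + 1) → ChainCoins P k (N γ) × (Slot P k (N γ) → BV (S.encCoins (N γ)))}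
    (hr : Computes (b := .list (.prod chainCoinsT slotsT)) cΓ fun γ =>
      codeVec (fun κ => (codeChainCoins κ.1, codeSlots κ.2)) (r γ)) :
    ∀ i, Computes cΓ fun γ => codeVector (simVectors C (pk γ) (sk γ) h (y γ) (c γ) (r γ) i) := by
  have hr' : ∀ i, Computes (b := .prod chainCoinsT slotsT) cΓ fun γ =>
      (codeChainCoins (r γ i).1, codeSlots (r γ i).2) := fun i =>
    Computes.entry (a := .prod chainCoinsT slotsT)
      (α := fun γ => ChainCoins P k (N γ) × (Slot P k (N γ) → BV (S.encCoins (N γ))))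
      (cα := fun _ κ => (codeChainCoins κ.1, codeSlots κ.2)) hr i
  refine Computes.runF (σ := fun γ => Slot P k (N γ) → BV (S.ctLen (N γ)))
    (cσ := fun _ => codeSlots) (cτ := fun _ => codeVector)
    (st := fun γ => PKMPSU.simChainStep C (pk γ) (sk γ) h (y γ)) (f := r)
    (g := fun _ _ => ((1, fun _ => PKMPSU.zeroBV, fun _ => PKMPSU.zeroBV), fun _ => PKMPSU.zeroBV))
    (fun t s hs => Computes.simChainStep hS hP hN hpk hsk h hy t hs (hr' t).fst (hr' t).snd)
    (fun _ => (Computes.dfltChainCoins hS hP hN).pair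
      (Computes.zeroSlots (hP.bins.computes hN) (hS.ctLen.computes hN))) _ hc

end VectorRules

/-! ### The simulator: views -/

section ViewRules

variable {e : Ty} {Γ : Type} {cΓ : Γ → e.den} {N : Γ → ℕ} {S : MKRScheme} {P : HashParams S}
  {k : ℕ} {C : Finset (Fin (k + 1))}

theorem Computes.someIf {a : Ty} {α : Γ → Type} {cα : ∀ γ, α γ → a.den} (p : Prop) [Decidable p]
    {v : ∀ γ, α γ} (hv : p → Computes cΓ fun γ => cα γ (v γ)) :
    Computes (b := .list a) cΓ fun γ => codeOpt (cα γ) (if p then some (v γ) else none) := by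
  by_cases hp : p
  · simp only [hp, if_true]
    exact (hv hp).cons Computes.nil
  · simp only [hp, if_false]
    exact Computes.nil

theorem Computes.mkView (hP : P.Efficient) (hN : Computes cΓ fun γ => unary (N γ))
    {X : ∀ γ, Finset (S.M (N γ))} (hX : Computes cΓ fun γ => codeSet (S.repM (N γ)) (X γ))
    {g : ∀ γ, BV (S.genCoins (N γ))} (hg : Computes cΓ fun γ => codeBV (g γ))
    {pk : ∀ γ, Fin (k + 1) → S.PK (N γ)}
    (hpk : ∀ i, Computes cΓ fun γ => S.codePK (N γ) (pk γ i))
    {TR : ∀ γ, Records P k (N γ)}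
    (hTR : Computes (b := .list (.list recordT)) cΓ fun γ => codeVec (codeVec codeRecord) (TR γ))
    {CH : ∀ γ, Vectors P k (N γ)} (hCH : ∀ i, Computes cΓ fun γ => codeVector (CH γ i))
    (i : Fin (k + 1)) :
    Computes cΓ fun γ => codeView (mkView (X γ) (g γ) (pk γ) (TR γ) (CH γ) i) := by
  have hB := hP.bins.computes hN
  have hT : ∀ j, Computes (e := .prod e unaryT)
      (fun x : Σ γ, Fin (P.bins (N γ)) => (cΓ x.1, codeFin x.2))
      fun x => codeRecord (TR x.1 j x.2) := fun j =>
    Computes.lookupVar (a := recordT)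
      (α := fun γ => BV (S.encCoins (N γ)) × (Fin (k + 1) → Exch S (N γ)))
      (cα := fun _ => codeRecord) (Computes.entry (a := .list recordT)
      (α := fun γ => Fin (P.bins (N γ)) → BV (S.encCoins (N γ)) × (Fin (k + 1) → Exch S (N γ)))
      (cα := fun _ => codeVec codeRecord) hTR j)
  have hE : ∀ j i, Computes (e := .prod e unaryT)
      (fun x : Σ γ, Fin (P.bins (N γ)) => (cΓ x.1, codeFin x.2))
      fun x => codeExch ((TR x.1 j x.2).2 i) := fun j i =>
    Computes.entry (a := exchT) (Γ := Σ γ, Fin (P.bins (N γ))) (α := fun x => Exch S (N x.1))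
      (cα := fun _ => codeExch) (hT j).snd i
  have hfst : ∀ j, Computes (e := .prod e unaryT)
      (fun x : Σ γ, Fin (P.bins (N γ)) => (cΓ x.1, codeFin x.2))
      fun x => codeBV (TR x.1 j x.2).1 := fun j => (hT j).fst
  have hdummy : ∀ j i, Computes (e := .prod e unaryT)
      (fun x : Σ γ, Fin (P.bins (N γ)) => (cΓ x.1, codeFin x.2))
      fun x => codeBV ((TR x.1 j x.2).2 i).dummy := fun j i => (hE j i).fst
  have hrecv : ∀ j i, Computes (e := .prod e unaryT)
      (fun x : Σ γ, Fin (P.bins (N γ)) => (cΓ x.1, codeFin x.2))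
      fun x => codeBV ((TR x.1 j x.2).2 i).recv := fun j i => (hE j i).snd.fst
  have hsend : ∀ j i, Computes (e := .prod e unaryT)
      (fun x : Σ γ, Fin (P.bins (N γ)) => (cΓ x.1, codeFin x.2))
      fun x => codeBV ((TR x.1 j x.2).2 i).send := fun j i => (hE j i).snd.snd.fst
  have hrotS : ∀ j i, Computes (e := .prod e unaryT)
      (fun x : Σ γ, Fin (P.bins (N γ)) => (cΓ x.1, codeFin x.2))
      fun x => codePair ((TR x.1 j x.2).2 i).rotS := fun j i => (hE j i).snd.snd.snd.snd.snd.fst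
  have hrotR : ∀ j i, Computes (e := .prod e unaryT)
      (fun x : Σ γ, Fin (P.bins (N γ)) => (cΓ x.1, codeFin x.2))
      fun x => codeBV ((TR x.1 j x.2).2 i).rotR := fun j i => (hE j i).snd.snd.snd.snd.snd.snd.fst
  have hmsgU : ∀ j i, Computes (e := .prod e unaryT)
      (fun x : Σ γ, Fin (P.bins (N γ)) => (cΓ x.1, codeFin x.2))
      fun x => codePair ((TR x.1 j x.2).2 i).msgU := fun j i =>
    (hE j i).snd.snd.snd.snd.snd.snd.snd.fst
  have hmsgV : ∀ j i, Computes (e := .prod e unaryT)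
      (fun x : Σ γ, Fin (P.bins (N γ)) => (cΓ x.1, codeFin x.2))
      fun x => codeBV ((TR x.1 j x.2).2 i).msgV := fun j i =>
    (hE j i).snd.snd.snd.snd.snd.snd.snd.snd
  have tabBV : ∀ {L : Γ → ℕ} {v : ∀ γ, Fin (P.bins (N γ)) → BV (L γ)},
      Computes (e := .prod e unaryT) (fun x : Σ γ, Fin (P.bins (N γ)) => (cΓ x.1, codeFin x.2))
        (fun x => codeBV (v x.1 x.2)) →
      Computes (b := .list bitsT) cΓ fun γ => codeVec codeBV (v γ) := fun {L v} hv =>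
    Computes.tabVec (a := bitsT) (α := fun γ => BV (L γ)) (cα := fun _ => codeBV) hB hv
  have tabPair : ∀ {L : Γ → ℕ} {v : ∀ γ, Fin (P.bins (N γ)) → Bool → BV (L γ)},
      Computes (e := .prod e unaryT) (fun x : Σ γ, Fin (P.bins (N γ)) => (cΓ x.1, codeFin x.2))
        (fun x => codePair (v x.1 x.2)) →
      Computes (b := .list (.prod bitsT bitsT)) cΓ fun γ => codeVec codePair (v γ) :=
    fun {L v} hv =>
    Computes.tabVec (a := .prod bitsT bitsT) (α := fun γ => Bool → BV (L γ))
      (cα := fun _ => codePair) hB hv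
  have tab2 : ∀ {L : Γ → ℕ} {v : ∀ γ, Fin (k + 1) → Fin (P.bins (N γ)) → BV (L γ)},
      (∀ j, Computes (b := .list bitsT) cΓ fun γ => codeVec codeBV (v γ j)) →
      Computes (b := .list (.list bitsT)) cΓ fun γ => codeVec (codeVec codeBV) (v γ) :=
    fun {L v} hv => Computes.ofVec (a := .list bitsT) (α := fun γ => Fin (P.bins (N γ)) → BV (L γ))
      (cα := fun _ => codeVec codeBV) hv
  have optBV : ∀ {L : Γ → ℕ} {p : Fin (k + 1) → Prop} [DecidablePred p]
      {v : ∀ γ, Fin (k + 1) → Fin (P.bins (N γ)) → BV (L γ)},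
      (∀ j, Computes (b := .list bitsT) cΓ fun γ => codeVec codeBV (v γ j)) →
      Computes (b := .list (.list (.list bitsT))) cΓ fun γ => codeVec (codeOpt (codeVec codeBV))
        fun j => if p j then some (v γ j) else none := fun {L p _ v} hv =>
    Computes.ofVec (a := .list (.list bitsT)) (α := fun γ => Option (Fin (P.bins (N γ)) → BV (L γ)))
      (cα := fun _ => codeOpt (codeVec codeBV)) fun j => Computes.someIf (a := .list bitsT)
        (α := fun γ => Fin (P.bins (N γ)) → BV (L γ)) (cα := fun _ => codeVec codeBV) (p j)
        fun _ => hv j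
  have optPair : ∀ {L : Γ → ℕ} {p : Fin (k + 1) → Prop} [DecidablePred p]
      {v : ∀ γ, Fin (k + 1) → Fin (P.bins (N γ)) → Bool → BV (L γ)},
      (∀ j, Computes (b := .list (.prod bitsT bitsT)) cΓ fun γ => codeVec codePair (v γ j)) →
      Computes (b := .list (.list (.list (.prod bitsT bitsT)))) cΓ fun γ =>
        codeVec (codeOpt (codeVec codePair)) fun j => if p j then some (v γ j) else none :=
    fun {L p _ v} hv => Computes.ofVec (a := .list (.list (.prod bitsT bitsT)))
      (α := fun γ => Option (Fin (P.bins (N γ)) → Bool → BV (L γ)))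
      (cα := fun _ => codeOpt (codeVec codePair)) fun j =>
        Computes.someIf (a := .list (.prod bitsT bitsT))
        (α := fun γ => Fin (P.bins (N γ)) → Bool → BV (L γ)) (cα := fun _ => codeVec codePair) (p j)
        fun _ => hv j
  have htape : Computes cΓ fun γ =>
      codeTape (PKMPSU.mkView (X γ) (g γ) (pk γ) (TR γ) (CH γ) i).tape :=
    hg.pair ((tabBV (hfst i)).pair ((tab2 fun i' => tabBV (hdummy i i')).pair
      ((tab2 fun j => tabBV (hrecv j i)).pair
      ((tab2 fun i' => tabBV (hsend i i')).pair (hCH i).fst))))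
  have hpks : Computes (b := .list bitsT) cΓ fun γ => codeVec (S.codePK (N γ)) (pk γ) :=
    Computes.ofVec (a := bitsT) (α := fun γ => S.PK (N γ)) (cα := fun γ => S.codePK (N γ)) hpk
  have hshares : Computes (b := .list (.list bitsT)) cΓ fun γ => codeVec (codeOpt codeBV)
      (PKMPSU.mkView (X γ) (g γ) (pk γ) (TR γ) (CH γ) i).shares := by
    refine Computes.ofVec (a := .list bitsT) (α := fun γ => Option (BV (P.bins (N γ))))
      (cα := fun _ => codeOpt codeBV) fun j => ?_
    simp only [PKMPSU.mkView, ← ite_not (j = i)]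
    refine Computes.someIf (a := bitsT) (α := fun γ => BV (P.bins (N γ))) (cα := fun _ => codeBV)
      _ fun _ => Computes.tab (a := .bool) hB ?_
    by_cases hij : i < j
    · simp only [hij, if_true]
      exact (hE j i).snd.snd.snd.fst
    · simp only [hij, if_false]
      exact (hE i j).snd.snd.snd.snd.fst
  have hvec : Computes cΓ fun γ => codeSlots
      (PKMPSU.mkView (X γ) (g γ) (pk γ) (TR γ) (CH γ) i).vec := by
    simp only [PKMPSU.mkView]
    by_cases hi : i = 0
    · simp only [hi, if_true]
      exact (hCH _).snd
    · simp only [hi, if_false]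
      exact (hCH _).snd
  exact hX.pair (htape.pair (hpks.pair (hshares.pair
    ((optPair fun j => tabPair (hrotS i j)).pair
    ((optBV fun j => tabBV (hrotR j i)).pair
    ((optPair fun j => tabPair (hmsgU j i)).pair
    ((optBV fun j => tabBV (hmsgV i j)).pair hvec)))))))

/-- The data type of the coins of the simulation. -/
abbrev simCoinsT : Ty :=
  .prod (.list (.list binCoinsT)) (.list (.prod chainCoinsT slotsT))

/-- The code of the coins of the simulation. -/
def codeSimCoins {n : ℕ} (r : SimCoins P k n) : simCoinsT.den :=
  (codeVec (codeVec codeBinCoins) r.1,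
    codeVec (fun κ => (codeChainCoins κ.1, codeSlots κ.2)) r.2)

theorem Computes.simViews (hS : S.Efficient) (hP : P.Efficient)
    (hN : Computes cΓ fun γ => unary (N γ)) {I : ∀ γ, Inputs P k (N γ)}
    (hseed : Computes cΓ fun γ => codeBV (I γ).seed)
    (hX : ∀ i ∈ C, Computes cΓ fun γ => codeSet (S.repM (N γ)) ((I γ).X i)) (h : Fin (k + 1))
    {y : ∀ γ, Slot P k (N γ) → Option (S.M (N γ))}
    (hy : Computes (b := .list (.list (.list bitsT))) cΓ fun γ =>
      codeVec (codeVec (S.codeMsg (N γ))) fun j b => y γ (j, b))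
    {g : ∀ γ, Fin (k + 1) → BV (S.genCoins (N γ))}
    (hg : ∀ i, Computes cΓ fun γ => codeBV (g γ i))
    {K : ∀ γ, S.PK (N γ)} (hK : Computes cΓ fun γ => S.codePK (N γ) (K γ))
    {F : ∀ γ, Fin (k + 1) → Fin (P.bins (N γ)) → Fin (k + 1) → BV (S.ctLen (N γ))}
    (hF : Computes (b := .list (.list (.list bitsT))) cΓ fun γ =>
      codeVec (codeVec (codeVec codeBV)) (F γ))
    {r : ∀ γ, SimCoins P k (N γ)} (hr : Computes cΓ fun γ => codeSimCoins (r γ)) :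
    Computes (b := viewsT) cΓ fun γ => PKMPSU.simViews C (I γ).seed (I γ).X h (y γ) (g γ)
      (programKeys (g γ) h (K γ)) (F γ) (r γ) := by
  have hgen := fun i => Computes.gen hS hN (hg i)
  have hpk : ∀ i, Computes cΓ fun γ => S.codePK (N γ) (programKeys (g γ) h (K γ) i) := by
    intro i
    by_cases hi : i = h
    · subst hi
      simp only [programKeys, Function.update_self]
      exact Computes.mul_prodPK hS hN hK _ fun i _ => hS.invPK.computes hN (hgen i).fst
    · simp only [programKeys, Function.update_of_ne hi]
      exact (hgen i).fst
  have hTR : Computes (b := .list (.list recordT)) cΓ fun γ => codeVec (codeVec codeRecord)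
      (PKMPSU.simRecords C (∏ i, programKeys (g γ) h (K γ) i) (I γ).seed (I γ).X (F γ)
        (r γ).1) := by
    simp only [prod_programKeys]
    exact Computes.simRecords hS hP hN hK hseed hX hF hr.fst
  have hleader : Computes cΓ fun γ => codeSlots (leaderOf
      (PKMPSU.simRecords C (∏ i, programKeys (g γ) h (K γ) i) (I γ).seed (I γ).X (F γ)
        (r γ).1)) := by
    have hB := hP.bins.computes hN
    refine Computes.ofVec (a := .list bitsT) (α := fun γ => Fin (P.bins (N γ)) → BV (S.ctLen (N γ)))
      (cα := fun _ => codeVec codeBV) fun j => ?_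
    refine Computes.tabVec (a := bitsT) (α := fun γ => BV (S.ctLen (N γ)))
      (cα := fun _ => codeBV) hB ?_
    have h1 := Computes.lookupVar (a := recordT)
      (α := fun γ => BV (S.encCoins (N γ)) × (Fin (k + 1) → Exch S (N γ)))
      (cα := fun _ => codeRecord) (Computes.entry (a := .list recordT)
      (α := fun γ => Fin (P.bins (N γ)) → BV (S.encCoins (N γ)) × (Fin (k + 1) → Exch S (N γ)))
      (cα := fun _ => codeVec codeRecord) hTR j.succ)
    exact (Computes.entry (a := exchT) (Γ := Σ γ, Fin (P.bins (N γ))) (α := fun x => Exch S (N x.1))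
      (cα := fun _ => codeExch) h1.snd 0).snd.snd.snd.snd.snd.snd.snd.snd
  have hCH := Computes.simVectors (C := C) hS hP hN hpk (fun i => (hgen i).snd) h hy hleader hr.snd
  exact Computes.ofVec (a := .list viewT) (α := fun γ => Option (View P k (N γ)))
    (cα := fun _ => codeOpt codeView) fun i => Computes.someIf (a := viewT)
      (α := fun γ => View P k (N γ)) (cα := fun _ => codeView) (i ∈ C) fun hi =>
      Computes.mkView hP hN (hX i hi) (hg i) hpk hTR hCH i

end ViewRules

/-! ### The simulator: sampling the coins -/

section CoinRules

variable {e a : Ty} {Γ : Type} {cΓ : Γ → e.den} {N : Γ → ℕ} {S : MKRScheme} {P : HashParams S}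
  {k : ℕ}

/-- Uniform samples are transported along bijections. -/
theorem Samples.unif_equiv {α β : Γ → Type} [∀ γ, Fintype (α γ)] [∀ γ, Nonempty (α γ)]
    [∀ γ, Fintype (β γ)] [∀ γ, Nonempty (β γ)] {cα : ∀ γ, α γ → a.den} {cβ : ∀ γ, β γ → a.den}
    (E : ∀ γ, α γ ≃ β γ) (hE : ∀ γ x, cβ γ (E γ x) = cα γ x)
    (h : Samples cΓ fun γ => (uniformOfFintype (α γ)).map (cα γ)) :
    Samples cΓ fun γ => (uniformOfFintype (β γ)).map (cβ γ) :=
  h.congr fun γ => by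
    rw [← uniform_map_equiv (E γ), PMF.map_comp]
    congr 1
    funext x
    exact (hE γ x).symm

theorem Samples.unif_pair {L : Γ → ℕ} (hL : Computes cΓ fun γ => unary (L γ)) :
    Samples (b := .prod bitsT bitsT) cΓ fun γ =>
      (uniformOfFintype (Bool → BV (L γ))).map codePair :=
  Samples.unif_equiv (α := fun γ => BV (L γ) × BV (L γ)) (β := fun γ => Bool → BV (L γ))
    (cα := fun _ x => (codeBV x.1, codeBV x.2)) (cβ := fun _ => codePair)
    (fun _ => (Equiv.boolArrowEquivProd _).symm) (fun _ _ => rfl)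
    (Samples.unif_prod (Samples.unif_BV hL) (Samples.unif_BV hL))

theorem Samples.pairCoins (hS : S.Efficient) (hN : Computes cΓ fun γ => unary (N γ)) :
    Samples cΓ fun γ => (uniformOfFintype (PairCoins S (N γ))).map codePairCoins := by
  have h1 := Samples.unif_BV (hS.encCoins.computes hN)
  have h2 := Samples.unif_BV (hS.reCoins.computes hN)
  have h3 : Samples (b := .bool) cΓ fun _ => (uniformOfFintype Bool).map fun x => x :=
    Samples.bool.congr fun _ => (PMF.map_id _).symm
  have h4 := Samples.unif_pair (hS.ctLen.computes hN)
  exact Samples.unif_prod h1 (Samples.unif_prod h2 (Samples.unif_prod h2 (Samples.unif_prod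
    (a := .bool) h3 h4)))

theorem Samples.binCoins (hS : S.Efficient) (hN : Computes cΓ fun γ => unary (N γ)) :
    Samples cΓ fun γ => (uniformOfFintype (BinCoins S k (N γ))).map codeBinCoins :=
  Samples.unif_prod (Samples.unif_BV (hS.encCoins.computes hN))
    (Samples.unif_table (a := pairCoinsT) (α := fun γ => PairCoins S (N γ))
      (cα := fun _ => codePairCoins) (L := fun _ => k + 1) (Computes.const _)
      (Samples.pairCoins hS hN))

/-- The concatenation of a fixed number of tables. -/
theorem Computes.flatten {m : ℕ} {L : Γ → ℕ} {v : Fin m → ∀ γ, Fin (L γ) → a.den}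
    (hL : Computes cΓ fun γ => unary (L γ))
    (hv : ∀ j, Computes (e := .prod e unaryT) (fun x : Σ γ, Fin (L γ) => (cΓ x.1, codeFin x.2))
      fun x => v j x.1 x.2) :
    Computes (b := .list a) cΓ fun γ => (List.ofFn fun j => List.ofFn (v j γ)).flatten := by
  induction m with
  | zero => exact Computes.nil.congr fun γ => by simp
  | succ m ih =>
    exact (Computes.tab_append hL (hv 0) (ih fun j => hv j.succ)).congr fun γ => by
      rw [List.ofFn_succ, List.flatten_cons]

/-- Splitting a list into rows of equal length. -/
theorem Computes.rows {m : ℕ} {L : Γ → ℕ} {α : Γ → Type} {cα : ∀ γ, α γ → a.den}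
    {v : ∀ γ, Fin (m * L γ) → α γ} (hL : Computes cΓ fun γ => unary (L γ))
    (hv : Computes (b := .list a) cΓ fun γ => codeVec (cα γ) (v γ)) :
    Computes (b := .list (.list a)) cΓ fun γ =>
      codeVec (codeVec (cα γ)) fun j b => v γ (finProdFinEquiv (j, b)) := by
  refine Computes.ofVec (a := .list a) (α := fun γ => Fin (L γ) → α γ)
    (cα := fun γ => codeVec (cα γ)) fun j => Computes.tabVec (a := a) hL ?_
  have hv' : Computes (e := .prod e unaryT) (b := .list a)
      (fun x : Σ γ, Fin (L γ) => (cΓ x.1, codeFin x.2)) fun x => codeVec (cα x.1) (v x.1) :=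
    hv.weaken
  have hL' : Computes (e := .prod e unaryT)
      (fun x : Σ γ, Fin (L γ) => (cΓ x.1, codeFin x.2)) fun x => unary (L x.1) := hL.weaken
  have hi : Computes (e := .prod e unaryT)
      (fun x : Σ γ, Fin (L γ) => (cΓ x.1, codeFin x.2)) fun x => codeFin x.2 := Computes.var
  refine Computes.lookup (Γ := Σ γ, Fin (L γ)) (α := fun x => α x.1) (cα := fun x => cα x.1)
    (L := fun x => m * L x.1) (v := fun x => v x.1) (i := fun x => finProdFinEquiv (j, x.2)) hv' ?_
  exact (Computes.uadd (i := fun x => (x.2 : ℕ)) hi (hL'.umul j)).congr fun x => by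
    rw [Nat.mul_comm]
    rfl

/-- A uniformly random permutation of the positions, as the table of its values. -/
theorem Samples.perm (hB : Computes cΓ fun γ => unary (P.bins (N γ))) :
    Samples (b := .list (.list (.prod unaryT unaryT))) cΓ fun γ =>
      (uniformOfFintype (Equiv.Perm (Slot P k (N γ)))).map fun π =>
        codeVec (codeVec codeSlot) fun j b => π (j, b) := by
  have h1 : Computes (b := .list (.prod unaryT unaryT)) cΓ fun γ =>
      List.ofFn fun i : Fin (k * P.bins (N γ)) =>
        (codeSlot (finProdFinEquiv.symm i) : (Ty.prod unaryT unaryT).den) := by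
    refine (Computes.flatten (a := .prod unaryT unaryT) (m := k) (L := fun γ => P.bins (N γ))
      (v := fun j _ b => (codeFin j, codeFin b)) hB
      fun j => (Computes.const (codeFin j)).pair Computes.var).congr fun γ => ?_
    rw [List.ofFn_mul]
    refine congrArg _ (congrArg _ (funext fun j => congrArg _ (funext fun b => ?_)))
    have : (⟨j * P.bins (N γ) + b, by
        exact (Nat.add_lt_add_left b.prop _).trans_le ((Nat.succ_mul _ _).symm.trans_le
          (Nat.mul_le_mul_right _ j.prop))⟩ : Fin (k * P.bins (N γ))) =
        finProdFinEquiv (j, b) := Fin.ext (by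
      simp only [finProdFinEquiv_apply_val]
      rw [Nat.mul_comm, Nat.add_comm])
    rw [this, Equiv.symm_apply_apply]
    rfl
  have h2 := Samples.shuffle (a := .prod unaryT unaryT) h1
  have h3 : Samples (b := .list (.prod unaryT unaryT)) cΓ fun γ =>
      (uniformOfFintype (Equiv.Perm (Slot P k (N γ)))).map fun π =>
        codeVec (codeSlot (P := P)) fun i => π (finProdFinEquiv.symm i) := by
    refine Samples.unif_equiv (α := fun γ => Equiv.Perm (Fin (k * P.bins (N γ))))
      (β := fun γ => Equiv.Perm (Slot P k (N γ))) (a := .list (.prod unaryT unaryT))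
      (cβ := fun γ π => codeVec (codeSlot (P := P)) fun i => π (finProdFinEquiv.symm i))
      (fun _ => Equiv.permCongr finProdFinEquiv.symm) (fun γ s => ?_) h2
    refine congrArg List.ofFn (funext fun i => ?_)
    show codeSlot (finProdFinEquiv.symm.permCongr s (finProdFinEquiv.symm i)) = _
    rw [Equiv.permCongr_apply, Equiv.symm_symm, Equiv.apply_symm_apply]
  refine (Samples.map (β := fun γ => Equiv.Perm (Slot P k (N γ))) (b := .list (.prod unaryT unaryT))
    (cβ := fun γ π => codeVec (codeSlot (P := P)) fun i => π (finProdFinEquiv.symm i))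
    (p := fun γ => uniformOfFintype (Equiv.Perm (Slot P k (N γ))))
    (v := fun γ π => codeVec (codeVec codeSlot) fun j b =>
      π (finProdFinEquiv.symm (finProdFinEquiv (j, b)))) h3 ?_).congr fun γ => by
        simp only [Equiv.symm_apply_apply]
  exact Computes.rows (Γ := Σ γ, Equiv.Perm (Slot P k (N γ))) (a := .prod unaryT unaryT)
    (L := fun x => P.bins (N x.1)) (α := fun x => Slot P k (N x.1)) (cα := fun _ => codeSlot)
    (v := fun x i => x.2 (finProdFinEquiv.symm i)) hB.weaken Computes.var

/-- Uniform tables indexed by the positions of the leader's vector. -/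
theorem Samples.slotTable {L : Γ → ℕ} (hB : Computes cΓ fun γ => unary (P.bins (N γ)))
    (hL : Computes cΓ fun γ => unary (L γ)) :
    Samples cΓ fun γ => (uniformOfFintype (Slot P k (N γ) → BV (L γ))).map codeSlots :=
  Samples.unif_equiv (α := fun γ => Fin k → Fin (P.bins (N γ)) → BV (L γ))
    (β := fun γ => Slot P k (N γ) → BV (L γ))
    (cα := fun _ => codeVec (codeVec codeBV)) (cβ := fun _ => codeSlots)
    (fun _ => (Equiv.curry _ _ _).symm) (fun _ _ => rfl)
    (Samples.unif_table (a := .list bitsT) (L := fun _ => k)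
      (α := fun γ => Fin (P.bins (N γ)) → BV (L γ)) (cα := fun _ => codeVec codeBV)
      (Computes.const _) (Samples.unif_table (a := bitsT) (α := fun γ => BV (L γ))
        (cα := fun _ => codeBV) hB (Samples.unif_BV hL)))

theorem Samples.simCoins (hS : S.Efficient) (hP : P.Efficient)
    (hN : Computes cΓ fun γ => unary (N γ)) :
    Samples cΓ fun γ => (uniformOfFintype (SimCoins P k (N γ))).map codeSimCoins := by
  have hB := hP.bins.computes hN
  have h1 := Samples.unif_table (a := .list binCoinsT) (L := fun _ => k + 1)
    (α := fun γ => Fin (P.bins (N γ)) → BinCoins S k (N γ)) (cα := fun _ => codeVec codeBinCoins)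
    (Computes.const _) (Samples.unif_table (a := binCoinsT) (α := fun γ => BinCoins S k (N γ))
      (cα := fun _ => codeBinCoins) hB (Samples.binCoins hS hN))
  have h2 : Samples cΓ fun γ => (uniformOfFintype (ChainCoins P k (N γ))).map codeChainCoins :=
    Samples.unif_prod (a := .list (.list (.prod unaryT unaryT)))
      (α := fun γ => Equiv.Perm (Slot P k (N γ)))
      (cα := fun γ π => codeVec (codeVec codeSlot) fun j b => π (j, b)) (Samples.perm hB)
      (Samples.unif_prod (Samples.slotTable (k := k) hB (hS.parCoins.computes hN))
        (Samples.slotTable (k := k) hB (hS.reCoins.computes hN)))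
  have h3 := Samples.unif_prod h2 (Samples.slotTable (P := P) (k := k) hB (hS.encCoins.computes hN))
  exact Samples.unif_prod h1 (Samples.unif_table (a := .prod chainCoinsT slotsT)
    (L := fun _ => k + 1)
    (α := fun γ => ChainCoins P k (N γ) × (Slot P k (N γ) → BV (S.encCoins (N γ))))
    (cα := fun _ κ => (codeChainCoins κ.1, codeSlots κ.2)) (Computes.const _) h3)

/-- The core of the simulator: the views from the joint key and the encryptions under it. -/
theorem Samples.simFrom {C : Finset (Fin (k + 1))} (hS : S.Efficient) (hP : P.Efficient)
    (hN : Computes cΓ fun γ => unary (N γ)) {I : ∀ γ, Inputs P k (N γ)}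
    (hseed : Computes cΓ fun γ => codeBV (I γ).seed)
    (hX : ∀ i ∈ C, Computes cΓ fun γ => codeSet (S.repM (N γ)) ((I γ).X i)) (h : Fin (k + 1))
    {y : ∀ γ, Slot P k (N γ) → Option (S.M (N γ))}
    (hy : Computes (b := .list (.list (.list bitsT))) cΓ fun γ =>
      codeVec (codeVec (S.codeMsg (N γ))) fun j b => y γ (j, b))
    {K : ∀ γ, S.PK (N γ)} (hK : Computes cΓ fun γ => S.codePK (N γ) (K γ))
    {F : ∀ γ, Fin (k + 1) → Fin (P.bins (N γ)) → Fin (k + 1) → BV (S.ctLen (N γ))}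
    (hF : Computes (b := .list (.list (.list bitsT))) cΓ fun γ =>
      codeVec (codeVec (codeVec codeBV)) (F γ)) :
    Samples cΓ fun γ => simFrom C (I γ) h (y γ) (K γ) (F γ) := by
  let β : Γ → Type := fun γ => (Fin (k + 1) → BV (S.genCoins (N γ))) × SimCoins P k (N γ)
  have h1 : Samples (b := .prod (.list bitsT) simCoinsT) cΓ fun γ =>
      (uniformOfFintype (β γ)).map fun r => (codeVec codeBV r.1, codeSimCoins r.2) :=
    Samples.unif_prod (Samples.unif_table (a := bitsT) (α := fun γ => BV (S.genCoins (N γ)))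
      (L := fun _ => k + 1) (cα := fun _ => codeBV) (Computes.const _)
      (Samples.unif_BV (hS.genCoins.computes hN))) (Samples.simCoins hS hP hN)
  refine Samples.map (β := β) (b := .prod (.list bitsT) simCoinsT)
    (p := fun γ => uniformOfFintype (β γ)) 
    (cβ := fun γ r => (codeVec codeBV r.1, codeSimCoins r.2)) h1 ?_
  have hr : Computes (e := .prod e (.prod (.list bitsT) simCoinsT))
      (b := .prod (.list bitsT) simCoinsT)
      (fun x : Σ γ, β γ => (cΓ x.1, (codeVec codeBV x.2.1, codeSimCoins x.2.2)))
      fun x => (codeVec codeBV x.2.1, codeSimCoins x.2.2) := Computes.var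
  exact Computes.simViews (Γ := Σ γ, β γ) (N := fun x => N x.1) (I := fun x => I x.1)
    (y := fun x => y x.1) (g := fun x => x.2.1) (K := fun x => K x.1) (F := fun x => F x.1)
    (r := fun x => x.2.2) hS hP hN.weaken hseed.weaken (fun i hi => (hX i hi).weaken) h hy.weaken
    (fun i => Computes.entry (a := bitsT) (Γ := Σ γ, β γ) (α := fun x => BV (S.genCoins (N x.1)))
      (cα := fun _ => codeBV) hr.fst i) hK.weaken hF.weaken hr.snd

end CoinRules

/-! ### The simulator and the reduction -/

section Listing

variable {S : MKRScheme} {n k : ℕ} {P : HashParams S}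

theorem codeM_injective : Function.Injective (S.codeM n) := fun _ _ h =>
  (S.repM n).injective (List.ofFn_injective h)

/-- The codes of the elements of the union outside of the leader's set, as they are computed. -/
def restCodes (I : Inputs P k n) : List bitsT.den :=
  ((codeSet (S.repM n) (funcMPSU I.X)).filter (· ∉ codeSet (S.repM n) (I.X 0))).reverse

theorem Enumerates.card_le {ι M : Type} [Fintype ι] {y : ι → Option M} {D : Finset M}
    (hy : Enumerates y D) : D.card ≤ Fintype.card ι := by
  classical
  have h : ∀ a : D, ∃ s, y s = some a.1 := fun a => (hy.2 a.1 a.2).exists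
  choose f hf using h
  rw [← Fintype.card_coe]
  exact Fintype.card_le_of_injective f fun a a' haa => Subtype.ext
    (Option.some_injective _ ((hf a).symm.trans ((congrArg y haa).trans (hf a'))))

/-- The computed codes, filled up with `⊥`, encode a listing of the union outside of the leader's
set. -/
theorem exists_listing (I : Inputs P k n) : ∃ y : Slot P k n → Option (S.M n),
    Enumerates y (funcMPSU I.X \ I.X 0) ∧
      ∀ s, S.codeMsg n (y s) = ((restCodes I)[(finProdFinEquiv s : ℕ)]?).toList := by
  obtain ⟨L, hL⟩ : restCodes I ∈ Set.range (List.map (S.codeM n)) := by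
    rw [Set.range_list_map]
    intro c hc
    unfold restCodes at hc
    rw [List.mem_reverse, List.mem_filter, codeSet, Finset.mem_sort, Finset.mem_image] at hc
    obtain ⟨⟨a, _, ha⟩, _⟩ := hc
    exact ⟨a, ha⟩
  have hnodup : L.Nodup := by
    refine List.Nodup.of_map (S.codeM n) ?_
    rw [hL]
    exact List.nodup_reverse.2 ((Finset.sort_nodup _ _).filter _)
  have hmem : ∀ a, a ∈ L ↔ a ∈ funcMPSU I.X \ I.X 0 := by
    intro a
    rw [← List.mem_map_of_injective codeM_injective, hL, restCodes, List.mem_reverse,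
      List.mem_filter, Finset.mem_sdiff, decide_eq_true_eq, mem_codeSet, mem_codeSet]
  have hlen : L.length ≤ k * P.bins n := by
    have h1 : L.toFinset = funcMPSU I.X \ I.X 0 := by
      ext a
      rw [List.mem_toFinset, hmem]
    rw [← List.toFinset_card_of_nodup hnodup, h1]
    refine (enumerates_finalMsg I).card_le.trans (le_of_eq ?_)
    simp
  refine ⟨fun s => L[(finProdFinEquiv s : ℕ)]?, ⟨fun s a h => (hmem a).1 (List.mem_of_getElem? h),
    fun a ha => ?_⟩, fun s => ?_⟩
  · obtain ⟨i, hi, rfl⟩ := List.getElem_of_mem ((hmem a).2 ha)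
    refine ⟨finProdFinEquiv.symm ⟨i, hi.trans_le hlen⟩, ?_, fun s hs => ?_⟩
    · simp only [Equiv.apply_symm_apply]
      exact List.getElem?_eq_getElem hi
    · rw [Equiv.eq_symm_apply]
      refine Fin.ext ?_
      beta_reduce at hs
      rw [← List.getElem?_eq_getElem hi] at hs
      exact ((List.getElem?_inj hi hnodup).1 hs.symm).symm
  · unfold MKRScheme.codeMsg codeOpt
    rw [← hL, List.getElem?_map]

/-- The plaintexts that the simulator fills into the vector: the elements of the union outside of
the leader's set, if the simulator knows the union. -/
noncomputable def fillPlain (C : Finset (Fin (k + 1))) (I : Inputs P k n) :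
    Slot P k n → Option (S.M n) :=
  if 0 ∈ C then (exists_listing I).choose else fun _ => none

theorem enumerates_fillPlain {C : Finset (Fin (k + 1))} (hC : 0 ∈ C) (I : Inputs P k n) :
    Enumerates (fillPlain C I) (funcMPSU I.X \ I.X 0) := by
  rw [fillPlain, if_pos hC]
  exact (exists_listing I).choose_spec.1

/-- The input of the simulator. -/
def simIn (C : Finset (Fin (k + 1))) (I : Inputs P k n) : simInT.den :=
  (unary n, (codeBV I.seed,
    (codeVec (codeOpt (codeSet (S.repM n))) (fun i => if i ∈ C then some (I.X i) else none),
      codeOutput S n (0 ∈ C) (funcMPSU I.X))))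

end Listing

section EncTables

variable {P : HashParams S} {k n : ℕ} {α : Type}

/-- The number of ciphertexts that the simulation replaces. -/
abbrev encCount {S : MKRScheme} (P : HashParams S) (k n : ℕ) : ℕ := (k + 1) * ((k + 1) * P.bins n)

/-- Tables with an entry for each party `j`, bin and party `i`, as tuples. -/
def encTableEquiv : (Fin (encCount P k n) → α) ≃
    (Fin (k + 1) → Fin (P.bins n) → Fin (k + 1) → α) where
  toFun F j b i := F (finProdFinEquiv (j, finProdFinEquiv (i, b)))
  invFun T t := T (finProdFinEquiv.symm t).1
    (finProdFinEquiv.symm (finProdFinEquiv.symm t).2).2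
    (finProdFinEquiv.symm (finProdFinEquiv.symm t).2).1
  left_inv F := by
    funext t
    show F (finProdFinEquiv ((finProdFinEquiv.symm t).1, finProdFinEquiv
      (finProdFinEquiv.symm (finProdFinEquiv.symm t).2))) = F t
    rw [Equiv.apply_symm_apply]
    show F (finProdFinEquiv (finProdFinEquiv.symm t)) = F t
    rw [Equiv.apply_symm_apply]
  right_inv T := by
    funext j b i
    simp only [Equiv.symm_apply_apply]

/-- A public key and encryptions under it of given messages. -/
noncomputable def keyEncs (S : MKRScheme) (n : ℕ) {q : ℕ} (msgs : Fin q → Option (S.M n)) :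
    PMF (S.PK n × (Fin q → BV (S.ctLen n))) :=
  (uniformOfFintype (BV (S.genCoins n) × (Fin q → BV (S.encCoins n)))).map fun ω =>
    ((S.gen n ω.1).1, fun i => S.enc n (S.gen n ω.1).1 (msgs i) (ω.2 i))

theorem multiEncDist_eq (S : MKRScheme) (n : ℕ) {q : ℕ} (msgs : Fin q → Option (S.M n)) :
    S.multiEncDist n msgs =
      (keyEncs S n msgs).map fun x => (S.codePK n x.1, codeVec codeBV x.2) := by
  rw [keyEncs, PMF.map_comp]
  rfl

/-- A key and a table of encryptions under it, as the experiment of multiple encryptions. -/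
theorem bind_keyEncs {β : Type} (msgs : Fin (k + 1) → Fin (P.bins n) → Fin (k + 1) → Option (S.M n))
    (G : S.PK n → (Fin (k + 1) → Fin (P.bins n) → Fin (k + 1) → BV (S.ctLen n)) → PMF β) :
    ((uniformOfFintype (BV (S.genCoins n) × EncTable P k n)).bind fun r =>
      G (S.gen n r.1).1 fun j b i => S.enc n (S.gen n r.1).1 (msgs j b i) (r.2 j b i)) =
    (keyEncs S n (encTableEquiv.symm msgs)).bind fun x => G x.1 (encTableEquiv x.2) := by
  rw [keyEncs, PMF.bind_map, ← uniform_map_equiv ((Equiv.refl (BV (S.genCoins n))).prodCongr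
    (encTableEquiv (P := P) (k := k) (n := n) (α := BV (S.encCoins n)))), PMF.bind_map]
  congr 1
  funext ω
  simp only [Function.comp]
  refine congrArg (G _) (funext fun j => funext fun b => funext fun i => ?_)
  have h : msgs j b i = encTableEquiv.symm msgs (finProdFinEquiv (j, finProdFinEquiv (i, b))) := by
    conv_lhs => rw [← encTableEquiv.apply_symm_apply msgs]
    rfl
  rw [h]
  rfl

end EncTables

section Programs

variable {e : Ty} {Γ : Type} {cΓ : Γ → e.den} {N : Γ → ℕ} {S : MKRScheme} {P : HashParams S}
  {k : ℕ} {C : Finset (Fin (k + 1))}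

theorem Computes.encCount (hP : P.Efficient) (hN : Computes cΓ fun γ => unary (N γ)) :
    Computes cΓ fun γ => unary (encCount P k (N γ)) :=
  ((hP.bins.computes hN).umul (k + 1)).umul (k + 1)

theorem Computes.encTable {L : Γ → ℕ} (hP : P.Efficient) (hN : Computes cΓ fun γ => unary (N γ))
    {F : ∀ γ, Fin (PKMPSU.encCount P k (N γ)) → BV (L γ)}
    (hF : Computes (b := .list bitsT) cΓ fun γ => codeVec codeBV (F γ)) :
    Computes (b := .list (.list (.list bitsT))) cΓ fun γ =>
      codeVec (codeVec (codeVec codeBV)) (encTableEquiv (F γ)) := by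
  have hB := hP.bins.computes hN
  have h1 := Computes.rows (a := bitsT) (m := k + 1) (L := fun γ => (k + 1) * P.bins (N γ))
    (α := fun γ => BV (L γ)) (cα := fun _ => codeBV) (v := F) (hB.umul (k + 1)) hF
  refine Computes.ofVec (a := .list (.list bitsT))
    (α := fun γ => Fin (P.bins (N γ)) → Fin (k + 1) → BV (L γ))
    (cα := fun _ => codeVec (codeVec codeBV)) fun j => ?_
  have h2 := Computes.rows (a := bitsT) (m := k + 1) (L := fun γ => P.bins (N γ))
    (α := fun γ => BV (L γ)) (cα := fun _ => codeBV)
    (v := fun γ u => F γ (finProdFinEquiv (j, u))) hB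
    (Computes.entry (a := .list bitsT) (α := fun γ => Fin ((k + 1) * P.bins (N γ)) → BV (L γ))
      (cα := fun _ => codeVec codeBV) (v := fun γ j u => F γ (finProdFinEquiv (j, u))) h1 j)
  refine Computes.tabVec (a := .list bitsT) (α := fun γ => Fin (k + 1) → BV (L γ))
    (cα := fun _ => codeVec codeBV) hB ?_
  refine Computes.ofVec (a := bitsT) (Γ := Σ γ, Fin (P.bins (N γ))) (α := fun x => BV (L x.1))
    (cα := fun _ => codeBV) fun i => ?_
  exact Computes.lookupVar (a := bitsT) (α := fun γ => BV (L γ)) (cα := fun _ => codeBV)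
    (v := fun γ b => F γ (finProdFinEquiv (j, finProdFinEquiv (i, b))))
    (Computes.entry (a := .list bitsT) (α := fun γ => Fin (P.bins (N γ)) → BV (L γ))
      (cα := fun _ => codeVec codeBV)
      (v := fun γ i b => F γ (finProdFinEquiv (j, finProdFinEquiv (i, b)))) h2 i)

theorem Samples.keyEncs (hS : S.Efficient) (hN : Computes cΓ fun γ => unary (N γ)) {q : Γ → ℕ}
    (hq : Computes cΓ fun γ => unary (q γ)) :
    Samples (b := .prod bitsT (.list bitsT)) cΓ fun γ =>
      (keyEncs S (N γ) fun _ : Fin (q γ) => none).map fun x =>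
        (S.codePK (N γ) x.1, codeVec codeBV x.2) := by
  let β : Γ → Type := fun γ => BV (S.genCoins (N γ)) × (Fin (q γ) → BV (S.encCoins (N γ)))
  have h1 : Samples (b := .prod bitsT (.list bitsT)) cΓ fun γ =>
      (uniformOfFintype (β γ)).map fun ω => (codeBV ω.1, codeVec codeBV ω.2) :=
    Samples.unif_prod (Samples.unif_BV (hS.genCoins.computes hN))
      (Samples.unif_table (a := bitsT) (α := fun γ => BV (S.encCoins (N γ)))
        (cα := fun _ => codeBV) hq (Samples.unif_BV (hS.encCoins.computes hN)))
  have hω : Computes (e := .prod e (.prod bitsT (.list bitsT))) (b := .prod bitsT (.list bitsT))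
      (fun x : Σ γ, β γ => (cΓ x.1, (codeBV x.2.1, codeVec codeBV x.2.2)))
      fun x => (codeBV x.2.1, codeVec codeBV x.2.2) := Computes.var
  have hN' : Computes (e := .prod e (.prod bitsT (.list bitsT)))
      (fun x : Σ γ, β γ => (cΓ x.1, (codeBV x.2.1, codeVec codeBV x.2.2)))
      fun x => unary (N x.1) := hN.weaken
  have hpk := (Computes.gen hS hN' hω.fst).fst
  refine (Samples.map (β := β) (b := .prod bitsT (.list bitsT)) (d := .prod bitsT (.list bitsT))
    (p := fun γ => uniformOfFintype (β γ))
    (cβ := fun γ ω => (codeBV ω.1, codeVec codeBV ω.2))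
    (v := fun γ ω => (S.codePK (N γ) (S.gen (N γ) ω.1).1, codeVec codeBV fun i =>
      S.enc (N γ) (S.gen (N γ) ω.1).1 none (ω.2 i))) h1 (hpk.pair ?_)).congr fun γ => by
        rw [PKMPSU.keyEncs, PMF.map_comp]
        rfl
  refine Computes.tabVec (a := bitsT) (Γ := Σ γ, β γ) (L := fun x => q x.1)
    (α := fun x => BV (S.ctLen (N x.1))) (cα := fun _ => codeBV) hq.weaken ?_
  exact Computes.enc hS hN'.weaken hpk.weaken (x := fun _ => none) Computes.nil
    (Computes.lookupVar (a := bitsT) (Γ := Σ γ, β γ) (α := fun x => BV (S.encCoins (N x.1)))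
      (cα := fun _ => codeBV) hω.snd)

variable {I : ∀ γ, Inputs P k (N γ)}

theorem Computes.fillPlain (hP : P.Efficient) (hN : Computes cΓ fun γ => unary (N γ))
    (hU : 0 ∈ C → Computes cΓ fun γ => codeSet (S.repM (N γ)) (funcMPSU (I γ).X))
    (hX : 0 ∈ C → Computes cΓ fun γ => codeSet (S.repM (N γ)) ((I γ).X 0)) :
    Computes (b := .list (.list (.list bitsT))) cΓ fun γ =>
      codeVec (codeVec (S.codeMsg (N γ))) fun j b => fillPlain C (I γ) (j, b) := by
  have hB := hP.bins.computes hN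
  by_cases hC : 0 ∈ C
  · have hl : Computes (b := .list bitsT) cΓ fun γ => restCodes (I γ) :=
      Computes.sdiff (hU hC) (hX hC)
    refine Computes.ofVec (a := .list (.list bitsT))
      (α := fun γ => Fin (P.bins (N γ)) → Option (S.M (N γ)))
      (cα := fun γ => codeVec (S.codeMsg (N γ))) fun j => ?_
    refine Computes.tabVec (a := .list bitsT) (α := fun γ => Option (S.M (N γ)))
      (cα := fun γ => S.codeMsg (N γ)) hB ?_
    have hi : Computes (e := .prod e unaryT)
        (fun x : Σ γ, Fin (P.bins (N γ)) => (cΓ x.1, codeFin x.2)) fun x => codeFin x.2 :=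
      Computes.var
    have hB' : Computes (e := .prod e unaryT)
        (fun x : Σ γ, Fin (P.bins (N γ)) => (cΓ x.1, codeFin x.2))
        fun x => unary (P.bins (N x.1)) := hB.weaken
    have hd := Computes.drop (a := bitsT)
      (Computes.uadd (i := fun x : Σ γ, Fin (P.bins (N γ)) => (x.2 : ℕ)) hi (hB'.umul j)) hl.weaken
    refine (Computes.caseList (c := .list bitsT) (v := fun _ c _ => [c]) hd Computes.nil
      (Computes.cons (Computes.fst (Computes.snd Computes.self)) Computes.nil)).congr fun x => ?_
    rw [PKMPSU.fillPlain, if_pos hC, (exists_listing (I x.1)).choose_spec.2,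
      finProdFinEquiv_apply_val, Nat.mul_comm, ← List.head?_drop]
    generalize (restCodes (I x.1)).drop _ = l
    cases l <;> rfl
  · refine Computes.slotTab (a := .list bitsT) (α := fun γ => Option (S.M (N γ)))
      (cα := fun γ => S.codeMsg (N γ)) (v := fun γ => PKMPSU.fillPlain C (I γ)) hB ?_
    simp only [PKMPSU.fillPlain, if_neg hC]
    exact Computes.nil

/-- The core of the simulator, from the input of the simulator, a joint key and encryptions under
it. -/
theorem Samples.simFrom_simIn (hS : S.Efficient) (hP : P.Efficient)
    (hin : Computes cΓ fun γ => simIn C (I γ)) (h : Fin (k + 1))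
    {K : ∀ γ, S.PK (N γ)} (hK : Computes cΓ fun γ => S.codePK (N γ) (K γ))
    {F : ∀ γ, Fin (PKMPSU.encCount P k (N γ)) → BV (S.ctLen (N γ))}
    (hF : Computes (b := .list bitsT) cΓ fun γ => codeVec codeBV (F γ)) :
    Samples cΓ fun γ =>
      PKMPSU.simFrom C (I γ) h (fillPlain C (I γ)) (K γ) (encTableEquiv (F γ)) := by
  have hN : Computes cΓ fun γ => unary (N γ) := hin.fst
  have hX : ∀ i ∈ C, Computes cΓ fun γ => codeSet (S.repM (N γ)) ((I γ).X i) := fun i hi =>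
    (Computes.headD (Computes.entry (a := .list (.list bitsT))
      (α := fun γ => Option (Finset (S.M (N γ)))) (cα := fun γ => codeOpt (codeSet (S.repM (N γ))))
      hin.snd.snd.fst i)).congr fun γ => by
        simp [hi, codeOpt]
  have hU : 0 ∈ C → Computes cΓ fun γ => codeSet (S.repM (N γ)) (funcMPSU (I γ).X) := fun h0 =>
    (Computes.headD (a := .list bitsT) hin.snd.snd.snd).congr fun γ => by
      simp [simIn, codeOutput, h0]
  exact Samples.simFrom hS hP hN hin.snd.fst hX h (Computes.fillPlain hP hN hU (hX 0)) hK
    (Computes.encTable hP hN hF)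

/-- The simulator: it encrypts the dummy message only. -/
theorem exists_simulator (hS : S.Efficient) (hP : P.Efficient) (C : Finset (Fin (k + 1)))
    (h : Fin (k + 1)) :
    ∃ sim : Tm simInT viewsT, sim.PolyTime ∧ ∀ n (I : Inputs P k n), sim.run (simIn C I) =
      (keyEncs S n fun _ : Fin (encCount P k n) => none).bind fun x =>
        simFrom C I h (fillPlain C I) x.1 (encTableEquiv x.2) := by
  let Γ := Σ n, Inputs P k n
  let cΓ : Γ → simInT.den := fun γ => simIn C γ.2
  have hin : Computes cΓ fun γ => simIn C γ.2 := Computes.self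
  let β : Γ → Type := fun γ => S.PK γ.1 × (Fin (encCount P k γ.1) → BV (S.ctLen γ.1))
  have hx : Computes (e := .prod simInT (.prod bitsT (.list bitsT))) (b := .prod bitsT (.list bitsT))
      (fun x : Σ γ, β γ => (cΓ x.1, (S.codePK x.1.1 x.2.1, codeVec codeBV x.2.2)))
      fun x => (S.codePK x.1.1 x.2.1, codeVec codeBV x.2.2) := Computes.var
  have hs := Samples.bind (β := β) (b := .prod bitsT (.list bitsT))
    (cβ := fun γ x => (S.codePK γ.1 x.1, codeVec codeBV x.2))
    (p := fun γ => keyEncs S γ.1 fun _ : Fin (encCount P k γ.1) => none)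
    (q := fun γ x => simFrom C γ.2 h (fillPlain C γ.2) x.1 (encTableEquiv x.2))
    (Samples.keyEncs hS hin.fst (Computes.encCount hP hin.fst))
    (Samples.simFrom_simIn (Γ := Σ γ, β γ) (N := fun x => x.1.1) (I := fun x => x.1.2)
      (K := fun x => x.2.1) (F := fun x => x.2.2) hS hP hin.weaken h hx.fst hx.snd)
  obtain ⟨t, ht, hrun⟩ := hs
  exact ⟨t, ht, fun n I => hrun ⟨n, I⟩⟩

/-- The reduction: from a distinguisher of views, one of encryptions. It receives the inputs as
advice. -/
theorem exists_reduction (hS : S.Efficient) (hP : P.Efficient) (C : Finset (Fin (k + 1)))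
    (h : Fin (k + 1)) {c : Ty} (D : Tm (.prod unaryT (.prod c jointT)) .bool) (hD : D.PolyTime) :
    ∃ D' : Tm (.prod unaryT (.prod (.prod c (.prod simInT (.list (.list bitsT))))
        (.prod bitsT (.list bitsT)))) .bool, D'.PolyTime ∧
      ∀ n (I : Inputs P k n) (z : c.den) (o : (Ty.list (.list bitsT)).den) (K : S.PK n)
        (F : Fin (encCount P k n) → BV (S.ctLen n)),
        D'.run (unary n, ((z, (simIn C I, o)), (S.codePK n K, codeVec codeBV F))) =
          (simFrom C I h (fillPlain C I) K (encTableEquiv F)).bind fun V =>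
            D.run (unary n, (z, (V, o))) := by
  let Γ := Σ n, Inputs P k n × c.den × (Ty.list (.list bitsT)).den × S.PK n ×
    (Fin (encCount P k n) → BV (S.ctLen n))
  let E : Ty := .prod unaryT (.prod (.prod c (.prod simInT (.list (.list bitsT))))
    (.prod bitsT (.list bitsT)))
  let cΓ : Γ → E.den := fun γ => (unary γ.1, ((γ.2.2.1, (simIn C γ.2.1, γ.2.2.2.1)),
    (S.codePK γ.1 γ.2.2.2.2.1, codeVec codeBV γ.2.2.2.2.2)))
  have hself : Computes (b := E) cΓ fun γ => (unary γ.1, ((γ.2.2.1, (simIn C γ.2.1, γ.2.2.2.1)),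
    (S.codePK γ.1 γ.2.2.2.2.1, codeVec codeBV γ.2.2.2.2.2))) := Computes.self
  have hsim := Samples.simFrom_simIn (Γ := Γ) (N := fun γ => γ.1) (I := fun γ => γ.2.1)
    (K := fun γ => γ.2.2.2.2.1) (F := fun γ => γ.2.2.2.2.2) hS hP hself.snd.fst.snd.fst h
    hself.snd.snd.fst hself.snd.snd.snd
  have hV : Computes (e := .prod E viewsT) (b := viewsT)
      (fun x : Σ _ : Γ, viewsT.den => (cΓ x.1, x.2)) fun x => x.2 := Computes.var
  have hself' : Computes (e := .prod E viewsT) (b := E)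
      (fun x : Σ _ : Γ, viewsT.den => (cΓ x.1, x.2)) fun x => cΓ x.1 := Computes.self.weaken
  have hs := Samples.bind (β := fun _ : Γ => viewsT.den) (b := viewsT) (cβ := fun _ V => V)
    (p := fun γ => simFrom C γ.2.1 h (fillPlain C γ.2.1) γ.2.2.2.2.1 (encTableEquiv γ.2.2.2.2.2))
    (q := fun γ V => D.run (unary γ.1, (γ.2.2.1, (V, γ.2.2.2.1))))
    (hsim.congr fun γ => (PMF.map_id _).symm)
    (Samples.subst (Δ := (Ty.prod unaryT (.prod c jointT)).den) (cΔ := fun x => x)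
      (p := fun x => D.run x) ⟨D, hD, fun _ => rfl⟩
      (g := fun x : Σ _ : Γ, viewsT.den => (unary x.1.1, (x.1.2.2.1, (x.2, x.1.2.2.2.1))))
      (hself'.fst.pair (hself'.snd.fst.fst.pair (hV.pair hself'.snd.fst.snd.snd))))
  obtain ⟨t, ht, hrun⟩ := hs
  exact ⟨t, ht, fun n I z o K F => hrun ⟨n, I, z, o, K, F⟩⟩

end Programs

/-! ### Polynomial and negligible bounds -/

section PolyBounds

theorem PolyBounded.const (m : ℕ) : PolyBounded fun _ => m := ⟨Polynomial.C m, fun n => by simp⟩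

theorem PolyBounded.self : PolyBounded fun n => n := ⟨Polynomial.X, fun n => by simp⟩

theorem PolyBounded.add {f g : ℕ → ℕ} (hf : PolyBounded f) (hg : PolyBounded g) :
    PolyBounded fun n => f n + g n := by
  obtain ⟨p, hp⟩ := hf
  obtain ⟨q, hq⟩ := hg
  exact ⟨p + q, fun n => by rw [Polynomial.eval_add]; exact add_le_add (hp n) (hq n)⟩

theorem PolyBounded.mul {f g : ℕ → ℕ} (hf : PolyBounded f) (hg : PolyBounded g) :
    PolyBounded fun n => f n * g n := by
  obtain ⟨p, hp⟩ := hf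
  obtain ⟨q, hq⟩ := hg
  exact ⟨p * q, fun n => by rw [Polynomial.eval_mul]; exact Nat.mul_le_mul (hp n) (hq n)⟩

theorem PolyBounded.mono {f g : ℕ → ℕ} (hg : PolyBounded g) (h : ∀ n, f n ≤ g n) :
    PolyBounded f := by
  obtain ⟨q, hq⟩ := hg
  exact ⟨q, fun n => (h n).trans (hq n)⟩

theorem size_list_le {a : Ty} {l : List a.den} {L s : ℕ} (hl : l.length ≤ L)
    (hs : ∀ y ∈ l, a.size y ≤ s) : (Ty.list a).size l ≤ 1 + L * (1 + s) := by
  refine le_trans ?_ (Nat.add_le_add_left (Nat.mul_le_mul_right (1 + s) hl) 1)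
  clear hl
  induction l with
  | nil => simp [Ty.size]
  | cons y l ih =>
    have h1 := ih fun z hz => hs z (List.mem_cons_of_mem _ hz)
    have h2 := hs y List.mem_cons_self
    rw [size_cons, List.length_cons, Nat.succ_mul]
    omega

theorem size_unary (n : ℕ) : unaryT.size (unary n) ≤ 1 + n * 2 :=
  size_list_le (s := 1) (by simp [unary]) fun _ _ => le_rfl

theorem size_codeBV {q : ℕ} (v : BV q) : bitsT.size (codeBV v) ≤ 1 + q * 2 :=
  size_list_le (s := 1) (by simp [codeBV]) fun _ _ => le_rfl

theorem PolyLength.polyBounded {f : ℕ → ℕ} (h : PolyLength f) : PolyBounded f := by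
  obtain ⟨t, ⟨p, hp⟩, hrun⟩ := h
  refine ⟨p.comp (1 + Polynomial.X * 2), fun n => ?_⟩
  have h1 := Tm.PolyTime.size_le hp (x := unary n) (y := unary (f n)) (by rw [hrun]; simp)
  have h2 := length_le_size (a := .unit) (unary (f n))
  have h3 := eval_mono p (size_unary n)
  have h4 : (unary (f n)).length = f n := by simp [unary]
  simp only [Polynomial.eval_comp, Polynomial.eval_add, Polynomial.eval_one, Polynomial.eval_mul,
    Polynomial.eval_X, Polynomial.eval_ofNat]
  change (Ty.list .unit).size (unary (f n)) ≤ _ at h1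
  omega

theorem size_codeSet {S : MKRScheme} {n m : ℕ} {X : Finset (S.M n)} (hX : X.card ≤ m) :
    (Ty.list bitsT).size (codeSet (S.repM n) X) ≤ 1 + m * (1 + (1 + S.msgLen n * 2)) := by
  refine size_list_le ?_ fun y hy => ?_
  · rw [codeSet, Finset.length_sort]
    exact Finset.card_image_le.trans hX
  · rw [codeSet, Finset.mem_sort, Finset.mem_image] at hy
    obtain ⟨a, _, rfl⟩ := hy
    exact size_codeBV _

/-- The part of the advice of the reduction that describes the inputs has polynomial size. -/
theorem exists_size_simIn_le {S : MKRScheme} {P : HashParams S} (hS : S.Efficient)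
    (hP : P.Efficient) (k : ℕ) (C : Finset (Fin (k + 1))) : ∃ f : ℕ → ℕ, PolyBounded f ∧
      ∀ n (I : Inputs P k n), (Ty.prod simInT (.list (.list bitsT))).size
        (simIn C I, codeOutput S n (0 ∉ C) (funcMPSU I.X)) ≤ f n := by
  let s : ℕ → ℕ → ℕ := fun m n => 1 + m * (1 + (1 + S.msgLen n * 2))
  have hs : ∀ f : ℕ → ℕ, PolyBounded f → PolyBounded fun n => s (f n) n := fun f hf =>
    (PolyBounded.const 1).add (hf.mul ((PolyBounded.const 1).add ((PolyBounded.const 1).add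
      (hS.msgLen.polyBounded.mul (PolyBounded.const 2)))))
  have hset := hP.setSize.polyBounded
  have ho : ∀ (p : Prop) [Decidable p] n (I : Inputs P k n),
      (Ty.list (.list bitsT)).size (codeOutput S n p (funcMPSU I.X)) ≤
        1 + 1 * (1 + s ((k + 1) * P.setSize n) n) := by
    intro p _ n I
    refine size_list_le ?_ fun y hy => ?_
    · unfold codeOutput
      split_ifs <;> simp
    · unfold codeOutput at hy
      split_ifs at hy
      · rw [List.mem_singleton] at hy
        subst hy
        refine size_codeSet (Finset.card_biUnion_le.trans (le_of_eq ?_))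
        simp [I.card_eq]
      · simp at hy
  refine ⟨fun n => 1 + (1 + (1 + n * 2) + (1 + (1 + P.seedLen n * 2) +
    (1 + (1 + (k + 1) * (1 + (1 + 1 * (1 + s (P.setSize n) n)))) +
      (1 + 1 * (1 + s ((k + 1) * P.setSize n) n))))) + (1 + 1 * (1 + s ((k + 1) * P.setSize n) n)),
    ?_, fun n I => ?_⟩
  · have h1 := PolyBounded.const 1
    have h2 := h1.add (h1.mul (h1.add (hs _ ((PolyBounded.const (k + 1)).mul hset))))
    exact (h1.add ((h1.add (h1.add (PolyBounded.self.mul (PolyBounded.const 2)))).add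
      ((h1.add (h1.add (hP.seedLen.polyBounded.mul (PolyBounded.const 2)))).add
        ((h1.add (h1.add ((PolyBounded.const (k + 1)).mul (h1.add (h1.add (h1.mul
          (h1.add (hs _ hset)))))))).add h2)))).add h2
  · simp only [simIn]
    have hX : (Ty.list (.list (.list bitsT))).size (codeVec (codeOpt (codeSet (S.repM n)))
        fun i => if i ∈ C then some (I.X i) else none) ≤
        1 + (k + 1) * (1 + (1 + 1 * (1 + s (P.setSize n) n))) := by
      refine size_list_le (by simp [codeVec]) fun y hy => ?_
      obtain ⟨i, rfl⟩ := (List.mem_ofFn' _ _).1 hy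
      beta_reduce
      refine size_list_le ?_ fun z hz => ?_
      · unfold codeOpt
        split_ifs <;> simp
      · unfold codeOpt at hz
        split_ifs at hz
        · simp only [Option.map_some, Option.toList_some, List.mem_singleton] at hz
          subst hz
          exact size_codeSet (I.card_eq i).le
        · simp at hz
    exact add_le_add (add_le_add le_rfl (add_le_add (add_le_add le_rfl (size_unary n))
      (add_le_add (add_le_add le_rfl (size_codeBV _)) (add_le_add (add_le_add le_rfl hX)
        (ho _ n I))))) (ho _ n I)

theorem Negligible.add {μ ν : ℕ → ℝ} (hμ : Negligible μ) (hν : Negligible ν) :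
    Negligible fun n => μ n + ν n := Asymptotics.SuperpolynomialDecay.add hμ hν

theorem Negligible.mul_poly {μ : ℕ → ℝ} (hμ : Negligible μ) (p : Polynomial ℕ) :
    Negligible fun n => μ n * (p.eval n : ℕ) := by
  refine (Asymptotics.SuperpolynomialDecay.mul_polynomial hμ
    (p.map (Nat.castRingHom ℝ))).congr fun n => ?_
  rw [Polynomial.eval_natCast_map]
  rfl

theorem statDist_nonneg {α : Type} [Fintype α] (p q : PMF α) : 0 ≤ statDist p q :=
  mul_nonneg (by norm_num) (Finset.sum_nonneg fun _ _ => abs_nonneg _)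

/-- Distinguishers do not notice a small change of the distribution. -/
theorem abs_acceptProb_sub_le {a c : Ty} (D : Tm (.prod unaryT (.prod c a)) .bool) (n : ℕ)
    (z : c.den) {p q : PMF a.den} {ε : ℝ≥0∞} (h : Close ε p q) (hε : ε ≠ ∞) :
    |acceptProb D n z p - acceptProb D n z q| ≤ ε.toReal := by
  unfold acceptProb
  set f : a.den → PMF Bool := fun x => D.run (unary n, (z, x))
  obtain ⟨h1, h2⟩ := h.bind_left f (fun b => if b = true then 1 else 0)
    fun b => by split_ifs <;> simp
  rw [← apply_eq_expect, ← apply_eq_expect] at h1 h2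
  have hp := (p.bind f).apply_ne_top true
  have hq := (q.bind f).apply_ne_top true
  rw [abs_sub_le_iff]
  constructor
  · have := ENNReal.toReal_mono (ENNReal.add_ne_top.2 ⟨hq, hε⟩) h1
    rw [ENNReal.toReal_add hq hε] at this
    linarith
  · have := ENNReal.toReal_mono (ENNReal.add_ne_top.2 ⟨hp, hε⟩) h2
    rw [ENNReal.toReal_add hp hε] at this
    linarith

end PolyBounds

/-! ### The hybrid argument -/

section Hybrid

variable {S : MKRScheme} {P : HashParams S} {k : ℕ} {C : Finset (Fin (k + 1))}

/-- The simulator's output, from encryptions of given messages, together with the output of the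
functionality. -/
noncomputable def hybrid (C : Finset (Fin (k + 1))) (h : Fin (k + 1)) {n : ℕ} (I : Inputs P k n)
    (msgs : Fin (encCount P k n) → Option (S.M n)) : PMF jointT.den :=
  (keyEncs S n msgs).bind fun x =>
    (simFrom C I h (fillPlain C I) x.1 (encTableEquiv x.2)).map fun V =>
      (V, codeOutput S n (0 ∉ C) (funcMPSU I.X))

/-- The messages of the hybrid experiment which is close to the protocol. -/
def trackedList {n : ℕ} (I : Inputs P k n) : Fin (encCount P k n) → Option (S.M n) :=
  encTableEquiv.symm (trackedMsg I.seed I.X)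

/-- The protocol is close to the hybrid experiment with the tracked plaintexts, by rerandomizability
and the near-uniformity of secret keys. No computational assumption is used here. -/
theorem close_real_hybrid (hcorrect : S.Correct) (hkeys : S.KeyHomomorphic)
    (hpar : S.PartiallyDecryptable) {n : ℕ} {ε σ : ℝ≥0∞}
    (hrr : ∀ K a r, Close ε (S.reRandDist n K (S.enc n K a r)) (S.encDist n K a))
    (hsk : Close σ (S.genSKDist n) (uniformOfFintype (S.SK n)))
    {h : Fin (k + 1)} (hh : h ∉ C) (h0 : h ≠ 0 → 0 ∈ C) (I : Inputs P k n) :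
    Close ((2 * (k + 2) : ℕ) * σ + ((6 * (k + 1) ^ 2 + 3 * k * (k + 1)) * P.bins n : ℕ) * ε)
      (realDist P k C n I) (hybrid C h I (trackedList I)) := by
  rw [realDist_eq]
  have h1 := Close.bind_bad (p := uniformOfFintype (Fin (k + 1) → BV (S.genCoins n)))
    (f := realGiven C I) (g := simGiven C I h (fillPlain C I)) _ (prob_bad_keys hkeys hsk)
    fun g _ hg => close_given hcorrect hpar hrr I hh
      (fun hne => enumerates_fillPlain (h0 hne) I) (not_not.1 hg)
  have h2 := close_programKeys hkeys hsk I hh (fillPlain C I)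
  have h3 := bind_keyEncs (P := P) (k := k) (trackedMsg I.seed I.X) fun K F =>
    (simFrom C I h (fillPlain C I) K F).map fun V =>
      (V, codeOutput S n (0 ∉ C) (funcMPSU I.X))
  rw [h3] at h2
  refine (h1.trans h2).mono (le_of_eq ?_)
  push_cast
  ring

/-- The reduction has the same advantage as the distinguisher of the hybrid experiments. -/
theorem acceptProb_hybrid {h : Fin (k + 1)} {c : Ty} {D : Tm (.prod unaryT (.prod c jointT)) .bool}
    {D' : Tm (.prod unaryT (.prod (.prod c (.prod simInT (.list (.list bitsT))))
        (.prod bitsT (.list bitsT)))) .bool}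
    (hD' : ∀ n (I : Inputs P k n) (z : c.den) (o : (Ty.list (.list bitsT)).den) (K : S.PK n)
        (F : Fin (encCount P k n) → BV (S.ctLen n)),
        D'.run (unary n, ((z, (simIn C I, o)), (S.codePK n K, codeVec codeBV F))) =
          (simFrom C I h (fillPlain C I) K (encTableEquiv F)).bind fun V =>
            D.run (unary n, (z, (V, o))))
    {n : ℕ} (I : Inputs P k n) (z : c.den) (msgs : Fin (encCount P k n) → Option (S.M n)) :
    acceptProb D' n (z, (simIn C I, codeOutput S n (0 ∉ C) (funcMPSU I.X)))
      (S.multiEncDist n msgs) = acceptProb D n z (hybrid C h I msgs) := by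
  unfold acceptProb hybrid
  rw [multiEncDist_eq, PMF.bind_map, PMF.bind_bind]
  congr 3
  funext x
  rw [PMF.bind_map]
  exact hD' n I z _ x.1 x.2

/-- For each security parameter, there are finitely many inputs; hence some of them maximize the
advantage of a distinguisher. -/
instance {n : ℕ} : Finite (Inputs P k n) := by
  have : Finite (S.M n) := Finite.of_injective _ (S.repM n).injective
  refine Finite.of_injective (fun I : Inputs P k n => (I.seed, I.X)) fun I I' h => ?_
  cases I
  cases I'
  simp only [Prod.mk.injEq] at h
  obtain ⟨rfl, rfl⟩ := h
  rfl

/-- An honest party whose part in the shuffle phase the simulator can play: its vector is computed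
from the union, which the simulator knows if the leader is corrupted; if the leader is honest, it
is this party, as its vector consists of replies that the simulation replaces anyway. -/
theorem exists_honest (hC : C ≠ Finset.univ) : ∃ h, h ∉ C ∧ (h ≠ 0 → (0 : Fin (k + 1)) ∈ C) := by
  by_cases h0 : 0 ∈ C
  · obtain ⟨h, hh⟩ : ∃ h, h ∉ C := by
      by_contra! hall
      exact hC (Finset.eq_univ_iff_forall.2 hall)
    exact ⟨h, hh, fun _ => h0⟩
  · exact ⟨0, h0, fun h => absurd rfl h⟩

/-- The hybrid experiments with any messages are indistinguishable, as the encryptions are. -/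
theorem compIndist_hybrid (hS : S.Efficient) (hP : P.Efficient) (hind : S.IndMultEnc)
    (h : Fin (k + 1)) : CompIndist (ι := fun n => Inputs P k n) (a := jointT)
      (fun _ I => hybrid C h I (trackedList I)) (fun _ I => hybrid C h I fun _ => none) := by
  intro c adv D hD hadv
  obtain ⟨D', hD', hrun⟩ := exists_reduction hS hP C h D hD
  -- the distinguishing advantage is largest for some inputs, which become part of the advice
  have hmax : ∀ n, ∃ o : Option (Inputs P k n), ∀ I : Inputs P k n, ∃ I', o = some I' ∧
      |acceptProb D n (adv n) (hybrid C h I (trackedList I)) -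
        acceptProb D n (adv n) (hybrid C h I fun _ => none)| ≤
      |acceptProb D n (adv n) (hybrid C h I' (trackedList I')) -
        acceptProb D n (adv n) (hybrid C h I' fun _ => none)| := by
    intro n
    by_cases hne : Nonempty (Inputs P k n)
    · obtain ⟨I', hI'⟩ := Finite.exists_max fun I : Inputs P k n =>
        |acceptProb D n (adv n) (hybrid C h I (trackedList I)) -
          acceptProb D n (adv n) (hybrid C h I fun _ => none)|
      exact ⟨some I', fun I => ⟨I', rfl, hI' I⟩⟩
    · exact ⟨none, fun I => absurd ⟨I⟩ hne⟩
  choose o ho using hmax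
  let adv' : ∀ _ : ℕ, (Ty.prod c (.prod simInT (.list (.list bitsT)))).den := fun n =>
    (adv n, (o n).elim (Ty.dflt _) fun I => (simIn C I, codeOutput S n (0 ∉ C) (funcMPSU I.X)))
  obtain ⟨f, hf, hsize⟩ := exists_size_simIn_le hS hP k C
  have hadv' : PolyBounded fun n =>
      (Ty.prod c (.prod simInT (.list (.list bitsT)))).size (adv' n) := by
    refine ((PolyBounded.const 1).add hadv |>.add (hf.add (PolyBounded.const
      ((Ty.prod simInT (.list (.list bitsT))).size (Ty.dflt _))))).mono fun n => ?_
    rw [size_prod]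
    refine add_le_add le_rfl ?_
    cases o n with
    | none => exact Nat.le_add_left _ _
    | some I => exact (hsize n I).trans (Nat.le_add_right _ _)
  have hq : PolyBounded (encCount P k) := (PolyBounded.const (k + 1)).mul
    ((PolyBounded.const (k + 1)).mul hP.bins.polyBounded)
  obtain ⟨μ, hμ, hle⟩ := hind (encCount P k) hq
    (fun n => (o n).elim (fun _ => none) trackedList) (fun n _ => none) _ adv' D' hD' hadv'
  refine ⟨μ, hμ, fun n I => ?_⟩
  obtain ⟨I', hoI, hI'⟩ := ho n I
  have := hle n ()
  simp only [adv', hoI, Option.elim_some] at this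
  rw [acceptProb_hybrid hrun, acceptProb_hybrid hrun] at this
  exact hI'.trans this

end Hybrid

end PKMPSU

open PKMPSU in
theorem theorem4 (S : PKMPSU.MKRScheme) (P : PKMPSU.HashParams S)
    (hS : S.Efficient) (hP : P.Efficient)
    (hcorrect : S.Correct) (hkeys : S.KeyHomomorphic) (hpar : S.PartiallyDecryptable)
    (hrerand : S.Rerandomizable) (hind : S.IndMultEnc)
    (k : ℕ) (C : Finset (Fin (k + 1))) (hC : C ≠ Finset.univ) :
    PKMPSU.SecurelyRealizes P k C := by
  obtain ⟨h, hh, h0⟩ := exists_honest hC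
  obtain ⟨sim, hsim, hrun⟩ := exists_simulator hS hP C h
  obtain ⟨ε, hε, hrr⟩ := hrerand
  have hσ := hkeys.2
  obtain ⟨p, hp⟩ := hP.bins.polyBounded
  refine ⟨sim, hsim, fun c adv D hD hadv => ?_⟩
  obtain ⟨μ, hμ, hle⟩ := compIndist_hybrid (C := C) hS hP hind h c adv D hD hadv
  have hε0 : ∀ n, 0 ≤ ε n := fun n =>
    (statDist_nonneg _ _).trans (hrr n 1 none fun _ => false)
  refine ⟨_, ((hσ.mul_poly (Polynomial.C (2 * (k + 2)))).add (hε.mul_poly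
    (Polynomial.C (6 * (k + 1) ^ 2 + 3 * k * (k + 1)) * p))).add hμ, fun n I => ?_⟩
  have hclose := close_real_hybrid hcorrect hkeys hpar
    (fun K a r => (close_of_statDist _ _).mono (ENNReal.ofReal_le_ofReal (hrr n K a r)))
    (close_of_statDist (S.genSKDist n) (PMF.uniformOfFintype (S.SK n))) hh h0 I
  have hideal : idealDist P k C sim n I = hybrid C h I fun _ => none := by
    show (sim.run (simIn C I)).map _ = _
    rw [hrun, PMF.map_bind, hybrid]
  rw [hideal]
  refine (abs_sub_le _ (acceptProb D n (adv n) (hybrid C h I (trackedList I))) _).trans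
    (add_le_add ((abs_acceptProb_sub_le D n (adv n) hclose ?_).trans ?_) (hle n I))
  · exact ENNReal.add_ne_top.2 ⟨ENNReal.mul_ne_top (ENNReal.natCast_ne_top _) ENNReal.ofReal_ne_top,
      ENNReal.mul_ne_top (ENNReal.natCast_ne_top _) ENNReal.ofReal_ne_top⟩
  · rw [ENNReal.toReal_add (ENNReal.mul_ne_top (ENNReal.natCast_ne_top _) ENNReal.ofReal_ne_top)
      (ENNReal.mul_ne_top (ENNReal.natCast_ne_top _) ENNReal.ofReal_ne_top), ENNReal.toReal_mul,
      ENNReal.toReal_mul, ENNReal.toReal_natCast, ENNReal.toReal_natCast,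
      ENNReal.toReal_ofReal (statDist_nonneg _ _), ENNReal.toReal_ofReal (hε0 n),
      Polynomial.eval_C, Polynomial.eval_mul, Polynomial.eval_C]
    refine add_le_add (mul_comm _ _).le ?_
    rw [mul_comm (ε n)]
    refine mul_le_mul_of_nonneg_right ?_ (hε0 n)
    exact_mod_cast Nat.mul_le_mul_left _ (hp n)
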